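/- **Setting.** Let $S$ be a compact connected Riemann surface with a holomorphic one-form $\omega$ whose set $\Sigma$ of zeros (conical points) is finite and non-empty (so the genus is at least $2$), with the flat structure given by local primitives $z=x+iy$ of $\omega$ on $S\smallsetminus\Sigma$, and let $\mathrm d$ be any distance inducing the topology of $S$. For each $\sigma\in\Sigma$ let $V_\sigma$ be an embedded open cone disc of flat radius $R_\sigma$ around $\sigma$, the $V_\sigma$ being pairwise disjoint: there are an integer $n_\sigma\ge 1$ and a chart $w$ from $V_\sigma$ onto $\{|w|<R_\sigma^{1/n_\sigma}\}$ with $w(\sigma)=0$ and $\omega=\mathrm d(w^{n_\sigma})$. Put $\xi=w^{n_\sigma}$. Let $\varphi:S\to S$ be a linear pseudo-Anosov map with stretch factor $\lambda>1$: a homeomorphism given in flat coordinates, up to translations, by $x+iy\mapsto\lambda x+i\lambda^{-1}y$, which fixes every $\sigma\in\Sigma$ and near $\sigma$ preserves each sheet of the branched cover $\xi$. The direction of $x$ is called vertical and that of $y$ horizontal, with unit vector fields $e_v=1$ and $e_h=i$. For every $\sigma\in\Sigma$ let $0<\alpha_\sigma<R_\sigma$, let $-\lambda<\beta_\sigma<1-\lambda$,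 and let $k_\sigma:\mathbb R\to\mathbb R$ be even, of class $\mathcal C^1$ with Lipschitz derivative, supported in $[-1,1]$, non-increasing on $[0,\infty)$, with $k_\sigma(0)=1$, and with $k_\sigma'(t)\ne0$ whenever $t>0$ and $\lambda+\beta_\sigma k_\sigma(t)=1$. Let $f=\varphi\circ\psi$, where $\psi$ is the identity outside $\bigcup_\sigma V_\sigma$ and on $V_\sigma$ is the sheet-preserving lift through $\xi$ of $x+iy\mapsto(1+\lambda^{-1}\beta_\sigma k_\sigma(|x+iy|/\alpha_\sigma))x+iy$. Thus $f=\varphi$ at flat distance at least $\alpha_\sigma$ from every $\sigma$, and near $\sigma$ the map $f$ is the sheet-preserving lift through $\xi$ of $x+iy\mapsto(\lambda+\beta_\sigma k_\sigma(|x+iy|/\alpha_\sigma))x+i\lambda^{-1}y$. Let $U_\sigma=\{x: f^m(x)\to\sigma \text{ as } m\to+\infty\}$ and $K=S\smallsetminus\bigcup_{\sigma\in\Sigma}U_\sigma$. Let $t_\sigma>0$ be the smallest positive solution of $(\lambda+\beta_\sigma k_\sigma(t/\alpha_\sigma))t=t$, and for $1\le i\le 2n_\sigma$ let $p^\sigma_i$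 be the point at flat distance $t_\sigma$ from $\sigma$ on the $i$-th of the $2n_\sigma$ vertical rays starting at $\sigma$ (counted counter-clockwise); it is a hyperbolic fixed point of $f$. Let $W^{ss}(x)=\{y: \mathrm d(f^m(x),f^m(y))\to0\text{ as }m\to+\infty\}$. On $S\smallsetminus\Sigma$ put $$v^s(x)=e_h-\sum_{i\ge0}\lambda^{-i}\,b(f^i(x))\prod_{j=0}^{i}\frac1{a(f^j(x))}\;e_v,\qquad a=\langle \mathrm df\,e_v,e_v\rangle,\quad b=\langle \mathrm df\,e_h,e_v\rangle,$$ and let $h_t$ be the (local) flow of $v^s$ on $S\smallsetminus\Sigma$. **Theorem.** The set $K$ is connected, and $K=\overline{W^{ss}(p^\sigma_i)}$ for every $\sigma\in\Sigma$ and every $1\le i\le 2n_\sigma$. If moreover $\beta_\sigma>-\lambda+\lambda^{-2}$ for all $\sigma\in\Sigma$, then at every point of $S\smallsetminus\Sigma$ the differential of $f$ exists and the series defining $v^s$ converges, and for every $\sigma\in\Sigma$ and $1\le i\le 2n_\sigma$ there is a unique trajectory $t\mapsto h_t(p^\sigma_i)$ of $v^s$ starting at $p^\sigma_i$, it is defined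 for all $t\in\mathbb R$ (every trajectory starting at $p^\sigma_i$ on an open interval containing $0$ is a restriction of it), and $W^{ss}(p^\sigma_i)=\{h_t(p^\sigma_i): t\in\mathbb R\}$. -/

import Mathlib

open Filter Topology Set Manifold

noncomputable section

namespace DerivedPA

section Surface

variable {S : Type*} [TopologicalSpace S] [ChartedSpace ℂ S]

/-- `F` is a primitive of the complex-linear one-form `η` on `U`: it is complex differentiable at
every point of `U`, with `dF = η`. Near a point where `η` does not vanish, such an `F` is a natural
(flat) coordinate of `η`. -/
def IsPrimitiveOn (η : ∀ x : S, TangentSpace 𝓘(ℂ) x →L[ℂ] ℂ) (F : S → ℂ) (U : Set S) : Prop :=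
  ∀ y ∈ U, HasMFDerivAt 𝓘(ℂ) 𝓘(ℂ) F y (η y)

/-- A one-form on a Riemann surface is holomorphic (an Abelian differential) iff it is locally the
differential of a holomorphic function. -/
def IsHolomorphicForm (η : ∀ x : S, TangentSpace 𝓘(ℂ) x →L[ℂ] ℂ) : Prop :=
  ∀ x : S, ∃ U : Set S, IsOpen U ∧ x ∈ U ∧ ∃ F : S → ℂ, IsPrimitiveOn η F U

end Surface

/-- The real-linear map `x + i y ↦ l x + i l⁻¹ y`. -/
def stretch (l : ℝ) (z : ℂ) : ℂ := ⟨l * z.re, l⁻¹ * z.im⟩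

/-- The lift of `g : ℂ → ℂ` through the branched cover `w ↦ w ^ n` that does not change the sheet.
It is used for maps `g` with `g 0 = 0` and `Re (g z / z) > 0` for `z ≠ 0`, so that the principal
`n`-th root of `g z / z` is the continuous one. If moreover `g` preserves the upper half plane, the
lower half plane and the two half-axes of the real line, each of the sectors cut out by
`w ^ n ∈ ℝ` is mapped to itself. -/
def sheetLift (n : ℕ) (g : ℂ → ℂ) (w : ℂ) : ℂ := w * (g (w ^ n) / w ^ n) ^ ((n : ℂ)⁻¹)

theorem sheetLift_pow {n : ℕ} (hn : n ≠ 0) {g : ℂ → ℂ} (h0 : g 0 = 0) (w : ℂ) :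
    sheetLift n g w ^ n = g (w ^ n) := by
  by_cases hw : w = 0
  · subst hw
    simp [sheetLift, hn, h0]
  · have hwn : w ^ n ≠ 0 := pow_ne_zero n hw
    rw [sheetLift, mul_pow, Complex.cpow_nat_inv_pow _ hn, mul_div_cancel₀ _ hwn]

/-- A compact connected Riemann surface with a holomorphic one-form `form`, and around each zero
`σ` of the form (each conical point) an embedded cone disc: a homeomorphism `chart σ` from a
neighbourhood of `σ` onto the disc `|w| < radius σ` in which `form = d (w ^ n)`. The disc has flat
radius `radius σ ^ n σ`, and the cone angle at `σ` is `2 π n σ`. The cone discs are pairwise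
disjoint. The form has at least one zero, that is, the genus is at least `2`. -/
structure ConicalSurface (S : Type*) [TopologicalSpace S] [ChartedSpace ℂ S] where
  form : ∀ x : S, TangentSpace 𝓘(ℂ) x →L[ℂ] ℂ
  holomorphic : IsHolomorphicForm form
  exists_zero : ∃ σ, form σ = 0
  n : S → ℕ
  radius : S → ℝ
  chart : S → OpenPartialHomeomorph S ℂ
  n_pos : ∀ σ, form σ = 0 → 0 < n σ
  radius_pos : ∀ σ, form σ = 0 → 0 < radius σ
  mem_source : ∀ σ, form σ = 0 → σ ∈ (chart σ).source
  chart_center : ∀ σ, form σ = 0 → chart σ σ = 0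
  chart_target : ∀ σ, form σ = 0 → (chart σ).target = Metric.ball 0 (radius σ)
  chart_form : ∀ σ, form σ = 0 →
    IsPrimitiveOn form (fun x => chart σ x ^ n σ) (chart σ).source
  disjoint : ∀ σ τ, form σ = 0 → form τ = 0 → σ ≠ τ →
    Disjoint (chart σ).source (chart τ).source

variable {S : Type*} [MetricSpace S] [ChartedSpace ℂ S]

/-- The set `Σ` of conical points. -/
def ConicalSurface.sing (X : ConicalSurface S) : Set S := {x | X.form x = 0}

/-- A linear pseudo-Anosov map of the flat surface `X`, with stretch factor `lam`: a homeomorphism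
which in flat coordinates is `x + i y ↦ lam x + i lam⁻¹ y` (up to translation). It fixes every
conical point, and near a conical point it does not permute the sheets of the branched cover. -/
structure LinearPA (X : ConicalSurface S) where
  map : S ≃ₜ S
  lam : ℝ
  one_lt_lam : 1 < lam
  affine : ∀ (x : S) (U V : Set S) (F G : S → ℂ), IsOpen U → x ∈ U → IsPrimitiveOn X.form F U →
    IsOpen V → map x ∈ V → IsPrimitiveOn X.form G V →
    ∀ᶠ y in 𝓝 x, G (map y) - G (map x) = stretch lam (F y - F x)
  fixes : ∀ σ ∈ X.sing, map σ = σ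
  respects_sheets : ∀ σ ∈ X.sing, ∀ᶠ w in 𝓝 (0 : ℂ),
    X.chart σ (map ((X.chart σ).symm w)) = sheetLift (X.n σ) (stretch lam) w

/-- The parameters of the perturbation at the conical points: sizes `α σ`, strengths `β σ`, and
profiles `k σ`, each even, unimodal, `C¹` with Lipschitz derivative, supported in `[-1, 1]` and
normalised by `k σ 0 = 1`. The last condition says that the derivative of
`t ↦ (lam + β k (t / α)) t` at its positive fixed point is not `1`. -/
structure Perturbation {X : ConicalSurface S} (φ : LinearPA X) where
  α : S → ℝ
  β : S → ℝ
  k : S → ℝ → ℝ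
  α_pos : ∀ σ ∈ X.sing, 0 < α σ
  α_lt : ∀ σ ∈ X.sing, α σ < X.radius σ ^ X.n σ
  lt_β : ∀ σ ∈ X.sing, -φ.lam < β σ
  β_lt : ∀ σ ∈ X.sing, β σ < 1 - φ.lam
  k_even : ∀ σ ∈ X.sing, Function.Even (k σ)
  k_contDiff : ∀ σ ∈ X.sing, ContDiff ℝ 1 (k σ)
  k_lipschitz : ∀ σ ∈ X.sing, ∃ C, LipschitzWith C (deriv (k σ))
  k_support : ∀ σ ∈ X.sing, Function.support (k σ) ⊆ Icc (-1) 1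
  k_zero : ∀ σ ∈ X.sing, k σ 0 = 1
  k_antitone : ∀ σ ∈ X.sing, AntitoneOn (k σ) (Ici 0)
  k_hyperbolic : ∀ σ ∈ X.sing, ∀ t, 0 < t → φ.lam + β σ * k σ t = 1 → deriv (k σ) t ≠ 0

namespace Perturbation

variable {X : ConicalSurface S} {φ : LinearPA X} (P : Perturbation φ)

/-- `x + i y ↦ (1 + lam⁻¹ β k (|x + i y| / α)) x + i y`. -/
def squeeze (σ : S) (z : ℂ) : ℂ :=
  ⟨(1 + φ.lam⁻¹ * (P.β σ * P.k σ (‖z‖ / P.α σ))) * z.re, z.im⟩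

theorem stretch_squeeze (σ : S) (z : ℂ) :
    stretch φ.lam (P.squeeze σ z) =
      ⟨(φ.lam + P.β σ * P.k σ (‖z‖ / P.α σ)) * z.re, φ.lam⁻¹ * z.im⟩ := by
  have h : φ.lam ≠ 0 := (zero_lt_one.trans φ.one_lt_lam).ne'
  apply Complex.ext
  · simp only [stretch, squeeze]
    field_simp
  · rfl

open Classical in
/-- The homeomorphism of `S` which on each cone disc is the sheet-preserving lift of `squeeze`
through the branched cover `w ↦ w ^ n`, and the identity elsewhere. It is the identity at flat
distance at least `α σ` from `σ`, because `k σ` vanishes there. -/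
def bump (x : S) : S :=
  if h : ∃ σ ∈ X.sing, x ∈ (X.chart σ).source then
    (X.chart h.choose).symm
      (sheetLift (X.n h.choose) (P.squeeze h.choose) (X.chart h.choose x))
  else x

/-- The perturbed map. By `stretch_squeeze`, in the coordinate `z = w ^ n` near `σ` it is the
sheet-preserving lift of `x + i y ↦ (lam + β k (|x + i y| / α)) x + i lam⁻¹ y`; this description
through `φ` also makes sense where the image leaves the cone disc. -/
def f (x : S) : S := φ.map (P.bump x)

/-- The basin of attraction of `σ`. -/
def basin (σ : S) : Set S := {x | Tendsto (fun m : ℕ => P.f^[m] x) atTop (𝓝 σ)}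

/-- The complement of the union of the basins of the conical points. -/
def K : Set S := (⋃ σ ∈ X.sing, P.basin σ)ᶜ

/-- The smallest positive fixed point of `t ↦ (lam + β k (t / α)) t`. -/
def fixedRadius (σ : S) : ℝ :=
  sInf {t : ℝ | 0 < t ∧ (φ.lam + P.β σ * P.k σ (t / P.α σ)) * t = t}

/-- The fixed point of `f` on the `j`-th ray in the expanding direction (`w ^ n ∈ ℝ`) starting at
`σ`, counted counter-clockwise. It is at flat distance `fixedRadius σ` from `σ`. -/
def p (σ : S) (j : Fin (2 * X.n σ)) : S :=
  (X.chart σ).symm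
    (((P.fixedRadius σ ^ ((X.n σ : ℝ)⁻¹) : ℝ) : ℂ) *
      Complex.exp ((j : ℕ) * Real.pi / X.n σ * Complex.I))

/-- The strong stable leaf of `x`. The space being compact, it is the same for all metrics that
induce the topology. -/
def Wss (x : S) : Set S :=
  {y | Tendsto (fun m : ℕ => dist (P.f^[m] x) (P.f^[m] y)) atTop (𝓝 0)}

/-- `A` is the differential of `f` at `x`, read in flat coordinates at `x` and at `f x`. -/
def HasFlatDerivAt (x : S) (A : ℂ →L[ℝ] ℂ) : Prop :=
  ∀ (U V : Set S) (F G : S → ℂ), IsOpen U → x ∈ U → IsPrimitiveOn X.form F U →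
    IsOpen V → P.f x ∈ V → IsPrimitiveOn X.form G V →
    (fun y => G (P.f y) - G (P.f x) - A (F y - F x)) =o[𝓝 x] (fun y => F y - F x)

open Classical in
/-- The differential of `f` at `x` in flat coordinates (`0` if there is none). -/
def flatDeriv (x : S) : ℂ →L[ℝ] ℂ :=
  if h : ∃ A, P.HasFlatDerivAt x A then h.choose else 0

/-- The coefficient `⟨df e₁, e₁⟩`, where `e₁ = 1` is the expanding direction of `φ`. -/
def a (x : S) : ℝ := (P.flatDeriv x 1).re

/-- The coefficient `⟨df e₂, e₁⟩`, where `e₂ = i` is the contracting direction of `φ`. -/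
def b (x : S) : ℝ := (P.flatDeriv x Complex.I).re

/-- The `i`-th term of the series defining the stable vector field. -/
def vsTerm (x : S) (i : ℕ) : ℝ :=
  φ.lam⁻¹ ^ i * P.b (P.f^[i] x) * ∏ j ∈ Finset.range (i + 1), (P.a (P.f^[j] x))⁻¹

/-- The stable vector field `e₂ - (∑ i, vsTerm i) e₁`, in flat coordinates. -/
def vs (x : S) : ℂ := Complex.I - ((∑' i, P.vsTerm x i : ℝ) : ℂ)

/-- `γ` is, on the open set of times `J`, a trajectory in `S ∖ Σ` of the vector field `vs`, that
is, `t ↦ γ t` is a piece of an orbit of the flow `h_t` of `vs`. -/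
def IsTrajectoryOn (γ : ℝ → S) (J : Set ℝ) : Prop :=
  ContinuousOn γ J ∧ ∀ t ∈ J, γ t ∉ X.sing ∧
    ∀ (U : Set S) (F : S → ℂ), IsOpen U → γ t ∈ U → IsPrimitiveOn X.form F U →
      HasDerivAt (fun s => F (γ s)) (P.vs (γ t)) t

end Perturbation

end DerivedPA

end

open Filter Topology Set Manifold

noncomputable section

set_option linter.unusedSectionVars false

namespace DerivedPA

/-! ### Primitives of a holomorphic form and flat charts. -/

section LocalStructure

variable {S : Type*} [TopologicalSpace S] [ChartedSpace ℂ S]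
  {η : ∀ x : S, TangentSpace 𝓘(ℂ) x →L[ℂ] ℂ} {F G : S → ℂ} {U V : Set S} {x : S}

/-! Horizontal means here the direction of `x`, which `φ` expands, and vertical that of `y`: the
reverse of the naming in the statement. Paths and local charts are handled through their
developments (`Dev`): two maps with the same development that agree at one point of a connected set
agree everywhere on it (`Dev.eqOn`).

Foliation of `φ`. Since `φ` stretches horizontal leaves and fixes the conical points, there are
neither horizontal saddle connections nor closed horizontal leaves. A closed set saturated by
horizontal leaves, if it is not `S`, has a boundary leaf with a vertical gap of constant height
beside it. That leaf returns infinitely often near a regular point: two returns at different heights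
would put one of them into the gap of the other, two returns at the same height would close the
leaf. The construction can fail only if a conical point is seen vertically from the set
(`LinearPA.eq_univ_of_saturated`). This is excluded for the closure of a horizontal ray at a conical
point, by its `φ`-invariance, so such rays are dense (`LinearPA.dense_ray`).

Local model. Near a conical point `f` lifts a planar map that contracts the disc of radius `τ` to
the centre and has saddles at `τ` and `-τ`. The local stable manifold of `τ` is the graph of `edge`,
the right end of the points at a given height whose orbits enter the disc. It is invariant and
Lipschitz, and a bounded solution of the invariance equation for slopes is minus its derivative
(`Profile.Box.hasDerivAt_edge`).

Density. On the compact set `K` the horizontal expansion `a` exceeds `1`. A horizontal segment in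
`K` would therefore grow under `f` and accumulate on a complete leaf in `K`, whose closure would be
`S` by the foliation argument: impossible, as `K` has no conical point. So every horizontal segment
through a point of `K` enters a basin, and on the way crosses the stable set of some saddle `q'`
(`HPath.exists_mem_stable`). To reach another saddle `q`: the horizontal ray through `q'` is dense,
so beyond `q'` it crosses the local stable manifold of `q`. As `f` expands the ray beyond `q'`, this
crossing pulls back close to `q'`, persists at nearby heights, and under further backward iteration
accumulates on the stable manifold of `q'`. Hence `K` is the closure of the stable set of `q`
(`K_eq_closure_stable`), which is a continuous image of the line, so `K` is connected.

Vector field. The differential of `f` is triangular with entries `a`, `b`, `lam⁻¹`, and the series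
`w` for the slope solves `a w = b + lam⁻¹ (w ∘ f)`. In the discs of radius `τ`, where `a` may be
small, `|b|` is at most a multiple of `|x| |y|`, a product that one iterate multiplies by `κ lam⁻¹`
with `κ ≤ a`; elsewhere `a ≥ 1`. So the partial sums are uniformly bounded. By the derivative
formula the local stable manifold is then a trajectory, and backward iteration gives the whole leaf.
Uniqueness needs no regularity of the field: `f^[m]` multiplies velocities by `lam⁻¹ ^ m`, so any
trajectory from a saddle is carried into the saddle's neighbourhood, at a height determined by its
time, and is thus a point of the stable manifold. -/

theorem IsPrimitiveOn.mono (h : IsPrimitiveOn η F U) (hV : V ⊆ U) : IsPrimitiveOn η F V :=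
  fun y hy => h y (hV hy)

theorem IsPrimitiveOn.add_const (h : IsPrimitiveOn η F U) (c : ℂ) :
    IsPrimitiveOn η (fun y => F y + c) U := fun y hy => by
  have h1 := (h y hy).add (hasMFDerivAt_const (I := 𝓘(ℂ)) (I' := 𝓘(ℂ)) c y)
  have h2 : (η y + (0 : TangentSpace 𝓘(ℂ) y →L[ℂ] ℂ)) = η y := add_zero _
  exact h2 ▸ h1

/-- The derivative of the inverse of the chart at `x`. -/
def chartSymmDeriv (x : S) (w : ℂ) : ℂ →L[ℂ] ℂ := mfderiv 𝓘(ℂ) 𝓘(ℂ) (chartAt ℂ x).symm w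

theorem IsPrimitiveOn.hasDerivAt_comp_chart_symm [IsManifold 𝓘(ℂ) 1 S] (h : IsPrimitiveOn η F U)
    (x : S) {w : ℂ} (hw : w ∈ (chartAt ℂ x).target) (hU : (chartAt ℂ x).symm w ∈ U) :
    HasDerivAt (F ∘ (chartAt ℂ x).symm)
      (η ((chartAt ℂ x).symm w) (chartSymmDeriv x w 1)) w := by
  have h1 : MDifferentiableAt 𝓘(ℂ) 𝓘(ℂ) (chartAt ℂ x).symm w :=
    mdifferentiableAt_atlas_symm (chart_mem_atlas ℂ x) hw
  have h2 := (h _ hU).comp w h1.hasMFDerivAt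
  have h3 : HasFDerivAt (𝕜 := ℂ) (F ∘ (chartAt ℂ x).symm)
      ((show ℂ →L[ℂ] ℂ from η ((chartAt ℂ x).symm w)).comp (chartSymmDeriv x w)) w :=
    hasMFDerivAt_iff_hasFDerivAt.1 h2
  exact h3.hasDerivAt

/-- At the base point of its preferred chart the manifold derivative is by definition the derivative
of the chart expression, so the factor `chartSymmDeriv` disappears. -/
theorem IsPrimitiveOn.hasDerivAt_comp_chart_self (h : IsPrimitiveOn η F U)
    (hU : x ∈ U) : HasDerivAt (F ∘ (chartAt ℂ x).symm) (η x (1 : ℂ)) (chartAt ℂ x x) := by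
  have h1 : HasFDerivWithinAt (𝕜 := ℂ) (F ∘ (chartAt ℂ x).symm)
      (show ℂ →L[ℂ] ℂ from η x) univ (chartAt ℂ x x) := by
    have h2 := (h x hU).2
    simp only [writtenInExtChartAt, mfld_simps] at h2
    exact h2
  exact (hasFDerivWithinAt_univ.1 h1).hasDerivAt

theorem eventually_chart_symm_mem (hU : IsOpen U) (hx : x ∈ U) :
    ∀ᶠ w in 𝓝 (chartAt ℂ x x), w ∈ (chartAt ℂ x).target ∧ (chartAt ℂ x).symm w ∈ U := by
  have h0 := mem_chart_source ℂ x
  have h1 := (chartAt ℂ x).tendsto_symm h0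
  exact (Filter.eventually_of_mem ((chartAt ℂ x).open_target.mem_nhds
    ((chartAt ℂ x).map_source h0)) fun _ h => h).and (h1 (hU.mem_nhds hx))

/-- In a chart disc the difference of the two primitives has derivative zero. Because of this,
statements quantified over all flat coordinates can be checked in one of them. -/
theorem IsPrimitiveOn.eventually_sub_eq [IsManifold 𝓘(ℂ) 1 S] (hF : IsPrimitiveOn η F U)
    (hG : IsPrimitiveOn η G V) (hU : IsOpen U) (hV : IsOpen V) (hxU : x ∈ U) (hxV : x ∈ V) :
    ∀ᶠ y in 𝓝 x, F y - F x = G y - G x := by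
  have h0 := mem_chart_source ℂ x
  obtain ⟨r, hr, hball⟩ := Metric.eventually_nhds_iff_ball.1
    (eventually_chart_symm_mem (hU.inter hV) (⟨hxU, hxV⟩ : x ∈ U ∩ V))
  have hd : ∀ w ∈ Metric.ball (chartAt ℂ x x) r,
      HasDerivAt (F ∘ (chartAt ℂ x).symm - G ∘ (chartAt ℂ x).symm) 0 w := fun w hw => by
    have h1 := hF.hasDerivAt_comp_chart_symm x (hball w hw).1 (hball w hw).2.1
    have h2 := hG.hasDerivAt_comp_chart_symm x (hball w hw).1 (hball w hw).2.2
    simpa using h1.sub h2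
  have hc := ((chartAt ℂ x).continuousAt h0) (Metric.ball_mem_nhds _ hr)
  filter_upwards [hc, (chartAt ℂ x).open_source.mem_nhds h0] with y hy hys
  have := Metric.isOpen_ball.is_const_of_deriv_eq_zero
    (convex_ball (chartAt ℂ x x) r).isPreconnected
    (fun w hw => (hd w hw).differentiableAt.differentiableWithinAt)
    (fun w hw => (hd w hw).deriv) hy (Metric.mem_ball_self hr)
  simp only [Pi.sub_apply, Function.comp, (chartAt ℂ x).left_inv hys,
    (chartAt ℂ x).left_inv h0] at this
  linear_combination this

theorem IsPrimitiveOn.congr (hF : IsPrimitiveOn η F U) (hU : IsOpen U) (h : EqOn G F U) :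
    IsPrimitiveOn η G U := fun y hy =>
  (hF y hy).congr_of_eventuallyEq (h.eventuallyEq_of_mem (hU.mem_nhds hy))

theorem apply_one_ne_zero {x : S} (h : η x ≠ 0) : η x (1 : ℂ) ≠ 0 := by
  intro h1
  apply h
  have h2 : ∀ v : ℂ, η x v = 0 := fun v => by
    have := (η x).map_smul v (1 : ℂ)
    rw [h1, smul_zero] at this
    rw [← this]; congr 1; change v = v * 1; rw [mul_one]
  ext1
  exact h2 _

/-- Complex differentiability on a disc gives analyticity, and with it the strict derivative
required by the inverse function theorem and the continuity of the derivative. -/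
theorem IsPrimitiveOn.exists_strictDeriv [IsManifold 𝓘(ℂ) 1 S] (hF : IsPrimitiveOn η F U)
    (hU : IsOpen U) (hx : x ∈ U) :
    AnalyticAt ℂ (F ∘ (chartAt ℂ x).symm) (chartAt ℂ x x) := by
  obtain ⟨r, hr, hball⟩ := Metric.eventually_nhds_iff_ball.1 (eventually_chart_symm_mem hU hx)
  refine DifferentiableOn.analyticAt (s := Metric.ball (chartAt ℂ x x) r) (fun w hw => ?_)
    (Metric.ball_mem_nhds _ hr)
  exact (hF.hasDerivAt_comp_chart_symm x (hball w hw).1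
    (hball w hw).2).differentiableAt.differentiableWithinAt

theorem IsPrimitiveOn.eventually_ne_zero [IsManifold 𝓘(ℂ) 1 S] (hF : IsPrimitiveOn η F U)
    (hU : IsOpen U) (hx : x ∈ U) (h : η x ≠ 0) : ∀ᶠ y in 𝓝 x, η y ≠ 0 := by
  have h0 := mem_chart_source ℂ x
  have hA := (hF.exists_strictDeriv hU hx).deriv.continuousAt
  have h1 : deriv (F ∘ (chartAt ℂ x).symm) (chartAt ℂ x x) ≠ 0 := by
    rw [(hF.hasDerivAt_comp_chart_self hx).deriv]
    exact apply_one_ne_zero h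
  have h2 := (hA.eventually_ne h1).and (eventually_chart_symm_mem hU hx)
  have hc := ((chartAt ℂ x).continuousAt h0).eventually h2
  filter_upwards [hc, (chartAt ℂ x).open_source.mem_nhds h0] with y hy hys hy0
  apply hy.1
  have h3 := hF.hasDerivAt_comp_chart_symm x hy.2.1 hy.2.2
  rw [h3.deriv, (chartAt ℂ x).left_inv hys, hy0]
  rfl

/-- Inverse function theorem: a primitive is a local coordinate wherever the form does not vanish.
-/
theorem IsPrimitiveOn.exists_chart [IsManifold 𝓘(ℂ) 1 S] (hF : IsPrimitiveOn η F U)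
    (hU : IsOpen U) (hx : x ∈ U) (h : η x ≠ 0) :
    ∃ e : OpenPartialHomeomorph S ℂ, x ∈ e.source ∧ e.source ⊆ U ∧ IsPrimitiveOn η e e.source := by
  have h0 := mem_chart_source ℂ x
  have hA := (hF.exists_strictDeriv hU hx).hasStrictDerivAt
  have h1 : deriv (F ∘ (chartAt ℂ x).symm) (chartAt ℂ x x) ≠ 0 := by
    rw [(hF.hasDerivAt_comp_chart_self hx).deriv]
    exact apply_one_ne_zero h
  have hB := hA.hasStrictFDerivAt_equiv h1
  let e := (((chartAt ℂ x).trans hB.toOpenPartialHomeomorph).restrOpen U hU)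
  have he : EqOn e F e.source := fun y hy => by
    simp only [e, OpenPartialHomeomorph.restrOpen_source, OpenPartialHomeomorph.trans_source] at hy
    change (F ∘ (chartAt ℂ x).symm) (chartAt ℂ x y) = F y
    simp [(chartAt ℂ x).left_inv hy.1.1]
  have hs : e.source ⊆ U := fun y hy => by
    simp only [e, OpenPartialHomeomorph.restrOpen_source] at hy
    exact hy.2
  refine ⟨e, ?_, hs, (hF.mono hs).congr e.open_source he⟩
  simp only [e, OpenPartialHomeomorph.restrOpen_source, OpenPartialHomeomorph.trans_source]
  exact ⟨⟨h0, hB.mem_toOpenPartialHomeomorph_source⟩, hx⟩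

end LocalStructure

/-! ### Conical points and local coordinates. -/

namespace ConicalSurface

variable {S : Type*} [MetricSpace S] [ChartedSpace ℂ S] (X : ConicalSurface S) {x σ : S}

theorem notMem_sing_of_mem_source (hσ : σ ∈ X.sing) (hx : x ∈ (X.chart σ).source) (hne : x ≠ σ) :
    x ∉ X.sing := fun h =>
  (X.disjoint σ x hσ h hne.symm).le_bot ⟨hx, X.mem_source x h⟩

theorem chart_ne_zero (hσ : σ ∈ X.sing) (hx : x ∈ (X.chart σ).source) (hne : x ≠ σ) :
    X.chart σ x ≠ 0 := fun h => by
  rw [← X.chart_center σ hσ] at h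
  exact hne ((X.chart σ).injOn hx (X.mem_source σ hσ) h)

variable [IsManifold 𝓘(ℂ) 1 S]

theorem exists_regular_chart (hx : x ∉ X.sing) {N : Set S} (hN : N ∈ 𝓝 x) :
    ∃ e : OpenPartialHomeomorph S ℂ, x ∈ e.source ∧ e.source ⊆ N ∧
      IsPrimitiveOn X.form e e.source := by
  obtain ⟨U, hU, hxU, F, hF⟩ := X.holomorphic x
  obtain ⟨V, hVN, hV, hxV⟩ := mem_nhds_iff.1 hN
  obtain ⟨e, h1, h2, h3⟩ := (hF.mono inter_subset_left).exists_chart (hU.inter hV) ⟨hxU, hxV⟩ hx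
  exact ⟨e, h1, (h2.trans inter_subset_right).trans hVN, h3⟩

theorem isClosed_sing : IsClosed X.sing := by
  rw [← isOpen_compl_iff, isOpen_iff_mem_nhds]
  intro x hx
  obtain ⟨U, hU, hxU, F, hF⟩ := X.holomorphic x
  exact hF.eventually_ne_zero hU hxU hx

/-- Around every point there is a coordinate `w` such that `w ^ n` is a primitive. -/
theorem exists_coord (x : S) : ∃ (e : OpenPartialHomeomorph S ℂ) (n : ℕ) (R : ℝ), n ≠ 0 ∧
    x ∈ e.source ∧ e x = 0 ∧ IsPrimitiveOn X.form (fun y => e y ^ n) e.source ∧ 0 < R ∧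
    Metric.ball 0 R ⊆ e.target ∧ ∀ y ∈ e.source, y ≠ x → y ∉ X.sing := by
  by_cases hx : x ∈ X.sing
  · exact ⟨X.chart x, X.n x, X.radius x, (X.n_pos x hx).ne', X.mem_source x hx,
      X.chart_center x hx, X.chart_form x hx, X.radius_pos x hx, (X.chart_target x hx).ge,
      fun y hy hne => X.notMem_sing_of_mem_source hx hy hne⟩
  · obtain ⟨e, h1, h2, h3⟩ := X.exists_regular_chart hx (X.isClosed_sing.isOpen_compl.mem_nhds hx)
    -- At a regular point a flat chart, translated so as to vanish at `x`, serves with exponent `1`.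
    -- This lets later arguments treat regular and conical points alike.
    let t := (Homeomorph.addRight (-(e x)) : ℂ ≃ₜ ℂ).toOpenPartialHomeomorph
    have h0 : e.trans t x = 0 := by simp [t]
    have hs : (e.trans t).source = e.source := by simp [t]
    have h4 : x ∈ (e.trans t).source := hs ▸ h1
    have h5 : (e.trans t).target ∈ 𝓝 (0 : ℂ) :=
      h0 ▸ (e.trans t).open_target.mem_nhds ((e.trans t).map_source h4)
    obtain ⟨R, hR, hb⟩ := Metric.mem_nhds_iff.1 h5
    refine ⟨e.trans t, 1, R, one_ne_zero, h4, h0, ?_, hR, hb, fun y hy _ => h2 (hs ▸ hy)⟩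
    rw [hs]
    have := h3.add_const (-(e x))
    simpa [t] using this

/-- A cone disc contains no other zero than its centre, so the zeros form a closed discrete set in a
compact space. -/
theorem finite_sing [CompactSpace S] : X.sing.Finite := by
  have hc : IsCompact X.sing := X.isClosed_sing.isCompact
  refine hc.finite ?_
  rw [isDiscrete_iff_forall_mem_exists_isOpen]
  intro x hx
  refine ⟨(X.chart x).source, (X.chart x).open_source, ?_⟩
  ext y
  constructor
  · rintro ⟨h1, h2⟩
    by_contra hne
    exact X.notMem_sing_of_mem_source hx h1 hne h2
  · rintro rfl
    exact ⟨X.mem_source y hx, hx⟩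

end ConicalSurface

/-- A function which is locally constant along a preconnected set is constant there. -/
theorem eq_of_eventually_eq_nhdsWithin {α β : Type*} [TopologicalSpace α] {Q : Set α}
    (hQ : IsPreconnected Q) {g : α → β} (h : ∀ z ∈ Q, ∀ᶠ z' in 𝓝[Q] z, g z' = g z)
    {z z' : α} (hz : z ∈ Q) (hz' : z' ∈ Q) : g z = g z' :=
  hQ.induction₂ (fun x y => g x = g y) (fun x hx => (h x hx).mono fun _ hy => hy.symm)
    (fun _ _ _ _ _ _ => Eq.trans) (fun _ _ _ _ => Eq.symm) hz hz'

/-- The straight line through `0` with velocity `u`. -/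
def line (u : ℂ) (t : ℝ) : ℂ := t * u

theorem continuous_line (u : ℂ) : Continuous (line u) := by
  unfold line; fun_prop

/-! ### Maps developed by the flat structure. -/

variable {S : Type*} [MetricSpace S] [ChartedSpace ℂ S]

/-- `c` maps `Q` into the regular part of the surface, and in flat coordinates it is `d`, up to
translations. -/
def Dev (X : ConicalSurface S) {α : Type*} [TopologicalSpace α] (d : α → ℂ) (c : α → S)
    (Q : Set α) : Prop :=
  ContinuousOn c Q ∧ ∀ z ∈ Q, c z ∉ X.sing ∧ ∀ (U : Set S) (F : S → ℂ), IsOpen U → c z ∈ U →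
    IsPrimitiveOn X.form F U → ∀ᶠ z' in 𝓝[Q] z, F (c z') - F (c z) = d z' - d z

namespace Dev

variable {X : ConicalSurface S} {α β : Type*} [TopologicalSpace α] [TopologicalSpace β]
  {d d' : α → ℂ} {c c' : α → S} {Q Q' : Set α}

theorem notMem (h : Dev X d c Q) {z : α} (hz : z ∈ Q) : c z ∉ X.sing := (h.2 z hz).1

theorem mono (h : Dev X d c Q) (hQ : Q' ⊆ Q) : Dev X d c Q' :=
  ⟨h.1.mono hQ, fun z hz => ⟨h.notMem (hQ hz), fun U F hU hcU hF =>
    ((h.2 z (hQ hz)).2 U F hU hcU hF).filter_mono (nhdsWithin_mono _ hQ)⟩⟩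

theorem congr (h : Dev X d c Q) (hc : EqOn c' c Q) : Dev X d c' Q := by
  refine ⟨h.1.congr hc, fun z hz => ?_⟩
  rw [hc hz]
  refine ⟨h.notMem hz, fun U F hU hcU hF => ?_⟩
  filter_upwards [(h.2 z hz).2 U F hU hcU hF, self_mem_nhdsWithin] with z' h1 h2
  rw [hc h2, h1]

theorem congr_dev (h : Dev X d c Q) (hd : ∀ z ∈ Q, ∀ z' ∈ Q, d' z' - d' z = d z' - d z) :
    Dev X d' c Q := by
  refine ⟨h.1, fun z hz => ⟨h.notMem hz, fun U F hU hcU hF => ?_⟩⟩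
  filter_upwards [(h.2 z hz).2 U F hU hcU hF, self_mem_nhdsWithin] with z' h1 h2
  rw [h1, hd z hz z' h2]

theorem comp (h : Dev X d c Q) {g : β → α} {P : Set β} (hg : ContinuousOn g P)
    (hm : MapsTo g P Q) : Dev X (d ∘ g) (c ∘ g) P := by
  refine ⟨h.1.comp hg hm, fun z hz => ⟨h.notMem (hm hz), fun U F hU hcU hF => ?_⟩⟩
  exact (tendsto_nhdsWithin_of_tendsto_nhds_of_eventually_within _ (hg z hz)
    (eventually_mem_nhdsWithin.mono fun y hy => hm hy)).eventually
    ((h.2 _ (hm hz)).2 U F hU hcU hF)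

theorem of_local (h : ∀ z ∈ Q, ∃ N ∈ 𝓝 z, Dev X d c (Q ∩ N)) : Dev X d c Q := by
  refine ⟨fun z hz => ?_, fun z hz => ?_⟩
  · obtain ⟨N, hN, hD⟩ := h z hz
    exact (continuousWithinAt_inter hN).1 (hD.1 z ⟨hz, mem_of_mem_nhds hN⟩)
  · obtain ⟨N, hN, hD⟩ := h z hz
    have := hD.2 z ⟨hz, mem_of_mem_nhds hN⟩
    rw [nhdsWithin_inter_of_mem' (mem_nhdsWithin_of_mem_nhds hN)] at this
    exact this

/-- A point of the union outside one piece is not in its closure, so the neighbourhood filter within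
that piece is trivial and only the other piece matters. -/
theorem union (h : Dev X d c Q) (h' : Dev X d c Q') (hQ : closure Q ∩ Q' ⊆ Q)
    (hQ' : closure Q' ∩ Q ⊆ Q') : Dev X d c (Q ∪ Q') := by
  have key : ∀ z ∈ Q ∪ Q', (z ∈ Q ∨ 𝓝[Q] z = ⊥) ∧ (z ∈ Q' ∨ 𝓝[Q'] z = ⊥) := by
    intro z hz
    constructor
    · by_cases hzQ : z ∈ Q
      · exact Or.inl hzQ
      · exact Or.inr (notMem_closure_iff_nhdsWithin_eq_bot.1 fun hcl =>
          hzQ (hQ ⟨hcl, hz.resolve_left hzQ⟩))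
    · by_cases hzQ : z ∈ Q'
      · exact Or.inl hzQ
      · exact Or.inr (notMem_closure_iff_nhdsWithin_eq_bot.1 fun hcl =>
          hzQ (hQ' ⟨hcl, hz.resolve_right hzQ⟩))
  refine ⟨fun z hz => ContinuousWithinAt.union ?_ ?_, fun z hz =>
    ⟨hz.elim h.notMem h'.notMem, fun U F hU hcU hF => ?_⟩⟩
  · rcases (key z hz).1 with h1 | h1
    · exact h.1 z h1
    · simp [ContinuousWithinAt, h1]
  · rcases (key z hz).2 with h1 | h1
    · exact h'.1 z h1
    · simp [ContinuousWithinAt, h1]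
  · rw [nhdsWithin_union, eventually_sup]
    constructor
    · rcases (key z hz).1 with h1 | h1
      · exact (h.2 z h1).2 U F hU hcU hF
      · simp [h1]
    · rcases (key z hz).2 with h1 | h1
      · exact (h'.2 z h1).2 U F hU hcU hF
      · simp [h1]

/-- Two paths that meet at time `a` can be joined. -/
theorem glue {d : ℝ → ℂ} {c c' : ℝ → S} {P : Set ℝ} {a : ℝ} (h : Dev X d c (P ∩ Iic a))
    (h' : Dev X d c' (P ∩ Ici a)) (hcc : c a = c' a) :
    Dev X d (fun t => if t ≤ a then c t else c' t) P := by
  have hP : P = P ∩ Iic a ∪ P ∩ Ici a := by rw [← inter_union_distrib_left, Iic_union_Ici, inter_univ]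
  rw [hP]
  refine union (h.congr fun t ht => if_pos ht.2) (h'.congr fun t ht => ?_) ?_ ?_
  · rcases eq_or_lt_of_le (show a ≤ t from ht.2) with rfl | h1
    · simp [hcc]
    · exact if_neg (not_le.2 h1)
  · exact fun t ht => ⟨ht.2.1, closure_minimal inter_subset_right isClosed_Iic ht.1⟩
  · exact fun t ht => ⟨ht.2.1, closure_minimal inter_subset_right isClosed_Ici ht.1⟩

theorem comp_add {E : ℂ → S} {A : Set ℂ} (h : Dev X id E A) (v : ℂ) :
    Dev X id (fun z => E (v + z)) ((fun z => v + z) ⁻¹' A) := by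
  refine ((h.comp (g := fun z => v + z) (P := (fun z => v + z) ⁻¹' A) (by fun_prop)
    fun z hz => hz)).congr_dev fun z _ z' _ => ?_
  simp

/-- A developed map whose development stays within a coordinate disc of a primitive stays in
that disc. -/
theorem trap (hQ : IsPreconnected Q) (h : Dev X d c Q)
    {e : OpenPartialHomeomorph S ℂ} {n : ℕ}
    {r : ℝ} (he : IsPrimitiveOn X.form (fun y => e y ^ n) e.source)
    (hr : Metric.closedBall 0 r ⊆ e.target) {t₀ : α} (ht₀ : t₀ ∈ Q) (hs : c t₀ ∈ e.source)
    (hlt : ∀ t ∈ Q, ‖e (c t₀) ^ n + (d t - d t₀)‖ < r ^ n) (hr0 : 0 < r) :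
    ∀ t ∈ Q, c t ∈ e.source ∧ ‖e (c t)‖ < r ∧ e (c t) ^ n = e (c t₀) ^ n + (d t - d t₀) := by
  -- The image of the closed disc is compact, hence closed in `S`. The path cannot leave it through
  -- a boundary that the chart does not see.
  have hcl : IsClosed (e.symm '' Metric.closedBall 0 r) :=
    ((isCompact_closedBall _ _).image_of_continuousOn (e.continuousOn_symm.mono hr)).isClosed
  have hmem : ∀ y, y ∈ e.symm '' Metric.closedBall 0 r ↔ y ∈ e.source ∧ ‖e y‖ ≤ r := fun y => by
    constructor
    · rintro ⟨w, hw, rfl⟩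
      refine ⟨e.map_target (hr hw), ?_⟩
      rw [e.right_inv (hr hw)]; simpa using hw
    · rintro ⟨h1, h2⟩
      exact ⟨e y, by simpa using h2, e.left_inv h1⟩
  have hnorm : ∀ w : ℂ, ‖w ^ n‖ < r ^ n → ‖w‖ < r := fun w hw => by
    rw [norm_pow] at hw
    exact lt_of_pow_lt_pow_left₀ n hr0.le hw
  let G : α → Prop := fun t =>
    c t ∈ e.source ∧ ‖e (c t)‖ < r ∧ e (c t) ^ n = e (c t₀) ^ n + (d t - d t₀)
  have h0 : G t₀ := ⟨hs, hnorm _ (by simpa using hlt t₀ ht₀), by simp⟩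
  intro t ht
  -- Open-closed argument, phrased as local constancy of the `Prop`-valued function `G`. Closedness
  -- uses the compact disc first, and then the strict bound on the development to return to the open
  -- disc.
  refine ((eq_of_eventually_eq_nhdsWithin hQ (g := G) (fun z hz => ?_)
    ht₀ ht)).mp h0
  by_cases hG : G z
  · have : ∀ᶠ z' in 𝓝[Q] z, G z' := by
      have hnm : ∀ᶠ y in 𝓝 (c z), ‖e y‖ < r :=
        (e.continuousAt hG.1).norm.eventually_lt_const hG.2.1
      filter_upwards [(h.2 z hz).2 _ _ e.open_source hG.1 he,
        (h.1 z hz) (e.open_source.mem_nhds hG.1), (h.1 z hz) hnm] with y a1 a2 a3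
      refine ⟨a2, a3, ?_⟩
      have := hG.2.2
      linear_combination a1 + this
    filter_upwards [this] with y hy
    exact propext (iff_of_true hy hG)
  · have : ∀ᶠ z' in 𝓝[Q] z, ¬ G z' := by
      by_contra hcon
      have hfr : ∃ᶠ z' in 𝓝[Q] z, G z' := hcon
      apply hG
      have m1 : c z ∈ e.symm '' Metric.closedBall 0 r := by
        have : ∃ᶠ z' in 𝓝[Q] z, c z' ∈ e.symm '' Metric.closedBall 0 r :=
          hfr.mono fun y hy => (hmem _).2 ⟨hy.1, hy.2.1.le⟩
        have h2 : ∃ᶠ y in 𝓝 (c z), y ∈ e.symm '' Metric.closedBall 0 r :=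
          (h.1 z hz).frequently this
        exact hcl.mem_of_frequently_of_tendsto h2 tendsto_id
      have m2 := ((hmem _).1 m1).1
      have m3 : e (c z) ^ n = e (c t₀) ^ n + (d z - d t₀) := by
        have hev := (h.2 z hz).2 _ _ e.open_source m2 he
        obtain ⟨y, hy, hy2⟩ := (hfr.and_eventually hev).exists
        have := hy.2.2
        linear_combination this - hy2
      exact ⟨m2, hnorm _ (m3 ▸ hlt z hz), m3⟩
    filter_upwards [this] with y hy
    exact propext (iff_of_false hy hG)

variable [IsManifold 𝓘(ℂ) 1 S]

/-- One primitive at each point is enough, since two primitives differ by a constant near the point.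
-/
theorem of_exists (hc : ContinuousOn c Q) (h : ∀ z ∈ Q, c z ∉ X.sing ∧ ∃ (U : Set S) (F : S → ℂ),
    IsOpen U ∧ c z ∈ U ∧ IsPrimitiveOn X.form F U ∧
      ∀ᶠ z' in 𝓝[Q] z, F (c z') - F (c z) = d z' - d z) : Dev X d c Q := by
  refine ⟨hc, fun z hz => ⟨(h z hz).1, fun V G hV hcV hG => ?_⟩⟩
  obtain ⟨U, F, hU, hcU, hF, he⟩ := (h z hz).2
  filter_upwards [he, (hc z hz).eventually (hG.eventually_sub_eq hF hV hU hcV hcU)] with z' h1 h2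
  rw [h2, h1]

theorem continuousOn_dev (h : Dev X d c Q) : ContinuousOn d Q := by
  intro z hz
  obtain ⟨e, h1, -, h3⟩ := X.exists_regular_chart (h.notMem hz) univ_mem
  have h4 := (h.2 z hz).2 _ _ e.open_source h1 h3
  have h5 : ContinuousWithinAt (fun z' => e (c z') - e (c z) + d z) Q z :=
    (((e.continuousAt h1).comp_continuousWithinAt (h.1 z hz)).sub
      continuousWithinAt_const).add continuousWithinAt_const
  refine h5.congr_of_eventuallyEq (h4.mono fun y hy => ?_) (by simp)
  simp only [hy]; ring

theorem eventually_eq (h : Dev X d c Q) (h' : Dev X d c' Q) {z : α} (hz : z ∈ Q)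
    (hcc : c z = c' z) : ∀ᶠ z' in 𝓝[Q] z, c z' = c' z' := by
  obtain ⟨e, h1, -, h3⟩ := X.exists_regular_chart (h.notMem hz) univ_mem
  have h1' : c' z ∈ e.source := hcc ▸ h1
  filter_upwards [(h.2 z hz).2 _ _ e.open_source h1 h3, (h'.2 z hz).2 _ _ e.open_source h1' h3,
    (h.1 z hz) (e.open_source.mem_nhds h1), (h'.1 z hz) (e.open_source.mem_nhds h1')]
    with z' a1 a2 a3 a4
  refine e.injOn a3 a4 ?_
  rw [← a2, hcc] at a1
  exact sub_left_injective a1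

/-- The coincidence set is open because a flat chart is injective and both maps move alike in it,
and closed because `S` is Hausdorff. -/
theorem eqOn (hQ : IsPreconnected Q) (h : Dev X d c Q) (h' : Dev X d c' Q) {z₀ : α}
    (hz₀ : z₀ ∈ Q) (hcc : c z₀ = c' z₀) : EqOn c c' Q := by
  intro z hz
  refine ((eq_of_eventually_eq_nhdsWithin hQ (g := fun z => c z = c' z) (fun z hz => ?_)
    hz₀ hz)).mp hcc
  by_cases hzz : c z = c' z
  · filter_upwards [h.eventually_eq h' hz hzz] with z' h1
    simp [h1, hzz]
  · have : ∀ᶠ z' in 𝓝[Q] z, c z' ≠ c' z' := by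
      obtain ⟨A, B, hA, hB, hzA, hzB, hAB⟩ := t2_separation hzz
      filter_upwards [(h.1 z hz) (hA.mem_nhds hzA), (h'.1 z hz) (hB.mem_nhds hzB)] with y h1 h2 h3
      exact hAB.le_bot ⟨h1, (show c y ∈ B from h3 ▸ h2)⟩
    filter_upwards [this] with z' h1
    simp [h1, hzz]

/-- In a flat chart, a map developed by the identity is a translation. -/
theorem isOpenMap_at {c : ℂ → S} {Q : Set ℂ} (h : Dev X id c Q) {z : ℂ} (hQ : Q ∈ 𝓝 z)
    {N : Set ℂ} (hN : N ∈ 𝓝 z) : c '' N ∈ 𝓝 (c z) := by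
  have hz := mem_of_mem_nhds hQ
  obtain ⟨e, h1, -, h3⟩ := X.exists_regular_chart (h.notMem hz) univ_mem
  have hcz : ContinuousAt c z := (h.1 z hz).continuousAt hQ
  have h4 := (h.2 z hz).2 _ _ e.open_source h1 h3
  rw [nhdsWithin_eq_nhds.2 hQ] at h4
  have h5 : ∀ᶠ z' in 𝓝 z, c z' ∈ e.source ∧ e (c z') = e (c z) + (z' - z) ∧ z' ∈ N := by
    filter_upwards [h4, hcz (e.open_source.mem_nhds h1), hN] with y a1 a2 a3
    refine ⟨a2, ?_, a3⟩
    simp only [id] at a1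
    linear_combination a1
  have h6 : Tendsto (fun y => z + (e y - e (c z))) (𝓝 (c z)) (𝓝 z) := by
    have : ContinuousAt (fun y => z + (e y - e (c z))) (c z) :=
      continuousAt_const.add ((e.continuousAt h1).sub continuousAt_const)
    simpa [ContinuousAt] using this
  filter_upwards [h6 h5, e.open_source.mem_nhds h1] with y hy hys
  refine ⟨_, hy.2.2, e.injOn hy.1 hys ?_⟩
  rw [hy.2.1]; ring

end Dev

namespace ConicalSurface

variable [IsManifold 𝓘(ℂ) 1 S] (X : ConicalSurface S)

/-- `E` is the flat exponential map: the inverse of a flat chart, translated. With a chart disc of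
radius `R`, the radius `R / 2` serves for all base points within `R / 2` of the centre. -/
theorem exists_exp_nhds {x : S} (hx : x ∉ X.sing) : ∃ r > 0, ∀ᶠ y in 𝓝 x,
    ∃ E : ℂ → S, E 0 = y ∧ Dev X id E (Metric.ball 0 r) := by
  obtain ⟨e, h1, h2, h3⟩ := X.exists_regular_chart hx (X.isClosed_sing.isOpen_compl.mem_nhds hx)
  obtain ⟨R, hR, hb⟩ := Metric.mem_nhds_iff.1 (e.open_target.mem_nhds (e.map_source h1))
  refine ⟨R / 2, by positivity, ?_⟩
  have h4 : ∀ᶠ y in 𝓝 x, e y ∈ Metric.ball (e x) (R / 2) :=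
    (e.continuousAt h1) (Metric.ball_mem_nhds _ (by positivity))
  filter_upwards [h4, e.open_source.mem_nhds h1] with y hy hys
  have hmaps : ∀ z ∈ Metric.ball (0 : ℂ) (R / 2), e y + z ∈ e.target := fun z hz => by
    apply hb
    simp only [Metric.mem_ball, dist_eq_norm, sub_zero] at *
    calc ‖e y + z - e x‖ = ‖(e y - e x) + z‖ := by ring_nf
      _ ≤ ‖e y - e x‖ + ‖z‖ := norm_add_le _ _
      _ < R := by linarith
  refine ⟨fun z => e.symm (e y + z), by simp [e.left_inv hys], Dev.of_exists ?_ fun z hz => ?_⟩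
  · exact e.continuousOn_symm.comp (by fun_prop) hmaps
  · refine ⟨h2 (e.map_target (hmaps z hz)), e.source, e, e.open_source,
      e.map_target (hmaps z hz), h3, ?_⟩
    filter_upwards [self_mem_nhdsWithin] with z' hz'
    rw [e.right_inv (hmaps z hz), e.right_inv (hmaps z' hz')]
    simp

theorem exists_exp {x : S} (hx : x ∉ X.sing) : ∃ r > 0,
    ∃ E : ℂ → S, E 0 = x ∧ Dev X id E (Metric.ball 0 r) := by
  obtain ⟨r, hr, h⟩ := X.exists_exp_nhds hx
  exact ⟨r, hr, h.self_of_nhds⟩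

theorem exists_exp_compact {M : Set S} (hM : IsCompact M) (hMs : ∀ x ∈ M, x ∉ X.sing) :
    ∃ r > 0, ∀ x ∈ M, ∃ E : ℂ → S, E 0 = x ∧ Dev X id E (Metric.ball 0 r) := by
  refine hM.induction_on (p := fun M => ∃ r > 0, ∀ x ∈ M,
    ∃ E : ℂ → S, E 0 = x ∧ Dev X id E (Metric.ball 0 r)) ⟨1, one_pos, by simp⟩ ?_ ?_ ?_
  · rintro s t hst ⟨r, hr, h⟩
    exact ⟨r, hr, fun x hx => h x (hst hx)⟩
  · rintro s t ⟨r, hr, h⟩ ⟨r', hr', h'⟩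
    refine ⟨min r r', lt_min hr hr', ?_⟩
    rintro x (hx | hx)
    · obtain ⟨E, h0, hE⟩ := h x hx
      exact ⟨E, h0, hE.mono (Metric.ball_subset_ball (min_le_left _ _))⟩
    · obtain ⟨E, h0, hE⟩ := h' x hx
      exact ⟨E, h0, hE.mono (Metric.ball_subset_ball (min_le_right _ _))⟩
  · intro x hx
    obtain ⟨r, hr, h⟩ := X.exists_exp_nhds (hMs x hx)
    exact ⟨_, mem_nhdsWithin_of_mem_nhds h, r, hr, fun y hy => hy⟩

end ConicalSurface

namespace Dev

variable [IsManifold 𝓘(ℂ) 1 S] {X : ConicalSurface S} {α : Type*} [TopologicalSpace α]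
  {d : α → ℂ} {c : α → S} {Q : Set α}

/-- A developed map on a compact set extends to a tube. -/
theorem exists_tube (h : Dev X d c Q) (hQ : IsCompact Q) : ∃ δ > 0, ∃ E : α × ℂ → S,
    (∀ q ∈ Q, E (q, 0) = c q) ∧
    Dev X (fun p => d p.1 + p.2) E (Q ×ˢ Metric.ball 0 δ) := by
  obtain ⟨r, hr, hE⟩ := X.exists_exp_compact (hQ.image_of_continuousOn h.1) (by
    rintro _ ⟨q, hq, rfl⟩
    exact h.notMem hq)
  have hE' : ∀ q : α, ∃ E : ℂ → S, q ∈ Q → E 0 = c q ∧ Dev X id E (Metric.ball 0 r) := fun q => by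
    by_cases hq : q ∈ Q
    · obtain ⟨E, hE⟩ := hE _ (mem_image_of_mem c hq)
      exact ⟨E, fun _ => hE⟩
    · exact ⟨fun _ => c q, fun h => (hq h).elim⟩
  choose E hE using hE'
  have hdc := h.continuousOn_dev
  refine ⟨r / 2, by positivity, fun p => E p.1 p.2, fun q hq => (hE q hq).1, of_local ?_⟩
  rintro ⟨q₀, z₀⟩ ⟨hq₀, hz₀⟩
  simp only at hq₀ hz₀
  have n1 : ∀ᶠ q in 𝓝[Q] q₀, d q - d q₀ ∈ Metric.ball (0 : ℂ) (r / 2) := by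
    have : ContinuousWithinAt (fun q => d q - d q₀) Q q₀ := (hdc q₀ hq₀).sub_const _
    have h2 := this.tendsto
    rw [sub_self] at h2
    exact h2 (Metric.ball_mem_nhds _ (by positivity))
  obtain ⟨A, hA, hA2⟩ := mem_nhdsWithin_iff_exists_mem_nhds_inter.1 n1
  have hAm : ∀ q ∈ Q ∩ A, d q - d q₀ ∈ Metric.ball (0 : ℂ) (r / 2) := fun q hq =>
    hA2 ⟨hq.2, hq.1⟩
  -- near `q₀` the map `c` is given by the exponential map at `c q₀`
  have n2 : ∀ᶠ q in 𝓝[Q ∩ A] q₀, c q = E q₀ (d q - d q₀) := by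
    have e1 := h.mono (Q' := Q ∩ A) inter_subset_left
    have e2 := (hE q₀ hq₀).2.comp (g := fun q => d q - d q₀) (P := Q ∩ A)
      ((hdc.mono inter_subset_left).sub continuousOn_const)
      (fun q hq => Metric.ball_subset_ball (by linarith) (hAm q hq))
    have e3 : Dev X d (E q₀ ∘ fun q => d q - d q₀) (Q ∩ A) :=
      e2.congr_dev fun _ _ _ _ => by simp
    refine e1.eventually_eq e3 ⟨hq₀, mem_of_mem_nhds hA⟩ ?_
    simp [(hE q₀ hq₀).1]
  rw [nhdsWithin_inter_of_mem' (mem_nhdsWithin_of_mem_nhds hA)] at n2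
  obtain ⟨B, hB, hB2⟩ := mem_nhdsWithin_iff_exists_mem_nhds_inter.1 n2
  -- Near `q₀` every exponential map `E q` is a restriction of the single map `E q₀`, shifted by `d
  -- q - d q₀`. So the separately chosen maps fit together continuously in `q`.
  have key : ∀ q ∈ Q ∩ (A ∩ B), ∀ z ∈ Metric.ball (0 : ℂ) (r / 2),
      E q z = E q₀ (d q - d q₀ + z) := fun q hq z hz => by
    have e1 := (hE q hq.1).2.mono (Metric.ball_subset_ball (by linarith : r / 2 ≤ r))
    have e2 := ((hE q₀ hq₀).2.comp_add (d q - d q₀)).mono (Q' := Metric.ball 0 (r / 2)) (by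
      intro z hz
      have h1 := hAm q ⟨hq.1, hq.2.1⟩
      simp only [mem_preimage, mem_ball_zero_iff] at *
      linarith [norm_add_le (d q - d q₀) z])
    refine eqOn (convex_ball _ _).isPreconnected e1 e2 (Metric.mem_ball_self (by positivity)) ?_ hz
    rw [(hE q hq.1).1, add_zero]
    exact hB2 ⟨hq.2.2, hq.1⟩
  refine ⟨(A ∩ B) ×ˢ univ, prod_mem_nhds (inter_mem hA hB) univ_mem, ?_⟩
  have hsub : Q ×ˢ Metric.ball (0 : ℂ) (r / 2) ∩ (A ∩ B) ×ˢ univ ⊆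
      (Q ∩ (A ∩ B)) ×ˢ Metric.ball (0 : ℂ) (r / 2) := fun p hp => ⟨⟨hp.1.1, hp.2.1⟩, hp.1.2⟩
  refine Dev.mono ?_ hsub
  have f1 := (hE q₀ hq₀).2.comp (g := fun p : α × ℂ => d p.1 - d q₀ + p.2)
    (P := (Q ∩ (A ∩ B)) ×ˢ Metric.ball (0 : ℂ) (r / 2))
    (((hdc.comp continuousOn_fst (fun p hp => hp.1.1)).sub continuousOn_const).add
      continuousOn_snd) (fun p hp => by
      have h1 := hAm p.1 ⟨hp.1.1, hp.1.2.1⟩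
      have h2 := hp.2
      simp only [mem_ball_zero_iff] at *
      linarith [norm_add_le (d p.1 - d q₀) p.2])
  refine (f1.congr (fun p hp => key p.1 hp.1 p.2 hp.2)).congr_dev fun p _ p' _ => ?_
  simp only [Function.comp, id]; ring

/-- Take a cluster point `w` by compactness. As the development converges, the tail of the path
hardly moves in the coordinate at `w`, so once it is near `w` it is trapped in a small disc there.
The coordinate is an `n`-th root, hence `w` may be conical. -/
theorem exists_tendsto [CompactSpace S] {d : ℝ → ℂ} {c : ℝ → S} {a b : ℝ} (hab : a < b)
    (h : Dev X d c (Ioo a b)) {D : ℂ} (hd : Tendsto d (𝓝[<] b) (𝓝 D)) :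
    ∃ w, Tendsto c (𝓝[<] b) (𝓝 w) := by
  obtain ⟨w, hw⟩ := exists_clusterPt_of_compactSpace (map c (𝓝[<] b))
  refine ⟨w, ?_⟩
  obtain ⟨e, n, R, hn, hws, hw0, hprim, hR, hRt, -⟩ := X.exists_coord w
  intro N hN
  -- a small disc inside `N`
  have hN' : e.symm ⁻¹' N ∈ 𝓝 (0 : ℂ) := by
    have := e.tendsto_symm hws
    rw [hw0] at this
    exact this hN
  obtain ⟨r₁, hr₁, hr₁N⟩ := Metric.mem_nhds_iff.1 hN'
  obtain ⟨r, hr, hrlt⟩ : ∃ r > 0, r < min r₁ R := exists_between (lt_min hr₁ hR)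
  have hrt : Metric.closedBall 0 r ⊆ e.target := (Metric.closedBall_subset_ball
    (hrlt.trans_le (min_le_right _ _))).trans hRt
  have hrn : 0 < r ^ n / 4 := by positivity
  have hd1 : ∀ᶠ t in 𝓝[<] b, d t ∈ Metric.ball D (r ^ n / 4) := hd (Metric.ball_mem_nhds _ hrn)
  obtain ⟨s, hs, hs2⟩ := (mem_nhdsLT_iff_exists_Ioo_subset' hab).1
    (inter_mem hd1 (Ioo_mem_nhdsLT hab))
  have hlt : ∀ᶠ y in 𝓝 w, y ∈ e.source ∧ ‖e y ^ n‖ < r ^ n / 4 := by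
    have : ContinuousAt (fun y => ‖e y ^ n‖) w := ((e.continuousAt hws).pow n).norm
    have h2 : ‖e w ^ n‖ < r ^ n / 4 := by simpa [hw0, hn] using hrn
    exact (Filter.eventually_of_mem (e.open_source.mem_nhds hws) fun _ h => h).and
      (this.eventually_lt_const h2)
  have hfr : ∃ᶠ t in 𝓝[<] b, c t ∈ e.source ∧ ‖e (c t) ^ n‖ < r ^ n / 4 :=
    hw.frequently hlt
  obtain ⟨t₀, ⟨h1, h2⟩, ht₀⟩ := (hfr.and_eventually (Ioo_mem_nhdsLT hs)).exists
  have htrap := (h.mono (Q' := Ioo s b) fun t ht => (hs2 ht).2).trap isPreconnected_Ioo hprim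
    hrt ht₀ h1 (fun t ht => by
      have a1 : ‖d t - D‖ < r ^ n / 4 := by simpa [dist_eq_norm] using (hs2 ht).1
      have a2 : ‖d t₀ - D‖ < r ^ n / 4 := by simpa [dist_eq_norm] using (hs2 ht₀).1
      have a3 : ‖d t - d t₀‖ ≤ ‖d t - D‖ + ‖d t₀ - D‖ := by
        rw [show d t - d t₀ = (d t - D) - (d t₀ - D) by ring]; exact norm_sub_le _ _
      linarith [norm_add_le (e (c t₀) ^ n) (d t - d t₀)]) hr
  change ∀ᶠ t in 𝓝[<] b, c t ∈ N
  filter_upwards [Ioo_mem_nhdsLT hs] with t ht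
  obtain ⟨b1, b2, -⟩ := htrap t ht
  have : e.symm (e (c t)) ∈ N :=
    hr₁N (by simpa using b2.trans (hrlt.trans_le (min_le_left _ _)))
  rwa [e.left_inv b1] at this

end Dev

/-! ### Maximal straight paths. -/

namespace ConicalSurface

variable [CompactSpace S] [IsManifold 𝓘(ℂ) 1 S] (X : ConicalSurface S)

/-- A straight path either goes on forever or runs into a conical point. -/
theorem exists_leaf {x : S} (hx : x ∉ X.sing) (u : ℂ) :
    (∃ c : ℝ → S, c 0 = x ∧ Dev X (line u) c (Ici 0)) ∨
    ∃ T > 0, ∃ c : ℝ → S, c 0 = x ∧ Dev X (line u) c (Ico 0 T) ∧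
      ∃ σ ∈ X.sing, Tendsto c (𝓝[<] T) (𝓝 σ) := by
  let A : Set ℝ := {T | 0 ≤ T ∧ ∃ c : ℝ → S, c 0 = x ∧ Dev X (line u) c (Icc 0 T)}
  -- A path up to time `T` is prolonged by the exponential map at its end point.
  have ext : ∀ T ∈ A, ∀ c : ℝ → S, c 0 = x → Dev X (line u) c (Icc 0 T) →
      ∀ r > 0, ∀ E : ℂ → S, E 0 = c T → Dev X id E (Metric.ball 0 r) → ∀ δ ≥ 0,
      δ * ‖u‖ < r → T + δ ∈ A := by
    intro T hT c hc0 hc r hr E hE0 hE δ hδ hδr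
    refine ⟨add_nonneg hT.1 hδ, fun t => if t ≤ T then c t else E ((t - T) * u), ?_, ?_⟩
    · change (if (0 : ℝ) ≤ T then c 0 else _) = x
      rw [if_pos hT.1, hc0]
    refine Dev.glue (c' := fun t : ℝ => E ((t - T) * u)) (hc.mono fun t ht => ⟨ht.1.1, ht.2⟩)
      (Dev.mono (Q := Icc T (T + δ)) ?_ fun t ht => ⟨ht.2, ht.1.2⟩) (by simp [hE0])
    have h1 := hE.comp (g := fun t : ℝ => ((t - T) * u : ℂ)) (P := Icc T (T + δ))
      (by fun_prop) (fun t ht => by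
        simp only [mem_ball_zero_iff, norm_mul]
        rw [show ((t : ℂ) - T) = ((t - T : ℝ) : ℂ) by push_cast; ring, Complex.norm_real,
          Real.norm_of_nonneg (by linarith [ht.1])]
        refine lt_of_le_of_lt ?_ hδr
        exact mul_le_mul_of_nonneg_right (by linarith [ht.2]) (norm_nonneg _))
    have h2 := h1.congr_dev (d' := line u) (fun t _ t' _ => by
      simp only [Function.comp, id, line]; ring)
    exact h2
  have h0 : (0 : ℝ) ∈ A := by
    refine ⟨le_rfl, fun _ => x, rfl, ?_⟩
    obtain ⟨r, hr, E, hE0, hE⟩ := X.exists_exp hx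
    have := hE.comp (g := fun _ : ℝ => (0 : ℂ)) (P := Icc 0 0) (by fun_prop)
      (fun _ _ => Metric.mem_ball_self hr)
    refine (this.congr_dev (fun t ht t' ht' => ?_)).congr fun t ht => hE0.symm
    simp only [Icc_self, mem_singleton_iff] at ht ht'
    simp [ht, ht', line]
  have hex : ∀ r > 0, ∃ δ > 0, δ * ‖u‖ < r := fun r hr => by
    refine ⟨r / (‖u‖ + 1), by positivity, ?_⟩
    rw [div_mul_eq_mul_div, div_lt_iff₀ (by positivity)]
    nlinarith [norm_nonneg u]
  have hdown : ∀ T ∈ A, ∀ t, 0 ≤ t → t ≤ T → t ∈ A := fun T hT t ht htT => by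
    obtain ⟨-, c, hc0, hc⟩ := hT
    exact ⟨ht, c, hc0, hc.mono (Icc_subset_Icc_right htT)⟩
  -- glue
  have glue : ∀ J : Set ℝ, J ⊆ Ici 0 → (∀ t ∈ J, ∃ t' ∈ A, t < t') →
      ∃ c : ℝ → S, Dev X (line u) c J ∧
      ∀ T ∈ A, ∀ c' : ℝ → S, c' 0 = x → Dev X (line u) c' (Icc 0 T) →
        EqOn c c' (Icc 0 T) := by
    intro J hJ0 hJ
    have hA : ∀ T, ∃ c : ℝ → S, T ∈ A → c 0 = x ∧ Dev X (line u) c (Icc 0 T) := fun T => by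
      by_cases hT : T ∈ A
      · obtain ⟨c, hc⟩ := hT.2
        exact ⟨c, fun _ => hc⟩
      · exact ⟨fun _ => x, fun h => (hT h).elim⟩
    choose C hC using hA
    have hC0 := fun T hT => (hC T hT).1
    replace hC := fun T hT => (hC T hT).2
    have heq : ∀ T ∈ A, ∀ c' : ℝ → S, c' 0 = x → Dev X (line u) c' (Icc 0 T) →
        EqOn (fun t => C t t) c' (Icc 0 T) := fun T hT c' h0' hc' t ht =>
      Dev.eqOn isPreconnected_Icc (hC t (hdown T hT t ht.1 ht.2))
        (hc'.mono (Icc_subset_Icc_right ht.2)) (left_mem_Icc.2 ht.1)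
        ((hC0 t (hdown T hT t ht.1 ht.2)).trans h0'.symm) (right_mem_Icc.2 ht.1)
    -- By uniqueness the diagonal of the chosen paths agrees with each of them, so it is itself a
    -- path.
    refine ⟨fun t => C t t, Dev.of_local fun t ht => ?_, heq⟩
    obtain ⟨t', ht', htt'⟩ := hJ t ht
    refine ⟨Iio t', Iio_mem_nhds htt', ?_⟩
    have := (hC t' ht').congr (heq t' ht' _ (hC0 t' ht') (hC t' ht'))
    exact this.mono fun s hs => ⟨hJ0 hs.1, (le_of_lt hs.2)⟩
  by_cases hb : BddAbove A
  · right
    set T := sSup A with hTdef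
    have hlt : ∀ t < T, 0 ≤ t → ∃ t' ∈ A, t < t' := fun t ht _ => exists_lt_of_lt_csSup ⟨0, h0⟩ ht
    have hT0 : 0 < T := by
      obtain ⟨r, hr, E, hE0, hE⟩ := X.exists_exp hx
      obtain ⟨δ, hδ, hδr⟩ := hex r hr
      obtain ⟨-, c, hc0, hc⟩ := id h0
      have := ext 0 h0 c hc0 hc r hr E (hE0.trans hc0.symm) hE δ hδ.le hδr
      exact lt_of_lt_of_le (by linarith) (le_csSup hb this)
    obtain ⟨c, hc, hceq⟩ := glue (Ico 0 T) (fun t ht => ht.1) fun t ht => hlt t ht.2 ht.1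
    have hc0 : c 0 = x := by
      obtain ⟨-, c', hc0, hc'⟩ := id h0
      rw [hceq 0 h0 c' hc0 hc' (left_mem_Icc.2 le_rfl), hc0]
    refine ⟨T, hT0, c, hc0, hc, ?_⟩
    have hdT : Tendsto (line u) (𝓝[<] T) (𝓝 (line u T)) := by
      exact (continuous_line u).continuousAt.tendsto.mono_left nhdsWithin_le_nhds
    obtain ⟨w, hw⟩ := (hc.mono Ioo_subset_Ico_self).exists_tendsto hT0 hdT
    refine ⟨w, ?_, hw⟩
    by_contra hws
    -- If the limit were regular, the exponential maps at nearby points would have a common radius,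
    -- which prolongs the path beyond the supremum `T`.
    obtain ⟨r, hr, hE⟩ := X.exists_exp_nhds hws
    obtain ⟨δ, hδ, hδr⟩ := hex r hr
    have : Ioo (max 0 (T - δ)) T ∈ 𝓝[<] T := Ioo_mem_nhdsLT (by simp [hT0, hδ])
    obtain ⟨t, ⟨E, hE0, hE⟩, ht⟩ := ((hw.eventually hE).and this).exists
    have ht0 : 0 ≤ t := (le_max_left _ _).trans ht.1.le
    have htA : t ∈ A := by
      obtain ⟨t', ht', htt'⟩ := hlt t ht.2 ht0
      exact hdown t' ht' t ht0 htt'.le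
    have h3 := ext t htA c hc0 (hc.mono (Icc_subset_Ico_right ht.2)) r hr E hE0 hE δ hδ.le hδr
    have h4 := le_csSup hb h3
    have := (le_max_right 0 (T - δ)).trans_lt ht.1
    linarith
  · left
    obtain ⟨c, hc, hceq⟩ := glue (Ici 0) subset_rfl fun t _ => by
      obtain ⟨t', h1, h2⟩ := not_bddAbove_iff.1 hb t
      exact ⟨t', h1, h2⟩
    refine ⟨c, ?_, hc⟩
    obtain ⟨-, c', hc0, hc'⟩ := id h0
    rw [hceq 0 h0 c' hc0 hc' (left_mem_Icc.2 le_rfl), hc0]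

end ConicalSurface

/-! ### The linear pseudo-Anosov map acting on developed paths. -/

theorem stretch_sub (l : ℝ) (z w : ℂ) : stretch l (z - w) = stretch l z - stretch l w := by
  apply Complex.ext <;> simp [stretch] <;> ring

theorem stretch_real_mul (l t : ℝ) (z : ℂ) : stretch l (t * z) = t * stretch l z := by
  apply Complex.ext <;> simp [stretch] <;> ring

theorem stretch_inv_stretch {l : ℝ} (hl : l ≠ 0) (z : ℂ) : stretch l⁻¹ (stretch l z) = z := by
  apply Complex.ext <;> simp [stretch, hl]

theorem stretch_ofReal (l x : ℝ) : stretch l x = (l : ℂ) * x := by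
  apply Complex.ext <;> simp [stretch]

theorem stretch_mul_I (l x : ℝ) : stretch l (x * Complex.I) = (l⁻¹ : ℝ) * (x * Complex.I) := by
  apply Complex.ext <;> simp [stretch]

theorem line_sub (u : ℂ) (s t : ℝ) : line u s - line u t = (s - t) * u := by
  simp [line, sub_mul]

variable {S : Type*} [MetricSpace S] [ChartedSpace ℂ S] {X : ConicalSurface S}

namespace LinearPA

variable (φ : LinearPA X)

theorem lam_pos : 0 < φ.lam := zero_lt_one.trans φ.one_lt_lam

theorem map_mem_sing {x : S} : φ.map x ∈ X.sing ↔ x ∈ X.sing := by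
  constructor
  · intro h
    have := φ.map.injective (φ.fixes _ h)
    rwa [this] at h
  · intro h
    rwa [φ.fixes x h]

end LinearPA

namespace Dev

variable [IsManifold 𝓘(ℂ) 1 S] {α : Type*} [TopologicalSpace α] {d : α → ℂ} {c : α → S} {Q : Set α}

theorem map_pa (h : Dev X d c Q) (φ : LinearPA X) :
    Dev X (fun t => stretch φ.lam (d t)) (φ.map ∘ c) Q := by
  refine ⟨φ.map.continuous.comp_continuousOn h.1, fun z hz =>
    ⟨fun hs => h.notMem hz (φ.map_mem_sing.1 hs), fun V G hV hcV hG => ?_⟩⟩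
  obtain ⟨e, h1, -, h3⟩ := X.exists_regular_chart (h.notMem hz) univ_mem
  filter_upwards [(h.1 z hz).eventually
    (φ.affine (c z) e.source V e G e.open_source h1 h3 hV hcV hG),
    (h.2 z hz).2 _ _ e.open_source h1 h3] with y a1 a2
  simp only [Function.comp] at *
  rw [a1, a2, stretch_sub]

theorem map_pa_symm (h : Dev X d c Q) (φ : LinearPA X) :
    Dev X (fun t => stretch φ.lam⁻¹ (d t)) (φ.map.symm ∘ c) Q := by
  have hs : ∀ z ∈ Q, φ.map.symm (c z) ∉ X.sing := fun z hz hs => by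
    apply h.notMem hz
    have := φ.map_mem_sing.2 hs
    rwa [Homeomorph.apply_symm_apply] at this
  have hcont : ContinuousOn (φ.map.symm ∘ c) Q := φ.map.symm.continuous.comp_continuousOn h.1
  refine ⟨hcont, fun z hz => ⟨hs z hz, fun U F hU hcU hF => ?_⟩⟩
  obtain ⟨e, h1, -, h3⟩ := X.exists_regular_chart (h.notMem hz) univ_mem
  filter_upwards [(hcont z hz).eventually
    (φ.affine (φ.map.symm (c z)) U e.source F e hU hcU hF e.open_source (by simpa using h1) h3),
    (h.2 z hz).2 _ _ e.open_source h1 h3] with y a1 a2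
  simp only [Function.comp, Homeomorph.apply_symm_apply] at *
  rw [← stretch_sub, ← a2, a1, stretch_inv_stretch φ.lam_pos.ne']

theorem congr_line {c : ℝ → S} {Q : Set ℝ} {d : ℝ → ℂ} {u : ℂ} (h : Dev X d c Q)
    (hd : ∀ s ∈ Q, ∀ t ∈ Q, d t - d s = (t - s) * u) : Dev X (line u) c Q :=
  h.congr_dev fun s hs t ht => by rw [line_sub, hd s hs t ht]

theorem comp_affine {c : ℝ → S} {Q P : Set ℝ} {u v : ℂ} (h : Dev X (line u) c Q) (a b : ℝ)
    (hm : ∀ t ∈ P, a + b * t ∈ Q) (hv : (b : ℂ) * u = v) :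
    Dev X (line v) (fun t => c (a + b * t)) P := by
  refine (h.comp (g := fun t => a + b * t) (P := P) (by fun_prop) hm).congr_line ?_
  intro s _ t _
  rw [Function.comp, Function.comp, line_sub, ← hv]
  push_cast; ring

/-- The exponential map along a horizontal or vertical line. -/
theorem comp_line {E : ℂ → S} {A : Set ℂ} (h : Dev X id E A) (z u : ℂ) {P : Set ℝ}
    (hm : ∀ t ∈ P, z + t * u ∈ A) : Dev X (line u) (fun t : ℝ => E (z + t * u)) P := by
  refine (h.comp (g := fun t : ℝ => z + t * u) (P := P) (by fun_prop) hm).congr_line ?_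
  intro s _ t _
  simp only [Function.comp, id]; ring

end Dev

/-! ### Rays at conical points, saddle connections, closed leaves. -/

section Rays

variable [IsManifold 𝓘(ℂ) 1 S] {σ : S} {u : ℂ} {s : ℝ} {c : ℝ → S}

/-- The initial piece of a straight path that starts at a conical point, in the coordinate of the
cone disc. -/
theorem Dev.ray_coord (hσ : σ ∈ X.sing) (h : Dev X (line u) c (Ioo 0 s)) (hs : 0 < s)
    (hlim : Tendsto c (𝓝[>] 0) (𝓝 σ)) {r : ℝ} (hr0 : 0 < r) (hr : r < X.radius σ)
    (hsr : s * ‖u‖ ≤ r ^ X.n σ) (hu : u ≠ 0) :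
    ∀ t ∈ Ioo 0 s, c t ∈ (X.chart σ).source ∧ X.chart σ (c t) ^ X.n σ = t * u := by
  have hprim := X.chart_form σ hσ
  have hev : ∀ᶠ t in 𝓝[>] (0 : ℝ), c t ∈ (X.chart σ).source :=
    hlim ((X.chart σ).open_source.mem_nhds (X.mem_source σ hσ))
  obtain ⟨s', hs', hs'2⟩ := (mem_nhdsGT_iff_exists_Ioo_subset' hs).1
    (inter_mem hev (Ioo_mem_nhdsGT hs))
  have hD := h.mono (Q' := Ioo 0 s') fun t ht => (hs'2 ht).2
  -- The coordinate and `t * u` differ by a constant along the path; letting `t → 0` shows that the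
  -- constant is `0`. Then `Dev.trap` covers the times beyond `s'`.
  have hconst : ∀ t ∈ Ioo 0 s', ∀ t' ∈ Ioo 0 s', X.chart σ (c t) ^ X.n σ - t * u =
      X.chart σ (c t') ^ X.n σ - t' * u := fun t ht t' ht' => by
    refine eq_of_eventually_eq_nhdsWithin (g := fun t : ℝ => X.chart σ (c t) ^ X.n σ - t * u)
      (isPreconnected_Ioo (a := 0) (b := s')) (fun z hz => ?_) ht ht'
    filter_upwards [(hD.2 z hz).2 _ _ (X.chart σ).open_source (hs'2 hz).1 hprim] with y hy
    rw [line_sub] at hy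
    linear_combination hy
  have hzero : ∀ t ∈ Ioo 0 s', X.chart σ (c t) ^ X.n σ = t * u := fun t ht => by
    have l1 : Tendsto (fun t : ℝ => X.chart σ (c t) ^ X.n σ - t * u) (𝓝[>] 0) (𝓝 0) := by
      have a1 := (((X.chart σ).continuousAt (X.mem_source σ hσ)).tendsto.comp hlim).pow (X.n σ)
      rw [X.chart_center σ hσ, zero_pow (X.n_pos σ hσ).ne'] at a1
      have a2 : Tendsto (fun t : ℝ => (t * u : ℂ)) (𝓝[>] 0) (𝓝 0) := by
        have : Continuous (fun t : ℝ => (t * u : ℂ)) := by fun_prop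
        simpa using this.continuousAt.tendsto.mono_left (nhdsWithin_le_nhds (a := (0 : ℝ)))
      simpa using a1.sub a2
    have l2 : Tendsto (fun t : ℝ => X.chart σ (c t) ^ X.n σ - t * u) (𝓝[>] 0)
        (𝓝 (X.chart σ (c t) ^ X.n σ - t * u)) := by
      refine tendsto_const_nhds.congr' ?_
      filter_upwards [Ioo_mem_nhdsGT hs'] with y hy
      exact hconst t ht y hy
    have := tendsto_nhds_unique l1 l2
    linear_combination -this
  have hs'0 : 0 < s' := hs'
  have hmid : s' / 2 ∈ Ioo 0 s' := ⟨by linarith, by linarith⟩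
  have hr' : Metric.closedBall 0 r ⊆ (X.chart σ).target := by
    rw [X.chart_target σ hσ]; exact Metric.closedBall_subset_ball hr
  have htr := h.trap isPreconnected_Ioo hprim hr' (hs'2 hmid).2 (hs'2 hmid).1
    (fun t ht => by
      rw [hzero _ hmid, line_sub]
      have : ((s' / 2 : ℝ) : ℂ) * u + (t - (s' / 2 : ℝ)) * u = t * u := by ring
      rw [this, norm_mul, Complex.norm_real, Real.norm_of_nonneg ht.1.le]
      exact lt_of_lt_of_le (mul_lt_mul_of_pos_right ht.2 (norm_pos_iff.2 hu)) hsr) hr0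
  intro t ht
  obtain ⟨b1, -, b2⟩ := htr t ht
  refine ⟨b1, ?_⟩
  rw [b2, hzero _ hmid, line_sub]
  ring

/-- The quotient of `w t` by the real root of `t` is continuous with values in the finite set of
`n`-th roots of `u`, hence constant. -/
theorem exists_root_of_pow_eq {n : ℕ} (hn : n ≠ 0) {w : ℝ → ℂ} {s : ℝ} (hs : 0 < s)
    (hw : ContinuousOn w (Ioo 0 s)) (h : ∀ t ∈ Ioo 0 s, w t ^ n = t * u) :
    ∃ ζ : ℂ, ζ ^ n = u ∧ ∀ t ∈ Ioo 0 s, w t = ζ * (t ^ ((n : ℝ)⁻¹) : ℝ) := by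
  have hpos : ∀ t ∈ Ioo 0 s, (((t ^ ((n : ℝ)⁻¹) : ℝ) : ℂ)) ≠ 0 := fun t ht =>
    Complex.ofReal_ne_zero.2 (Real.rpow_pos_of_pos ht.1 _).ne'
  have hpow : ∀ t ∈ Ioo 0 s, ((t ^ ((n : ℝ)⁻¹) : ℝ) : ℂ) ^ n = t := fun t ht => by
    rw [← Complex.ofReal_pow, Real.rpow_inv_natCast_pow ht.1.le hn]
  have hfin : {ζ : ℂ | ζ ^ n = u}.Finite := by
    have := (Polynomial.nthRootsFinset n u).finite_toSet
    refine (Polynomial.nthRoots n u).toFinset.finite_toSet.subset fun ζ hζ => ?_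
    simpa [Polynomial.mem_nthRoots (Nat.pos_of_ne_zero hn)] using hζ
  have hm : MapsTo (fun t => w t / (t ^ ((n : ℝ)⁻¹) : ℝ)) (Ioo 0 s) {ζ : ℂ | ζ ^ n = u} :=
    fun t ht => by
      simp only [mem_ofPred_eq, div_pow, h t ht, hpow t ht]
      have := Complex.ofReal_ne_zero.2 ht.1.ne'
      field_simp
  obtain ⟨ζ, hζ, heq⟩ := isPreconnected_Ioo.eqOn_const_of_mapsTo hfin.isDiscrete
    (hw.div (Complex.continuous_ofReal.comp_continuousOn
      (ContinuousOn.rpow_const continuousOn_id fun t ht => Or.inl ht.1.ne')) hpos) hm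
    ⟨_, hm (⟨half_pos hs, half_lt_self hs⟩ : s / 2 ∈ Ioo 0 s)⟩
  refine ⟨ζ, hζ, fun t ht => ?_⟩
  have := heq ht
  simp only [Function.const] at this
  rw [← this]
  exact (div_mul_cancel₀ _ (hpos t ht)).symm

/-- A linear pseudo-Anosov map preserves the straight rays in its eigendirections that start at
the conical points. -/
theorem LinearPA.map_ray (φ : LinearPA X) (hσ : σ ∈ X.sing) (h : Dev X (line u) c (Ioo 0 s))
    (hlim : Tendsto c (𝓝[>] 0) (𝓝 σ)) (hu : u ≠ 0) {μ : ℝ} (hμ : 0 < μ)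
    (hμu : stretch φ.lam u = μ * u) {t : ℝ} (ht : t ∈ Ioo 0 s) (hμt : μ * t ∈ Ioo 0 s) :
    φ.map (c t) = c (μ * t) := by
  have hs : 0 < s := ht.1.trans ht.2
  have hR := X.radius_pos σ hσ
  have hn := (X.n_pos σ hσ).ne'
  set n := X.n σ
  obtain ⟨r, hr0, hr⟩ := exists_between hR
  -- a short piece of the ray in the cone disc
  obtain ⟨s₁, hs₁, hs₁s, hs₁r⟩ : ∃ s₁ > 0, s₁ ≤ s ∧ s₁ * ‖u‖ ≤ r ^ n := by
    refine ⟨min s (r ^ n / ‖u‖), lt_min hs (by positivity), min_le_left _ _, ?_⟩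
    calc _ ≤ r ^ n / ‖u‖ * ‖u‖ := mul_le_mul_of_nonneg_right (min_le_right _ _) (norm_nonneg _)
      _ = r ^ n := div_mul_cancel₀ _ (norm_ne_zero_iff.2 hu)
  have hsub : Ioo 0 s₁ ⊆ Ioo 0 s := Ioo_subset_Ioo_right hs₁s
  have hcoord := (h.mono hsub).ray_coord hσ hs₁ hlim hr0 hr hs₁r hu
  obtain ⟨ζ, hζ, hζt⟩ := exists_root_of_pow_eq hn hs₁ (w := fun t => X.chart σ (c t))
    ((X.chart σ).continuousOn.comp (h.mono hsub).1 fun t ht => (hcoord t ht).1)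
    fun t ht => (hcoord t ht).2
  -- On the ray the points are `ζ t ^ (1 / n)`, and the sheet-preserving lift multiplies them by the
  -- positive root `μ ^ (1 / n)`. This is where it matters that `φ` does not permute the sheets.
  have hev : ∀ᶠ t in 𝓝[>] (0 : ℝ), φ.map (c t) = c (μ * t) := by
    have e1 : ∀ᶠ t in 𝓝[>] (0 : ℝ), X.chart σ (φ.map ((X.chart σ).symm (X.chart σ (c t)))) =
        sheetLift n (stretch φ.lam) (X.chart σ (c t)) := by
      have : Tendsto (fun t => X.chart σ (c t)) (𝓝[>] 0) (𝓝 0) := by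
        rw [← X.chart_center σ hσ]
        exact ((X.chart σ).continuousAt (X.mem_source σ hσ)).tendsto.comp hlim
      exact this.eventually (φ.respects_sheets σ hσ)
    have e2 : ∀ᶠ t in 𝓝[>] (0 : ℝ), φ.map (c t) ∈ (X.chart σ).source := by
      have a1 : Tendsto (fun t => φ.map (c t)) (𝓝[>] 0) (𝓝 (φ.map σ)) :=
        (φ.map.continuous.tendsto σ).comp hlim
      rw [φ.fixes σ hσ] at a1
      exact a1 ((X.chart σ).open_source.mem_nhds (X.mem_source σ hσ))
    have e3 : ∀ᶠ t in 𝓝[>] (0 : ℝ), t ∈ Ioo 0 s₁ := Ioo_mem_nhdsGT hs₁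
    have e4 : ∀ᶠ t in 𝓝[>] (0 : ℝ), μ * t ∈ Ioo 0 s₁ := by
      filter_upwards [Ioo_mem_nhdsGT (div_pos hs₁ hμ)] with t ht
      exact ⟨mul_pos hμ ht.1, by rw [mul_comm]; exact (lt_div_iff₀ hμ).1 ht.2⟩
    filter_upwards [e1, e2, e3, e4] with t a1 a2 a3 a4
    refine (X.chart σ).injOn a2 (hcoord _ a4).1 ?_
    rw [(X.chart σ).left_inv (hcoord _ a3).1] at a1
    rw [a1, sheetLift, (hcoord _ a3).2, stretch_real_mul, hμu]
    have ht0 : (t : ℂ) ≠ 0 := Complex.ofReal_ne_zero.2 a3.1.ne'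
    rw [show (t : ℂ) * (μ * u) / (t * u) = (μ : ℂ) by field_simp]
    have h1 := hζt _ a3
    have h2 := hζt _ a4
    rw [h1, h2, Real.mul_rpow hμ.le a3.1.le, Complex.ofReal_mul, Complex.ofReal_cpow hμ.le]
    push_cast
    ring
  -- extend by uniqueness
  let s₂ := min s (s / μ)
  have hs₂ : 0 < s₂ := lt_min hs (div_pos hs hμ)
  have hm2 : ∀ t ∈ Ioo 0 s₂, t ∈ Ioo 0 s ∧ μ * t ∈ Ioo 0 s := fun t ht =>
    ⟨⟨ht.1, ht.2.trans_le (min_le_left _ _)⟩, mul_pos hμ ht.1, by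
      rw [mul_comm]; exact (lt_div_iff₀ hμ).1 (ht.2.trans_le (min_le_right _ _))⟩
  have d1 : Dev X (line (μ * u)) (φ.map ∘ c) (Ioo 0 s₂) := by
    refine ((h.map_pa φ).mono fun t ht => (hm2 t ht).1).congr_line fun t _ t' _ => ?_
    rw [← stretch_sub, line_sub, ← Complex.ofReal_sub, stretch_real_mul, hμu]
  have d2 : Dev X (line (μ * u)) (fun t => c (0 + μ * t)) (Ioo 0 s₂) :=
    h.comp_affine 0 μ (fun t ht => by simpa using (hm2 t ht).2) rfl
  obtain ⟨t₀, ht₀, ht₀'⟩ := (hev.and (Ioo_mem_nhdsGT hs₂)).exists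
  have := Dev.eqOn isPreconnected_Ioo d1 d2 ht₀' (by simpa using ht₀)
    (show t ∈ Ioo 0 s₂ from ⟨ht.1, lt_min ht.2 (by rw [lt_div_iff₀ hμ, mul_comm]; exact hμt.2)⟩)
  simpa using this

/-- There are no saddle connections in the expanding direction. -/
theorem LinearPA.no_saddle_connection (φ : LinearPA X) (hσ : σ ∈ X.sing)
    (h : Dev X (line u) c (Ioo 0 s)) (hs : 0 < s) (hlim : Tendsto c (𝓝[>] 0) (𝓝 σ)) (hu : u ≠ 0)
    (hμu : stretch φ.lam u = φ.lam * u) {σ' : S} (hσ' : σ' ∈ X.sing) :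
    ¬ Tendsto c (𝓝[<] s) (𝓝 σ') := by
  intro hlim'
  have hl := φ.one_lt_lam
  have hl0 := φ.lam_pos
  have hmem : s / φ.lam ∈ Ioo 0 s := ⟨div_pos hs hl0, div_lt_self hs hl⟩
  have t1 : Tendsto (fun t => φ.map (c t)) (𝓝[<] (s / φ.lam)) (𝓝 (φ.map (c (s / φ.lam)))) := by
    have : ContinuousAt c (s / φ.lam) := (h.1 _ hmem).continuousAt (isOpen_Ioo.mem_nhds hmem)
    exact (φ.map.continuous.continuousAt.comp this).tendsto.mono_left nhdsWithin_le_nhds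
  have t2 : Tendsto (fun t => c (φ.lam * t)) (𝓝[<] (s / φ.lam)) (𝓝 σ') := by
    refine hlim'.comp (tendsto_nhdsWithin_of_tendsto_nhds_of_eventually_within _ ?_ ?_)
    · have : Continuous fun t => φ.lam * t := by fun_prop
      have h2 := this.tendsto (s / φ.lam)
      rw [mul_div_cancel₀ _ hl0.ne'] at h2
      exact h2.mono_left nhdsWithin_le_nhds
    · filter_upwards [self_mem_nhdsWithin] with t ht
      rw [mem_Iio, mul_comm]
      exact (lt_div_iff₀ hl0).1 ht
  -- `φ` carries the regular point at time `s / lam` to the limit of the ray at time `s`. A conical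
  -- limit contradicts that `φ` preserves the set of regular points.
  have heq : φ.map (c (s / φ.lam)) = σ' := by
    refine tendsto_nhds_unique (t1.congr' ?_) t2
    filter_upwards [Ioo_mem_nhdsLT hmem.1] with t ht
    refine φ.map_ray hσ h hlim hu hl0 hμu ⟨ht.1, ht.2.trans hmem.2⟩ ⟨mul_pos hl0 ht.1, ?_⟩
    rw [mul_comm]; exact (lt_div_iff₀ hl0).1 ht.2
  exact h.notMem hmem (φ.map_mem_sing.1 (heq ▸ hσ'))

/-- There are no closed leaves in the expanding direction. -/
theorem LinearPA.no_closed_leaf [CompactSpace S] (φ : LinearPA X) {a b : ℝ} (hab : a < b)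
    (h : Dev X (line u) c (Icc a b)) (hu : u ≠ 0) (hμu : stretch φ.lam⁻¹ u = (φ.lam⁻¹ : ℝ) * u) :
    c a ≠ c b := by
  intro hc
  have hl0 := φ.lam_pos
  -- Under `φ⁻¹` the loop shrinks by the factor `lam⁻¹` at each step, until it fits into a
  -- coordinate disc at a cluster point of its base points.
  have hD : ∀ m : ℕ, Dev X (line ((φ.lam⁻¹ : ℝ) ^ m * u)) (φ.map.symm^[m] ∘ c) (Icc a b) := by
    intro m
    induction m with
    | zero => simpa using h
    | succ m ih =>
      rw [Function.iterate_succ', Function.comp_assoc]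
      refine (ih.map_pa_symm φ).congr_line fun t _ t' _ => ?_
      rw [← stretch_sub, line_sub, ← Complex.ofReal_sub, ← Complex.ofReal_pow, stretch_real_mul,
        stretch_real_mul, hμu]
      push_cast; ring
  obtain ⟨w, hw⟩ := exists_clusterPt_of_compactSpace (Filter.map (fun m : ℕ => φ.map.symm^[m] (c a)) atTop)
  obtain ⟨e, n, R, hn, hws, hw0, hprim, hR, hRt, -⟩ := X.exists_coord w
  obtain ⟨r, hr0, hr⟩ := exists_between hR
  have hrt : Metric.closedBall 0 r ⊆ e.target := (Metric.closedBall_subset_ball hr).trans hRt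
  have hlt : ∀ᶠ y in 𝓝 w, y ∈ e.source ∧ ‖e y ^ n‖ < r ^ n / 2 := by
    have : ContinuousAt (fun y => ‖e y ^ n‖) w := ((e.continuousAt hws).pow n).norm
    have h2 : ‖e w ^ n‖ < r ^ n / 2 := by
      have : 0 < r ^ n / 2 := by positivity
      simpa [hw0, hn] using this
    exact (Filter.eventually_of_mem (e.open_source.mem_nhds hws) fun _ h => h).and
      (this.eventually_lt_const h2)
  have hfr : ∃ᶠ m : ℕ in atTop, φ.map.symm^[m] (c a) ∈ e.source ∧
      ‖e (φ.map.symm^[m] (c a)) ^ n‖ < r ^ n / 2 := hw.frequently hlt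
  have hsmall : ∀ᶠ m : ℕ in atTop, φ.lam⁻¹ ^ m * ((b - a) * ‖u‖) < r ^ n / 2 := by
    have := (tendsto_pow_atTop_nhds_zero_of_lt_one (inv_nonneg.2 hl0.le)
      (inv_lt_one_of_one_lt₀ φ.one_lt_lam)).mul_const ((b - a) * ‖u‖)
    rw [zero_mul] at this
    exact this.eventually_lt_const (by positivity)
  obtain ⟨m, ⟨h1, h2⟩, h3⟩ := (hfr.and_eventually hsmall).exists
  have ha := left_mem_Icc.2 hab.le
  have htr := (hD m).trap isPreconnected_Icc hprim hrt ha h1 (fun t ht => by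
    refine (norm_add_le _ _).trans_lt ?_
    have : ‖line ((φ.lam⁻¹ : ℝ) ^ m * u) t - line ((φ.lam⁻¹ : ℝ) ^ m * u) a‖ ≤
        φ.lam⁻¹ ^ m * ((b - a) * ‖u‖) := by
      rw [line_sub, ← Complex.ofReal_sub, norm_mul, norm_mul, norm_pow, Complex.norm_real,
        Complex.norm_real, Real.norm_of_nonneg (inv_nonneg.2 hl0.le),
        Real.norm_of_nonneg (sub_nonneg.2 ht.1)]
      have h4 : t - a ≤ b - a := by linarith [ht.2]
      calc (t - a) * (φ.lam⁻¹ ^ m * ‖u‖) ≤ (b - a) * (φ.lam⁻¹ ^ m * ‖u‖) :=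
            mul_le_mul_of_nonneg_right h4 (by positivity)
        _ = _ := by ring
    simp only [Function.comp]
    linarith) hr0
  -- Inside the disc the power `e ^ n` changes along the loop by the nonzero displacement, although
  -- the loop returns to its start.
  have := (htr b (right_mem_Icc.2 hab.le)).2.2
  simp only [Function.comp, ← hc, line_sub] at this
  have h5 : ((b : ℂ) - a) * ((φ.lam⁻¹ : ℝ) ^ m * u) = 0 := by linear_combination -this
  rw [← Complex.ofReal_sub] at h5
  have h6 : ((b - a : ℝ) : ℂ) ≠ 0 := Complex.ofReal_ne_zero.2 (sub_pos.2 hab).ne'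
  have h7 : ((φ.lam⁻¹ : ℝ) : ℂ) ^ m ≠ 0 :=
    pow_ne_zero _ (Complex.ofReal_ne_zero.2 (inv_ne_zero hl0.ne'))
  exact (mul_ne_zero h6 (mul_ne_zero h7 hu)) h5

end Rays

/-! ### Saturated sets and density of horizontal rays. -/

variable {S : Type*} [MetricSpace S] [ChartedSpace ℂ S] {X : ConicalSurface S}

/-- A set which contains, with a point, every horizontal segment through it. -/
def Saturated (X : ConicalSurface S) (C : Set S) : Prop :=
  ∀ (ρ : ℝ) (c : ℝ → S) (a b : ℝ), Dev X (line ρ) c (Icc a b) → ∀ s ∈ Icc a b, ∀ t ∈ Icc a b,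
    c s ∈ C → c t ∈ C

/-- A segment of length `η` in the direction `v` starts at `x` and then avoids `C`. -/
def HasGap (X : ConicalSurface S) (C : Set S) (v : ℂ) (η : ℝ) (x : S) : Prop :=
  ∃ V : ℝ → S, V 0 = x ∧ Dev X (line v) V (Icc 0 η) ∧ ∀ t ∈ Ioc 0 η, V t ∉ C

variable [IsManifold 𝓘(ℂ) 1 S] {C : Set S}

theorem Saturated.of_exp (hC : Saturated X C) {E : ℂ → S} {A : Set ℂ} (hE : Dev X id E A)
    (hA : Convex ℝ A) {z z' : ℂ} (hz : z ∈ A) (hz' : z' ∈ A) (him : z.im = z'.im)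
    (h : E z ∈ C) : E z' ∈ C := by
  have hre : z' - z = ((z'.re - z.re : ℝ) : ℂ) := by
    apply Complex.ext <;> simp [him]
  have hD := hE.comp_line z ((z'.re - z.re : ℝ) : ℂ) (P := Icc (0 : ℝ) 1) fun t ht => by
    rw [← hre]
    simpa using hA.add_smul_sub_mem hz hz' ht
  have := hC _ _ 0 1 hD 0 (by simp) 1 (by simp) (by simpa using h)
  rw [← hre] at this
  simpa using this

/-- A tube around a horizontal segment is made of parallel segments, which transport points of `C`
near one end to points of `C` near the other. -/
theorem Saturated.closure (hC : Saturated X C) : Saturated X (closure C) := by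
  intro ρ c a b hc s hs t ht hcs
  obtain ⟨δ, hδ, E, hE0, hE⟩ := hc.exists_tube isCompact_Icc
  rw [mem_closure_iff_nhds]
  intro N hN
  have hball : Metric.ball (0 : ℂ) δ ∈ 𝓝 0 := Metric.ball_mem_nhds _ hδ
  have hslice : ∀ q ∈ Icc a b, Dev X id (fun z => E (q, z)) (Metric.ball 0 δ) := fun q hq => by
    refine (hE.comp (g := fun z : ℂ => (q, z)) (P := Metric.ball 0 δ) (by fun_prop)
      (fun z hz => ⟨hq, hz⟩)).congr_dev fun z _ z' _ => by simp
  have hNt : ∀ᶠ z in 𝓝 (0 : ℂ), E (t, z) ∈ N := by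
    have : ContinuousAt (fun z => E (t, z)) 0 :=
      ((hslice t ht).1 0 (Metric.mem_ball_self hδ)).continuousAt hball
    exact this (by simpa only [hE0 t ht] using hN)
  have hNs := (hslice s hs).isOpenMap_at hball (inter_mem hNt hball)
  rw [hE0 s hs] at hNs
  obtain ⟨y, ⟨z, hz, rfl⟩, hy⟩ := mem_closure_iff_nhds.1 hcs _ hNs
  refine ⟨E (t, z), hz.1, ?_⟩
  have hD : Dev X (line ρ) (fun q => E (q, z)) (Icc a b) :=
    (hE.comp (g := fun q : ℝ => (q, z)) (P := Icc a b) (by fun_prop)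
      (fun q hq => ⟨hq, hz.2⟩)).congr_dev fun q _ q' _ => by simp
  exact hC ρ _ a b hD s hs t ht hy

theorem isPreconnected_punctured_ball (R : ℝ) :
    IsPreconnected (Metric.ball (0 : ℂ) R \ {0}) := by
  have : Metric.ball (0 : ℂ) R \ {0} =
      (fun p : ℝ × ℝ => (p.1 : ℂ) * Complex.exp (p.2 * Complex.I)) '' (Ioo 0 R ×ˢ univ) := by
    ext z
    constructor
    · rintro ⟨h1, h2⟩
      refine ⟨(‖z‖, z.arg), ⟨⟨norm_pos_iff.2 h2, by simpa using h1⟩, mem_univ _⟩, ?_⟩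
      exact Complex.norm_mul_exp_arg_mul_I z
    · rintro ⟨⟨ρ, θ⟩, ⟨hρ, -⟩, rfl⟩
      refine ⟨?_, ?_⟩
      · simp [Complex.norm_exp_ofReal_mul_I, abs_of_pos hρ.1, hρ.2]
      · simp [hρ.1.ne']
  rw [this]
  exact (isPreconnected_Ioo.prod isPreconnected_univ).image _ (by fun_prop)

/-- Otherwise the closure of the regular part of `C` is open and closed: at a conical point in it,
the punctured disc is connected and meets `C`, so it lies in `C`. -/
theorem exists_boundary_point [ConnectedSpace S] (hC : IsClosed C) (hne : C ≠ univ) {x : S}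
    (hx : x ∈ C) (hxs : x ∉ X.sing) : ∃ y ∈ C, y ∉ X.sing ∧ C ∉ 𝓝 y := by
  by_contra hcon
  push Not at hcon
  set A := closure (C \ X.sing)
  have hAC : A ⊆ C := closure_minimal sdiff_subset hC
  have hopen : IsOpen A := by
    rw [isOpen_iff_mem_nhds]
    intro y hy
    by_cases hys : y ∈ X.sing
    · obtain ⟨e, n, R, hn, hyso, hy0, -, hR, hRt, hreg⟩ := X.exists_coord y
      set P := e.symm '' (Metric.ball (0 : ℂ) R \ {0})
      have hP : IsPreconnected P := (isPreconnected_punctured_ball R).image _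
        (e.continuousOn_symm.mono (sdiff_subset.trans hRt))
      have hPreg : ∀ p ∈ P, p ∉ X.sing := by
        rintro _ ⟨w, hw, rfl⟩
        refine hreg _ (e.map_target (hRt hw.1)) fun h => hw.2 ?_
        have := e.right_inv (hRt hw.1)
        rw [h, hy0] at this
        exact this.symm
      have hmemP : ∀ p ∈ e.source, ‖e p‖ < R → p ≠ y → p ∈ P := fun p hp h1 h2 =>
        ⟨e p, ⟨by simpa using h1, fun h3 => h2 (e.injOn hp hyso (h3.trans hy0.symm))⟩,
          e.left_inv hp⟩
      have hN : ∀ᶠ p in 𝓝 y, p ∈ e.source ∧ ‖e p‖ < R := by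
        refine (Filter.eventually_of_mem (e.open_source.mem_nhds hyso) fun _ h => h).and
          ((e.continuousAt hyso).norm.eventually_lt_const (by simpa [hy0] using hR))
      obtain ⟨p, hp1, hp2⟩ := mem_closure_iff_nhds.1 hy _ hN
      have hpP : p ∈ P := hmemP p hp1.1 hp1.2 fun h => hp2.2 (h ▸ hys)
      have hPC : P ⊆ C := fun q hq => by
        refine (eq_of_eventually_eq_nhdsWithin hP (g := fun p => p ∈ C) (fun z hz => ?_)
          hpP hq).mp hp2.1
        by_cases hzC : z ∈ C
        · filter_upwards [mem_nhdsWithin_of_mem_nhds (hcon z hzC (hPreg z hz))] with p hp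
          exact propext (iff_of_true hp hzC)
        · filter_upwards [mem_nhdsWithin_of_mem_nhds (hC.isOpen_compl.mem_nhds hzC)] with p hp
          exact propext (iff_of_false hp hzC)
      filter_upwards [hN] with p hp
      by_cases hpy : p = y
      · exact hpy ▸ hy
      · have := hmemP p hp.1 hp.2 hpy
        exact subset_closure ⟨hPC this, hPreg p this⟩
    · filter_upwards [hcon y (hAC hy) hys, X.isClosed_sing.isOpen_compl.mem_nhds hys] with p h1 h2
      exact subset_closure ⟨h1, h2⟩
  have : A = univ := IsClopen.eq_univ ⟨isClosed_closure, hopen⟩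
    ⟨x, subset_closure ⟨hx, hxs⟩⟩
  exact hne (univ_subset_iff.1 (this ▸ hAC))

/-- Near a regular boundary point some point of a flat chart lies outside `C`, and by saturation
only its height matters. The gap starts at the last point of `C` on the vertical segment up to this
height. -/
theorem exists_hasGap [ConnectedSpace S] (hC : IsClosed C) (hsat : Saturated X C)
    (hne : C ≠ univ) {x : S} (hx : x ∈ C) (hxs : x ∉ X.sing) {η₀ : ℝ} (hη₀ : 0 < η₀) :
    ∃ δ : ℝ, (δ = 1 ∨ δ = -1) ∧ ∃ η > 0, η < η₀ ∧
      ∃ y ∈ C, HasGap X C (δ * Complex.I) η y := by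
  obtain ⟨x, hx, hxs, hnhds⟩ := exists_boundary_point hC hne hx hxs
  obtain ⟨r, hr, E, hE0, hE⟩ := X.exists_exp hxs
  have hn := hE.isOpenMap_at (Metric.ball_mem_nhds 0 hr)
    (Metric.ball_mem_nhds (0 : ℂ) (lt_min hr hη₀))
  rw [hE0] at hn
  obtain ⟨_, ⟨z₁, hz₁, rfl⟩, hz₁C⟩ := not_subset.1 fun h => hnhds (mem_of_superset hn h)
  set s₁ := |z₁.im|
  obtain ⟨δ, hδ, hδs⟩ : ∃ δ : ℝ, (δ = 1 ∨ δ = -1) ∧ z₁.im = δ * s₁ := by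
    rcases le_total 0 z₁.im with h | h
    · exact ⟨1, Or.inl rfl, by simp [s₁, abs_of_nonneg h]⟩
    · exact ⟨-1, Or.inr rfl, by simp [s₁, abs_of_nonpos h]⟩
  have hδ1 : |δ| = 1 := by rcases hδ with rfl | rfl <;> simp
  have hs₁ : s₁ < min r η₀ := by
    have := Complex.abs_im_le_norm z₁
    simp only [mem_ball_zero_iff] at hz₁
    exact this.trans_lt hz₁
  have hin : ∀ s : ℝ, |s| ≤ s₁ → (s * (δ * Complex.I) : ℂ) ∈ Metric.ball (0 : ℂ) r := fun s hs => by
    simp only [mem_ball_zero_iff, norm_mul, Complex.norm_real, Complex.norm_I, mul_one,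
      Real.norm_eq_abs, hδ1]
    exact hs.trans_lt (hs₁.trans_le (min_le_left _ _))
  have hs₁0 : 0 ≤ s₁ := abs_nonneg _
  have h1 : E (s₁ * (δ * Complex.I)) ∉ C := fun h => by
    refine hz₁C (hsat.of_exp hE (convex_ball _ _) (hin s₁ (abs_of_nonneg hs₁0).le)
      (Metric.ball_subset_ball (min_le_left _ _) hz₁) ?_ h)
    simp [hδs, mul_comm]
  have hcont : ContinuousOn (fun s : ℝ => E (s * (δ * Complex.I))) (Icc 0 s₁) :=
    hE.1.comp (by fun_prop) fun s hs => hin s (by rw [abs_of_nonneg hs.1]; exact hs.2)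
  have hcomp : IsCompact (Icc 0 s₁ ∩ (fun s : ℝ => E (s * (δ * Complex.I))) ⁻¹' C) :=
    isCompact_Icc.of_isClosed_subset (hcont.preimage_isClosed_of_isClosed isClosed_Icc hC)
      inter_subset_left
  obtain ⟨u, ⟨hu, huC⟩, humax⟩ := hcomp.exists_isGreatest
    ⟨0, left_mem_Icc.2 hs₁0, by simpa [hE0] using hx⟩
  have hus : u < s₁ := lt_of_le_of_ne hu.2 fun h => h1 (by subst h; exact huC)
  refine ⟨δ, hδ, s₁ - u, sub_pos.2 hus, ?_, E (u * (δ * Complex.I)), huC,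
    fun t => E (u * (δ * Complex.I) + t * (δ * Complex.I)), by simp, hE.comp_line _ _ ?_, ?_⟩
  · linarith [hs₁.trans_le (min_le_right _ _), hu.1]
  · intro t ht
    have := hin (u + t) (by rw [abs_of_nonneg (add_nonneg hu.1 ht.1)]; linarith [ht.2])
    push_cast at this
    rwa [add_mul] at this
  · intro t ht htC
    have hmem : u + t ∈ Icc 0 s₁ := ⟨by linarith [hu.1, ht.1], by linarith [ht.2]⟩
    have := humax ⟨hmem, by simpa [add_mul] using htC⟩
    linarith [ht.1]

/-- Of the two horizontal half-leaves of a regular point, at least one is infinite. -/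
theorem LinearPA.exists_infinite_leaf [CompactSpace S] (φ : LinearPA X) {x : S}
    (hx : x ∉ X.sing) : ∃ ε : ℝ, (ε = 1 ∨ ε = -1) ∧ ∃ c : ℝ → S, c 0 = x ∧
      Dev X (line ε) c (Ici 0) := by
  rcases X.exists_leaf hx ((1 : ℝ) : ℂ) with ⟨c, h0, hc⟩ | ⟨T, hT, c, h0, hc, σ, hσ, hlim⟩
  · exact ⟨1, Or.inl rfl, c, h0, hc⟩
  rcases X.exists_leaf hx ((-1 : ℝ) : ℂ) with ⟨c', h0', hc'⟩ | ⟨T', hT', c', h0', hc', σ', hσ', hlim'⟩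
  · exact ⟨-1, Or.inr rfl, c', h0', hc'⟩
  exfalso
  -- If both half-leaves ran into conical points, they would join to a horizontal saddle connection.
  have hA : Dev X (line (1 : ℝ)) (fun t => c' (0 + (-1 : ℝ) * t)) (Ioo (-T') T ∩ Iic 0) :=
    hc'.comp_affine 0 (-1) (fun t ht => by
      have := ht.1.1
      have h2 : t ≤ 0 := ht.2
      constructor <;> linarith) (by simp)
  have hB := hA.glue (hc.mono fun t ht => ⟨ht.2, ht.1.2⟩) (by simp [h0, h0'])
  have hD := hB.comp_affine (-T') 1 (P := Ioo 0 (T' + T))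
    (fun t ht => ⟨by linarith [ht.1], by linarith [ht.2]⟩) (v := ((1 : ℝ) : ℂ)) (by simp)
  refine φ.no_saddle_connection (u := ((1 : ℝ) : ℂ)) hσ' hD (by linarith) ?_ (by simp)
    (by rw [stretch_ofReal]) hσ ?_
  · have : Tendsto (fun t : ℝ => T' - t) (𝓝[>] 0) (𝓝[<] T') := by
      refine tendsto_nhdsWithin_of_tendsto_nhds_of_eventually_within _ ?_ ?_
      · have h2 : Continuous fun t : ℝ => T' - t := by fun_prop
        have := h2.tendsto 0
        rw [sub_zero] at this
        exact this.mono_left nhdsWithin_le_nhds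
      · filter_upwards [self_mem_nhdsWithin] with t ht
        exact sub_lt_self _ (mem_Ioi.1 ht)
    refine (hlim'.comp this).congr' ?_
    filter_upwards [Ioo_mem_nhdsGT hT'] with t ht
    rw [if_pos (by linarith [ht.2])]
    simp only [Function.comp]
    congr 1; ring
  · have : Tendsto (fun t : ℝ => t - T') (𝓝[<] (T' + T)) (𝓝[<] T) := by
      refine tendsto_nhdsWithin_of_tendsto_nhds_of_eventually_within _ ?_ ?_
      · have h2 : Continuous fun t : ℝ => t - T' := by fun_prop
        have := h2.tendsto (T' + T)
        rw [add_sub_cancel_left] at this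
        exact this.mono_left nhdsWithin_le_nhds
      · filter_upwards [self_mem_nhdsWithin] with t ht
        have : t < T' + T := ht
        rw [mem_Iio]; linarith
    refine (hlim.comp this).congr' ?_
    filter_upwards [Ioo_mem_nhdsLT (show T' < T' + T by linarith)] with t ht
    rw [if_neg (by linarith [ht.1])]
    simp only [Function.comp]
    congr 1; ring

/-- The gap next to a boundary leaf of a closed saturated set has constant height. -/
theorem hasGap_of_leaf [CompactSpace S] (hsat : Saturated X C) {v : ℂ} {η : ℝ}
    (hvis : ∀ (V : ℝ → S) (s : ℝ), 0 < s → s ≤ η → Dev X (line v) V (Ico 0 s) → V 0 ∈ C →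
      (∀ t ∈ Ioo 0 s, V t ∉ C) → ∀ σ ∈ X.sing, ¬ Tendsto V (𝓝[<] s) (𝓝 σ))
    (hη : 0 < η) {ε : ℝ} {c : ℝ → S} (hc : Dev X (line ε) c (Ici 0)) (h0C : c 0 ∈ C)
    (h0 : HasGap X C v η (c 0)) {t : ℝ} (ht : 0 ≤ t) : HasGap X C v η (c t) := by
  have hcC : ∀ t, 0 ≤ t → c t ∈ C := fun t ht =>
    hsat ε c 0 t (hc.mono fun s hs => hs.1) 0 (by simp [ht]) t (by simp [ht]) h0C
  -- a vertical segment and nearby horizontal translates of it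
  have htube : ∀ T ≥ 0, ∀ s ≥ 0, ∀ V : ℝ → S, V 0 = c T → Dev X (line v) V (Icc 0 s) →
      ∀ᶠ T' in 𝓝[Ici 0] T, ∃ V' : ℝ → S, V' 0 = c T' ∧ Dev X (line v) V' (Icc 0 s) ∧
        ∀ q ∈ Icc 0 s, V q ∈ C ↔ V' q ∈ C := by
    intro T hT s hs V hV0 hV
    obtain ⟨δ, hδ, E, hE0, hE⟩ := hV.exists_tube isCompact_Icc
    have hslice : ∀ q ∈ Icc 0 s, Dev X id (fun z => E (q, z)) (Metric.ball 0 δ) := fun q hq =>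
      (hE.comp (g := fun z : ℂ => (q, z)) (P := Metric.ball 0 δ) (by fun_prop)
        (fun z hz => ⟨hq, hz⟩)).congr_dev fun z _ z' _ => by simp
    set W := {t : ℝ | |(t - T) * ε| < δ}
    have hWo : IsOpen W := isOpen_lt (by fun_prop) (by fun_prop)
    have hWT : T ∈ W := by simpa [W] using hδ
    obtain ⟨κ, hκ, hκW⟩ := Metric.isOpen_iff.1 hWo T hWT
    have hmem : ∀ t ∈ Metric.ball T κ, (-T * ε + t * ε : ℂ) ∈ Metric.ball (0 : ℂ) δ := fun t ht => by
      have : |(t - T) * ε| < δ := hκW ht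
      rw [mem_ball_zero_iff, show (-T * ε + t * ε : ℂ) = (((t - T) * ε : ℝ) : ℂ) by push_cast; ring,
        Complex.norm_real]
      exact this
    have hagree : EqOn c (fun t : ℝ => E (0, (-T * ε + t * ε : ℂ))) (Ici 0 ∩ Metric.ball T κ) := by
      have hpre : IsPreconnected (Ici (0 : ℝ) ∩ Metric.ball T κ) :=
        ((convex_Ici 0).inter (convex_ball _ _)).isPreconnected
      refine Dev.eqOn hpre (hc.mono inter_subset_left)
        ((hslice 0 ⟨le_rfl, hs⟩).comp_line (-T * ε : ℂ) ε fun t ht => hmem t ht.2)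
        ⟨hT, Metric.mem_ball_self hκ⟩ ?_
      simp only [neg_mul, neg_add_cancel]
      rw [hE0 0 ⟨le_rfl, hs⟩, hV0]
    filter_upwards [self_mem_nhdsWithin, mem_nhdsWithin_of_mem_nhds (Metric.ball_mem_nhds T hκ)]
      with T' h1 h2
    refine ⟨fun q => E (q, (-T * ε + T' * ε : ℂ)), (hagree ⟨h1, h2⟩).symm, ?_, fun q hq => ?_⟩
    · exact (hE.comp (g := fun q : ℝ => (q, (-T * ε + T' * ε : ℂ))) (P := Icc 0 s) (by fun_prop)
        (fun q hq => ⟨hq, hmem T' h2⟩)).congr_dev fun q _ q' _ => by simp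
    · have him : ((0 : ℂ)).im = (-T * ε + T' * ε : ℂ).im := by simp
      rw [← hE0 q hq]
      exact ⟨hsat.of_exp (hslice q hq) (convex_ball _ _) (Metric.mem_ball_self hδ) (hmem T' h2) him,
        hsat.of_exp (hslice q hq) (convex_ball _ _) (hmem T' h2) (Metric.mem_ball_self hδ) him.symm⟩
  -- Having the gap is a locally constant property along the leaf. It is open because a tube around
  -- the vertical segment meets `C` in horizontal pieces. It is closed because a vertical path at
  -- the limit is parallel to gaps at nearby times, and such a path of length `η` exists unless it
  -- ends at a conical point, which `hvis` forbids.
  refine ((eq_of_eventually_eq_nhdsWithin (Q := Ici (0 : ℝ)) isPreconnected_Ici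
    (g := fun t => HasGap X C v η (c t)) (fun T hT => ?_) (mem_Ici.2 le_rfl) ht)).mp h0
  have hT0 : 0 ≤ T := hT
  by_cases hgap : HasGap X C v η (c T)
  · obtain ⟨V, hV0, hV, hVC⟩ := hgap
    filter_upwards [htube T hT0 η hη.le V hV0 hV] with T' ⟨V', a1, a2, a3⟩
    refine propext (iff_of_true ⟨V', a1, a2, fun t ht h => hVC t ht ?_⟩ ⟨V, hV0, hV, hVC⟩)
    exact (a3 t ⟨ht.1.le, ht.2⟩).2 h
  · have : ∀ᶠ T' in 𝓝[Ici 0] T, ¬ HasGap X C v η (c T') := by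
      by_contra hcon
      have hfr : ∃ᶠ T' in 𝓝[Ici 0] T, HasGap X C v η (c T') := hcon
      have hout : ∀ s ≥ 0, s ≤ η → ∀ V : ℝ → S, V 0 = c T → Dev X (line v) V (Icc 0 s) →
          ∀ t ∈ Ioc 0 s, V t ∉ C := by
        intro s hs hsη V hV0 hV t ht htC
        obtain ⟨T', ⟨W, hW0, hW, hWC⟩, V', a1, a2, a3⟩ :=
          (hfr.and_eventually (htube T hT0 s hs V hV0 hV)).exists
        have hEq := Dev.eqOn isPreconnected_Icc (hW.mono (Icc_subset_Icc_right hsη)) a2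
          (left_mem_Icc.2 hs) (hW0.trans a1.symm)
        have ht' : t ∈ Icc 0 s := ⟨ht.1.le, ht.2⟩
        refine hWC t ⟨ht.1, ht.2.trans hsη⟩ ?_
        rw [hEq ht']
        exact (a3 t ht').1 htC
      apply hgap
      rcases X.exists_leaf (hc.notMem hT) v with ⟨V, hV0, hV⟩ | ⟨s, hs, V, hV0, hV, σ, hσ, hlim⟩
      · exact ⟨V, hV0, hV.mono Icc_subset_Ici_self,
          hout η hη.le le_rfl V hV0 (hV.mono Icc_subset_Ici_self)⟩
      · by_cases hsη : s ≤ η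
        · exfalso
          refine hvis V s hs hsη hV (hV0 ▸ hcC T hT0) (fun t ht => ?_) σ hσ hlim
          exact hout t ht.1.le (ht.2.le.trans hsη) V hV0 (hV.mono (Icc_subset_Ico_right ht.2)) t
            ⟨ht.1, le_rfl⟩
        · have := hV.mono (Icc_subset_Ico_right (not_le.1 hsη))
          exact ⟨V, hV0, this, hout η hη.le le_rfl V hV0 this⟩
    filter_upwards [this] with T' hT'
    exact propext (iff_of_false hT' hgap)

/-- An infinite horizontal half-leaf accumulates at a regular point. -/
theorem exists_regular_mapClusterPt [CompactSpace S] {ε : ℝ} (hε : ε = 1 ∨ ε = -1) {c : ℝ → S}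
    (hc : Dev X (line ε) c (Ici 0)) : ∃ w, w ∉ X.sing ∧ MapClusterPt w atTop c := by
  obtain ⟨w, hw⟩ := exists_clusterPt_of_compactSpace (Filter.map c atTop)
  by_cases hws : w ∉ X.sing
  · exact ⟨w, hws, hw⟩
  obtain ⟨e, n, R, hn, hwso, hw0, hprim, hR, hRt, hreg⟩ := X.exists_coord w
  obtain ⟨r, hr0, hr⟩ := exists_between hR
  have hrt : Metric.closedBall 0 r ⊆ e.target := (Metric.closedBall_subset_ball hr).trans hRt
  set ρ := r ^ n / 2 with hρ
  have hρ0 : 0 < ρ := by positivity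
  have hlt : ∀ᶠ y in 𝓝 w, y ∈ e.source ∧ ‖e y ^ n‖ < ρ / 2 := by
    have : ContinuousAt (fun y => ‖e y ^ n‖) w := ((e.continuousAt hwso).pow n).norm
    have h2 : ‖e w ^ n‖ < ρ / 2 := by simpa [hw0, hn] using hρ0
    exact (Filter.eventually_of_mem (e.open_source.mem_nhds hwso) fun _ h => h).and
      (this.eventually_lt_const h2)
  have hfr : ∃ᶠ t in atTop, c t ∈ e.source ∧ ‖e (c t) ^ n‖ < ρ / 2 := hw.frequently hlt
  have hε1 : ‖(ε : ℂ)‖ = 1 := by rcases hε with rfl | rfl <;> simp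
  set Z := e.symm '' (Metric.closedBall 0 r ∩ {z | ρ / 2 ≤ ‖z ^ n‖}) with hZdef
  have hZ : IsCompact Z := by
    refine IsCompact.image_of_continuousOn ?_
      (e.continuousOn_symm.mono (inter_subset_left.trans hrt))
    exact (isCompact_closedBall _ _).inter_right (isClosed_le (by fun_prop) (by fun_prop))
  -- The path has unit speed, so after each visit near the conical point it is, a time `ρ` later, in
  -- the compact annulus `Z`. A cluster point in `Z` is regular.
  have hfr2 : ∃ᶠ t in atTop, c t ∈ Z := by
    rw [frequently_atTop] at hfr ⊢
    intro a
    obtain ⟨t, hta, h1, h2⟩ := hfr (max a 0)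
    have ht0 : 0 ≤ t := (le_max_right _ _).trans hta
    refine ⟨t + ρ, by linarith [(le_max_left a 0).trans hta], ?_⟩
    have htr := (hc.mono (Q' := Icc t (t + ρ)) fun s hs => ht0.trans hs.1).trap isPreconnected_Icc
      hprim hrt (left_mem_Icc.2 (by linarith)) h1 (fun s hs => by
        refine (norm_add_le _ _).trans_lt ?_
        rw [line_sub, norm_mul, hε1, mul_one, ← Complex.ofReal_sub, Complex.norm_real,
          Real.norm_of_nonneg (sub_nonneg.2 hs.1)]
        have := hs.2
        have h3 : r ^ n = 2 * ρ := by rw [hρ]; ring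
        linarith) hr0
    obtain ⟨b1, b2, b3⟩ := htr (t + ρ) (right_mem_Icc.2 (by linarith))
    refine ⟨e (c (t + ρ)), ⟨by simpa using b2.le, ?_⟩, e.left_inv b1⟩
    simp only [mem_ofPred_eq]
    rw [b3, line_sub]
    have h4 : ‖((t + ρ : ℝ) - t : ℂ) * ε‖ = ρ := by
      rw [norm_mul, hε1, mul_one, ← Complex.ofReal_sub, Complex.norm_real, add_sub_cancel_left,
        Real.norm_of_nonneg hρ0.le]
    have h5 := norm_sub_norm_le (((t + ρ : ℝ) - t : ℂ) * ε) (-(e (c t) ^ n))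
    rw [norm_neg, h4, sub_neg_eq_add, add_comm] at h5
    linarith
  obtain ⟨y, hyZ, hy⟩ := hZ.exists_mapClusterPt_of_frequently hfr2
  refine ⟨y, ?_, hy⟩
  obtain ⟨z, ⟨hz1, hz2⟩, rfl⟩ := hyZ
  refine hreg _ (e.map_target (hrt hz1)) fun h => ?_
  have := e.right_inv (hrt hz1)
  rw [h, hw0] at this
  simp only [mem_ofPred_eq, ← this, zero_pow hn, norm_zero] at hz2
  linarith

/-- A closed saturated set with a regular point is the whole surface, unless a vertical segment
leads from it to a conical point without meeting it in between. -/
theorem LinearPA.eq_univ_of_saturated [CompactSpace S] [ConnectedSpace S] (φ : LinearPA X)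
    (hC : IsClosed C) (hsat : Saturated X C) {x : S} (hx : x ∈ C) (hxs : x ∉ X.sing) {η₀ : ℝ}
    (hη₀ : 0 < η₀)
    (hvis : ∀ δ : ℝ, (δ = 1 ∨ δ = -1) → ∀ (V : ℝ → S) (s : ℝ), 0 < s → s < η₀ →
      Dev X (line (δ * Complex.I)) V (Ico 0 s) → V 0 ∈ C → (∀ t ∈ Ioo 0 s, V t ∉ C) →
      ∀ σ ∈ X.sing, ¬ Tendsto V (𝓝[<] s) (𝓝 σ)) : C = univ := by
  by_contra hne
  obtain ⟨δ, hδ, η, hη, hηη, y, hyC, hgap⟩ := exists_hasGap hC hsat hne hx hxs hη₀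
  have hys : y ∉ X.sing := by
    obtain ⟨V, rfl, hV, -⟩ := hgap
    exact hV.notMem (left_mem_Icc.2 hη.le)
  obtain ⟨ε, hε, c, hc0, hc⟩ := φ.exists_infinite_leaf hys
  have hgaps : ∀ t, 0 ≤ t → HasGap X C (δ * Complex.I) η (c t) := fun t ht =>
    hasGap_of_leaf hsat (fun V s hs hsη => hvis δ hδ V s hs (hsη.trans_lt hηη)) hη hc
      (hc0 ▸ hyC) (hc0 ▸ hgap) ht
  have hcC : ∀ t, 0 ≤ t → c t ∈ C := fun t ht =>
    hsat ε c 0 t (hc.mono fun s hs => hs.1) 0 (by simp [ht]) t (by simp [ht]) (hc0 ▸ hyC)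
  obtain ⟨w, hws, hw⟩ := exists_regular_mapClusterPt hε hc
  obtain ⟨r, hr, E, hE0, hE⟩ := X.exists_exp hws
  -- Heights and offsets of two visits to the `ρ`-disc differ by at most `2 ρ`. This has to stay
  -- within the chart, below the gap height `η`, and below the time `1` that separates the visits.
  set ρ := min r (min η 1) / 4 with hρ
  have hm : 0 < min r (min η 1) := lt_min hr (lt_min hη one_pos)
  have hρ0 : 0 < ρ := by positivity
  have hρr : ρ * 4 ≤ r := by rw [hρ]; linarith [min_le_left r (min η 1)]
  have hρη : ρ * 4 ≤ η := by
    rw [hρ]; linarith [(min_le_right r (min η 1)).trans (min_le_left η 1)]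
  have hρ1 : ρ * 4 ≤ 1 := by
    rw [hρ]; linarith [(min_le_right r (min η 1)).trans (min_le_right η 1)]
  have hN := hE.isOpenMap_at (Metric.ball_mem_nhds 0 hr) (Metric.ball_mem_nhds (0 : ℂ) hρ0)
  rw [hE0] at hN
  have hfr := frequently_atTop.1 (mapClusterPt_iff_frequently.1 hw _ hN)
  obtain ⟨t₁, ht₁, z₁, hz₁, hcz₁⟩ := hfr 1
  obtain ⟨t₂, ht₂, z₂, hz₂, hcz₂⟩ := hfr (t₁ + 1)
  rw [mem_ball_zero_iff] at hz₁ hz₂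
  have hδ1 : |δ| = 1 := by rcases hδ with rfl | rfl <;> simp
  have hδδ : δ * δ = 1 := by rcases hδ with rfl | rfl <;> simp
  have hεε : ε * ε = 1 := by rcases hε with rfl | rfl <;> simp
  -- If the visit at `tb` lay further in the gap direction than the one at `ta`, then by saturation
  -- the vertical segment above `c ta` would meet `C` inside its gap. By symmetry all visits have
  -- the same height.
  have key : ∀ ta tb : ℝ, 0 ≤ ta → 0 ≤ tb → ∀ za zb : ℂ, ‖za‖ < ρ → ‖zb‖ < ρ → E za = c ta →
      E zb = c tb → δ * zb.im ≤ δ * za.im := by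
    intro ta tb hta htb za zb hza hzb ha hb
    by_contra hlt
    set s := δ * zb.im - δ * za.im with hs
    have hs0 : 0 < s := by rw [hs]; linarith [not_le.1 hlt]
    have hsle : s ≤ 2 * ρ := by
      have h1 : δ * zb.im ≤ ρ := (le_abs_self _).trans (by
        rw [abs_mul, hδ1, one_mul]; exact (Complex.abs_im_le_norm zb).trans hzb.le)
      have h2 : -(δ * za.im) ≤ ρ := (neg_le_abs _).trans (by
        rw [abs_mul, hδ1, one_mul]; exact (Complex.abs_im_le_norm za).trans hza.le)
      linarith
    obtain ⟨V, hV0, hV, hVC⟩ := hgaps ta hta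
    have hin : ∀ q ∈ Icc 0 s, za + q * (δ * Complex.I) ∈ Metric.ball (0 : ℂ) r := fun q hq => by
      rw [mem_ball_zero_iff]
      refine (norm_add_le _ _).trans_lt ?_
      simp only [norm_mul, Complex.norm_real, Complex.norm_I, mul_one, Real.norm_eq_abs, hδ1,
        abs_of_nonneg hq.1]
      linarith [hq.2]
    have hEq := Dev.eqOn isPreconnected_Icc (hV.mono (Icc_subset_Icc_right (by linarith)))
      (hE.comp_line za (δ * Complex.I) hin) (left_mem_Icc.2 hs0.le) (by simp [hV0, ha])
    apply hVC s ⟨hs0, by linarith⟩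
    rw [hEq (right_mem_Icc.2 hs0.le)]
    refine hsat.of_exp hE (convex_ball _ _) (z := zb) ?_ (hin s (right_mem_Icc.2 hs0.le)) ?_
      (hb ▸ hcC tb htb)
    · rw [mem_ball_zero_iff]; linarith
    · simp only [Complex.add_im, Complex.mul_im, Complex.ofReal_re, Complex.ofReal_im,
        Complex.I_re, Complex.I_im, hs, Complex.mul_re]
      linear_combination (za.im - zb.im) * hδδ
  have him : z₁.im = z₂.im := by
    have h1 := key t₁ t₂ (by linarith) (by linarith) z₁ z₂ hz₁ hz₂ hcz₁ hcz₂
    have h2 := key t₂ t₁ (by linarith) (by linarith) z₂ z₁ hz₂ hz₁ hcz₂ hcz₁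
    rcases hδ with rfl | rfl <;> linarith
  set q := ε * (z₂.re - z₁.re) with hq
  have hq1 : |q| ≤ 2 * ρ := by
    have h1 : |ε| = 1 := by rcases hε with rfl | rfl <;> simp
    rw [hq, abs_mul, h1, one_mul]
    have h2 := (Complex.abs_re_le_norm z₁).trans hz₁.le
    have h3 := (Complex.abs_re_le_norm z₂).trans hz₂.le
    exact (abs_sub _ _).trans (by linarith)
  -- Both visits lie on one horizontal plaque with offset `q`. Since `|q| < 1 ≤ t₂ - t₁`, the two
  -- times are distinct and the leaf closes up.
  have hclose : c (t₁ + q) = c t₂ := by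
    have hD : Dev X (line ε) (fun t : ℝ => E (z₁ + t * ε)) (Icc (-(2 * ρ)) (2 * ρ)) := by
      refine hE.comp_line z₁ ε fun t ht => ?_
      rw [mem_ball_zero_iff]
      refine (norm_add_le _ _).trans_lt ?_
      have h1 : ‖(ε : ℂ)‖ = 1 := by rcases hε with rfl | rfl <;> simp
      rw [norm_mul, h1, mul_one, Complex.norm_real, Real.norm_eq_abs]
      linarith [abs_le.2 ht]
    have hD' : Dev X (line ε) (fun t => c (t₁ + 1 * t)) (Icc (-(2 * ρ)) (2 * ρ)) :=
      hc.comp_affine t₁ 1 (fun t ht => by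
        have := ht.1
        rw [mem_Ici]; linarith) (by simp)
    have := Dev.eqOn isPreconnected_Icc hD' hD (z₀ := 0) ⟨by linarith, by linarith⟩
      (by simp [hcz₁]) (abs_le.1 hq1)
    simp only [one_mul] at this
    rw [this, ← hcz₂]
    congr 1
    apply Complex.ext
    · simp only [Complex.add_re, Complex.mul_re, Complex.ofReal_re, Complex.ofReal_im, hq]
      linear_combination (z₂.re - z₁.re) * hεε
    · simp [him]
  have hq2 := abs_le.1 hq1
  refine φ.no_closed_leaf (u := ε) (a := t₁ + q) (b := t₂) (by linarith [hq2.2])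
    (hc.mono fun t ht => ?_) ?_ (by rw [stretch_ofReal]) hclose
  · have := ht.1
    rw [mem_Ici]; linarith [hq2.1]
  · rcases hε with rfl | rfl <;> simp

/-- By uniqueness, a horizontal path through a point of the ray is a reparametrised piece of it. It
cannot run back past the start, since it would go through the conical point. -/
theorem saturated_ray {ε : ℝ} (hε : ε = 1 ∨ ε = -1) {σ : S} (hσ : σ ∈ X.sing) {c : ℝ → S}
    (hc : Dev X (line ε) c (Ioi 0)) (hlim : Tendsto c (𝓝[>] 0) (𝓝 σ)) :
    Saturated X (c '' Ioi 0) := by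
  have hεε : ε * ε = 1 := by rcases hε with rfl | rfl <;> simp
  rintro ρ c' a b hc' s hs t ht ⟨t₀, ht₀, hcs⟩
  -- reparametrise such that both paths start at time `0`
  have hab : ∀ q ∈ Icc (0 : ℝ) 1, s + (t - s) * q ∈ Icc a b := fun q hq => by
    have := (convex_Icc a b).add_smul_sub_mem hs ht hq
    simpa [mul_comm] using this
  set κ := ε * ρ * (t - s) with hκ
  have hD : Dev X (line ((t - s : ℝ) * ρ)) (fun q => c' (s + (t - s) * q)) (Icc 0 1) :=
    hc'.comp_affine s (t - s) hab rfl
  have hκu : (κ : ℂ) * ε = (t - s : ℝ) * ρ := by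
    rw [hκ, ← Complex.ofReal_mul, ← Complex.ofReal_mul]
    congr 1
    linear_combination (ρ * (t - s)) * hεε
  have hpos : ∀ q ∈ Icc (0 : ℝ) 1, 0 < t₀ + κ * q := by
    by_contra hcon
    push Not at hcon
    obtain ⟨q, hq, hneg⟩ := hcon
    have ht₀' : 0 < t₀ := ht₀
    -- the first time at which the ray has run back into the conical point
    have hκ0 : κ < 0 := by
      by_contra h
      have := mul_nonneg (not_lt.1 h) hq.1
      linarith
    set q₁ := t₀ / (-κ) with hq₁
    have hq₁0 : 0 < q₁ := div_pos ht₀' (neg_pos.2 hκ0)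
    have hq₁q : q₁ ≤ q := by
      rw [hq₁, div_le_iff₀ (neg_pos.2 hκ0)]
      linarith
    have hlin : ∀ p < q₁, 0 < t₀ + κ * p := fun p hp => by
      have := (lt_div_iff₀ (neg_pos.2 hκ0)).1 hp
      linarith
    have hzero : t₀ + κ * q₁ = 0 := by
      rw [hq₁]; field_simp [hκ0.ne]; ring
    have hD2 : Dev X (line ((t - s : ℝ) * ρ)) (fun q => c (t₀ + κ * q)) (Ico 0 q₁) :=
      hc.comp_affine t₀ κ (fun p hp => hlin p hp.2) hκu
    have hEq := Dev.eqOn isPreconnected_Ico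
      (hD.mono (Q' := Ico 0 q₁) fun p hp => ⟨hp.1, (hp.2.le.trans hq₁q).trans hq.2⟩) hD2
      (left_mem_Ico.2 hq₁0) (by simp [hcs])
    have l1 : Tendsto (fun q => c' (s + (t - s) * q)) (𝓝[<] q₁) (𝓝 (c' (s + (t - s) * q₁))) := by
      have := hD.1 q₁ ⟨hq₁0.le, hq₁q.trans hq.2⟩
      have h2 := this.mono (t := Icc 0 1) (s := Ico 0 q₁) fun p hp => ⟨hp.1, (hp.2.le.trans hq₁q).trans hq.2⟩
      rw [ContinuousWithinAt, nhdsWithin_Ico_eq_nhdsLT hq₁0] at h2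
      exact h2
    have l2 : Tendsto (fun q => c (t₀ + κ * q)) (𝓝[<] q₁) (𝓝 σ) := by
      refine hlim.comp (tendsto_nhdsWithin_of_tendsto_nhds_of_eventually_within _ ?_ ?_)
      · have : Continuous fun q => t₀ + κ * q := by fun_prop
        have h2 := this.tendsto q₁
        rw [hzero] at h2
        exact h2.mono_left nhdsWithin_le_nhds
      · filter_upwards [self_mem_nhdsWithin] with p hp
        exact hlin p hp
    have : c' (s + (t - s) * q₁) = σ := by
      refine tendsto_nhds_unique l1 (l2.congr' ?_)
      filter_upwards [Ico_mem_nhdsLT hq₁0] with p hp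
      exact (hEq hp).symm
    exact hc'.notMem (hab q₁ ⟨hq₁0.le, hq₁q.trans hq.2⟩) (this ▸ hσ)
  have hD2 : Dev X (line ((t - s : ℝ) * ρ)) (fun q => c (t₀ + κ * q)) (Icc 0 1) :=
    hc.comp_affine t₀ κ (fun p hp => hpos p hp) hκu
  have hEq := Dev.eqOn isPreconnected_Icc hD hD2 (left_mem_Icc.2 zero_le_one) (by simp [hcs])
    (right_mem_Icc.2 zero_le_one)
  simp only [mul_one, add_sub_cancel] at hEq
  have h1 := hpos 1 (right_mem_Icc.2 zero_le_one)
  rw [mul_one] at h1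
  exact ⟨t₀ + κ, h1, hEq.symm⟩

theorem saturated_leaf {c : ℝ → S} (hc : Dev X (line (1 : ℝ)) c univ) : Saturated X (range c) := by
  rintro ρ c' a b hc' s hs t ht ⟨t₀, hcs⟩
  have hD2 : Dev X (line ρ) (fun q => c ((t₀ - ρ * s) + ρ * q)) (Icc a b) :=
    hc.comp_affine _ ρ (fun _ _ => mem_univ _) (by simp)
  have hEq := Dev.eqOn isPreconnected_Icc hc' hD2 hs (by simp [hcs]) ht
  exact ⟨_, hEq.symm⟩

/-- Every infinite horizontal ray that starts at a conical point is dense. -/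
theorem LinearPA.dense_ray [CompactSpace S] [ConnectedSpace S] (φ : LinearPA X) {ε : ℝ}
    (hε : ε = 1 ∨ ε = -1) {σ : S} (hσ : σ ∈ X.sing) {c : ℝ → S}
    (hc : Dev X (line ε) c (Ioi 0)) (hlim : Tendsto c (𝓝[>] 0) (𝓝 σ)) :
    closure (c '' Ioi 0) = univ := by
  have hε0 : (ε : ℂ) ≠ 0 := by rcases hε with rfl | rfl <;> simp
  have hmap : ∀ t > 0, φ.map (c t) = c (φ.lam * t) := fun t ht => by
    have h1 := mul_pos φ.lam_pos ht
    exact φ.map_ray (s := max t (φ.lam * t) + 1) hσ (hc.mono fun s hs => hs.1) hlim hε0 φ.lam_pos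
      (stretch_ofReal _ _) ⟨ht, by linarith [le_max_left t (φ.lam * t)]⟩
      ⟨h1, by linarith [le_max_right t (φ.lam * t)]⟩
  have hinv : ∀ x ∈ closure (c '' Ioi 0), φ.map x ∈ closure (c '' Ioi 0) := fun x hx => by
    refine map_mem_closure φ.map.continuous hx ?_
    rintro _ ⟨t, ht, rfl⟩
    exact ⟨φ.lam * t, mul_pos φ.lam_pos ht, (hmap t ht).symm⟩
  have h1 : c 1 ∈ c '' Ioi 0 := ⟨1, mem_Ioi.2 one_pos, rfl⟩
  refine φ.eq_univ_of_saturated isClosed_closure (saturated_ray hε hσ hc hlim).closure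
    (subset_closure h1) (hc.notMem (mem_Ioi.2 one_pos)) one_pos ?_
  intro δ hδ V s hs _ hV hV0 hVC σ' hσ' hVlim
  have hδ0 : (δ : ℂ) ≠ 0 := by rcases hδ with rfl | rfl <;> simp
  have hD : Dev X (line (-(δ * Complex.I))) (fun t => V (s + (-1 : ℝ) * t)) (Ioo 0 s) :=
    (hV.mono Ioo_subset_Ico_self).comp_affine s (-1) (fun t ht =>
      ⟨by linarith [ht.2], by linarith [ht.1]⟩) (by simp)
  have hlimV : Tendsto (fun t => V (s + (-1 : ℝ) * t)) (𝓝[>] 0) (𝓝 σ') := by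
    refine hVlim.comp (tendsto_nhdsWithin_of_tendsto_nhds_of_eventually_within _ ?_ ?_)
    · have h2 : Continuous fun t : ℝ => s + (-1 : ℝ) * t := by fun_prop
      have := h2.tendsto 0
      rw [mul_zero, add_zero] at this
      exact this.mono_left nhdsWithin_le_nhds
    · filter_upwards [self_mem_nhdsWithin] with t ht
      have : 0 < t := ht
      rw [mem_Iio]; linarith
  have hl := φ.lam_pos
  have hl1 := inv_lt_one_of_one_lt₀ φ.one_lt_lam
  have hst : stretch φ.lam (-(δ * Complex.I)) = (φ.lam⁻¹ : ℝ) * (-(δ * Complex.I)) := by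
    have := stretch_mul_I φ.lam (-δ)
    simpa using this
  have hray : ∀ t ∈ Ioo 0 s, φ.map (V (s + (-1 : ℝ) * t)) = V (s + (-1 : ℝ) * (φ.lam⁻¹ * t)) :=
    fun t ht => φ.map_ray hσ' hD hlimV (by simpa using hδ0) (inv_pos.2 hl) hst ht
      ⟨mul_pos (inv_pos.2 hl) ht.1, by nlinarith [ht.1, ht.2]⟩
  have hq : s - φ.lam⁻¹ * s ∈ Ioo 0 s := by
    have := mul_pos (inv_pos.2 hl) hs
    constructor <;> nlinarith
  -- The vertical segment ends at a fixed conical point and `φ` contracts it towards that point. So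
  -- `φ` moves its start `V 0` into its interior, where invariance of the closed set contradicts
  -- `hVC`.
  have heq : φ.map (V 0) = V (s - φ.lam⁻¹ * s) := by
    have c1 : Tendsto (fun t => V (s + (-1 : ℝ) * t)) (𝓝[<] s) (𝓝 (V 0)) := by
      have h2 := hV.1 0 (left_mem_Ico.2 hs)
      rw [ContinuousWithinAt, nhdsWithin_Ico_eq_nhdsGE hs] at h2
      refine h2.comp (tendsto_nhdsWithin_of_tendsto_nhds_of_eventually_within _ ?_ ?_)
      · have h3 : Continuous fun t : ℝ => s + (-1 : ℝ) * t := by fun_prop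
        have := h3.tendsto s
        rw [neg_one_mul, add_neg_cancel] at this
        exact this.mono_left nhdsWithin_le_nhds
      · filter_upwards [self_mem_nhdsWithin] with t ht
        have : t < s := ht
        rw [mem_Ici]; linarith
    have c2 : Tendsto (fun t => V (s + (-1 : ℝ) * (φ.lam⁻¹ * t))) (𝓝[<] s)
        (𝓝 (V (s - φ.lam⁻¹ * s))) := by
      have h2 : ContinuousAt V (s - φ.lam⁻¹ * s) :=
        (hV.1 _ (Ioo_subset_Ico_self hq)).continuousAt
          (mem_of_superset (isOpen_Ioo.mem_nhds hq) Ioo_subset_Ico_self)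
      refine h2.tendsto.comp (Tendsto.mono_left ?_ nhdsWithin_le_nhds)
      have h3 : Continuous fun t : ℝ => s + (-1 : ℝ) * (φ.lam⁻¹ * t) := by fun_prop
      have := h3.tendsto s
      rwa [neg_one_mul, ← sub_eq_add_neg] at this
    refine tendsto_nhds_unique ((φ.map.continuous.tendsto _).comp c1) (c2.congr' ?_)
    filter_upwards [Ioo_mem_nhdsLT hs] with t ht
    exact (hray t ht).symm
  exact hVC _ hq (heq ▸ hinv _ hV0)

/-- The radial profile `κ` of the planar map `x + i y ↦ κ(|x + i y|) x + i lam⁻¹ y`. -/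
structure Profile (lam : ℝ) where
  κ : ℝ → ℝ
  α : ℝ
  one_lt_lam : 1 < lam
  α_pos : 0 < α
  contDiff : ContDiff ℝ 1 κ
  even : Function.Even κ
  lipschitz : ∃ C, LipschitzWith C (deriv κ)
  pos : 0 < κ 0
  lt_one : κ 0 < 1
  mono : MonotoneOn κ (Ici 0)
  eq_lam : ∀ s, α ≤ s → κ s = lam
  hyperbolic : ∀ t, 0 < t → κ t = 1 → deriv κ t ≠ 0

/-! ### The planar model map. -/

namespace Profile

variable {lam : ℝ} (p : Profile lam)

/-- The planar map. -/
def map (z : ℂ) : ℂ := ⟨p.κ ‖z‖ * z.re, lam⁻¹ * z.im⟩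

/-- The derivative of the horizontal part in the horizontal direction. -/
def a (z : ℂ) : ℝ := p.κ ‖z‖ + deriv p.κ ‖z‖ * z.re ^ 2 / ‖z‖

/-- The derivative of the horizontal part in the vertical direction. -/
def b (z : ℂ) : ℝ := deriv p.κ ‖z‖ * (z.re * z.im) / ‖z‖

/-- The differential of the planar map. -/
def dmap (z : ℂ) : ℂ →L[ℝ] ℂ :=
  Complex.ofRealCLM.comp (p.a z • Complex.reCLM + p.b z • Complex.imCLM) +
    Complex.imCLM.smulRight ((lam⁻¹ : ℝ) * Complex.I)

theorem dmap_apply (z v : ℂ) : p.dmap z v = ⟨p.a z * v.re + p.b z * v.im, lam⁻¹ * v.im⟩ := by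
  apply Complex.ext <;> simp [dmap, mul_comm]

theorem lam_pos (p : Profile lam) : 0 < lam := zero_lt_one.trans p.one_lt_lam

theorem continuous_κ : Continuous p.κ := p.contDiff.continuous

theorem differentiable_κ : Differentiable ℝ p.κ := p.contDiff.differentiable (by simp)

theorem continuous_deriv : Continuous (deriv p.κ) := p.contDiff.continuous_deriv le_rfl

theorem κ_zero_le {s : ℝ} (hs : 0 ≤ s) : p.κ 0 ≤ p.κ s := p.mono (mem_Ici.2 le_rfl) hs hs

theorem κ_pos {s : ℝ} (hs : 0 ≤ s) : 0 < p.κ s := p.pos.trans_le (p.κ_zero_le hs)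

theorem κ_norm_pos (z : ℂ) : 0 < p.κ ‖z‖ := p.κ_pos (norm_nonneg z)

theorem deriv_nonneg {s : ℝ} (hs : 0 ≤ s) : 0 ≤ deriv p.κ s := by
  have h : ∀ t > 0, 0 ≤ deriv p.κ t := fun t ht => by
    rw [← derivWithin_of_isOpen isOpen_Ioi (mem_Ioi.2 ht)]
    exact (p.mono.mono Ioi_subset_Ici_self).derivWithin_nonneg
  rcases eq_or_lt_of_le hs with rfl | hs
  · refine ge_of_tendsto (p.continuous_deriv.continuousAt.tendsto.mono_left
      (nhdsWithin_le_nhds (s := Ioi 0))) ?_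
    filter_upwards [self_mem_nhdsWithin] with t ht using h t ht
  · exact h s hs

theorem deriv_zero : deriv p.κ 0 = 0 := by
  have h : deriv p.κ (-0) = -deriv p.κ 0 := by
    have h1 : (fun x => p.κ (-x)) = p.κ := funext p.even
    have h2 := deriv_comp_neg p.κ 0
    rw [h1] at h2
    linarith
  rw [neg_zero] at h
  linarith

theorem κ_le_a (z : ℂ) : p.κ ‖z‖ ≤ p.a z := by
  have := p.deriv_nonneg (norm_nonneg z)
  rw [a]
  have h2 : 0 ≤ deriv p.κ ‖z‖ * z.re ^ 2 / ‖z‖ := by positivity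
  linarith

theorem a_pos (z : ℂ) : 0 < p.a z := (p.κ_norm_pos z).trans_le (p.κ_le_a z)

theorem κ_zero_le_a (z : ℂ) : p.κ 0 ≤ p.a z := (p.κ_zero_le (norm_nonneg z)).trans (p.κ_le_a z)

/-- By evenness `deriv κ` vanishes at `0`, and it is Lipschitz, so it is at most a multiple of `‖z‖`
and cancels the denominator of `b`. The product form on the right is what makes the slope series
converge near the conical point. -/
theorem exists_abs_b_le : ∃ C ≥ 0, ∀ z, |p.b z| ≤ C * (|z.re| * |z.im|) := by
  obtain ⟨C, hC⟩ := p.lipschitz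
  refine ⟨C, C.2, fun z => ?_⟩
  have h1 : |deriv p.κ ‖z‖| ≤ C * ‖z‖ := by
    have := hC.dist_le_mul ‖z‖ 0
    rwa [Real.dist_eq, p.deriv_zero, sub_zero, Real.dist_eq, sub_zero, abs_norm] at this
  rw [b, abs_div, abs_mul, abs_norm, abs_mul]
  rcases eq_or_lt_of_le (norm_nonneg z) with h | h
  · rw [← h, div_zero]
    exact mul_nonneg C.2 (by positivity)
  · rw [div_le_iff₀ h]
    calc _ ≤ C * ‖z‖ * (|z.re| * |z.im|) := mul_le_mul_of_nonneg_right h1 (by positivity)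
      _ = _ := by ring

theorem deriv_eq_zero {s : ℝ} (hs : p.α < s) : deriv p.κ s = 0 := by
  have : p.κ =ᶠ[𝓝 s] fun _ => lam := by
    filter_upwards [Ioi_mem_nhds hs] with t ht
    exact p.eq_lam t (le_of_lt ht)
  rw [this.deriv_eq, deriv_const]

theorem b_eq_zero {z : ℂ} (hz : p.α < ‖z‖) : p.b z = 0 := by
  rw [b, p.deriv_eq_zero hz]; simp

theorem exists_abs_b_le_const : ∃ B ≥ 0, ∀ z, |p.b z| ≤ B := by
  obtain ⟨C, hC, h⟩ := p.exists_abs_b_le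
  have hα := p.α_pos
  refine ⟨C * (p.α * p.α), by positivity, fun z => ?_⟩
  by_cases hz : p.α < ‖z‖
  · rw [p.b_eq_zero hz, abs_zero]; positivity
  · push Not at hz
    refine (h z).trans (mul_le_mul_of_nonneg_left ?_ hC)
    exact mul_le_mul ((Complex.abs_re_le_norm z).trans hz) ((Complex.abs_im_le_norm z).trans hz)
      (abs_nonneg _) hα.le

theorem hasFDerivAt_map {z : ℂ} (hz : z ≠ 0) : HasFDerivAt p.map (p.dmap z) z := by
  have hn : (0 : ℝ) < z.re * z.re + z.im * z.im := by
    have := Complex.normSq_pos.2 hz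
    rwa [Complex.normSq_apply] at this
  have hnorm : ∀ w : ℂ, ‖w‖ = Real.sqrt (w.re * w.re + w.im * w.im) := fun w => by
    rw [Complex.norm_def, Complex.normSq_apply]
  have hre : HasFDerivAt (fun w : ℂ => w.re) Complex.reCLM z := Complex.reCLM.hasFDerivAt
  have him : HasFDerivAt (fun w : ℂ => w.im) Complex.imCLM z := Complex.imCLM.hasFDerivAt
  have h1 := ((hre.mul hre).add (him.mul him)).sqrt hn.ne'
  have h2 : HasFDerivAt (fun w : ℂ => ‖w‖) _ z := h1.congr_of_eventuallyEq
    (Eventually.of_forall hnorm)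
  have h3 := (p.differentiable_κ ‖z‖).hasDerivAt.comp_hasFDerivAt z h2
  have h4 := Complex.ofRealCLM.hasFDerivAt.comp z (h3.mul hre)
  have h5 : HasFDerivAt (fun w : ℂ => (w.im : ℝ) • ((lam⁻¹ : ℝ) * Complex.I : ℂ)) _ z :=
    him.smul_const ((lam⁻¹ : ℝ) * Complex.I : ℂ)
  have h6 := h4.add h5
  have hfun : p.map = ((Complex.ofRealCLM : ℝ → ℂ) ∘ ((p.κ ∘ fun w : ℂ => ‖w‖) * fun w => w.re)) +
      fun w : ℂ => (w.im : ℝ) • ((lam⁻¹ : ℝ) * Complex.I : ℂ) := by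
    funext w
    apply Complex.ext <;> simp [map, mul_comm]
  rw [hfun]
  refine h6.congr_fderiv ?_
  have hnz : ‖z‖ ≠ 0 := norm_ne_zero_iff.2 hz
  ext1 v
  rw [p.dmap_apply]
  apply Complex.ext
  · simp [a, b, ← hnorm]
    field_simp
    ring
  · simp [mul_comm]

theorem continuousAt_a {z : ℂ} (hz : z ≠ 0) : ContinuousAt p.a z := by
  have h1 : ContinuousAt (fun z : ℂ => ‖z‖) z := continuous_norm.continuousAt
  exact (p.continuous_κ.continuousAt.comp h1).add
    (((p.continuous_deriv.continuousAt.comp h1).mul (Complex.continuous_re.continuousAt.pow 2)).div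
      h1 (norm_ne_zero_iff.2 hz))

theorem continuousAt_b {z : ℂ} (hz : z ≠ 0) : ContinuousAt p.b z := by
  have h1 : ContinuousAt (fun z : ℂ => ‖z‖) z := continuous_norm.continuousAt
  exact (((p.continuous_deriv.continuousAt.comp h1).mul
    (Complex.continuous_re.continuousAt.mul Complex.continuous_im.continuousAt))).div
      h1 (norm_ne_zero_iff.2 hz)

theorem continuous_map : Continuous p.map := by
  have h1 : p.map = fun z : ℂ => ((p.κ ‖z‖ * z.re : ℝ) : ℂ) + ((lam⁻¹ * z.im : ℝ) : ℂ) * Complex.I := by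
    funext z
    apply Complex.ext <;> simp [map]
  rw [h1]
  have := p.continuous_κ
  fun_prop

theorem map_neg (z : ℂ) : p.map (-z) = -p.map z := by
  apply Complex.ext <;> simp [map]

theorem map_iterate_im (m : ℕ) (z : ℂ) : (p.map^[m] z).im = lam⁻¹ ^ m * z.im := by
  induction m with
  | zero => simp
  | succ m ih => rw [Function.iterate_succ_apply', map, ih, pow_succ]; ring

/-- The horizontal part of the planar map is strictly increasing along horizontal lines. -/
theorem strictMono_re (y : ℝ) : StrictMono fun x : ℝ => (p.map ⟨x, y⟩).re := by
  have hpos : ∀ x x' : ℝ, 0 ≤ x → x < x' → (p.map ⟨x, y⟩).re < (p.map ⟨x', y⟩).re := by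
    intro x x' hx hxx
    have h1 : ‖(⟨x, y⟩ : ℂ)‖ ≤ ‖(⟨x', y⟩ : ℂ)‖ := by
      rw [Complex.norm_def, Complex.norm_def]
      apply Real.sqrt_le_sqrt
      simp only [Complex.normSq_mk]
      nlinarith
    have h2 := p.mono (norm_nonneg _) (norm_nonneg _) h1
    have h3 := p.κ_norm_pos ⟨x', y⟩
    simp only [map]
    calc _ ≤ p.κ ‖(⟨x', y⟩ : ℂ)‖ * x := mul_le_mul_of_nonneg_right h2 hx
      _ < _ := mul_lt_mul_of_pos_left hxx h3
  have hneg : ∀ x : ℝ, (p.map ⟨-x, y⟩).re = -(p.map ⟨x, y⟩).re := fun x => by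
    have : ‖(⟨-x, y⟩ : ℂ)‖ = ‖(⟨x, y⟩ : ℂ)‖ := by
      rw [Complex.norm_def, Complex.norm_def]; simp [Complex.normSq_mk]
    simp [map, this]
  intro x x' hxx
  rcases le_or_gt 0 x with h | h
  · exact hpos x x' h hxx
  rcases le_or_gt x' 0 with h' | h'
  · have := hpos (-x') (-x) (by linarith) (by linarith)
    rw [hneg, hneg] at this
    simpa using this
  · have h1 : (p.map ⟨x, y⟩).re < 0 := mul_neg_of_pos_of_neg (p.κ_norm_pos _) h
    have h2 : 0 < (p.map ⟨x', y⟩).re := mul_pos (p.κ_norm_pos _) h'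
    exact h1.trans h2

theorem map_injective : Function.Injective p.map := by
  intro z w h
  have him : z.im = w.im := by
    have h1 : lam⁻¹ * z.im = lam⁻¹ * w.im := congr_arg Complex.im h
    exact mul_left_cancel₀ (inv_ne_zero p.lam_pos.ne') h1
  have hre : (p.map ⟨z.re, z.im⟩).re = (p.map ⟨w.re, z.im⟩).re := by
    rw [show (⟨w.re, z.im⟩ : ℂ) = w from Complex.ext rfl him, ← h]
  exact Complex.ext ((p.strictMono_re z.im).injective hre) him

/-- Existence is the intermediate value theorem. Between two solutions the monotone `κ` would be
constant, with zero derivative at the midpoint, contrary to `hyperbolic`. -/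
theorem exists_τ : ∃ t, 0 < t ∧ t < p.α ∧ p.κ t = 1 ∧ (∀ s, 0 ≤ s → s < t → p.κ s < 1) ∧
    (∀ s, t < s → 1 < p.κ s) := by
  obtain ⟨t, ht, ht1⟩ := intermediate_value_Ioo p.α_pos.le p.continuous_κ.continuousOn
    (show (1 : ℝ) ∈ Ioo (p.κ 0) (p.κ p.α) from ⟨p.lt_one, by
      rw [p.eq_lam _ le_rfl]; exact p.one_lt_lam⟩)
  have huniq : ∀ s s', 0 < s → s < s' → p.κ s = 1 → p.κ s' ≠ 1 := by
    intro s s' hs hss h1 h2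
    have hmid : ∀ q ∈ Icc s s', p.κ q = 1 := fun q hq => le_antisymm
      (h2 ▸ p.mono (mem_Ici.2 (hs.le.trans hq.1)) (mem_Ici.2 (hs.trans hss).le) hq.2)
      (h1 ▸ p.mono (mem_Ici.2 hs.le) (mem_Ici.2 (hs.le.trans hq.1)) hq.1)
    have hm : (s + s') / 2 ∈ Ioo s s' := ⟨by linarith, by linarith⟩
    have hd : p.κ =ᶠ[𝓝 ((s + s') / 2)] fun _ => 1 := by
      filter_upwards [isOpen_Ioo.mem_nhds hm] with q hq using hmid q (Ioo_subset_Icc_self hq)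
    exact p.hyperbolic _ (hs.trans hm.1) (hmid _ (Ioo_subset_Icc_self hm))
      (by rw [hd.deriv_eq, deriv_const])
  refine ⟨t, ht.1, ht.2, ht1, fun s hs0 hs => ?_, fun s hs => ?_⟩
  · refine lt_of_le_of_ne (ht1 ▸ p.mono (mem_Ici.2 hs0) (mem_Ici.2 ht.1.le) hs.le) fun h => ?_
    rcases eq_or_lt_of_le hs0 with rfl | h0
    · exact p.lt_one.ne h
    · exact huniq s t h0 hs h ht1
  · exact lt_of_le_of_ne (ht1 ▸ p.mono (mem_Ici.2 ht.1.le) (mem_Ici.2 (ht.1.trans hs).le) hs.le)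
      fun h => huniq t s ht.1 hs ht1 h.symm

/-- The radius at which `κ = 1`. -/
def τ : ℝ := p.exists_τ.choose

theorem τ_pos : 0 < p.τ := p.exists_τ.choose_spec.1

theorem τ_lt_α : p.τ < p.α := p.exists_τ.choose_spec.2.1

theorem κ_τ : p.κ p.τ = 1 := p.exists_τ.choose_spec.2.2.1

theorem κ_lt_one {s : ℝ} (hs : 0 ≤ s) (h : s < p.τ) : p.κ s < 1 :=
  p.exists_τ.choose_spec.2.2.2.1 s hs h

theorem one_lt_κ {s : ℝ} (h : p.τ < s) : 1 < p.κ s := p.exists_τ.choose_spec.2.2.2.2 s h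

theorem one_le_κ {s : ℝ} (h : p.τ ≤ s) : 1 ≤ p.κ s :=
  h.eq_or_lt.elim (fun h => h ▸ p.κ_τ.ge) fun h => (p.one_lt_κ h).le

theorem one_le_a {z : ℂ} (h : p.τ ≤ ‖z‖) : 1 ≤ p.a z := (p.one_le_κ h).trans (p.κ_le_a z)

/-- Beyond radius `τ` already `κ > 1`. On the circle itself strictness comes from `deriv κ τ > 0`,
and this term is seen only off the vertical axis. -/
theorem one_lt_a {z : ℂ} (h : p.τ ≤ ‖z‖) (hz : z.re ≠ 0) : 1 < p.a z := by
  rcases h.eq_or_lt with h | h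
  · have h1 : 0 < deriv p.κ p.τ := lt_of_le_of_ne (p.deriv_nonneg p.τ_pos.le)
      (p.hyperbolic _ p.τ_pos p.κ_τ).symm
    have := p.τ_pos
    rw [a, ← h, p.κ_τ]
    have h2 : 0 < z.re ^ 2 := by positivity
    have : 0 < deriv p.κ p.τ * z.re ^ 2 / p.τ := by positivity
    linarith
  · exact (p.one_lt_κ h).trans_le (p.κ_le_a z)

theorem norm_map_le {z : ℂ} {θ : ℝ} (h1 : p.κ ‖z‖ ≤ θ) (h2 : lam⁻¹ ≤ θ) : ‖p.map z‖ ≤ θ * ‖z‖ := by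
  have hθ : 0 ≤ θ := (p.κ_norm_pos z).le.trans h1
  rw [Complex.norm_def, Complex.norm_def]
  refine Real.sqrt_le_iff.2 ⟨by positivity, ?_⟩
  rw [mul_pow, Real.sq_sqrt (Complex.normSq_nonneg z), Complex.normSq_apply, Complex.normSq_apply]
  simp only [map]
  have k1 : p.κ ‖z‖ ^ 2 ≤ θ ^ 2 := pow_le_pow_left₀ (p.κ_norm_pos z).le h1 2
  have k2 : lam⁻¹ ^ 2 ≤ θ ^ 2 := pow_le_pow_left₀ (inv_nonneg.2 p.lam_pos.le) h2 2
  nlinarith [sq_nonneg z.re, sq_nonneg z.im, mul_le_mul_of_nonneg_right k1 (sq_nonneg z.re),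
    mul_le_mul_of_nonneg_right k2 (sq_nonneg z.im)]

theorem norm_map_lt {z : ℂ} (hz : ‖z‖ < p.τ) : ‖p.map z‖ < p.τ := by
  have h := p.norm_map_le (z := z) (θ := 1) (p.κ_lt_one (norm_nonneg z) hz).le
    (inv_le_one_of_one_le₀ p.one_lt_lam.le)
  linarith

/-- The orbit never gets farther from `0` than `z`, so by monotonicity `κ` stays at most `κ ‖z‖ <
1`, and one contraction factor `θ` works for all iterates. -/
theorem tendsto_iterate_zero {z : ℂ} (hz : ‖z‖ < p.τ) :
    Tendsto (fun m => p.map^[m] z) atTop (𝓝 0) := by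
  set θ := max (p.κ ‖z‖) lam⁻¹
  have hθ1 : θ < 1 := max_lt (p.κ_lt_one (norm_nonneg z) hz) (inv_lt_one_of_one_lt₀ p.one_lt_lam)
  have hθ0 : 0 ≤ θ := (inv_nonneg.2 p.lam_pos.le).trans (le_max_right _ _)
  have key : ∀ m, ‖p.map^[m] z‖ ≤ θ ^ m * ‖z‖ := by
    intro m
    induction m with
    | zero => simp
    | succ m ih =>
      have h1 : ‖p.map^[m] z‖ ≤ ‖z‖ := ih.trans
        (mul_le_of_le_one_left (norm_nonneg z) (pow_le_one₀ hθ0 hθ1.le))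
      have h2 := p.norm_map_le (z := p.map^[m] z) (θ := θ)
        ((p.mono (norm_nonneg _) (norm_nonneg _) h1).trans (le_max_left _ _)) (le_max_right _ _)
      rw [Function.iterate_succ_apply', pow_succ]
      calc _ ≤ θ * ‖p.map^[m] z‖ := h2
        _ ≤ θ * (θ ^ m * ‖z‖) := mul_le_mul_of_nonneg_left ih hθ0
        _ = _ := by ring
  refine squeeze_zero_norm key ?_
  simpa using (tendsto_pow_atTop_nhds_zero_of_lt_one hθ0 hθ1).mul_const ‖z‖

end Profile

/-! ### The local stable manifold of the saddle. -/

namespace Profile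

variable {lam : ℝ} (p : Profile lam)

/-- A box around the saddle `τ` of the planar map, on which the map expands horizontal segments,
and whose left side lies in the disc of radius `τ`. -/
structure Box (R : ℝ) where
  x₁ : ℝ
  x₂ : ℝ
  ε : ℝ
  μ : ℝ
  x₁_pos : 0 < x₁
  x₁_lt : x₁ < p.τ
  lt_x₂ : p.τ < x₂
  ε_pos : 0 < ε
  one_lt_μ : 1 < μ
  μ_le : ∀ z : ℂ, z.re ∈ Icc x₁ x₂ → |z.im| ≤ ε → μ ≤ p.a z
  norm_left : ∀ y, |y| ≤ ε → ‖(⟨x₁, y⟩ : ℂ)‖ < p.τ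
  norm_lt : ∀ z : ℂ, z.re ∈ Icc x₁ x₂ → |z.im| ≤ ε → ‖z‖ < R

/-- At the saddle `a > 1`, and this persists nearby by continuity. The height `ε` is chosen after
the width `δ`, so that the left side stays inside the disc of radius `τ`. -/
theorem nonempty_box {R : ℝ} (hR : p.τ < R) : Nonempty (p.Box R) := by
  have hτ := p.τ_pos
  have hτ0 : (p.τ : ℂ) ≠ 0 := Complex.ofReal_ne_zero.2 hτ.ne'
  have hn : ‖(p.τ : ℂ)‖ = p.τ := by rw [Complex.norm_real, Real.norm_of_nonneg hτ.le]
  have h1 : 1 < p.a p.τ := p.one_lt_a hn.ge (by simpa using hτ.ne')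
  obtain ⟨μ, hμ1, hμ⟩ := exists_between h1
  have hev : ∀ᶠ z : ℂ in 𝓝 (p.τ : ℂ), μ < p.a z ∧ ‖z‖ < R :=
    ((p.continuousAt_a hτ0).eventually_const_lt hμ).and
      (continuous_norm.continuousAt.eventually_lt_const (hn.trans_lt hR))
  obtain ⟨r, hr, hball⟩ := Metric.eventually_nhds_iff_ball.1 hev
  obtain ⟨δ, hδ0, hδ⟩ : ∃ δ > 0, δ < min (r / 2) p.τ :=
    exists_between (lt_min (half_pos hr) hτ)
  have hδr := hδ.trans_le (min_le_left _ _)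
  have hδτ := hδ.trans_le (min_le_right _ _)
  have hleft : ∀ᶠ e : ℝ in 𝓝[>] 0, Real.sqrt ((p.τ - δ) ^ 2 + e ^ 2) < p.τ ∧ e < δ := by
    have hc : Continuous fun e : ℝ => Real.sqrt ((p.τ - δ) ^ 2 + e ^ 2) := by fun_prop
    have h0 : Real.sqrt ((p.τ - δ) ^ 2 + 0 ^ 2) < p.τ := by
      rw [zero_pow two_ne_zero, add_zero, Real.sqrt_sq (by linarith)]
      linarith
    exact ((hc.continuousAt.eventually_lt_const h0).and
      (eventually_lt_nhds hδ0)).filter_mono nhdsWithin_le_nhds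
  obtain ⟨e, ⟨he1, he2⟩, he0⟩ := (hleft.and self_mem_nhdsWithin).exists
  have he0 : 0 < e := he0
  have hmem : ∀ z : ℂ, z.re ∈ Icc (p.τ - δ) (p.τ + δ) → |z.im| ≤ e →
      z ∈ Metric.ball (p.τ : ℂ) r := fun z hz hz' => by
    rw [mem_ball_iff_norm]
    refine (Complex.norm_le_abs_re_add_abs_im _).trans_lt ?_
    have : |(z - p.τ).re| ≤ δ := by
      simp only [Complex.sub_re, Complex.ofReal_re]
      exact abs_le.2 ⟨by linarith [hz.1], by linarith [hz.2]⟩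
    have h2 : |(z - p.τ).im| ≤ e := by simpa using hz'
    linarith
  exact ⟨{
    x₁ := p.τ - δ, x₂ := p.τ + δ, ε := e, μ := μ
    x₁_pos := by linarith
    x₁_lt := by linarith
    lt_x₂ := by linarith
    ε_pos := he0
    one_lt_μ := hμ1
    μ_le := fun z hz hz' => (hball z (hmem z hz hz')).1.le
    norm_left := fun y hy => by
      refine lt_of_le_of_lt ?_ he1
      rw [Complex.norm_def, Complex.normSq_mk]
      apply Real.sqrt_le_sqrt
      have := sq_le_sq' (abs_le.1 hy).1 (abs_le.1 hy).2
      nlinarith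
    norm_lt := fun z hz hz' => (hball z (hmem z hz hz')).2 }⟩

/-- Points of one horizontal line stay at a common height and the map preserves their order. Hence a
point is trapped whenever one to its right is. -/
theorem iterate_re_mono {x x' y : ℝ} (hx' : 0 ≤ x') (h : x' ≤ x) (m : ℕ) :
    0 ≤ (p.map^[m] ⟨x', y⟩).re ∧ (p.map^[m] ⟨x', y⟩).re ≤ (p.map^[m] ⟨x, y⟩).re := by
  induction m with
  | zero => exact ⟨hx', h⟩
  | succ m ih =>
    rw [Function.iterate_succ_apply', Function.iterate_succ_apply']
    refine ⟨mul_nonneg (p.κ_norm_pos _).le ih.1, ?_⟩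
    have him : (p.map^[m] ⟨x', y⟩).im = (p.map^[m] ⟨x, y⟩).im := by
      rw [p.map_iterate_im, p.map_iterate_im]
    have h2 := (p.strictMono_re (p.map^[m] ⟨x, y⟩).im).monotone ih.2
    have h3 : (⟨(p.map^[m] ⟨x', y⟩).re, (p.map^[m] ⟨x, y⟩).im⟩ : ℂ) = p.map^[m] ⟨x', y⟩ :=
      Complex.ext rfl him.symm
    change (p.map ⟨_, _⟩).re ≤ (p.map ⟨_, _⟩).re at h2
    rwa [h3] at h2

theorem τ_le_iterate_re {z : ℂ} (hz : p.τ ≤ z.re) (m : ℕ) : p.τ ≤ (p.map^[m] z).re := by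
  induction m with
  | zero => exact hz
  | succ m ih =>
    rw [Function.iterate_succ_apply']
    have h0 : 0 ≤ (p.map^[m] z).re := p.τ_pos.le.trans ih
    refine ih.trans (le_mul_of_one_le_left h0 (p.one_le_κ (ih.trans ?_)))
    exact (le_abs_self _).trans (Complex.abs_re_le_norm _)

/-- The points of the right half of a horizontal line whose orbit enters the disc of radius `τ`. -/
def trapped (y : ℝ) : Set ℝ := {x | 0 ≤ x ∧ ∃ m, ‖p.map^[m] ⟨x, y⟩‖ < p.τ}

/-- The right end of the set of trapped points at height `y`. Its graph is the local stable
manifold of the saddle `τ`. -/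
def edge (y : ℝ) : ℝ := sSup (p.trapped y)

variable {p} {x x' y y' : ℝ}

theorem trapped_of_le (h : x ∈ p.trapped y) (h0 : 0 ≤ x') (hx : x' ≤ x) : x' ∈ p.trapped y := by
  obtain ⟨-, m, hm⟩ := h
  refine ⟨h0, m, lt_of_le_of_lt ?_ hm⟩
  have h1 := p.iterate_re_mono h0 hx (y := y) m
  rw [Complex.norm_def, Complex.norm_def]
  apply Real.sqrt_le_sqrt
  rw [Complex.normSq_apply, Complex.normSq_apply, p.map_iterate_im, p.map_iterate_im]
  nlinarith

theorem lt_τ_of_trapped (h : x ∈ p.trapped y) : x < p.τ := by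
  by_contra hx
  obtain ⟨-, m, hm⟩ := h
  have := p.τ_le_iterate_re (z := ⟨x, y⟩) (not_lt.1 hx) m
  have h2 := (le_abs_self _).trans (Complex.abs_re_le_norm (p.map^[m] ⟨x, y⟩))
  linarith

theorem bddAbove_trapped : BddAbove (p.trapped y) := ⟨p.τ, fun _ h => (lt_τ_of_trapped h).le⟩

/-- Being trapped is an open condition in `x`, so the supremum is not attained. -/
theorem edge_notMem : p.edge y ∉ p.trapped y := by
  rintro ⟨h0, m, hm⟩
  have hc : Continuous fun x : ℝ => ‖p.map^[m] ⟨x, y⟩‖ := by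
    have h1 : (fun x : ℝ => ‖p.map^[m] ⟨x, y⟩‖) = fun x : ℝ => ‖p.map^[m] (x + y * Complex.I)‖ := by
      funext x
      rw [Complex.mk_eq_add_mul_I]
    rw [h1]
    have := p.continuous_map.iterate m
    fun_prop
  have hev : ∀ᶠ x in 𝓝[>] p.edge y, ‖p.map^[m] ⟨x, y⟩‖ < p.τ :=
    (hc.continuousAt.eventually_lt_const hm).filter_mono nhdsWithin_le_nhds
  obtain ⟨x, hx, hxe⟩ := (hev.and self_mem_nhdsWithin).exists
  have hxe : p.edge y < x := hxe
  have := le_csSup bddAbove_trapped (show x ∈ p.trapped y from ⟨h0.trans hxe.le, m, hx⟩)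
  exact absurd hxe (not_lt.2 this)

theorem trapped_of_lt_edge (h0 : 0 ≤ x) (h : x < p.edge y) (hne : (p.trapped y).Nonempty) :
    x ∈ p.trapped y := by
  obtain ⟨x', hx', hlt⟩ := exists_lt_of_lt_csSup hne h
  exact trapped_of_le hx' h0 hlt.le

theorem map_mem_trapped (h : x ∈ p.trapped y) : (p.map ⟨x, y⟩).re ∈ p.trapped (lam⁻¹ * y) := by
  obtain ⟨h0, m, hm⟩ := h
  refine ⟨mul_nonneg (p.κ_norm_pos _).le h0, ?_⟩
  have h1 : (⟨(p.map ⟨x, y⟩).re, lam⁻¹ * y⟩ : ℂ) = p.map ⟨x, y⟩ := rfl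
  rw [h1]
  cases m with
  | zero => exact ⟨0, p.norm_map_lt hm⟩
  | succ m => exact ⟨m, by rwa [Function.iterate_succ_apply] at hm⟩

theorem trapped_of_map (h0 : 0 ≤ x) (h : (p.map ⟨x, y⟩).re ∈ p.trapped (lam⁻¹ * y)) :
    x ∈ p.trapped y := by
  obtain ⟨-, m, hm⟩ := h
  exact ⟨h0, m + 1, by rwa [Function.iterate_succ_apply]⟩

theorem abs_inv_mul_le (p : Profile lam) {e : ℝ} (h : |y| ≤ e) : |lam⁻¹ * y| ≤ e := by
  rw [abs_mul, abs_of_pos (inv_pos.2 p.lam_pos)]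
  have := inv_le_one_of_one_le₀ p.one_lt_lam.le
  nlinarith [abs_nonneg y]

theorem abs_inv_pow_mul_le (p : Profile lam) {e : ℝ} (h : |y| ≤ e) (m : ℕ) :
    |lam⁻¹ ^ m * y| ≤ e := by
  induction m with
  | zero => simpa using h
  | succ m ih => rw [pow_succ', mul_assoc]; exact p.abs_inv_mul_le ih

namespace Box

variable {R : ℝ} (B : p.Box R)

/-- The points of the box. -/
def set : Set ℂ := {z | z.re ∈ Icc B.x₁ B.x₂ ∧ |z.im| ≤ B.ε}

theorem convex_set : Convex ℝ B.set := by
  have h1 : Convex ℝ {z : ℂ | z.re ∈ Icc B.x₁ B.x₂} :=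
    (convex_Icc B.x₁ B.x₂).is_linear_preimage Complex.reLm.isLinear
  have h2 : Convex ℝ {z : ℂ | z.im ∈ Icc (-B.ε) B.ε} :=
    (convex_Icc (-B.ε) B.ε).is_linear_preimage Complex.imLm.isLinear
  have : B.set = {z : ℂ | z.re ∈ Icc B.x₁ B.x₂} ∩ {z : ℂ | z.im ∈ Icc (-B.ε) B.ε} := by
    ext z; simp [set, abs_le]
  rw [this]
  exact h1.inter h2

theorem isCompact_set : IsCompact B.set := by
  refine Metric.isCompact_of_isClosed_isBounded ?_ ?_
  · exact (isClosed_Icc.preimage Complex.continuous_re).inter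
      (isClosed_le (Complex.continuous_im.abs) continuous_const)
  · refine (Metric.isBounded_ball (x := (0 : ℂ)) (r := R)).subset fun z hz => ?_
    simpa using B.norm_lt z hz.1 hz.2

theorem ne_zero {z : ℂ} (hz : z ∈ B.set) : z ≠ 0 := by
  rintro rfl
  have := hz.1.1
  simp at this
  linarith [B.x₁_pos]

theorem mem_trapped (hy : |y| ≤ B.ε) : B.x₁ ∈ p.trapped y :=
  ⟨B.x₁_pos.le, 0, B.norm_left y hy⟩

theorem nonempty_trapped (hy : |y| ≤ B.ε) : (p.trapped y).Nonempty := ⟨_, B.mem_trapped hy⟩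

theorem le_edge (hy : |y| ≤ B.ε) : B.x₁ ≤ p.edge y := le_csSup bddAbove_trapped (B.mem_trapped hy)

theorem edge_pos (hy : |y| ≤ B.ε) : 0 < p.edge y := B.x₁_pos.trans_le (B.le_edge hy)

theorem edge_le_τ (hy : |y| ≤ B.ε) : p.edge y ≤ p.τ :=
  csSup_le (B.nonempty_trapped hy) fun _ h => (lt_τ_of_trapped h).le

theorem edge_mem (hy : |y| ≤ B.ε) : (⟨p.edge y, y⟩ : ℂ) ∈ B.set :=
  ⟨⟨B.le_edge hy, (B.edge_le_τ hy).trans B.lt_x₂.le⟩, hy⟩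

/-- The planar map commutes with `x ↦ -x`, which reduces the left half of the line to the right
half. -/
theorem trapped_of_abs_lt_edge (hy : |y| ≤ B.ε) (h : |x| < p.edge y) :
    ∃ m, ‖p.map^[m] ⟨x, y⟩‖ < p.τ := by
  rcases le_total 0 x with hx | hx
  · rw [abs_of_nonneg hx] at h
    exact (trapped_of_lt_edge hx h (B.nonempty_trapped hy)).2
  · rw [abs_of_nonpos hx] at h
    have hconj : ∀ z w : ℂ, z.re = -w.re → z.im = w.im → ∀ m,
        (p.map^[m] z).re = -(p.map^[m] w).re ∧ (p.map^[m] z).im = (p.map^[m] w).im := by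
      intro z w h1 h2 m
      induction m with
      | zero => exact ⟨h1, h2⟩
      | succ m ih =>
        have hn : ‖p.map^[m] z‖ = ‖p.map^[m] w‖ := by
          rw [Complex.norm_def, Complex.norm_def, Complex.normSq_apply, Complex.normSq_apply,
            ih.1, ih.2]
          ring_nf
        rw [Function.iterate_succ_apply', Function.iterate_succ_apply']
        simp only [map, hn, ih.1, ih.2]
        exact ⟨by ring, trivial⟩
    obtain ⟨m, hm⟩ := (trapped_of_lt_edge (by linarith) h (B.nonempty_trapped hy)).2
    refine ⟨m, ?_⟩
    obtain ⟨c1, c2⟩ := hconj ⟨x, y⟩ ⟨-x, y⟩ (by simp) rfl m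
    have : ‖p.map^[m] ⟨x, y⟩‖ = ‖p.map^[m] ⟨-x, y⟩‖ := by
      rw [Complex.norm_def, Complex.norm_def, Complex.normSq_apply, Complex.normSq_apply, c1, c2]
      ring_nf
    rwa [this]

theorem continuous_mk_right (y : ℝ) : Continuous fun x : ℝ => (⟨x, y⟩ : ℂ) := by
  have : (fun x : ℝ => (⟨x, y⟩ : ℂ)) = fun x : ℝ => (x + y * Complex.I : ℂ) := by
    funext x; rw [Complex.mk_eq_add_mul_I]
  rw [this]; fun_prop

theorem continuous_map_re (p : Profile lam) (y : ℝ) :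
    Continuous fun x : ℝ => (p.map ⟨x, y⟩).re :=
  Complex.continuous_re.comp (p.continuous_map.comp (continuous_mk_right y))

/-- The graph of `edge` is invariant. -/
theorem map_edge (hy : |y| ≤ B.ε) : p.map ⟨p.edge y, y⟩ = ⟨p.edge (lam⁻¹ * y), lam⁻¹ * y⟩ := by
  have hy' := p.abs_inv_mul_le hy
  refine Complex.ext (le_antisymm ?_ ?_) rfl
  -- Trapped points have trapped images, which gives one inequality in the limit. Conversely, if the
  -- image of the edge fell short of the new edge it would be trapped, and then so would the edge
  -- itself.
  · have hle : ∀ᶠ x in 𝓝[<] p.edge y, (p.map ⟨x, y⟩).re ≤ p.edge (lam⁻¹ * y) := by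
      filter_upwards [Ioo_mem_nhdsLT (B.edge_pos hy)] with x hx
      exact le_csSup bddAbove_trapped (map_mem_trapped
        (trapped_of_lt_edge hx.1.le hx.2 (B.nonempty_trapped hy)))
    exact le_of_tendsto ((continuous_map_re p y).continuousAt.tendsto.mono_left
      nhdsWithin_le_nhds) hle
  · by_contra hlt
    refine edge_notMem (p := p) (y := y) (trapped_of_map (B.edge_pos hy).le ?_)
    exact trapped_of_lt_edge (mul_nonneg (p.κ_norm_pos _).le (B.edge_pos hy).le) (not_le.1 hlt)
      (B.nonempty_trapped hy')

theorem iterate_edge (hy : |y| ≤ B.ε) (m : ℕ) :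
    p.map^[m] ⟨p.edge y, y⟩ = ⟨p.edge (lam⁻¹ ^ m * y), lam⁻¹ ^ m * y⟩ := by
  induction m with
  | zero => simp
  | succ m ih =>
    rw [Function.iterate_succ_apply', ih, B.map_edge (p.abs_inv_pow_mul_le hy m), pow_succ',
      mul_assoc]

theorem hasDerivAt_map_re {z : ℂ} (hz : z ≠ 0) (p : Profile lam) :
    HasDerivAt (fun x : ℝ => (p.map ⟨x, z.im⟩).re) (p.a z) z.re := by
  have h1 : HasDerivAt (fun x : ℝ => (x + z.im * Complex.I : ℂ)) 1 z.re :=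
    (Complex.ofRealCLM.hasDerivAt (x := z.re)).add_const _
  have h2 : (z.re + z.im * Complex.I : ℂ) = z := Complex.re_add_im z
  have h3 : HasFDerivAt p.map (p.dmap z) (z.re + z.im * Complex.I : ℂ) := by
    rw [h2]; exact p.hasFDerivAt_map hz
  have h4 := Complex.reCLM.hasFDerivAt.comp_hasDerivAt z.re (h3.comp_hasDerivAt z.re h1)
  have h5 : (Complex.reCLM : ℂ → ℝ) ∘ p.map ∘ (fun x : ℝ => (x + z.im * Complex.I : ℂ)) =
      fun x : ℝ => (p.map ⟨x, z.im⟩).re := by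
    funext x; simp [Complex.mk_eq_add_mul_I]
  rw [h5] at h4
  have h6 : (p.dmap z 1).re = p.a z := by simp [p.dmap_apply]
  rw [← h6]
  exact h4

theorem mul_sub_le {z w : ℂ} (hz : z ∈ B.set) (hw : w ∈ B.set) (him : z.im = w.im)
    (h : z.re ≤ w.re) : B.μ * (w.re - z.re) ≤ (p.map w).re - (p.map z).re := by
  have hmem : ∀ x ∈ Icc z.re w.re, (⟨x, z.im⟩ : ℂ) ∈ B.set := fun x hx =>
    ⟨⟨hz.1.1.trans hx.1, hx.2.trans hw.1.2⟩, hz.2⟩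
  have hd : ∀ x ∈ Icc z.re w.re,
      HasDerivAt (fun x : ℝ => (p.map ⟨x, z.im⟩).re) (p.a ⟨x, z.im⟩) x := fun x hx =>
    hasDerivAt_map_re (z := ⟨x, z.im⟩) (B.ne_zero (hmem x hx)) p
  have := (convex_Icc z.re w.re).mul_sub_le_image_sub_of_le_deriv
    (f := fun x : ℝ => (p.map ⟨x, z.im⟩).re) (C := B.μ)
    (fun x hx => (hd x hx).continuousAt.continuousWithinAt)
    (fun x hx => (hd x (interior_subset hx)).differentiableAt.differentiableWithinAt)
    (fun x hx => by
      rw [(hd x (interior_subset hx)).deriv]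
      exact B.μ_le _ (hmem x (interior_subset hx)).1 (hmem x (interior_subset hx)).2)
    z.re (left_mem_Icc.2 h) w.re (right_mem_Icc.2 h) h
  simpa only [Complex.eta, show (⟨w.re, z.im⟩ : ℂ) = w from Complex.ext rfl him] using this

theorem mul_abs_sub_le {z w : ℂ} (hz : z ∈ B.set) (hw : w ∈ B.set) (him : z.im = w.im) :
    B.μ * |w.re - z.re| ≤ |(p.map w).re - (p.map z).re| := by
  rcases le_total z.re w.re with h | h
  · rw [abs_of_nonneg (sub_nonneg.2 h)]
    exact (B.mul_sub_le hz hw him h).trans (le_abs_self _)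
  · rw [abs_sub_comm, abs_of_nonneg (sub_nonneg.2 h), abs_sub_comm]
    exact (B.mul_sub_le hw hz him.symm h).trans (le_abs_self _)

/-- A point whose orbit stays in the box lies on the local stable manifold. -/
theorem re_eq_edge {z : ℂ} (h : ∀ m, p.map^[m] z ∈ B.set) : z.re = p.edge z.im := by
  have hz : |z.im| ≤ B.ε := (h 0).2
  have hμ0 : 0 < B.μ := zero_lt_one.trans B.one_lt_μ
  -- The horizontal distance to the invariant graph grows by the factor `μ` at each step, but the
  -- width of the box bounds it.
  have key : ∀ m, B.μ ^ m * |z.re - p.edge z.im| ≤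
      |(p.map^[m] z).re - p.edge (lam⁻¹ ^ m * z.im)| := by
    intro m
    induction m with
    | zero => simp
    | succ m ih =>
      have hy := p.abs_inv_pow_mul_le hz m
      have h1 := B.mul_abs_sub_le (B.edge_mem hy) (h m) (p.map_iterate_im m z).symm
      rw [B.map_edge hy, ← mul_assoc, ← pow_succ', ← Function.iterate_succ_apply' p.map m z] at h1
      calc _ = B.μ * (B.μ ^ m * |z.re - p.edge z.im|) := by ring
        _ ≤ _ := mul_le_mul_of_nonneg_left ih hμ0.le
        _ ≤ _ := h1
  by_contra hne
  have hpos : 0 < |z.re - p.edge z.im| := abs_pos.2 (sub_ne_zero.2 hne)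
  obtain ⟨m, hm⟩ := pow_unbounded_of_one_lt ((B.x₂ - B.x₁) / |z.re - p.edge z.im|) B.one_lt_μ
  rw [div_lt_iff₀ hpos] at hm
  have h2 := (B.edge_mem (p.abs_inv_pow_mul_le hz m)).1
  have h3 := (h m).1
  have h4 : |(p.map^[m] z).re - p.edge (lam⁻¹ ^ m * z.im)| ≤ B.x₂ - B.x₁ :=
    abs_le.2 ⟨by linarith [h2.2, h3.1], by linarith [h2.1, h3.2]⟩
  linarith [key m]

theorem edge_zero (B : p.Box R) : p.edge 0 = p.τ := by
  have hmap : p.map p.τ = p.τ := by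
    apply Complex.ext <;> simp [map, abs_of_pos p.τ_pos, p.κ_τ]
  have h : ∀ m, p.map^[m] (p.τ : ℂ) ∈ B.set := fun m => by
    rw [Function.iterate_fixed hmap]
    refine ⟨?_, by simpa using B.ε_pos.le⟩
    simpa using ⟨B.x₁_lt.le, B.lt_x₂.le⟩
  have := B.re_eq_edge h
  simpa using this.symm

/-- Points to the right of the local stable manifold have backward orbits in the box. -/
theorem exists_backward (hy : |y| ≤ B.ε) (i : ℕ) {x : ℝ} (hx : p.edge (lam⁻¹ ^ i * y) ≤ x)
    (hx₂ : x ≤ B.x₂) : ∃ q, p.edge y ≤ q ∧ q ≤ B.x₂ ∧ B.μ ^ i * (q - p.edge y) ≤ B.x₂ - B.x₁ ∧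
      p.map^[i] ⟨q, y⟩ = ⟨x, lam⁻¹ ^ i * y⟩ ∧ ∀ j ≤ i, p.map^[j] ⟨q, y⟩ ∈ B.set := by
  have hμ0 : 0 < B.μ := zero_lt_one.trans B.one_lt_μ
  induction i generalizing y with
  | zero =>
    simp only [pow_zero, one_mul] at hx ⊢
    refine ⟨x, hx, hx₂, by linarith [B.le_edge hy], rfl, fun j hj => ?_⟩
    obtain rfl : j = 0 := Nat.le_zero.1 hj
    exact ⟨⟨(B.le_edge hy).trans hx, hx₂⟩, hy⟩
  | succ i ih =>
    have hy' := p.abs_inv_mul_le hy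
    obtain ⟨q', h1, h2, h3, h4, h5⟩ := ih hy' (by rwa [← mul_assoc, ← pow_succ])
    have hx₂' : B.x₂ ≤ (p.map ⟨B.x₂, y⟩).re := by
      refine le_mul_of_one_le_left (p.τ_pos.trans B.lt_x₂).le (p.one_le_κ ?_)
      exact B.lt_x₂.le.trans ((le_abs_self _).trans (Complex.abs_re_le_norm (⟨B.x₂, y⟩ : ℂ)))
    have hedge := congr_arg Complex.re (B.map_edge hy)
    -- The edge goes to the edge and the right side `x₂` does not move to the left, so each point in
    -- between has a preimage on the line above; its distance from the edge shrinks by `μ`.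
    obtain ⟨q, hq, hqq⟩ := intermediate_value_Icc ((B.edge_le_τ hy).trans B.lt_x₂.le)
      (continuous_map_re p y).continuousOn
      (show q' ∈ Icc (p.map ⟨p.edge y, y⟩).re (p.map ⟨B.x₂, y⟩).re from
        ⟨hedge.trans_le h1, h2.trans hx₂'⟩)
    have hqB : (⟨q, y⟩ : ℂ) ∈ B.set := ⟨⟨(B.le_edge hy).trans hq.1, hq.2⟩, hy⟩
    have hstep : p.map ⟨q, y⟩ = ⟨q', lam⁻¹ * y⟩ := Complex.ext hqq rfl
    refine ⟨q, hq.1, hq.2, ?_, ?_, ?_⟩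
    · have := B.mul_sub_le (B.edge_mem hy) hqB rfl hq.1
      rw [hedge, hstep] at this
      simp only at this
      calc _ = B.μ ^ i * (B.μ * (q - p.edge y)) := by ring
        _ ≤ B.μ ^ i * (q' - p.edge (lam⁻¹ * y)) :=
          mul_le_mul_of_nonneg_left this (pow_nonneg hμ0.le _)
        _ ≤ _ := h3
    · rw [Function.iterate_succ_apply, hstep, h4, ← mul_assoc, ← pow_succ]
    · intro j hj
      cases j with
      | zero => exact hqB
      | succ j =>
        rw [Function.iterate_succ_apply, hstep]
        exact h5 j (Nat.le_of_succ_le_succ hj)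

theorem exists_abs_re_sub_le : ∃ L ≥ 0, ∀ y y' x : ℝ, (⟨x, y⟩ : ℂ) ∈ B.set → (⟨x, y'⟩ : ℂ) ∈ B.set →
    |(p.map ⟨x, y⟩).re - (p.map ⟨x, y'⟩).re| ≤ L * |y - y'| := by
  obtain ⟨L, hL, hb⟩ := p.exists_abs_b_le_const
  refine ⟨L, hL,
    fun y y' x h h' => ?_⟩
  have hd : ∀ t ∈ uIcc y' y, HasDerivWithinAt (fun t : ℝ => (p.map ⟨x, t⟩).re) (p.b ⟨x, t⟩)
      (uIcc y' y) t := fun t ht => by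
    have htB : (⟨x, t⟩ : ℂ) ∈ B.set := ⟨h.1, by
      have h1 := abs_le.1 h.2
      have h2 := abs_le.1 h'.2
      simp only at h1 h2
      rcases mem_uIcc.1 ht with h3 | h3 <;> exact abs_le.2 ⟨by linarith, by linarith⟩⟩
    have h1 : HasDerivAt (fun t : ℝ => (x + t * Complex.I : ℂ)) Complex.I t := by
      simpa using ((Complex.ofRealCLM.hasDerivAt (x := t)).mul_const Complex.I).const_add (x : ℂ)
    have h3 : HasFDerivAt p.map (p.dmap ⟨x, t⟩) (x + t * Complex.I : ℂ) := by
      rw [← Complex.mk_eq_add_mul_I]; exact p.hasFDerivAt_map (B.ne_zero htB)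
    have h4 := Complex.reCLM.hasFDerivAt.comp_hasDerivAt t (h3.comp_hasDerivAt t h1)
    have h5 : (Complex.reCLM : ℂ → ℝ) ∘ p.map ∘ (fun t : ℝ => (x + t * Complex.I : ℂ)) =
        fun t : ℝ => (p.map ⟨x, t⟩).re := by
      funext x; simp [Complex.mk_eq_add_mul_I]
    rw [h5] at h4
    have h6 : (p.dmap ⟨x, t⟩ Complex.I).re = p.b ⟨x, t⟩ := by simp [p.dmap_apply]
    rw [← h6]
    exact h4.hasDerivWithinAt
  have := (convex_uIcc y' y).norm_image_sub_le_of_norm_hasDerivWithin_le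
    (f := fun t : ℝ => (p.map ⟨x, t⟩).re) (C := L) hd (fun t _ => hb _)
    left_mem_uIcc right_mem_uIcc
  rwa [Real.norm_eq_abs, Real.norm_eq_abs] at this

/-- The graph of `edge` is Lipschitz. -/
theorem exists_edge_lipschitz : ∃ C ≥ 0, ∀ y y' : ℝ, |y| ≤ B.ε → |y'| ≤ B.ε →
    |p.edge y - p.edge y'| ≤ C * |y - y'| := by
  obtain ⟨L, hL, hLip⟩ := B.exists_abs_re_sub_le
  have hμ := B.one_lt_μ
  have hμ0 : 0 < B.μ := zero_lt_one.trans hμ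
  have hC : 0 ≤ L / (B.μ - 1) := div_nonneg hL (by linarith)
  -- This constant is the fixed point of `C ↦ (C + L) / μ`, the effect of one backward step on the
  -- Lipschitz constant. Starting from the crude bound by the box width, the remaining error is
  -- divided by `μ` at each step.
  refine ⟨L / (B.μ - 1), hC, ?_⟩
  have key : ∀ m : ℕ, ∀ y y' : ℝ, |y| ≤ B.ε → |y'| ≤ B.ε →
      |p.edge y - p.edge y'| ≤ (B.x₂ - B.x₁) / B.μ ^ m + L / (B.μ - 1) * |y - y'| := by
    intro m
    induction m with
    | zero =>
      intro y y' hy hy'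
      have h1 := (B.edge_mem hy).1
      have h2 := (B.edge_mem hy').1
      have h3 : 0 ≤ L / (B.μ - 1) * |y - y'| := mul_nonneg hC (abs_nonneg _)
      have h4 : |p.edge y - p.edge y'| ≤ B.x₂ - B.x₁ :=
        abs_le.2 ⟨by linarith [h1.1, h2.2], by linarith [h1.2, h2.1]⟩
      rw [pow_zero, div_one]
      linarith
    | succ m ih =>
      intro y y' hy hy'
      have h1 := ih _ _ (p.abs_inv_mul_le hy) (p.abs_inv_mul_le hy')
      have hmem : (⟨p.edge y', y⟩ : ℂ) ∈ B.set := ⟨(B.edge_mem hy').1, hy⟩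
      have h2 := B.mul_abs_sub_le hmem (B.edge_mem hy) rfl
      have h3 := hLip y' y (p.edge y') (B.edge_mem hy') hmem
      rw [B.map_edge hy] at h2
      rw [B.map_edge hy'] at h3
      simp only at h2 h3
      have h4 : |lam⁻¹ * y - lam⁻¹ * y'| ≤ |y - y'| := by
        rw [← mul_sub]; exact p.abs_inv_mul_le le_rfl
      have h5 : B.μ * |p.edge y - p.edge y'| ≤
          (B.x₂ - B.x₁) / B.μ ^ m + L / (B.μ - 1) * |y - y'| + L * |y - y'| := by
        rw [abs_sub_comm y' y] at h3
        have h6 := mul_le_mul_of_nonneg_left h4 hC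
        have h7 := abs_sub_le (p.edge (lam⁻¹ * y)) (p.edge (lam⁻¹ * y')) (p.map ⟨p.edge y', y⟩).re
        linarith
      have h6 : (B.x₂ - B.x₁) / B.μ ^ (m + 1) + L / (B.μ - 1) * |y - y'| =
          ((B.x₂ - B.x₁) / B.μ ^ m + L / (B.μ - 1) * |y - y'| + L * |y - y'|) / B.μ := by
        have : B.μ - 1 ≠ 0 := by linarith
        field_simp
        ring
      rw [h6, le_div_iff₀ hμ0, mul_comm]
      exact h5
  intro y y' hy hy'
  have hlim : Tendsto (fun m : ℕ => (B.x₂ - B.x₁) / B.μ ^ m + L / (B.μ - 1) * |y - y'|) atTop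
      (𝓝 (0 + L / (B.μ - 1) * |y - y'|)) :=
    ((tendsto_const_nhds (x := B.x₂ - B.x₁)).div_atTop
      (tendsto_pow_atTop_atTop_of_one_lt hμ)).add tendsto_const_nhds
  rw [zero_add] at hlim
  exact ge_of_tendsto' hlim fun m => key m y y' hy hy'

theorem continuousOn_edge : ContinuousOn p.edge (Icc (-B.ε) B.ε) := by
  obtain ⟨C, hC, h⟩ := B.exists_edge_lipschitz
  have : LipschitzOnWith (Real.toNNReal C) p.edge (Icc (-B.ε) B.ε) :=
    LipschitzOnWith.of_dist_le_mul fun y hy y' hy' => by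
      rw [Real.dist_eq, Real.dist_eq, Real.coe_toNNReal _ hC]
      exact h y y' (abs_le.2 hy) (abs_le.2 hy')
  exact this.continuousOn

theorem continuousOn_dmap : ContinuousOn p.dmap B.set := by
  intro z hz
  have ha := p.continuousAt_a (B.ne_zero hz)
  have hb := p.continuousAt_b (B.ne_zero hz)
  refine ContinuousAt.continuousWithinAt ?_
  refine ContinuousAt.add ?_ continuousAt_const
  exact ((ContinuousLinearMap.compL ℝ ℂ ℝ ℂ Complex.ofRealCLM).continuous.continuousAt).comp
    ((ha.smul continuousAt_const).add (hb.smul continuousAt_const))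

/-- Uniform differentiability of the planar map on the box. -/
theorem exists_uniform_deriv {c : ℝ} (hc : 0 < c) : ∃ δ > 0, ∀ z ∈ B.set, ∀ w ∈ B.set,
    ‖w - z‖ < δ → ‖p.map w - p.map z - p.dmap z (w - z)‖ ≤ c * ‖w - z‖ := by
  have hu := B.isCompact_set.uniformContinuousOn_of_continuous B.continuousOn_dmap
  obtain ⟨δ, hδ, h⟩ := Metric.uniformContinuousOn_iff.1 hu c hc
  refine ⟨δ, hδ, fun z hz w hw hzw => ?_⟩
  have hseg : segment ℝ z w ⊆ B.set := B.convex_set.segment_subset hz hw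
  refine (convex_segment z w).norm_image_sub_le_of_norm_hasFDerivWithin_le'
    (f' := p.dmap) (fun v hv => (p.hasFDerivAt_map (B.ne_zero (hseg hv))).hasFDerivWithinAt)
    (fun v hv => ?_) (left_mem_segment ℝ z w) (right_mem_segment ℝ z w)
  rw [← dist_eq_norm]
  refine (h v (hseg hv) z hz (lt_of_le_of_lt ?_ hzw)).le
  rw [dist_eq_norm]
  obtain ⟨t, ht, rfl⟩ := (segment_eq_image' ℝ z w ▸ hv : v ∈ _)
  rw [add_sub_cancel_left, norm_smul, Real.norm_of_nonneg ht.1]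
  exact mul_le_of_le_one_left (norm_nonneg _) ht.2

/-- The slope of the local stable manifold is determined by its invariance. -/
theorem hasDerivAt_edge {W : ℝ → ℝ} {M : ℝ} (hW : ∀ y, |y| ≤ B.ε → |W y| ≤ M)
    (hrec : ∀ y, |y| ≤ B.ε → p.a ⟨p.edge y, y⟩ * W y =
      p.b ⟨p.edge y, y⟩ + lam⁻¹ * W (lam⁻¹ * y)) (hy : |y| < B.ε) :
    HasDerivAt p.edge (-W y) y := by
  obtain ⟨C, hC, hLip⟩ := B.exists_edge_lipschitz
  have hμ := B.one_lt_μ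
  have hμ0 : 0 < B.μ := zero_lt_one.trans hμ
  have hl1 : lam⁻¹ ≤ 1 := inv_le_one_of_one_le₀ p.one_lt_lam.le
  have hl0 : 0 < lam⁻¹ := inv_pos.2 p.lam_pos
  rw [hasDerivAt_iff_isLittleO, Asymptotics.isLittleO_iff]
  intro η hη
  -- Chosen such that `(η / 2 + c) / μ = η / 2`: the target precision is stable under one backward
  -- step with linearisation error `c`.
  set c := η / 2 * (B.μ - 1) with hcdef
  have hc : 0 < c := mul_pos (half_pos hη) (by linarith)
  obtain ⟨δ, hδ, hd⟩ := B.exists_uniform_deriv (c := c / (C + 1)) (by positivity)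
  have hdist : ∀ v w, |v| ≤ B.ε → |w| ≤ B.ε →
      ‖(⟨p.edge w, w⟩ - ⟨p.edge v, v⟩ : ℂ)‖ ≤ (C + 1) * |w - v| := by
    intro v w hv hw
    refine (Complex.norm_le_abs_re_add_abs_im _).trans ?_
    have := hLip w v hw hv
    simp only [Complex.sub_re, Complex.sub_im]
    linarith
  -- Since `W` solves the invariance equation, the deviation of the graph from the line of slope
  -- `-W` at `v` is carried to the corresponding deviation at `lam⁻¹ * v`, after expansion by at
  -- least `μ` and up to the linearisation error.
  have hstep : ∀ v w, |v| ≤ B.ε → |w| ≤ B.ε → (C + 1) * |w - v| < δ →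
      B.μ * |p.edge w - p.edge v + (w - v) * W v| ≤
        |p.edge (lam⁻¹ * w) - p.edge (lam⁻¹ * v) + (lam⁻¹ * w - lam⁻¹ * v) * W (lam⁻¹ * v)| +
          c * |w - v| := by
    intro v w hv hw hlt
    have h1 := hdist v w hv hw
    have h2 := hd _ (B.edge_mem hv) _ (B.edge_mem hw) (h1.trans_lt hlt)
    rw [B.map_edge hv, B.map_edge hw, p.dmap_apply] at h2
    have h3 := (Complex.abs_re_le_norm _).trans (h2.trans
      (mul_le_mul_of_nonneg_left h1 (by positivity)))
    have h4 : c / (C + 1) * ((C + 1) * |w - v|) = c * |w - v| := by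
      field_simp
    rw [h4] at h3
    simp only [Complex.sub_re, Complex.sub_im] at h3
    have h5 := B.μ_le _ (B.edge_mem hv).1 (B.edge_mem hv).2
    have h6 : p.a ⟨p.edge v, v⟩ * (p.edge w - p.edge v + (w - v) * W v) =
        (p.edge (lam⁻¹ * w) - p.edge (lam⁻¹ * v) + (lam⁻¹ * w - lam⁻¹ * v) * W (lam⁻¹ * v)) -
        (p.edge (lam⁻¹ * w) - p.edge (lam⁻¹ * v) -
          (p.a ⟨p.edge v, v⟩ * (p.edge w - p.edge v) + p.b ⟨p.edge v, v⟩ * (w - v))) := by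
      linear_combination (w - v) * hrec v hv
    calc _ ≤ p.a ⟨p.edge v, v⟩ * |p.edge w - p.edge v + (w - v) * W v| :=
          mul_le_mul_of_nonneg_right h5 (abs_nonneg _)
      _ = |p.a ⟨p.edge v, v⟩ * (p.edge w - p.edge v + (w - v) * W v)| := by
          rw [abs_mul, abs_of_pos (p.a_pos _)]
      _ ≤ _ := by
          rw [h6]
          exact (abs_sub _ _).trans (by linarith)
  -- The crude bound `C + M` holds at every pair of heights. Applied to the `m`-th images, it
  -- improves by the factor `μ ^ m`.
  have key : ∀ m : ℕ, ∀ v w, |v| ≤ B.ε → |w| ≤ B.ε → (C + 1) * |w - v| < δ →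
      |p.edge w - p.edge v + (w - v) * W v| ≤ ((C + M) / B.μ ^ m + η / 2) * |w - v| := by
    intro m
    induction m with
    | zero =>
      intro v w hv hw _
      rw [pow_zero, div_one]
      refine (abs_add_le _ _).trans ?_
      rw [abs_mul]
      have h1 := hLip w v hw hv
      have h2 := mul_le_mul_of_nonneg_left (hW v hv) (abs_nonneg (w - v))
      have h3 := mul_nonneg hη.le (abs_nonneg (w - v))
      linarith
    | succ m ih =>
      intro v w hv hw hlt
      have hM : 0 ≤ M := (abs_nonneg _).trans (hW v hv)
      have hvw : |lam⁻¹ * w - lam⁻¹ * v| ≤ |w - v| := by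
        rw [← mul_sub]; exact p.abs_inv_mul_le le_rfl
      have h1 := ih _ _ (p.abs_inv_mul_le hv) (p.abs_inv_mul_le hw)
        (lt_of_le_of_lt (mul_le_mul_of_nonneg_left hvw (by linarith)) hlt)
      have h2 := hstep v w hv hw hlt
      have h3 : ((C + M) / B.μ ^ m + η / 2) * |lam⁻¹ * w - lam⁻¹ * v| ≤
          ((C + M) / B.μ ^ m + η / 2) * |w - v| :=
        mul_le_mul_of_nonneg_left hvw (by positivity)
      have h4 : ((C + M) / B.μ ^ (m + 1) + η / 2) * |w - v| =
          (((C + M) / B.μ ^ m + η / 2) * |w - v| + c * |w - v|) / B.μ := by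
        rw [hcdef]
        field_simp
        ring
      rw [h4, le_div_iff₀ hμ0, mul_comm]
      linarith
  have hlim : Tendsto (fun m : ℕ => (C + M) / B.μ ^ m) atTop (𝓝 0) :=
    (tendsto_const_nhds (x := C + M)).div_atTop (tendsto_pow_atTop_atTop_of_one_lt hμ)
  obtain ⟨m, hm⟩ := (hlim.eventually_lt_const (half_pos hη)).exists
  have hev1 : ∀ᶠ w in 𝓝 y, |w| < B.ε := continuous_abs.continuousAt.eventually_lt_const hy
  have hev2 : ∀ᶠ w in 𝓝 y, (C + 1) * |w - y| < δ := by
    have : ContinuousAt (fun w => (C + 1) * |w - y|) y := by fun_prop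
    exact this.eventually_lt_const (by simpa using hδ)
  filter_upwards [hev1, hev2] with w hw hw2
  have h1 := key m y w hy.le hw.le hw2
  rw [Real.norm_eq_abs, Real.norm_eq_abs, smul_eq_mul, mul_neg, sub_neg_eq_add]
  exact h1.trans (mul_le_mul_of_nonneg_right (by linarith) (abs_nonneg _))

/-- Points of the local stable manifold converge to the saddle. -/
theorem tendsto_iterate_edge (hy : |y| ≤ B.ε) :
    Tendsto (fun m => p.map^[m] ⟨p.edge y, y⟩) atTop (𝓝 (p.τ : ℂ)) := by
  have h0 : Tendsto (fun m : ℕ => lam⁻¹ ^ m * y) atTop (𝓝 0) := by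
    simpa using (tendsto_pow_atTop_nhds_zero_of_lt_one (inv_nonneg.2 p.lam_pos.le)
      (inv_lt_one_of_one_lt₀ p.one_lt_lam)).mul_const y
  have h1 : Tendsto (fun m : ℕ => p.edge (lam⁻¹ ^ m * y)) atTop (𝓝 (p.edge 0)) := by
    have hc : ContinuousAt p.edge 0 :=
      B.continuousOn_edge.continuousAt (Icc_mem_nhds (neg_lt_zero.2 B.ε_pos) B.ε_pos)
    exact hc.tendsto.comp h0
  rw [B.edge_zero] at h1
  have h2 : (fun m => p.map^[m] ⟨p.edge y, y⟩) =
      fun m => ((p.edge (lam⁻¹ ^ m * y) : ℝ) : ℂ) + ((lam⁻¹ ^ m * y : ℝ) : ℂ) * Complex.I := by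
    funext m
    rw [B.iterate_edge hy, Complex.mk_eq_add_mul_I]
  rw [h2]
  have h3 := ((Complex.continuous_ofReal.tendsto _).comp h1).add
    (((Complex.continuous_ofReal.tendsto _).comp h0).mul_const Complex.I)
  simpa using h3

end Box

end Profile

/-! ### Sheet-preserving lifts through `w ↦ w ^ n`. -/

theorem cpow_mul_of_re_pos {z w : ℂ} (hz : 0 < z.re) (hw : 0 < w.re) (s : ℂ) :
    (z * w) ^ s = z ^ s * w ^ s := by
  have hz0 : z ≠ 0 := by rintro rfl; simp at hz
  have hw0 : w ≠ 0 := by rintro rfl; simp at hw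
  have h1 := abs_lt.1 (Complex.abs_arg_lt_pi_div_two_iff.2 (Or.inl hz))
  have h2 := abs_lt.1 (Complex.abs_arg_lt_pi_div_two_iff.2 (Or.inl hw))
  rw [Complex.cpow_def_of_ne_zero (mul_ne_zero hz0 hw0), Complex.cpow_def_of_ne_zero hz0,
    Complex.cpow_def_of_ne_zero hw0, ← Complex.exp_add,
    (Complex.log_mul_eq_add_log_iff hz0 hw0).2 ⟨by linarith, by linarith⟩, add_mul]

/-- Up to the factor `|z|²` the real part is `A x² + B y²`. So the quotients `g z / z` in the lifts
stay in the right half plane, where principal roots are continuous. -/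
theorem re_div_pos {z : ℂ} (hz : z ≠ 0) {A B : ℝ} (hA : 0 < A) (hB : 0 < B) :
    0 < ((⟨A * z.re, B * z.im⟩ : ℂ) / z).re := by
  have h := Complex.normSq_pos.2 hz
  rw [Complex.div_re, ← add_div]
  refine div_pos ?_ h
  rw [Complex.normSq_apply] at h
  have h1 := mul_nonneg hA.le (mul_self_nonneg z.re)
  have h2 := mul_nonneg hB.le (mul_self_nonneg z.im)
  rcases lt_or_eq_of_le h1 with h3 | h3
  · simp only; linarith
  rcases lt_or_eq_of_le h2 with h4 | h4
  · simp only; linarith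
  · rw [eq_comm, mul_eq_zero, or_iff_right hA.ne'] at h3
    rw [eq_comm, mul_eq_zero, or_iff_right hB.ne'] at h4
    linarith

section SheetLift

variable {n : ℕ} {g h : ℂ → ℂ}

theorem sheetLift_zero (n : ℕ) (g : ℂ → ℂ) : sheetLift n g 0 = 0 := by simp [sheetLift]

/-- Principal powers are multiplicative on the right half plane, as the two arguments add up to less
than `π`. -/
theorem sheetLift_comp (hn : n ≠ 0) (h0 : h 0 = 0) (hh : ∀ z ≠ 0, 0 < (h z / z).re)
    (hg : ∀ z ≠ 0, 0 < (g z / z).re) (w : ℂ) :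
    sheetLift n g (sheetLift n h w) = sheetLift n (fun z => g (h z)) w := by
  rcases eq_or_ne w 0 with rfl | hw
  · simp [sheetLift_zero]
  have hwn : w ^ n ≠ 0 := pow_ne_zero n hw
  have h1 := hh _ hwn
  have h2 : h (w ^ n) ≠ 0 := fun h2 => by simp [h2] at h1
  have h3 := hg _ h2
  rw [sheetLift, sheetLift_pow hn h0]
  simp only [sheetLift]
  rw [mul_assoc, ← cpow_mul_of_re_pos h1 h3, div_mul_div_comm, mul_comm (h _),
    mul_div_mul_right _ _ h2]

theorem norm_sheetLift_pow (hn : n ≠ 0) (h0 : g 0 = 0) (w : ℂ) :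
    ‖sheetLift n g w‖ ^ n = ‖g (w ^ n)‖ := by
  rw [← norm_pow, sheetLift_pow hn h0]

/-- Injectivity of `g` makes the `n`-th powers agree, and then both points are multiplied by the
same nonzero root. -/
theorem sheetLift_injective (hn : n ≠ 0) (h0 : g 0 = 0) (hg : ∀ z ≠ 0, 0 < (g z / z).re)
    (hinj : Function.Injective g) : Function.Injective (sheetLift n g) := by
  intro w w' h
  have h1 : w ^ n = w' ^ n := by
    apply hinj
    rw [← sheetLift_pow hn h0, ← sheetLift_pow hn h0, h]
  rcases eq_or_ne w 0 with rfl | hw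
  · rw [zero_pow hn] at h1
    exact (pow_eq_zero_iff hn |>.1 h1.symm).symm
  · have h2 := hg _ (pow_ne_zero n hw)
    have h3 : g (w ^ n) / w ^ n ≠ 0 := fun h3 => by simp [h3] at h2
    rw [sheetLift, sheetLift, ← h1] at h
    refine mul_right_cancel₀ ?_ h
    rw [Complex.cpow_def_of_ne_zero h3]
    exact Complex.exp_ne_zero _

theorem exists_sheetLift_eq (hn : n ≠ 0) (h0 : g 0 = 0) (hg : ∀ z ≠ 0, 0 < (g z / z).re)
    {w z : ℂ} (hz : g z = w ^ n) : ∃ v, v ^ n = z ∧ sheetLift n g v = w := by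
  rcases eq_or_ne z 0 with rfl | hz0
  · rw [h0] at hz
    obtain rfl := (pow_eq_zero_iff hn).1 hz.symm
    exact ⟨0, zero_pow hn, sheetLift_zero n g⟩
  · have h2 := hg _ hz0
    have h3 : g z / z ≠ 0 := fun h3 => by simp [h3] at h2
    have h4 : (g z / z) ^ ((n : ℂ)⁻¹) ≠ 0 := by
      rw [Complex.cpow_def_of_ne_zero h3]
      exact Complex.exp_ne_zero _
    have h5 : (w / (g z / z) ^ ((n : ℂ)⁻¹)) ^ n = z := by
      rw [div_pow, Complex.cpow_nat_inv_pow _ hn, ← hz]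
      have : g z ≠ 0 := fun h => by simp [h] at h3
      field_simp
    refine ⟨_, h5, ?_⟩
    rw [sheetLift, h5, div_mul_cancel₀ _ h4]

/-- Away from `0` the principal root is continuous; at `0` the norm identity for the lift suffices.
-/
theorem continuous_sheetLift (hn : n ≠ 0) (h0 : g 0 = 0) (hg : ∀ z ≠ 0, 0 < (g z / z).re)
    (hc : Continuous g) : Continuous (sheetLift n g) := by
  rw [continuous_iff_continuousAt]
  intro w
  rcases eq_or_ne w 0 with rfl | hw
  · rw [Metric.continuousAt_iff]
    intro ε hε
    have h1 : ContinuousAt (fun w => ‖g (w ^ n)‖) 0 := by fun_prop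
    have h2 : ∀ᶠ w in 𝓝 (0 : ℂ), ‖g (w ^ n)‖ < ε ^ n :=
      h1.eventually_lt_const (by simpa [hn, h0] using pow_pos hε n)
    obtain ⟨δ, hδ, h3⟩ := Metric.eventually_nhds_iff.1 h2
    refine ⟨δ, hδ, fun {w} hw => ?_⟩
    rw [sheetLift_zero, dist_zero_right]
    have h4 := h3 hw
    rw [← norm_sheetLift_pow hn h0] at h4
    exact lt_of_pow_lt_pow_left₀ n hε.le h4
  · have hwn : w ^ n ≠ 0 := pow_ne_zero n hw
    have h1 : ContinuousAt (fun w => g (w ^ n) / w ^ n) w :=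
      (hc.comp (continuous_pow n)).continuousAt.div (continuous_pow n).continuousAt hwn
    exact continuousAt_id.mul (h1.cpow continuousAt_const (Or.inl (hg _ hwn)))

end SheetLift

/-! ### The planar map relative to the linear one. -/

namespace Profile

variable {lam : ℝ} (p : Profile lam)

theorem map_zero : p.map 0 = 0 := by
  apply Complex.ext <;> simp [map]

theorem re_map_div_pos {z : ℂ} (hz : z ≠ 0) : 0 < (p.map z / z).re :=
  re_div_pos hz (p.κ_norm_pos z) (inv_pos.2 p.lam_pos)

theorem map_eq_stretch {z : ℂ} (hz : p.α ≤ ‖z‖) : p.map z = stretch lam z := by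
  rw [map, p.eq_lam _ hz, stretch]

theorem κ_le_lam {s : ℝ} (hs : 0 ≤ s) : p.κ s ≤ lam := by
  exact (p.mono hs (mem_Ici.2 (hs.trans (le_max_left s p.α))) (le_max_left _ _)).trans
    (p.eq_lam (max s p.α) (le_max_right _ _)).le

/-- The planar map followed by the inverse of the linear map. -/
def sq (z : ℂ) : ℂ := stretch lam⁻¹ (p.map z)

theorem sq_eq (z : ℂ) : p.sq z = ⟨lam⁻¹ * p.κ ‖z‖ * z.re, z.im⟩ := by
  have := p.lam_pos.ne'
  apply Complex.ext <;> simp [sq, stretch, map, mul_assoc, this]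

theorem stretch_sq (z : ℂ) : stretch lam (p.sq z) = p.map z := by
  have := p.lam_pos.ne'
  apply Complex.ext <;> simp [sq, stretch, this]

theorem sq_zero : p.sq 0 = 0 := by
  rw [sq_eq]; apply Complex.ext <;> simp

theorem re_sq_div_pos {z : ℂ} (hz : z ≠ 0) : 0 < (p.sq z / z).re := by
  have := re_div_pos hz (mul_pos (inv_pos.2 p.lam_pos) (p.κ_norm_pos z)) one_pos
  rwa [one_mul, ← sq_eq] at this

theorem sq_injective : Function.Injective p.sq := fun z w h => p.map_injective (by
  rw [← p.stretch_sq, h, p.stretch_sq])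

theorem continuous_stretch (l : ℝ) : Continuous (stretch l) := by
  have : stretch l = fun z : ℂ => ((l * z.re : ℝ) : ℂ) + ((l⁻¹ * z.im : ℝ) : ℂ) * Complex.I := by
    funext z; apply Complex.ext <;> simp [stretch]
  rw [this]; fun_prop

theorem continuous_sq : Continuous p.sq := (continuous_stretch _).comp p.continuous_map

theorem sq_eq_self {z : ℂ} (hz : p.α ≤ ‖z‖) : p.sq z = z := by
  rw [sq, p.map_eq_stretch hz, stretch_inv_stretch p.lam_pos.ne']

theorem norm_sq_le (z : ℂ) : ‖p.sq z‖ ≤ ‖z‖ := by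
  have h1 : lam⁻¹ * p.κ ‖z‖ ≤ 1 := by
    rw [inv_mul_le_iff₀ p.lam_pos, mul_one]
    exact p.κ_le_lam (norm_nonneg z)
  have h0 : 0 ≤ lam⁻¹ * p.κ ‖z‖ := mul_nonneg (inv_nonneg.2 p.lam_pos.le) (p.κ_norm_pos z).le
  have h2 : (lam⁻¹ * p.κ ‖z‖) ^ 2 ≤ 1 := pow_le_one₀ h0 h1
  rw [sq_eq]
  generalize lam⁻¹ * p.κ ‖z‖ = q at h2
  rw [Complex.norm_def, Complex.norm_def]
  apply Real.sqrt_le_sqrt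
  rw [Complex.normSq_mk, Complex.normSq_apply]
  nlinarith [mul_le_mul_of_nonneg_right h2 (sq_nonneg z.re)]

/-- On each horizontal line the map is continuous and equals the identity far out. -/
theorem sq_surjective : Function.Surjective p.sq := by
  intro w
  have hc : Continuous fun x : ℝ => (p.sq ⟨x, w.im⟩).re :=
    Complex.continuous_re.comp (p.continuous_sq.comp (Box.continuous_mk_right w.im))
  have hbig : ∀ x : ℝ, p.α ≤ |x| → (p.sq ⟨x, w.im⟩).re = x := fun x hx => by
    rw [p.sq_eq_self (hx.trans (Complex.abs_re_le_norm (⟨x, w.im⟩ : ℂ)))]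
  have h1 : Tendsto (fun x : ℝ => (p.sq ⟨x, w.im⟩).re) atTop atTop :=
    tendsto_id.congr' ((eventually_ge_atTop p.α).mono fun x hx =>
      (hbig x (hx.trans (le_abs_self x))).symm)
  have h2 : Tendsto (fun x : ℝ => (p.sq ⟨x, w.im⟩).re) atBot atBot :=
    tendsto_id.congr' ((eventually_le_atBot (-p.α)).mono fun x hx =>
      (hbig x (by rw [le_abs]; right; linarith)).symm)
  obtain ⟨x, hx⟩ := hc.surjective h1 h2 w.re
  refine ⟨⟨x, w.im⟩, Complex.ext hx ?_⟩
  rw [sq_eq]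

end Profile

/-! ### The perturbed map is a homeomorphism. -/

variable {S : Type*} [MetricSpace S] [ChartedSpace ℂ S] {X : ConicalSurface S} {φ : LinearPA X}
  (P : Perturbation φ) {σ : S}

namespace Perturbation

theorem β_neg (hσ : σ ∈ X.sing) : P.β σ < 0 := by
  linarith [P.β_lt σ hσ, φ.one_lt_lam]

theorem k_eq_zero (hσ : σ ∈ X.sing) {t : ℝ} (ht : 1 ≤ t) : P.k σ t = 0 := by
  have h1 : ∀ t, 1 < t → P.k σ t = 0 := fun t ht => by
    by_contra h
    linarith [(P.k_support σ hσ h).2]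
  rcases ht.eq_or_lt with rfl | ht
  · have h2 : Tendsto (P.k σ) (𝓝[>] 1) (𝓝 (P.k σ 1)) :=
      (P.k_contDiff σ hσ).continuous.continuousAt.tendsto.mono_left nhdsWithin_le_nhds
    refine tendsto_nhds_unique h2 (tendsto_const_nhds.congr' ?_)
    filter_upwards [self_mem_nhdsWithin] with t ht
    exact (h1 t ht).symm
  · exact h1 t ht

theorem hasDerivAt_profile (hσ : σ ∈ X.sing) (s : ℝ) :
    HasDerivAt (fun s => φ.lam + P.β σ * P.k σ (s / P.α σ))
      (P.β σ * (deriv (P.k σ) (s / P.α σ) / P.α σ)) s := by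
  have h1 : HasDerivAt (P.k σ) (deriv (P.k σ) (s / P.α σ)) (s / P.α σ) :=
    ((P.k_contDiff σ hσ).differentiable (by simp) _).hasDerivAt
  have h2 : HasDerivAt (fun s => s / P.α σ) (1 / P.α σ) s := (hasDerivAt_id s).div_const _
  have h3 := ((h1.comp s h2).const_mul (P.β σ)).const_add φ.lam
  rw [mul_one_div] at h3
  exact h3

/-- The radial profile of the perturbed map at a conical point. -/
def profile (hσ : σ ∈ X.sing) : Profile φ.lam where
  κ s := φ.lam + P.β σ * P.k σ (s / P.α σ)
  α := P.α σ
  one_lt_lam := φ.one_lt_lam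
  α_pos := P.α_pos σ hσ
  contDiff := contDiff_const.add (contDiff_const.mul
    ((P.k_contDiff σ hσ).comp (contDiff_id.div_const _)))
  even := fun s => by simp only [neg_div, P.k_even σ hσ _]
  lipschitz := by
    obtain ⟨C, hC⟩ := P.k_lipschitz σ hσ
    have hd : ∀ s, deriv (fun s => φ.lam + P.β σ * P.k σ (s / P.α σ)) s =
        P.β σ * (deriv (P.k σ) (s / P.α σ) / P.α σ) := fun s => (P.hasDerivAt_profile hσ s).deriv
    have hα := P.α_pos σ hσ
    refine ⟨Real.toNNReal (|P.β σ| * (C * (P.α σ)⁻¹ * (P.α σ)⁻¹)),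
      LipschitzWith.of_dist_le_mul fun s t => ?_⟩
    rw [Real.coe_toNNReal _ (by positivity), hd, hd, Real.dist_eq, Real.dist_eq, ← mul_sub,
      ← sub_div, abs_mul, abs_div, abs_of_pos hα]
    have := hC.dist_le_mul (s / P.α σ) (t / P.α σ)
    rw [Real.dist_eq, Real.dist_eq, ← sub_div, abs_div, abs_of_pos hα] at this
    calc _ ≤ |P.β σ| * (C * (|s - t| / P.α σ) / P.α σ) := by gcongr
      _ = _ := by ring
  pos := by
    rw [zero_div, P.k_zero σ hσ]; linarith [P.lt_β σ hσ]
  lt_one := by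
    rw [zero_div, P.k_zero σ hσ]; linarith [P.β_lt σ hσ]
  mono := fun s hs t ht hst => by
    have hα := P.α_pos σ hσ
    have h1 := P.k_antitone σ hσ (div_nonneg hs hα.le) (div_nonneg ht hα.le)
      (div_le_div_of_nonneg_right hst hα.le)
    have := mul_le_mul_of_nonpos_left h1 (P.β_neg hσ).le
    simp only; linarith
  eq_lam := fun s hs => by
    rw [P.k_eq_zero hσ ((one_le_div (P.α_pos σ hσ)).2 hs), mul_zero, add_zero]
  hyperbolic := fun t ht h => by
    have hα := P.α_pos σ hσ
    rw [(P.hasDerivAt_profile hσ t).deriv]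
    exact mul_ne_zero (P.β_neg hσ).ne (div_ne_zero
      (P.k_hyperbolic σ hσ _ (div_pos ht hα) h) hα.ne')

theorem squeeze_eq (hσ : σ ∈ X.sing) : P.squeeze σ = (P.profile hσ).sq := by
  funext z
  rw [Profile.sq_eq]
  have := φ.lam_pos.ne'
  apply Complex.ext
  · simp only [squeeze, profile]
    field_simp
  · rfl

theorem fixedRadius_eq (hσ : σ ∈ X.sing) : P.fixedRadius σ = (P.profile hσ).τ := by
  set p := P.profile hσ
  have h : {t : ℝ | 0 < t ∧ (φ.lam + P.β σ * P.k σ (t / P.α σ)) * t = t} = {p.τ} := by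
    ext t
    constructor
    · rintro ⟨ht, h⟩
      have h1 : p.κ t = 1 := mul_right_cancel₀ ht.ne' (h.trans (one_mul t).symm)
      rcases lt_trichotomy t p.τ with h2 | h2 | h2
      · exact absurd h1 (p.κ_lt_one ht.le h2).ne
      · exact h2
      · exact absurd h1 (p.one_lt_κ h2).ne'
    · rintro rfl
      refine ⟨p.τ_pos, ?_⟩
      have : p.κ p.τ * p.τ = p.τ := by rw [p.κ_τ, one_mul]
      exact this
  rw [fixedRadius, h, csInf_singleton]

/-- The cone discs are disjoint, so the one picked in the definition of `bump` is the given one. -/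
theorem bump_eq (hσ : σ ∈ X.sing) {x : S} (hx : x ∈ (X.chart σ).source) :
    P.bump x = (X.chart σ).symm (sheetLift (X.n σ) (P.profile hσ).sq (X.chart σ x)) := by
  have h : ∃ σ ∈ X.sing, x ∈ (X.chart σ).source := ⟨σ, hσ, hx⟩
  have h1 : h.choose = σ := by
    by_contra hne
    exact (X.disjoint _ _ h.choose_spec.1 hσ hne).le_bot ⟨h.choose_spec.2, hx⟩
  rw [bump, dif_pos h, h1, P.squeeze_eq hσ]

theorem bump_eq_self {x : S} (hx : ∀ σ ∈ X.sing, x ∈ (X.chart σ).source →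
    P.α σ ≤ ‖X.chart σ x ^ X.n σ‖) : P.bump x = x := by
  by_cases h : ∃ σ ∈ X.sing, x ∈ (X.chart σ).source
  · obtain ⟨σ, hσ, hxσ⟩ := h
    rw [P.bump_eq hσ hxσ, sheetLift, Profile.sq_eq_self _ (hx σ hσ hxσ)]
    rcases eq_or_ne (X.chart σ x) 0 with h0 | h0
    · have := hx σ hσ hxσ
      rw [h0, zero_pow (X.n_pos σ hσ).ne', norm_zero] at this
      exact absurd (P.α_pos σ hσ) (not_lt.2 this)
    · rw [div_self (pow_ne_zero _ h0), Complex.one_cpow, mul_one, (X.chart σ).left_inv hxσ]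
  · rw [bump, dif_neg h]

end Perturbation

namespace ConicalSurface

theorem mem_target (hσ : σ ∈ X.sing) {w : ℂ} :
    w ∈ (X.chart σ).target ↔ ‖w‖ < X.radius σ := by
  rw [X.chart_target σ hσ, mem_ball_zero_iff]

theorem mem_target_of_pow (hσ : σ ∈ X.sing) {w : ℂ}
    (h : ‖w ^ X.n σ‖ < X.radius σ ^ X.n σ) : w ∈ (X.chart σ).target := by
  rw [X.mem_target hσ]
  rw [norm_pow] at h
  exact lt_of_pow_lt_pow_left₀ _ (X.radius_pos σ hσ).le h

theorem norm_pow_lt (hσ : σ ∈ X.sing) {w : ℂ} (h : w ∈ (X.chart σ).target) :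
    ‖w ^ X.n σ‖ < X.radius σ ^ X.n σ := by
  rw [X.mem_target hσ] at h
  rw [norm_pow]
  exact pow_lt_pow_left₀ h (norm_nonneg _) (X.n_pos σ hσ).ne'

theorem chart_symm_zero (hσ : σ ∈ X.sing) : (X.chart σ).symm 0 = σ := by
  rw [← X.chart_center σ hσ, (X.chart σ).left_inv (X.mem_source σ hσ)]

/-- The flat disc of radius `s` around a conical point. -/
def disc (X : ConicalSurface S) (σ : S) (s : ℝ) : Set S :=
  {x ∈ (X.chart σ).source | ‖X.chart σ x ^ X.n σ‖ < s}

/-- The closed flat disc of radius `s` around a conical point. -/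
def closedDisc (X : ConicalSurface S) (σ : S) (s : ℝ) : Set S :=
  {x ∈ (X.chart σ).source | ‖X.chart σ x ^ X.n σ‖ ≤ s}

theorem isOpen_disc (σ : S) (s : ℝ) : IsOpen (X.disc σ s) := by
  have h : ContinuousOn (fun x => ‖X.chart σ x ^ X.n σ‖) (X.chart σ).source :=
    ((X.chart σ).continuousOn.pow _).norm
  exact h.isOpen_inter_preimage (X.chart σ).open_source isOpen_Iio

theorem isCompact_closedDisc (hσ : σ ∈ X.sing) {s : ℝ} (hs : s < X.radius σ ^ X.n σ) :
    IsCompact (X.closedDisc σ s) := by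
  have h1 : IsCompact {w : ℂ | ‖w ^ X.n σ‖ ≤ s} := by
    refine Metric.isCompact_of_isClosed_isBounded
      (isClosed_le (by fun_prop) continuous_const) ?_
    refine (Metric.isBounded_ball (x := (0 : ℂ)) (r := X.radius σ)).subset fun w hw => ?_
    rw [mem_ball_zero_iff, ← X.mem_target hσ]
    exact X.mem_target_of_pow hσ (lt_of_le_of_lt hw hs)
  have hsub : {w : ℂ | ‖w ^ X.n σ‖ ≤ s} ⊆ (X.chart σ).target := fun w hw =>
    X.mem_target_of_pow hσ (lt_of_le_of_lt hw hs)
  have h2 : X.closedDisc σ s = (X.chart σ).symm '' {w : ℂ | ‖w ^ X.n σ‖ ≤ s} := by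
    ext x
    constructor
    · rintro ⟨h1, h2⟩
      exact ⟨_, h2, (X.chart σ).left_inv h1⟩
    · rintro ⟨w, hw, rfl⟩
      refine ⟨(X.chart σ).map_target (hsub hw), ?_⟩
      rw [(X.chart σ).right_inv (hsub hw)]
      exact hw
  rw [h2]
  exact h1.image_of_continuousOn ((X.chart σ).continuousOn_symm.mono hsub)

theorem mem_disc_self (hσ : σ ∈ X.sing) {s : ℝ} (hs : 0 < s) : σ ∈ X.disc σ s := by
  refine ⟨X.mem_source σ hσ, ?_⟩
  rwa [X.chart_center σ hσ, zero_pow (X.n_pos σ hσ).ne', norm_zero]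

end ConicalSurface

namespace Perturbation

theorem bump_mem_source (hσ : σ ∈ X.sing) {x : S} (hx : x ∈ (X.chart σ).source) :
    sheetLift (X.n σ) (P.profile hσ).sq (X.chart σ x) ∈ (X.chart σ).target := by
  have hn := (X.n_pos σ hσ).ne'
  refine X.mem_target_of_pow hσ ?_
  rw [sheetLift_pow hn (Profile.sq_zero _)]
  exact ((P.profile hσ).norm_sq_le _).trans_lt (X.norm_pow_lt hσ ((X.chart σ).map_source hx))

/-- The bump preserves each cone disc, on which it is injective by the sheet lift, and it fixes the
points outside all of them. -/
theorem bump_injective : Function.Injective P.bump := by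
  have hin : ∀ {x y : S}, P.bump x = P.bump y → ∀ σ ∈ X.sing, x ∈ (X.chart σ).source → x = y := by
    intro x y h σ hσ hx
    have hn := (X.n_pos σ hσ).ne'
    have h1 := (X.chart σ).map_target (P.bump_mem_source hσ hx)
    rw [← P.bump_eq hσ hx] at h1
    have hy : y ∈ (X.chart σ).source := by
      by_cases hy : ∃ σ' ∈ X.sing, y ∈ (X.chart σ').source
      · obtain ⟨σ', hσ', hy⟩ := hy
        have h2 := (X.chart σ').map_target (P.bump_mem_source hσ' hy)
        rw [← P.bump_eq hσ' hy] at h2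
        by_contra hne
        have hne' : σ ≠ σ' := by rintro rfl; exact hne hy
        exact (X.disjoint _ _ hσ hσ' hne').le_bot ⟨h1, (show P.bump x ∈ _ from h ▸ h2)⟩
      · rw [h, bump, dif_neg hy] at h1
        exact h1
    rw [P.bump_eq hσ hx, P.bump_eq hσ hy] at h
    exact (X.chart σ).injOn hx hy (sheetLift_injective hn (Profile.sq_zero _)
      (fun z hz => Profile.re_sq_div_pos _ hz) (Profile.sq_injective _)
      ((X.chart σ).symm.injOn (P.bump_mem_source hσ hx) (P.bump_mem_source hσ hy) h))
  intro x y h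
  by_cases hx : ∃ σ ∈ X.sing, x ∈ (X.chart σ).source
  · obtain ⟨σ, hσ, hx⟩ := hx
    exact hin h σ hσ hx
  by_cases hy : ∃ σ ∈ X.sing, y ∈ (X.chart σ).source
  · obtain ⟨σ, hσ, hy⟩ := hy
    exact (hin h.symm σ hσ hy).symm
  · rwa [bump, bump, dif_neg hx, dif_neg hy] at h

theorem bump_surjective : Function.Surjective P.bump := by
  intro y
  by_cases hy : ∃ σ ∈ X.sing, y ∈ (X.chart σ).source
  · obtain ⟨σ, hσ, hy⟩ := hy
    set p := P.profile hσ
    have hn := (X.n_pos σ hσ).ne'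
    obtain ⟨z, hz⟩ := p.sq_surjective (X.chart σ y ^ X.n σ)
    obtain ⟨v, hv, hvw⟩ := exists_sheetLift_eq hn p.sq_zero (fun z hz => p.re_sq_div_pos hz) hz
    have hvt : v ∈ (X.chart σ).target := by
      refine X.mem_target_of_pow hσ ?_
      rw [hv]
      -- The lifted preimage must stay in the cone disc: at radius at least `α` the planar preimage
      -- is the point itself, and below `α` it lies in the disc because `α` is less than the flat
      -- radius.
      by_cases hα : p.α ≤ ‖z‖
      · rw [p.sq_eq_self hα] at hz
        rw [hz]
        exact X.norm_pow_lt hσ ((X.chart σ).map_source hy)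
      · exact (not_le.1 hα).trans (P.α_lt σ hσ)
    refine ⟨(X.chart σ).symm v, ?_⟩
    rw [P.bump_eq hσ ((X.chart σ).map_target hvt), (X.chart σ).right_inv hvt, hvw,
      (X.chart σ).left_inv hy]
  · exact ⟨y, by rw [bump, dif_neg hy]⟩

/-- The bump is the identity near points outside the closed discs of radius `α`. -/
theorem eventually_bump_eq [CompactSpace S] [IsManifold 𝓘(ℂ) 1 S] {x : S}
    (hx : ∀ σ ∈ X.sing, x ∉ X.closedDisc σ (P.α σ)) : ∀ᶠ y in 𝓝 x, P.bump y = y := by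
  have h1 : ∀ᶠ y in 𝓝 x, ∀ σ ∈ X.sing, y ∉ X.closedDisc σ (P.α σ) :=
    (Filter.eventually_all_finite X.finite_sing).2 fun σ hσ =>
      (X.isCompact_closedDisc hσ (P.α_lt σ hσ)).isClosed.isOpen_compl.mem_nhds (hx σ hσ)
  filter_upwards [h1] with y hy
  refine P.bump_eq_self fun σ hσ hys => ?_
  by_contra hlt
  exact hy σ hσ ⟨hys, (not_le.1 hlt).le⟩

/-- A point outside all cone discs is also outside the compact discs of radius `α`, hence has a
neighbourhood on which the bump is the identity. This settles the boundary of the cone discs. -/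
theorem continuous_bump [CompactSpace S] [IsManifold 𝓘(ℂ) 1 S] : Continuous P.bump := by
  rw [continuous_iff_continuousAt]
  intro x
  by_cases hx : ∃ σ ∈ X.sing, x ∈ (X.chart σ).source
  · obtain ⟨σ, hσ, hx⟩ := hx
    set p := P.profile hσ
    have hn := (X.n_pos σ hσ).ne'
    have h1 : P.bump =ᶠ[𝓝 x] fun y =>
        (X.chart σ).symm (sheetLift (X.n σ) p.sq (X.chart σ y)) := by
      filter_upwards [(X.chart σ).open_source.mem_nhds hx] with y hy using P.bump_eq hσ hy
    have h2 := (X.chart σ).continuousAt hx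
    have h3 := (continuous_sheetLift hn p.sq_zero (fun z hz => p.re_sq_div_pos hz)
      p.continuous_sq).continuousAt (x := X.chart σ x)
    have h4 := (X.chart σ).continuousAt_symm (P.bump_mem_source hσ hx)
    exact (ContinuousAt.comp (f := fun y => sheetLift (X.n σ) p.sq (X.chart σ y)) h4
      (h3.comp h2)).congr_of_eventuallyEq h1
  · have h1 := P.eventually_bump_eq (x := x) fun σ hσ hxσ => hx ⟨σ, hσ, hxσ.1⟩
    exact continuousAt_id.congr_of_eventuallyEq h1

section Homeo

variable [CompactSpace S] [IsManifold 𝓘(ℂ) 1 S]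

theorem continuous_f : Continuous P.f := φ.map.continuous.comp P.continuous_bump

theorem injective_f : Function.Injective P.f := φ.map.injective.comp P.bump_injective

theorem surjective_f : Function.Surjective P.f := φ.map.surjective.comp P.bump_surjective

/-- The perturbed map as a homeomorphism. -/
def homeo : S ≃ₜ S :=
  (Equiv.ofBijective P.f ⟨P.injective_f, P.surjective_f⟩).toHomeomorphOfContinuousClosed
    P.continuous_f P.continuous_f.isClosedMap

theorem coe_homeo : ⇑P.homeo = P.f := rfl

end Homeo

theorem f_sing (hσ : σ ∈ X.sing) : P.f σ = σ := by
  rw [f, P.bump_eq hσ (X.mem_source σ hσ), X.chart_center σ hσ, sheetLift_zero,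
    X.chart_symm_zero hσ, φ.fixes σ hσ]

end Perturbation

theorem re_stretch_div_pos {l : ℝ} (hl : 0 < l) {z : ℂ} (hz : z ≠ 0) :
    0 < (stretch l z / z).re := re_div_pos hz hl (inv_pos.2 hl)

theorem stretch_zero (l : ℝ) : stretch l 0 = 0 := by
  apply Complex.ext <;> simp [stretch]

theorem sheetLift_real_mul {n : ℕ} (g : ℂ → ℂ) {s : ℝ} (hs : s ≠ 0) {w : ℂ} {t : ℝ}
    (ht : s ^ n = t) (hg : g (t * w ^ n) = t * g (w ^ n)) :
    sheetLift n g (s * w) = s * sheetLift n g w := by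
  have ht0 : (t : ℂ) ≠ 0 := Complex.ofReal_ne_zero.2 (ht ▸ pow_ne_zero n hs)
  rw [sheetLift, sheetLift, mul_pow, ← Complex.ofReal_pow, ht, hg, mul_div_mul_left _ _ ht0,
    mul_assoc]

/-! ### The perturbed map in cone discs, traps and basins. -/

variable {S : Type*} [MetricSpace S] [ChartedSpace ℂ S] {X : ConicalSurface S} {φ : LinearPA X}
  (P : Perturbation φ) {σ : S}

section Charts

variable [IsManifold 𝓘(ℂ) 1 S]

theorem Dev.of_chart_symm (hσ : σ ∈ X.sing) {α : Type*} [TopologicalSpace α] {h : α → ℂ} {Q : Set α}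
    (hc : ContinuousOn h Q) (hm : ∀ q ∈ Q, h q ∈ (X.chart σ).target ∧ h q ≠ 0) :
    Dev X (fun q => h q ^ X.n σ) (fun q => (X.chart σ).symm (h q)) Q := by
  refine Dev.of_exists ((X.chart σ).continuousOn_symm.comp hc fun q hq => (hm q hq).1)
    fun q hq => ⟨?_, _, _, (X.chart σ).open_source, (X.chart σ).map_target (hm q hq).1,
      X.chart_form σ hσ, ?_⟩
  · refine X.notMem_sing_of_mem_source hσ ((X.chart σ).map_target (hm q hq).1) fun h0 => ?_
    apply (hm q hq).2
    rw [← (X.chart σ).right_inv (hm q hq).1, h0, X.chart_center σ hσ]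
  · filter_upwards [self_mem_nhdsWithin] with q' hq'
    rw [(X.chart σ).right_inv (hm q hq).1, (X.chart σ).right_inv (hm q' hq').1]

/-- The linear map in a cone disc. -/
theorem LinearPA.map_chart_symm (φ : LinearPA X) (hσ : σ ∈ X.sing) {w : ℂ}
    (hw : w ∈ (X.chart σ).target)
    (h : ‖stretch φ.lam (w ^ X.n σ)‖ < X.radius σ ^ X.n σ) :
    φ.map ((X.chart σ).symm w) =
      (X.chart σ).symm (sheetLift (X.n σ) (stretch φ.lam) w) := by
  have hn := (X.n_pos σ hσ).ne'
  rcases eq_or_ne w 0 with rfl | hw0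
  · rw [sheetLift_zero, X.chart_symm_zero hσ, φ.fixes σ hσ]
  set n := X.n σ
  set g := stretch φ.lam
  set v := sheetLift n g w
  have hvn : v ^ n = g (w ^ n) := sheetLift_pow hn (stretch_zero _) w
  have hv : v ∈ (X.chart σ).target := X.mem_target_of_pow hσ (hvn ▸ h)
  have hv0 : v ≠ 0 := by
    intro h0
    rw [h0, zero_pow hn] at hvn
    have := re_stretch_div_pos φ.lam_pos (pow_ne_zero n hw0)
    change 0 < (g (w ^ n) / w ^ n).re at this
    rw [← hvn] at this
    simp at this
  have hr : ∀ t ∈ Ioc (0 : ℝ) 1, 0 < t ^ ((n : ℝ)⁻¹) ∧ t ^ ((n : ℝ)⁻¹) ≤ 1 ∧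
      (t ^ ((n : ℝ)⁻¹)) ^ n = t := fun t ht => ⟨Real.rpow_pos_of_pos ht.1 _,
    Real.rpow_le_one ht.1.le ht.2 (by positivity), Real.rpow_inv_natCast_pow ht.1.le hn⟩
  have hcont : ContinuousOn (fun t : ℝ => ((t ^ ((n : ℝ)⁻¹) : ℝ) : ℂ)) (Ioc 0 1) :=
    Complex.continuous_ofReal.comp_continuousOn
      (ContinuousOn.rpow_const continuousOn_id fun t ht => Or.inl ht.1.ne')
  have hdev : ∀ u : ℂ, u ∈ (X.chart σ).target → u ≠ 0 →
      Dev X (fun t : ℝ => (t : ℂ) * u ^ n)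
        (fun t : ℝ => (X.chart σ).symm ((t ^ ((n : ℝ)⁻¹) : ℝ) * u)) (Ioc 0 1) := by
    intro u hu hu0
    have hcu : ContinuousOn (fun t : ℝ => ((t ^ ((n : ℝ)⁻¹) : ℝ) : ℂ) * u) (Ioc 0 1) :=
      hcont.mul continuousOn_const
    refine (Dev.of_chart_symm hσ hcu fun t ht => ⟨?_, ?_⟩).congr_dev ?_
    · rw [X.mem_target hσ] at hu ⊢
      rw [norm_mul, Complex.norm_real, Real.norm_of_nonneg (hr t ht).1.le]
      exact (mul_le_of_le_one_left (norm_nonneg _) (hr t ht).2.1).trans_lt hu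
    · exact mul_ne_zero (Complex.ofReal_ne_zero.2 (hr t ht).1.ne') hu0
    · intro t ht t' ht'
      have e : ∀ t ∈ Ioc (0 : ℝ) 1, (((t ^ ((n : ℝ)⁻¹) : ℝ) : ℂ) * u) ^ X.n σ = t * u ^ n :=
        fun t ht => by
          rw [mul_pow, ← Complex.ofReal_pow]
          change (((t ^ ((n : ℝ)⁻¹)) ^ n : ℝ) : ℂ) * u ^ n = _
          rw [(hr t ht).2.2]
      rw [e t ht, e t' ht']
  -- The sheet condition on `φ` is only a germ at the conical point. Along the radial path to `w`
  -- both sides have the same development and agree near its start, so they agree at its end.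
  have d1 := (hdev w hw hw0).map_pa φ
  have d2 : Dev X (fun t : ℝ => stretch φ.lam ((t : ℂ) * w ^ n))
      (fun t : ℝ => (X.chart σ).symm ((t ^ ((n : ℝ)⁻¹) : ℝ) * v)) (Ioc 0 1) :=
    (hdev v hv hv0).congr_dev fun t _ t' _ => by
      rw [stretch_real_mul, stretch_real_mul, hvn]
  have hlim : Tendsto (fun t : ℝ => ((t ^ ((n : ℝ)⁻¹) : ℝ) : ℂ) * w) (𝓝[>] 0) (𝓝 0) := by
    have h1 : Tendsto (fun t : ℝ => t ^ ((n : ℝ)⁻¹)) (𝓝[>] 0) (𝓝 0) := by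
      have : ContinuousAt (fun t : ℝ => t ^ ((n : ℝ)⁻¹)) 0 :=
        Real.continuousAt_rpow_const _ _ (Or.inr (by positivity))
      have h2 := this.tendsto
      rw [Real.zero_rpow (by positivity)] at h2
      exact h2.mono_left nhdsWithin_le_nhds
    simpa using ((Complex.continuous_ofReal.tendsto 0).comp h1).mul_const w
  have hsrc : ∀ᶠ w' in 𝓝 (0 : ℂ), φ.map ((X.chart σ).symm w') ∈ (X.chart σ).source := by
    have h0 : (0 : ℂ) ∈ (X.chart σ).target := by
      rw [← X.chart_center σ hσ]; exact (X.chart σ).map_source (X.mem_source σ hσ)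
    have h1 : ContinuousAt (fun w' => φ.map ((X.chart σ).symm w')) 0 :=
      φ.map.continuous.continuousAt.comp ((X.chart σ).continuousAt_symm h0)
    refine h1.eventually ((X.chart σ).open_source.mem_nhds ?_)
    change φ.map ((X.chart σ).symm 0) ∈ (X.chart σ).source
    rw [X.chart_symm_zero hσ, φ.fixes σ hσ]
    exact X.mem_source σ hσ
  obtain ⟨t, ⟨h1, h2⟩, ht⟩ := ((hlim.eventually ((φ.respects_sheets σ hσ).and hsrc)).and
    (Ioc_mem_nhdsGT one_pos)).exists
  have hstart : φ.map ((X.chart σ).symm ((t ^ ((n : ℝ)⁻¹) : ℝ) * w)) =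
      (X.chart σ).symm ((t ^ ((n : ℝ)⁻¹) : ℝ) * v) := by
    rw [sheetLift_real_mul g (hr t ht).1.ne' (hr t ht).2.2 (stretch_real_mul _ _ _)] at h1
    rw [← h1, (X.chart σ).left_inv h2]
  have := Dev.eqOn isPreconnected_Ioc d1 d2 ht hstart (right_mem_Ioc.2 one_pos)
  simpa using this

end Charts

namespace Perturbation

theorem τ_lt_radius (hσ : σ ∈ X.sing) : (P.profile hσ).τ < X.radius σ ^ X.n σ :=
  (P.profile hσ).τ_lt_α.trans (P.α_lt σ hσ)

section Coordinates

variable [IsManifold 𝓘(ℂ) 1 S]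

/-- The perturbed map in a cone disc. -/
theorem f_chart_symm (hσ : σ ∈ X.sing) {w : ℂ} (hw : w ∈ (X.chart σ).target)
    (h : ‖(P.profile hσ).map (w ^ X.n σ)‖ < X.radius σ ^ X.n σ) :
    P.f ((X.chart σ).symm w) =
      (X.chart σ).symm (sheetLift (X.n σ) (P.profile hσ).map w) := by
  set p := P.profile hσ
  have hn := (X.n_pos σ hσ).ne'
  have h1 := (X.chart σ).map_target hw
  have h2 := P.bump_mem_source hσ h1
  rw [(X.chart σ).right_inv hw] at h2
  rw [f, P.bump_eq hσ h1, (X.chart σ).right_inv hw, φ.map_chart_symm hσ h2,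
    sheetLift_comp hn p.sq_zero (fun z hz => p.re_sq_div_pos hz)
      fun z hz => re_stretch_div_pos φ.lam_pos hz]
  · congr 2
    funext z
    exact p.stretch_sq z
  · rw [sheetLift_pow hn p.sq_zero]
    exact (congr_arg norm (p.stretch_sq _)).trans_lt h

theorem f_coord (hσ : σ ∈ X.sing) {x : S} (hx : x ∈ (X.chart σ).source)
    (h : ‖(P.profile hσ).map (X.chart σ x ^ X.n σ)‖ < X.radius σ ^ X.n σ) :
    P.f x ∈ (X.chart σ).source ∧
      X.chart σ (P.f x) ^ X.n σ = (P.profile hσ).map (X.chart σ x ^ X.n σ) := by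
  have hn := (X.n_pos σ hσ).ne'
  have h1 := P.f_chart_symm hσ ((X.chart σ).map_source hx) h
  rw [(X.chart σ).left_inv hx] at h1
  have h3 : sheetLift (X.n σ) (P.profile hσ).map (X.chart σ x) ^ X.n σ = _ :=
    sheetLift_pow hn (Profile.map_zero _) _
  have h2 : sheetLift (X.n σ) (P.profile hσ).map (X.chart σ x) ∈ (X.chart σ).target := by
    refine X.mem_target_of_pow hσ ?_
    rwa [h3]
  rw [h1]
  refine ⟨(X.chart σ).map_target h2, ?_⟩
  rw [(X.chart σ).right_inv h2, h3]

/-- The disc of radius `τ`, which the perturbed map contracts to the conical point. -/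
def trap (hσ : σ ∈ X.sing) : Set S := X.disc σ (P.profile hσ).τ

theorem isOpen_trap (hσ : σ ∈ X.sing) : IsOpen (P.trap hσ) := X.isOpen_disc _ _

theorem f_trap (hσ : σ ∈ X.sing) {x : S} (hx : x ∈ P.trap hσ) : P.f x ∈ P.trap hσ ∧
    X.chart σ (P.f x) ^ X.n σ = (P.profile hσ).map (X.chart σ x ^ X.n σ) := by
  have h1 := (P.profile hσ).norm_map_lt hx.2
  obtain ⟨h2, h3⟩ := P.f_coord hσ hx.1 (h1.trans (P.τ_lt_radius hσ))
  refine ⟨⟨h2, ?_⟩, h3⟩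
  rwa [h3]

theorem iterate_trap (hσ : σ ∈ X.sing) {x : S} (hx : x ∈ P.trap hσ) (m : ℕ) :
    P.f^[m] x ∈ P.trap hσ ∧
    X.chart σ (P.f^[m] x) ^ X.n σ = (P.profile hσ).map^[m] (X.chart σ x ^ X.n σ) := by
  induction m with
  | zero => exact ⟨hx, rfl⟩
  | succ m ih =>
    rw [Function.iterate_succ_apply', Function.iterate_succ_apply', ← ih.2]
    exact P.f_trap hσ ih.1

theorem trap_subset_basin (hσ : σ ∈ X.sing) : P.trap hσ ⊆ P.basin σ := by
  intro x hx
  have hn := (X.n_pos σ hσ).ne'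
  have h1 : Tendsto (fun m => X.chart σ (P.f^[m] x)) atTop (𝓝 0) := by
    rw [Metric.tendsto_atTop]
    intro ε hε
    have h2 := (P.profile hσ).tendsto_iterate_zero hx.2
    obtain ⟨N, hN⟩ := Metric.tendsto_atTop.1 h2 (ε ^ X.n σ) (pow_pos hε _)
    refine ⟨N, fun m hm => ?_⟩
    have h3 := hN m hm
    rw [← (P.iterate_trap hσ hx m).2, dist_zero_right, norm_pow] at h3
    rw [dist_zero_right]
    exact lt_of_pow_lt_pow_left₀ _ hε.le h3
  have h0 : (0 : ℂ) ∈ (X.chart σ).target := by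
    rw [← X.chart_center σ hσ]; exact (X.chart σ).map_source (X.mem_source σ hσ)
  have h2 := ((X.chart σ).continuousAt_symm h0).tendsto.comp h1
  rw [X.chart_symm_zero hσ] at h2
  refine h2.congr fun m => ?_
  exact (X.chart σ).left_inv (P.iterate_trap hσ hx m).1.1

/-- The trap is an open neighbourhood of `σ` contained in the basin, so entering it is the same as
converging to `σ`. This makes basins open and `K` closed. -/
theorem mem_basin_iff (hσ : σ ∈ X.sing) {x : S} :
    x ∈ P.basin σ ↔ ∃ m, P.f^[m] x ∈ P.trap hσ := by
  constructor
  · intro h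
    exact (h.eventually ((P.isOpen_trap hσ).mem_nhds
      (X.mem_disc_self hσ (P.profile hσ).τ_pos))).exists
  · rintro ⟨m, hm⟩
    have h1 : Tendsto (fun k => P.f^[k + m] x) atTop (𝓝 σ) := by
      have := P.trap_subset_basin hσ hm
      simpa only [basin, mem_ofPred_eq, ← Function.iterate_add_apply] using this
    exact (tendsto_add_atTop_iff_nat m).1 h1

theorem f_mem_basin {x : S} : P.f x ∈ P.basin σ ↔ x ∈ P.basin σ := by
  have : (fun m => P.f^[m] (P.f x)) = fun m => P.f^[m + 1] x := by
    funext m; rw [Function.iterate_succ_apply]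
  rw [basin, mem_ofPred_eq, mem_ofPred_eq, this]
  exact tendsto_add_atTop_iff_nat (f := fun m => P.f^[m] x) 1

theorem mem_K {x : S} : x ∈ P.K ↔ ∀ σ ∈ X.sing, x ∉ P.basin σ := by
  simp [K]

theorem f_mem_K {x : S} : P.f x ∈ P.K ↔ x ∈ P.K := by
  simp only [mem_K, f_mem_basin]

theorem notMem_sing_of_mem_K {x : S} (hx : x ∈ P.K) : x ∉ X.sing := fun h =>
  P.mem_K.1 hx x h (P.trap_subset_basin h (X.mem_disc_self h (P.profile h).τ_pos))

theorem f_mem_sing {x : S} : P.f x ∈ X.sing ↔ x ∈ X.sing := by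
  constructor
  · intro h
    have h1 := φ.fixes _ h
    have h2 : P.f (P.f x) = P.f x := P.f_sing h
    have := P.bump_injective (φ.map.injective h2)
    rwa [this] at h
  · intro h
    rwa [P.f_sing h]

theorem iterate_mem_sing {x : S} (m : ℕ) : P.f^[m] x ∈ X.sing ↔ x ∈ X.sing := by
  induction m with
  | zero => rfl
  | succ m ih => rw [Function.iterate_succ_apply', f_mem_sing, ih]

end Coordinates

section Basins

variable [CompactSpace S] [IsManifold 𝓘(ℂ) 1 S]

theorem isOpen_basin (hσ : σ ∈ X.sing) : IsOpen (P.basin σ) := by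
  have : P.basin σ = ⋃ m, P.f^[m] ⁻¹' P.trap hσ := by
    ext x; simp [P.mem_basin_iff hσ]
  rw [this]
  exact isOpen_iUnion fun m => (P.isOpen_trap hσ).preimage (P.continuous_f.iterate m)

theorem isClosed_K : IsClosed P.K :=
  (isOpen_biUnion fun _ hσ => P.isOpen_basin hσ).isClosed_compl

theorem isCompact_K : IsCompact P.K := P.isClosed_K.isCompact

end Basins

/-! ### The differential of `f` in flat coordinates. -/

section Derivative

variable [CompactSpace S] [IsManifold 𝓘(ℂ) 1 S]

theorem f_sub_disc (hσ : σ ∈ X.sing) {x : S} (hx : x ∈ (X.chart σ).source) {V : Set S} {G : S → ℂ}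
    (hV : IsOpen V) (hxV : P.f x ∈ V) (hG : IsPrimitiveOn X.form G V) :
    ∀ᶠ y in 𝓝 x, G (P.f y) - G (P.f x) =
      (P.profile hσ).map (X.chart σ y ^ X.n σ) - (P.profile hσ).map (X.chart σ x ^ X.n σ) := by
  have hn := (X.n_pos σ hσ).ne'
  have hb : ∀ y ∈ (X.chart σ).source, P.bump y ∈ (X.chart σ).source ∧
      X.chart σ (P.bump y) ^ X.n σ = (P.profile hσ).sq (X.chart σ y ^ X.n σ) := fun y hy => by
    have h1 := P.bump_mem_source hσ hy
    rw [P.bump_eq hσ hy]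
    refine ⟨(X.chart σ).map_target h1, ?_⟩
    rw [(X.chart σ).right_inv h1, sheetLift_pow hn (Profile.sq_zero _)]
  have h1 := φ.affine (P.bump x) _ V _ G (X.chart σ).open_source (hb x hx).1 (X.chart_form σ hσ)
    hV hxV hG
  filter_upwards [P.continuous_bump.continuousAt.eventually h1,
    (X.chart σ).open_source.mem_nhds hx] with y hy hys
  rw [f, f, hy, (hb y hys).2, (hb x hx).2, stretch_sub, Profile.stretch_sq, Profile.stretch_sq]

theorem f_sub_out {x : S} (hx : ∀ σ ∈ X.sing, x ∉ X.closedDisc σ (P.α σ)) {U V : Set S}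
    {F G : S → ℂ} (hU : IsOpen U) (hxU : x ∈ U) (hF : IsPrimitiveOn X.form F U)
    (hV : IsOpen V) (hxV : P.f x ∈ V) (hG : IsPrimitiveOn X.form G V) :
    ∀ᶠ y in 𝓝 x, G (P.f y) - G (P.f x) = stretch φ.lam (F y - F x) := by
  have h1 := P.eventually_bump_eq hx
  have hx1 := h1.self_of_nhds
  have h2 := φ.affine x U V F G hU hxU hF hV (by rwa [f, hx1] at hxV) hG
  filter_upwards [h1, h2] with y a1 a2
  rw [f, f, a1, hx1, a2]

theorem HasFlatDerivAt.hasFDerivAt {x : S} {A : ℂ →L[ℝ] ℂ} (h : P.HasFlatDerivAt x A)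
    {e : OpenPartialHomeomorph S ℂ} (hx : x ∈ e.source) (he : IsPrimitiveOn X.form e e.source)
    {V : Set S} {G : S → ℂ} (hV : IsOpen V) (hxV : P.f x ∈ V) (hG : IsPrimitiveOn X.form G V) :
    HasFDerivAt (fun z => G (P.f (e.symm z))) A (e x) := by
  have h1 := h e.source V e G e.open_source hx he hV hxV hG
  have h2 : Tendsto e.symm (𝓝 (e x)) (𝓝 x) := e.tendsto_symm hx
  have h3 := h1.comp_tendsto h2
  rw [hasFDerivAt_iff_isLittleO]
  refine h3.congr' ?_ ?_
  · filter_upwards [e.open_target.mem_nhds (e.map_source hx)] with z hz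
    simp only [Function.comp, e.right_inv hz, e.left_inv hx]
  · filter_upwards [e.open_target.mem_nhds (e.map_source hx)] with z hz
    simp only [Function.comp, e.right_inv hz]

/-- A flat derivative is an ordinary derivative in regular charts at `x` and at `P.f x`, hence
unique. So the choice made in `flatDeriv` is harmless. -/
theorem flatDeriv_eq {x : S} (hx : x ∉ X.sing) {A : ℂ →L[ℝ] ℂ} (h : P.HasFlatDerivAt x A) :
    P.flatDeriv x = A := by
  have hex : ∃ A, P.HasFlatDerivAt x A := ⟨A, h⟩
  obtain ⟨e, h1, -, h3⟩ := X.exists_regular_chart hx univ_mem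
  obtain ⟨e', h1', -, h3'⟩ := X.exists_regular_chart (mt P.f_mem_sing.1 hx) univ_mem
  rw [flatDeriv, dif_pos hex]
  exact (HasFlatDerivAt.hasFDerivAt P hex.choose_spec h1 h3 e'.open_source h1' h3').unique
    (HasFlatDerivAt.hasFDerivAt P h h1 h3 e'.open_source h1' h3')

theorem hasFlatDerivAt_disc (hσ : σ ∈ X.sing) {x : S} (hx : x ∈ (X.chart σ).source) (hxσ : x ≠ σ) :
    P.HasFlatDerivAt x ((P.profile hσ).dmap (X.chart σ x ^ X.n σ)) := by
  intro U V F G hU hxU hF hV hxV hG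
  have h0 : X.chart σ x ^ X.n σ ≠ 0 := pow_ne_zero _ (X.chart_ne_zero hσ hx hxσ)
  have h1 := (hasFDerivAt_iff_isLittleO.1 ((P.profile hσ).hasFDerivAt_map h0)).comp_tendsto
    (((X.chart σ).continuousAt hx).pow (X.n σ))
  have hsub := hF.eventually_sub_eq (X.chart_form σ hσ) hU (X.chart σ).open_source hxU hx
  refine h1.congr' ?_ ?_
  · filter_upwards [P.f_sub_disc hσ hx hV hxV hG, hsub] with y a1 a2
    simp only [Function.comp, a1, a2]
    rfl
  · filter_upwards [hsub] with y a2
    simp only [Function.comp, a2]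
    rfl

/-- The linear stretch as a continuous linear map. -/
def stretchL (l : ℝ) : ℂ →L[ℝ] ℂ :=
  Complex.ofRealCLM.comp (l • Complex.reCLM) + Complex.imCLM.smulRight ((l⁻¹ : ℝ) * Complex.I)

theorem stretchL_apply (l : ℝ) (v : ℂ) : stretchL l v = stretch l v := by
  apply Complex.ext <;> simp [stretchL, stretch, mul_comm]

theorem hasFlatDerivAt_out {x : S} (hx : ∀ σ ∈ X.sing, x ∉ X.closedDisc σ (P.α σ)) :
    P.HasFlatDerivAt x (stretchL φ.lam) := by
  intro U V F G hU hxU hF hV hxV hG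
  refine (Asymptotics.isLittleO_zero _ _).congr' ?_ EventuallyEq.rfl
  filter_upwards [P.f_sub_out hx hU hxU hF hV hxV hG] with y hy
  rw [hy, stretchL_apply, sub_self]

/-- A regular point lies in a cone disc or outside the support of the perturbation. -/
theorem disc_or_out {x : S} (hx : x ∉ X.sing) :
    (∃ σ, ∃ _ : σ ∈ X.sing, x ∈ (X.chart σ).source ∧ x ≠ σ) ∨
      ∀ σ ∈ X.sing, x ∉ X.closedDisc σ (P.α σ) := by
  by_cases h : ∃ σ ∈ X.sing, x ∈ X.closedDisc σ (P.α σ)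
  · obtain ⟨σ, hσ, h⟩ := h
    exact Or.inl ⟨σ, hσ, h.1, fun h => hx (h ▸ hσ)⟩
  · push Not at h
    exact Or.inr h

theorem hasFlatDerivAt {x : S} (hx : x ∉ X.sing) : P.HasFlatDerivAt x (P.flatDeriv x) := by
  rcases P.disc_or_out hx with ⟨σ, hσ, h, h'⟩ | h
  · have := P.hasFlatDerivAt_disc hσ h h'
    rwa [P.flatDeriv_eq hx this]
  · have := P.hasFlatDerivAt_out h
    rwa [P.flatDeriv_eq hx this]

theorem a_disc (hσ : σ ∈ X.sing) {x : S} (hx : x ∈ (X.chart σ).source) (hxσ : x ≠ σ) :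
    P.a x = (P.profile hσ).a (X.chart σ x ^ X.n σ) := by
  rw [a, P.flatDeriv_eq (X.notMem_sing_of_mem_source hσ hx hxσ) (P.hasFlatDerivAt_disc hσ hx hxσ),
    Profile.dmap_apply]
  simp

theorem b_disc (hσ : σ ∈ X.sing) {x : S} (hx : x ∈ (X.chart σ).source) (hxσ : x ≠ σ) :
    P.b x = (P.profile hσ).b (X.chart σ x ^ X.n σ) := by
  rw [b, P.flatDeriv_eq (X.notMem_sing_of_mem_source hσ hx hxσ) (P.hasFlatDerivAt_disc hσ hx hxσ),
    Profile.dmap_apply]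
  simp

theorem notMem_sing_of_out {x : S} (hx : ∀ σ ∈ X.sing, x ∉ X.closedDisc σ (P.α σ)) :
    x ∉ X.sing := fun h => hx x h ⟨X.mem_source x h, by
  rw [X.chart_center x h, zero_pow (X.n_pos x h).ne', norm_zero]
  exact (P.α_pos x h).le⟩

theorem a_out {x : S} (hx : ∀ σ ∈ X.sing, x ∉ X.closedDisc σ (P.α σ)) : P.a x = φ.lam := by
  rw [a, P.flatDeriv_eq (P.notMem_sing_of_out hx) (P.hasFlatDerivAt_out hx), stretchL_apply]
  simp [stretch]

theorem b_out {x : S} (hx : ∀ σ ∈ X.sing, x ∉ X.closedDisc σ (P.α σ)) : P.b x = 0 := by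
  rw [b, P.flatDeriv_eq (P.notMem_sing_of_out hx) (P.hasFlatDerivAt_out hx), stretchL_apply]
  simp [stretch]

/-- The differential is triangular, with constant contraction `lam⁻¹` of heights. This holds both in
the cone discs and outside the support of the perturbation. -/
theorem flatDeriv_apply {x : S} (hx : x ∉ X.sing) (v : ℂ) :
    P.flatDeriv x v = ⟨P.a x * v.re + P.b x * v.im, φ.lam⁻¹ * v.im⟩ := by
  rcases P.disc_or_out hx with ⟨σ, hσ, h, h'⟩ | h
  · rw [P.a_disc hσ h h', P.b_disc hσ h h', P.flatDeriv_eq hx (P.hasFlatDerivAt_disc hσ h h'),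
      Profile.dmap_apply]
  · rw [P.a_out h, P.b_out h, P.flatDeriv_eq hx (P.hasFlatDerivAt_out h), stretchL_apply, stretch,
      zero_mul, add_zero]

theorem a_pos {x : S} (hx : x ∉ X.sing) : 0 < P.a x := by
  rcases P.disc_or_out hx with ⟨σ, hσ, h, h'⟩ | h
  · rw [P.a_disc hσ h h']; exact (P.profile hσ).a_pos _
  · rw [P.a_out h]; exact φ.lam_pos

theorem one_le_a {x : S} (hx : ∀ σ, ∀ hσ : σ ∈ X.sing, x ∉ P.trap hσ) : 1 ≤ P.a x := by
  have hxs : x ∉ X.sing := fun h => hx x h (X.mem_disc_self h (P.profile h).τ_pos)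
  rcases P.disc_or_out hxs with ⟨σ, hσ, h, h'⟩ | h
  · rw [P.a_disc hσ h h']
    refine (P.profile hσ).one_le_a ?_
    by_contra hlt
    exact hx σ hσ ⟨h, not_le.1 hlt⟩
  · rw [P.a_out h]; exact φ.one_lt_lam.le

theorem notMem_trap_of_mem_K {x : S} (hx : x ∈ P.K) (hσ : σ ∈ X.sing) : x ∉ P.trap hσ :=
  fun h => P.mem_K.1 hx σ hσ (P.trap_subset_basin hσ h)

/-- On the vertical axis of a cone disc the map is multiplication by `lam⁻¹`, so points there
converge to `σ`. -/
theorem re_coord_ne_zero (hσ : σ ∈ X.sing) {x : S} (hx : x ∈ (X.chart σ).source)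
    (hK : x ∉ P.basin σ) : (X.chart σ x ^ X.n σ).re ≠ 0 := by
  intro h0
  set p := P.profile hσ
  have hl0 : 0 ≤ φ.lam⁻¹ := inv_nonneg.2 φ.lam_pos.le
  have hl1 : φ.lam⁻¹ < 1 := inv_lt_one_of_one_lt₀ φ.one_lt_lam
  have key : ∀ m, P.f^[m] x ∈ (X.chart σ).source ∧
      (X.chart σ (P.f^[m] x) ^ X.n σ).re = 0 ∧
      ‖X.chart σ (P.f^[m] x) ^ X.n σ‖ ≤ φ.lam⁻¹ ^ m * ‖X.chart σ x ^ X.n σ‖ := by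
    intro m
    induction m with
    | zero => exact ⟨hx, h0, by simp⟩
    | succ m ih =>
      obtain ⟨i1, i2, i3⟩ := ih
      have hmap : ‖p.map (X.chart σ (P.f^[m] x) ^ X.n σ)‖ =
          φ.lam⁻¹ * ‖X.chart σ (P.f^[m] x) ^ X.n σ‖ := by
        have : p.map (X.chart σ (P.f^[m] x) ^ X.n σ) =
            (φ.lam⁻¹ : ℝ) * (X.chart σ (P.f^[m] x) ^ X.n σ) := by
          apply Complex.ext <;> simp [Profile.map, i2]
        rw [this, norm_mul, Complex.norm_real, Real.norm_of_nonneg hl0]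
      have hlt : ‖p.map (X.chart σ (P.f^[m] x) ^ X.n σ)‖ < X.radius σ ^ X.n σ := by
        rw [hmap]
        have := X.norm_pow_lt hσ ((X.chart σ).map_source i1)
        exact (mul_le_of_le_one_left (norm_nonneg _) hl1.le).trans_lt this
      obtain ⟨j1, j2⟩ := P.f_coord hσ i1 hlt
      rw [Function.iterate_succ_apply', j2]
      refine ⟨j1, ?_, ?_⟩
      · simp [Profile.map, i2]
      · rw [hmap, pow_succ']
        calc _ ≤ φ.lam⁻¹ * (φ.lam⁻¹ ^ m * ‖X.chart σ x ^ X.n σ‖) :=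
              mul_le_mul_of_nonneg_left i3 hl0
          _ = _ := by ring
  have hlim := (tendsto_pow_atTop_nhds_zero_of_lt_one hl0 hl1).mul_const ‖X.chart σ x ^ X.n σ‖
  rw [zero_mul] at hlim
  obtain ⟨m, hm⟩ := (hlim.eventually_lt_const p.τ_pos).exists
  exact hK ((P.mem_basin_iff hσ).2 ⟨m, (key m).1, (key m).2.2.trans_lt hm⟩)

/-- A point of `K` in a cone disc has radius at least `τ` and is not on the vertical axis, which is
what the planar estimate needs. -/
theorem one_lt_a {x : S} (hx : x ∈ P.K) : 1 < P.a x := by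
  have hxs := P.notMem_sing_of_mem_K hx
  rcases P.disc_or_out hxs with ⟨σ, hσ, h, h'⟩ | h
  · rw [P.a_disc hσ h h']
    refine (P.profile hσ).one_lt_a ?_ (P.re_coord_ne_zero hσ h (P.mem_K.1 hx σ hσ))
    by_contra hlt
    exact P.notMem_trap_of_mem_K hx hσ ⟨h, not_le.1 hlt⟩
  · rw [P.a_out h]; exact φ.one_lt_lam

theorem eventually_out {x : S} (hx : ∀ σ ∈ X.sing, x ∉ X.closedDisc σ (P.α σ)) :
    ∀ᶠ y in 𝓝 x, ∀ σ ∈ X.sing, y ∉ X.closedDisc σ (P.α σ) :=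
  (Filter.eventually_all_finite X.finite_sing).2 fun σ hσ =>
    (X.isCompact_closedDisc hσ (P.α_lt σ hσ)).isClosed.isOpen_compl.mem_nhds (hx σ hσ)

theorem continuousAt_a {x : S} (hx : x ∉ X.sing) : ContinuousAt P.a x := by
  rcases P.disc_or_out hx with ⟨σ, hσ, h, h'⟩ | h
  · have h0 : X.chart σ x ^ X.n σ ≠ 0 := pow_ne_zero _ (X.chart_ne_zero hσ h h')
    have h1 : ContinuousAt (fun y => (P.profile hσ).a (X.chart σ y ^ X.n σ)) x :=
      ContinuousAt.comp (f := fun y => X.chart σ y ^ X.n σ)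
        ((P.profile hσ).continuousAt_a h0) (((X.chart σ).continuousAt h).pow _)
    refine h1.congr_of_eventuallyEq ?_
    filter_upwards [(X.chart σ).open_source.mem_nhds h, isOpen_ne.mem_nhds h'] with y hy hy'
    exact P.a_disc hσ hy hy'
  · refine (continuousAt_const (y := φ.lam)).congr_of_eventuallyEq ?_
    filter_upwards [P.eventually_out h] with y hy using P.a_out hy

/-- On the invariant set the horizontal expansion is uniform. -/
theorem exists_lt_a_of_mem_K : ∃ μ > 1, ∀ x ∈ P.K, μ ≤ P.a x := by
  rcases P.K.eq_empty_or_nonempty with h | h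
  · exact ⟨2, by norm_num, by simp [h]⟩
  obtain ⟨x, hx, hmin⟩ := P.isCompact_K.exists_isMinOn h
    (f := P.a) fun x hx => (P.continuousAt_a (P.notMem_sing_of_mem_K hx)).continuousWithinAt
  exact ⟨P.a x, P.one_lt_a hx, fun y hy => hmin hy⟩

theorem exists_abs_b_le : ∃ C ≥ 0, ∀ x ∉ X.sing, |P.b x| ≤ C := by
  have h : ∀ σ : S, ∃ C ≥ (0 : ℝ), ∀ hσ : σ ∈ X.sing, ∀ z, |(P.profile hσ).b z| ≤ C := fun σ => by
    by_cases hσ : σ ∈ X.sing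
    · obtain ⟨C, h0, hC⟩ := (P.profile hσ).exists_abs_b_le_const
      exact ⟨C, h0, fun _ => hC⟩
    · exact ⟨0, le_rfl, fun h => (hσ h).elim⟩
  choose C hC0 hC using h
  refine ⟨∑ σ ∈ X.finite_sing.toFinset, C σ, Finset.sum_nonneg fun σ _ => hC0 σ, fun x hx => ?_⟩
  rcases P.disc_or_out hx with ⟨σ, hσ, h, h'⟩ | h
  · rw [P.b_disc hσ h h']
    exact (hC σ hσ _).trans (Finset.single_le_sum (f := C) (fun σ _ => hC0 σ)
      (X.finite_sing.mem_toFinset.2 hσ))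
  · rw [P.b_out h, abs_zero]
    exact Finset.sum_nonneg fun σ _ => hC0 σ

end Derivative

end Perturbation

/-! ### Sectors and stable sets of the saddles. -/

variable {S : Type*} [MetricSpace S] [ChartedSpace ℂ S] {X : ConicalSurface S} {φ : LinearPA X}
  (P : Perturbation φ) {σ : S} {ζ : ℂ} {e : ℝ} {z : ℂ}

/-- The half disc in which the branches of the inverse of `w ↦ w ^ n` are defined. -/
def halfDisc (X : ConicalSurface S) (σ : S) : Set ℂ := {z | 0 < z.re ∧ ‖z‖ < X.radius σ ^ X.n σ}

/-- A branch of the inverse of the flat coordinate at a conical point. -/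
def branch (X : ConicalSurface S) (σ : S) (ζ z : ℂ) : S :=
  (X.chart σ).symm (ζ * z ^ ((X.n σ : ℂ)⁻¹))

/-- `ζ` is the direction of a horizontal ray starting at the conical point `σ`; the ray points to
the right if `e = 1` and to the left if `e = -1`. -/
structure IsSector (X : ConicalSurface S) (σ : S) (ζ : ℂ) (e : ℝ) : Prop where
  mem : σ ∈ X.sing
  sign : e = 1 ∨ e = -1
  pow : ζ ^ X.n σ = e

namespace IsSector

variable (h : IsSector X σ ζ e)

include h

theorem mul_self : e * e = 1 := by
  rcases h.sign with h | h <;> rw [h] <;> norm_num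

theorem abs_eq : |e| = 1 := by
  rcases h.sign with h | h <;> rw [h] <;> norm_num

theorem mul_self' : (e : ℂ) * e = 1 := by
  rw [← Complex.ofReal_mul, h.mul_self, Complex.ofReal_one]

theorem norm_mul (z : ℂ) : ‖(e : ℂ) * z‖ = ‖z‖ := by
  rw [_root_.norm_mul, Complex.norm_real, Real.norm_eq_abs, h.abs_eq, one_mul]

theorem root_pow (z : ℂ) : (ζ * z ^ ((X.n σ : ℂ)⁻¹)) ^ X.n σ = e * z := by
  rw [mul_pow, h.pow, Complex.cpow_nat_inv_pow _ (X.n_pos σ h.mem).ne']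

theorem mem_target (hz : ‖z‖ < X.radius σ ^ X.n σ) :
    ζ * z ^ ((X.n σ : ℂ)⁻¹) ∈ (X.chart σ).target := by
  refine X.mem_target_of_pow h.mem ?_
  rwa [h.root_pow, h.norm_mul]

theorem branch_mem (hz : ‖z‖ < X.radius σ ^ X.n σ) : branch X σ ζ z ∈ (X.chart σ).source :=
  (X.chart σ).map_target (h.mem_target hz)

theorem coord_branch (hz : ‖z‖ < X.radius σ ^ X.n σ) :
    X.chart σ (branch X σ ζ z) ^ X.n σ = e * z := by
  rw [branch, (X.chart σ).right_inv (h.mem_target hz), h.root_pow]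

theorem branch_inj {z' : ℂ} (hz : ‖z‖ < X.radius σ ^ X.n σ) (hz' : ‖z'‖ < X.radius σ ^ X.n σ)
    (heq : branch X σ ζ z = branch X σ ζ z') : z = z' := by
  have h1 := h.coord_branch hz
  rw [heq, h.coord_branch hz'] at h1
  have h2 : (e : ℂ) ≠ 0 := fun h0 => by simpa [h0] using h.mul_self'
  exact (mul_left_cancel₀ h2 h1).symm

section Manifold

variable [IsManifold 𝓘(ℂ) 1 S]

theorem dev_branch : Dev X (fun z => (e : ℂ) * z) (branch X σ ζ) (halfDisc X σ) := by
  have hζ : ζ ≠ 0 := by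
    rintro rfl
    have := h.pow
    rw [zero_pow (X.n_pos σ h.mem).ne'] at this
    simpa [← this] using h.mul_self'
  have hc : ContinuousOn (fun z : ℂ => ζ * z ^ ((X.n σ : ℂ)⁻¹)) (halfDisc X σ) := fun z hz =>
    (continuousAt_const.mul (continuousAt_cpow_const (Or.inl hz.1))).continuousWithinAt
  refine (Dev.of_chart_symm h.mem hc fun z hz => ⟨h.mem_target hz.2, mul_ne_zero hζ ?_⟩).congr_dev ?_
  · have h0 : z ≠ 0 := by
      rintro rfl
      simpa using hz.1
    rw [Complex.cpow_def_of_ne_zero h0]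
    exact Complex.exp_ne_zero _
  · intro z _ z' _
    rw [h.root_pow, h.root_pow]

theorem isOpen_halfDisc : IsOpen (halfDisc X σ) :=
  (isOpen_lt continuous_const Complex.continuous_re).inter (isOpen_lt continuous_norm continuous_const)

theorem continuousAt_branch (hz : z ∈ halfDisc X σ) : ContinuousAt (branch X σ ζ) z :=
  (h.dev_branch.1 z hz).continuousAt (h.isOpen_halfDisc.mem_nhds hz)

theorem image_branch_mem_nhds (hz : z ∈ halfDisc X σ) {N : Set ℂ} (hN : N ∈ 𝓝 z) :
    branch X σ ζ '' N ∈ 𝓝 (branch X σ ζ z) := by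
  have he : ∀ w : ℂ, (e : ℂ) * (e * w) = w := fun w => by
    rw [← mul_assoc, h.mul_self', one_mul]
  have hc : Continuous fun w : ℂ => (e : ℂ) * w := by fun_prop
  have h1 : Dev X id (fun w => branch X σ ζ (e * w)) ((fun w : ℂ => (e : ℂ) * w) ⁻¹' halfDisc X σ) :=
    (h.dev_branch.comp (g := fun w : ℂ => (e : ℂ) * w) hc.continuousOn fun w hw => hw).congr_dev
      fun w _ w' _ => by simp only [Function.comp, he, id]
  have h2 := h1.isOpenMap_at (z := e * z) (N := (fun w : ℂ => (e : ℂ) * w) ⁻¹' N)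
    (hc.continuousAt.preimage_mem_nhds (by
      rw [he]; exact h.isOpen_halfDisc.mem_nhds hz))
    (hc.continuousAt.preimage_mem_nhds (by rwa [he]))
  simp only [he] at h2
  refine mem_of_superset h2 ?_
  rintro _ ⟨w, hw, rfl⟩
  exact ⟨_, hw, rfl⟩

/-- Near a point of the branch, the flat coordinate is an inverse of the branch. -/
theorem eventually_branch_coord (hz : z ∈ halfDisc X σ) {N : Set ℂ} (hN : N ∈ 𝓝 z) :
    ∀ᶠ x in 𝓝 (branch X σ ζ z), x ∈ (X.chart σ).source ∧
      (e : ℂ) * X.chart σ x ^ X.n σ ∈ N ∧ branch X σ ζ (e * X.chart σ x ^ X.n σ) = x := by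
  filter_upwards [h.image_branch_mem_nhds hz (inter_mem hN (h.isOpen_halfDisc.mem_nhds hz))]
  rintro _ ⟨w, ⟨hwN, hw⟩, rfl⟩
  have h1 : (e : ℂ) * X.chart σ (branch X σ ζ w) ^ X.n σ = w := by
    rw [h.coord_branch hw.2, ← mul_assoc, h.mul_self', one_mul]
  rw [h1]
  exact ⟨h.branch_mem hw.2, hwN, rfl⟩

theorem profile_map_mul (hσ : σ ∈ X.sing) (z : ℂ) :
    (P.profile hσ).map (e * z) = e * (P.profile hσ).map z := by
  rcases h.sign with h | h
  · rw [h]; simp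
  · rw [h]; simp [Profile.map_neg]

/-- In a sector the perturbed map is given by the planar map. -/
theorem f_branch (hz : z ∈ halfDisc X σ)
    (hm : ‖(P.profile h.mem).map z‖ < X.radius σ ^ X.n σ) :
    P.f (branch X σ ζ z) = branch X σ ζ ((P.profile h.mem).map z) := by
  set p := P.profile h.mem
  have hz0 : z ≠ 0 := by
    rintro rfl
    simpa using hz.1
  have he0 : (e : ℂ) ≠ 0 := fun h0 => by simpa [h0] using h.mul_self'
  have h1 : p.map ((ζ * z ^ ((X.n σ : ℂ)⁻¹)) ^ X.n σ) = e * p.map z := by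
    rw [h.root_pow, h.profile_map_mul P h.mem]
  rw [branch, P.f_chart_symm h.mem (h.mem_target hz.2) (by rwa [h1, h.norm_mul]), branch,
    sheetLift, h1, h.root_pow, mul_div_mul_left _ _ he0, mul_assoc,
    ← cpow_mul_of_re_pos hz.1 (p.re_map_div_pos hz0), mul_div_cancel₀ _ hz0]

theorem iterate_branch (m : ℕ) (hz : ∀ j ≤ m, (P.profile h.mem).map^[j] z ∈ halfDisc X σ) :
    P.f^[m] (branch X σ ζ z) = branch X σ ζ ((P.profile h.mem).map^[m] z) := by
  induction m with
  | zero => rfl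
  | succ m ih =>
    have h1 := (hz (m + 1) le_rfl).2
    rw [Function.iterate_succ_apply'] at h1
    rw [Function.iterate_succ_apply', ih fun j hj => hz j (hj.trans (Nat.le_succ m)),
      h.f_branch P (hz m (Nat.le_succ m)) h1, Function.iterate_succ_apply']

end Manifold

end IsSector

theorem exists_branch (hσ : σ ∈ X.sing) (he : e = 1 ∨ e = -1) {x : S} (hx : x ∈ (X.chart σ).source)
    (hz : X.chart σ x ^ X.n σ = e * z) (hz0 : z ≠ 0) :
    ∃ ζ, IsSector X σ ζ e ∧ x = branch X σ ζ z := by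
  have hn := (X.n_pos σ hσ).ne'
  have h0 : z ^ ((X.n σ : ℂ)⁻¹) ≠ 0 := by
    rw [Complex.cpow_def_of_ne_zero hz0]
    exact Complex.exp_ne_zero _
  refine ⟨X.chart σ x / z ^ ((X.n σ : ℂ)⁻¹), ⟨hσ, he, ?_⟩, ?_⟩
  · rw [div_pow, Complex.cpow_nat_inv_pow _ hn, hz, mul_div_cancel_right₀ _ hz0]
  · rw [branch, div_mul_cancel₀ _ h0, (X.chart σ).left_inv hx]

namespace Perturbation

/-- The direction of the `j`-th horizontal ray. -/
def dir (X : ConicalSurface S) (σ : S) (j : ℕ) : ℂ :=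
  Complex.exp (j * Real.pi / X.n σ * Complex.I)

theorem dir_pow (hσ : σ ∈ X.sing) (j : ℕ) : dir X σ j ^ X.n σ = (-1) ^ j := by
  have hn : (X.n σ : ℂ) ≠ 0 := Nat.cast_ne_zero.2 (X.n_pos σ hσ).ne'
  rw [dir, ← Complex.exp_nat_mul, ← Complex.exp_pi_mul_I, ← Complex.exp_nat_mul]
  congr 1
  field_simp

theorem isSector_dir (hσ : σ ∈ X.sing) (j : ℕ) : IsSector X σ (dir X σ j) ((-1) ^ j) :=
  ⟨hσ, neg_one_pow_eq_or ℝ j, by rw [dir_pow hσ]; push_cast; rfl⟩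

theorem p_eq (hσ : σ ∈ X.sing) (j : Fin (2 * X.n σ)) :
    P.p σ j = branch X σ (dir X σ j) (P.profile hσ).τ := by
  rw [p, branch, P.fixedRadius_eq hσ, dir, Complex.ofReal_cpow (P.profile hσ).τ_pos.le, mul_comm]
  push_cast
  rfl

/-- A box around the saddle, contained in the cone disc. -/
def box (hσ : σ ∈ X.sing) : (P.profile hσ).Box (X.radius σ ^ X.n σ) :=
  Classical.choice ((P.profile hσ).nonempty_box (P.τ_lt_radius hσ))

theorem box_subset (hσ : σ ∈ X.sing) : (P.box hσ).set ⊆ halfDisc X σ := fun z hz =>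
  ⟨(P.box hσ).x₁_pos.trans_le hz.1.1, (P.box hσ).norm_lt z hz.1 hz.2⟩

theorem τ_mem_halfDisc (hσ : σ ∈ X.sing) : ((P.profile hσ).τ : ℂ) ∈ halfDisc X σ := by
  refine ⟨by simpa using (P.profile hσ).τ_pos, ?_⟩
  rw [Complex.norm_real, Real.norm_of_nonneg (P.profile hσ).τ_pos.le]
  exact P.τ_lt_radius hσ

theorem map_τ (hσ : σ ∈ X.sing) : (P.profile hσ).map (P.profile hσ).τ = (P.profile hσ).τ := by
  apply Complex.ext
  · simp [Profile.map, abs_of_pos (P.profile hσ).τ_pos, (P.profile hσ).κ_τ]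
  · simp [Profile.map]

section Manifold

variable [IsManifold 𝓘(ℂ) 1 S]

theorem f_saddle (h : IsSector X σ ζ e) :
    P.f (branch X σ ζ (P.profile h.mem).τ) = branch X σ ζ (P.profile h.mem).τ := by
  rw [h.f_branch P (P.τ_mem_halfDisc h.mem), P.map_τ]
  rw [P.map_τ]
  exact (P.τ_mem_halfDisc h.mem).2

theorem iterate_edge_branch (h : IsSector X σ ζ e) {y : ℝ} (hy : |y| ≤ (P.box h.mem).ε) (m : ℕ) :
    P.f^[m] (branch X σ ζ ⟨(P.profile h.mem).edge y, y⟩) =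
      branch X σ ζ ⟨(P.profile h.mem).edge (φ.lam⁻¹ ^ m * y), φ.lam⁻¹ ^ m * y⟩ := by
  rw [h.iterate_branch P m, (P.box h.mem).iterate_edge hy]
  intro j _
  rw [(P.box h.mem).iterate_edge hy]
  exact P.box_subset h.mem ((P.box h.mem).edge_mem ((P.profile h.mem).abs_inv_pow_mul_le hy j))

/-- The stable set of a saddle. -/
def stable (P : Perturbation φ) (q : S) : Set S := {x | Tendsto (fun m => P.f^[m] x) atTop (𝓝 q)}

theorem Wss_eq_stable {q : S} (hq : P.f q = q) : P.Wss q = P.stable q := by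
  ext x
  have : ∀ m, P.f^[m] q = q := fun m => Function.iterate_fixed hq m
  simp only [Wss, stable, mem_ofPred_eq, this, dist_comm q]
  exact tendsto_iff_dist_tendsto_zero.symm

theorem iterate_mem_stable {q x : S} (m : ℕ) : P.f^[m] x ∈ P.stable q ↔ x ∈ P.stable q := by
  simp only [stable, mem_ofPred_eq, ← Function.iterate_add_apply]
  exact tendsto_add_atTop_iff_nat (f := fun m => P.f^[m] x) m

theorem edge_mem_stable (h : IsSector X σ ζ e) {y : ℝ} (hy : |y| ≤ (P.box h.mem).ε) :
    branch X σ ζ ⟨(P.profile h.mem).edge y, y⟩ ∈ P.stable (branch X σ ζ (P.profile h.mem).τ) := by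
  have h1 := (h.continuousAt_branch (P.τ_mem_halfDisc h.mem)).tendsto.comp
    ((P.box h.mem).tendsto_iterate_edge hy)
  refine h1.congr fun m => ?_
  rw [P.iterate_edge_branch h hy, Function.comp, (P.box h.mem).iterate_edge hy]

/-- The points of the stable set of a saddle arrive on its local stable manifold. -/
theorem exists_iterate_eq_edge (h : IsSector X σ ζ e) {x : S}
    (hx : x ∈ P.stable (branch X σ ζ (P.profile h.mem).τ)) {η : ℝ} (hη : 0 < η) :
    ∀ᶠ m in atTop, ∃ y, |y| < η ∧ |y| < (P.box h.mem).ε ∧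
      P.f^[m] x = branch X σ ζ ⟨(P.profile h.mem).edge y, y⟩ := by
  set p := P.profile h.mem
  set B := P.box h.mem
  have hτ := P.τ_mem_halfDisc h.mem
  have hN : ∀ᶠ z in 𝓝 (p.τ : ℂ), z ∈ B.set ∧ |z.im| < min η B.ε ∧ ‖p.map z‖ < X.radius σ ^ X.n σ := by
    have h1 : ∀ᶠ z : ℂ in 𝓝 (p.τ : ℂ), z.re ∈ Ioo B.x₁ B.x₂ :=
      Complex.continuous_re.continuousAt.eventually
        (isOpen_Ioo.mem_nhds (by simpa using ⟨B.x₁_lt, B.lt_x₂⟩))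
    have h2 : ∀ᶠ z : ℂ in 𝓝 (p.τ : ℂ), |z.im| < min η B.ε :=
      (Complex.continuous_im.abs.continuousAt (x := (p.τ : ℂ))).eventually_lt_const
        (by simpa using ⟨hη, B.ε_pos⟩)
    have h3 : ∀ᶠ z : ℂ in 𝓝 (p.τ : ℂ), ‖p.map z‖ < X.radius σ ^ X.n σ := by
      refine (p.continuous_map.norm.continuousAt (x := (p.τ : ℂ))).eventually_lt_const ?_
      change ‖p.map p.τ‖ < _
      rw [P.map_τ]
      exact hτ.2
    filter_upwards [h1, h2, h3] with z a1 a2 a3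
    exact ⟨⟨Ioo_subset_Icc_self a1, a2.le.trans (min_le_right _ _)⟩, a2, a3⟩
  obtain ⟨M, hM⟩ := eventually_atTop.1 (hx.eventually (h.eventually_branch_coord hτ hN))
  filter_upwards [eventually_ge_atTop M] with m hm
  -- The sector coordinates of the orbit from time `m` on. They form an orbit of the planar map that
  -- stays in the box, so `re_eq_edge` places its start on the graph.
  set zz : ℕ → ℂ := fun k => (e : ℂ) * X.chart σ (P.f^[m + k] x) ^ X.n σ with hzz
  have hz : ∀ k, zz k ∈ B.set ∧ |(zz k).im| < min η B.ε ∧ ‖p.map (zz k)‖ < X.radius σ ^ X.n σ ∧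
      branch X σ ζ (zz k) = P.f^[m + k] x := fun k => by
    obtain ⟨-, h1, h2⟩ := hM (m + k) (by omega)
    exact ⟨h1.1, h1.2.1, h1.2.2, h2⟩
  have hstep : ∀ k, p.map (zz k) = zz (k + 1) := fun k => by
    obtain ⟨a1, -, a3, a4⟩ := hz k
    obtain ⟨b1, -, b3, b4⟩ := hz (k + 1)
    refine h.branch_inj a3 (P.box_subset h.mem b1).2 ?_
    rw [← h.f_branch P (P.box_subset h.mem a1) a3, a4, b4, ← add_assoc,
      Function.iterate_succ_apply']
  have hit : ∀ k, p.map^[k] (zz 0) = zz k := fun k => by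
    induction k with
    | zero => rfl
    | succ k ih => rw [Function.iterate_succ_apply', ih, hstep]
  have hre := B.re_eq_edge (z := zz 0) fun k => (hit k) ▸ (hz k).1
  obtain ⟨-, a2, -, a4⟩ := hz 0
  refine ⟨(zz 0).im, a2.trans_le (min_le_left _ _), a2.trans_le (min_le_right _ _), ?_⟩
  rw [← hre]
  exact a4.symm

theorem stable_subset_K (h : IsSector X σ ζ e) :
    P.stable (branch X σ ζ (P.profile h.mem).τ) ⊆ P.K := by
  intro x hx
  rw [P.mem_K]
  intro σ' hσ' hb
  have h2 := tendsto_nhds_unique (show Tendsto (fun m => P.f^[m] x) atTop (𝓝 σ') from hb) hx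
  exact h.dev_branch.notMem (P.τ_mem_halfDisc h.mem) (h2 ▸ hσ')

end Manifold

end Perturbation

/-! ### The region between opposite stable manifolds. -/

namespace Profile.Box

variable {lam : ℝ} {p : Profile lam} {R : ℝ} (B : p.Box R)

theorem abs_map_lt_edge {x y : ℝ} (hy : |y| ≤ B.ε) (hx : |x| < p.edge y) :
    |(p.map ⟨x, y⟩).re| < p.edge (lam⁻¹ * y) := by
  have h1 := congr_arg Complex.re (B.map_edge hy)
  simp only at h1
  obtain ⟨h2, h3⟩ := abs_lt.1 hx
  have h4 := p.strictMono_re y h3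
  have h5 := p.strictMono_re y h2
  have h6 : (p.map ⟨-p.edge y, y⟩).re = -(p.map ⟨p.edge y, y⟩).re := by
    have : ‖(⟨-p.edge y, y⟩ : ℂ)‖ = ‖(⟨p.edge y, y⟩ : ℂ)‖ := by
      rw [Complex.norm_def, Complex.norm_def]; simp [Complex.normSq_mk]
    simp [map, this]
  simp only at h4 h5
  rw [h1] at h4 h6
  rw [h6] at h5
  exact abs_lt.2 ⟨h5, h4⟩

theorem norm_lt_of_abs_lt_edge {x y : ℝ} (hy : |y| ≤ B.ε) (hx : |x| ≤ p.edge y) :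
    ‖(⟨x, y⟩ : ℂ)‖ < R := by
  refine lt_of_le_of_lt ?_ (B.norm_lt _ (B.edge_mem hy).1 hy)
  rw [Complex.norm_def, Complex.norm_def]
  apply Real.sqrt_le_sqrt
  rw [Complex.normSq_mk, Complex.normSq_mk]
  have := abs_le.1 hx
  nlinarith

end Profile.Box

namespace Perturbation

variable [IsManifold 𝓘(ℂ) 1 S]

/-- The points between the local stable manifolds of two opposite saddles lie in the basin. -/
theorem mem_basin_of_abs_lt_edge (hσ : σ ∈ X.sing) {x : S} (hx : x ∈ (X.chart σ).source)
    (hy : |(X.chart σ x ^ X.n σ).im| ≤ (P.box hσ).ε)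
    (hlt : |(X.chart σ x ^ X.n σ).re| < (P.profile hσ).edge (X.chart σ x ^ X.n σ).im) :
    x ∈ P.basin σ := by
  set p := P.profile hσ
  set B := P.box hσ
  obtain ⟨M, hM⟩ := B.trapped_of_abs_lt_edge hy hlt
  have key : ∀ m, P.f^[m] x ∈ (X.chart σ).source ∧
      X.chart σ (P.f^[m] x) ^ X.n σ = p.map^[m] (X.chart σ x ^ X.n σ) ∧
      |(p.map^[m] (X.chart σ x ^ X.n σ)).im| ≤ B.ε ∧
      |(p.map^[m] (X.chart σ x ^ X.n σ)).re| < p.edge (p.map^[m] (X.chart σ x ^ X.n σ)).im := by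
    intro m
    induction m with
    | zero => exact ⟨hx, rfl, hy, hlt⟩
    | succ m ih =>
      obtain ⟨h1, h2, h3, h4⟩ := ih
      have h5 : |(p.map (p.map^[m] (X.chart σ x ^ X.n σ))).re| <
          p.edge (p.map (p.map^[m] (X.chart σ x ^ X.n σ))).im := B.abs_map_lt_edge h3 h4
      have h6 : |(p.map (p.map^[m] (X.chart σ x ^ X.n σ))).im| ≤ B.ε := p.abs_inv_mul_le h3
      have h7 := B.norm_lt_of_abs_lt_edge h6 h5.le
      obtain ⟨h8, h9⟩ := P.f_coord hσ h1 (by rw [h2]; exact h7)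
      rw [Function.iterate_succ_apply', Function.iterate_succ_apply', h9, h2]
      exact ⟨h8, rfl, h6, h5⟩
  refine (P.mem_basin_iff hσ).2 ⟨M, (key M).1, ?_⟩
  rw [(key M).2.1]
  exact hM

/-- A point of the cone disc with the coordinate of a point of the local stable manifold lies on
the stable set of a saddle. -/
theorem exists_mem_stable_of_abs_eq_edge (hσ : σ ∈ X.sing) {x : S} (hx : x ∈ (X.chart σ).source)
    (hy : |(X.chart σ x ^ X.n σ).im| ≤ (P.box hσ).ε)
    (heq : |(X.chart σ x ^ X.n σ).re| = (P.profile hσ).edge (X.chart σ x ^ X.n σ).im) :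
    ∃ ζ e, ∃ h : IsSector X σ ζ e, x ∈ P.stable (branch X σ ζ (P.profile h.mem).τ) := by
  set p := P.profile hσ
  set B := P.box hσ
  set w := X.chart σ x ^ X.n σ
  -- The edge is an even function of the height. This is needed when the point lies on the left,
  -- where the sector coordinate is `-w`.
  have hneg : p.edge (-w.im) = p.edge w.im := by
    have h1 : p.trapped (-w.im) = p.trapped w.im := by
      have hconj : ∀ t : ℝ, ∀ m, ‖p.map^[m] ⟨t, -w.im⟩‖ = ‖p.map^[m] ⟨t, w.im⟩‖ := by
        intro t m
        have hc : ∀ z w : ℂ, z.re = w.re → z.im = -w.im → ‖z‖ = ‖w‖ := fun z w h1 h2 => by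
          rw [Complex.norm_def, Complex.norm_def, Complex.normSq_apply, Complex.normSq_apply, h1, h2]
          ring_nf
        suffices (p.map^[m] ⟨t, -w.im⟩).re = (p.map^[m] ⟨t, w.im⟩).re ∧
            (p.map^[m] ⟨t, -w.im⟩).im = -(p.map^[m] ⟨t, w.im⟩).im from hc _ _ this.1 this.2
        induction m with
        | zero => exact ⟨rfl, rfl⟩
        | succ m ih =>
          rw [Function.iterate_succ_apply', Function.iterate_succ_apply']
          simp only [Profile.map, hc _ _ ih.1 ih.2, ih.1, ih.2]
          exact ⟨trivial, by ring⟩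
      ext t
      simp only [Profile.trapped, mem_ofPred_eq, hconj]
    rw [Profile.edge, h1]
    rfl
  obtain ⟨e, he, hew⟩ : ∃ e : ℝ, (e = 1 ∨ e = -1) ∧
      w = e * (⟨p.edge (e * w.im), e * w.im⟩ : ℂ) := by
    rcases abs_choice w.re with h | h
    · refine ⟨1, Or.inl rfl, Complex.ext ?_ ?_⟩
      · simp [← heq, h]
      · simp
    · refine ⟨-1, Or.inr rfl, Complex.ext ?_ ?_⟩
      · simp [hneg, ← heq, h]
      · simp
  have hy' : |e * w.im| ≤ B.ε := by
    rcases he with rfl | rfl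
    · simpa using hy
    · simpa using hy
  obtain ⟨ζ, hs, hxb⟩ := exists_branch hσ he hx hew (by
    intro h0
    have := congr_arg Complex.re h0
    simp only [Complex.zero_re] at this
    exact (B.edge_pos hy').ne' this)
  exact ⟨ζ, e, hs, hxb ▸ P.edge_mem_stable hs hy'⟩

end Perturbation

/-! ### Horizontal paths under `f`. -/

variable {S : Type*} [MetricSpace S] [ChartedSpace ℂ S] {X : ConicalSurface S} {φ : LinearPA X}
  (P : Perturbation φ) {σ : S} {ζ : ℂ} {e : ℝ} {c : ℝ → S} {θ θ' : ℝ → ℝ} {U : Set ℝ}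

/-- A horizontal path with its developed position `e θ` and the speed `θ'`. -/
structure HPath (X : ConicalSurface S) (e : ℝ) (c : ℝ → S) (θ θ' : ℝ → ℝ) (U : Set ℝ) : Prop where
  dev : Dev X (fun t => ((e * θ t : ℝ) : ℂ)) c U
  hasDerivAt : ∀ t ∈ U, HasDerivAt θ (θ' t) t
  continuousOn : ContinuousOn θ' U

theorem HPath.of_line (h : Dev X (line e) c U) : HPath X e c id (fun _ => 1) U :=
  ⟨h.congr_dev fun t _ t' _ => by simp only [line, id]; push_cast; ring,
    fun t _ => hasDerivAt_id t, continuousOn_const⟩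

theorem eventually_sub_eq_of_hasDerivAt {H K g : ℝ → ℝ} {z : ℝ}
    (hH : ∀ᶠ t in 𝓝 z, HasDerivAt H (g t) t) (hK : ∀ᶠ t in 𝓝 z, HasDerivAt K (g t) t) :
    ∀ᶠ t in 𝓝 z, H t - H z = K t - K z := by
  obtain ⟨r, hr, hb⟩ := Metric.eventually_nhds_iff_ball.1 (hH.and hK)
  filter_upwards [Metric.ball_mem_nhds z hr] with t ht
  have := Metric.isOpen_ball.is_const_of_deriv_eq_zero (convex_ball z r).isPreconnected
    (f := fun t => H t - K t)
    (fun t ht => ((hb t ht).1.sub (hb t ht).2).differentiableAt.differentiableWithinAt)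
    (fun t ht => by
      have := ((hb t ht).1.sub (hb t ht).2).deriv
      rw [sub_self] at this
      exact this) ht (Metric.mem_ball_self hr)
  change H t - K t = H z - K z at this
  linarith

section Manifold

variable [CompactSpace S] [IsManifold 𝓘(ℂ) 1 S]

/-- The planar map sends horizontal lines to horizontal lines and stretches them at the rate `a`, so
the new position is the integral of `a θ'`. In each chart the claim reduces to comparing derivatives
of two real functions. -/
theorem HPath.map_f (h : HPath X e c θ θ' U) (hU : IsOpen U) (hU' : U.OrdConnected) {t₀ : ℝ}
    (ht₀ : t₀ ∈ U) (v : ℝ) : ∃ θ₁, θ₁ t₀ = v ∧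
      HPath X e (P.f ∘ c) θ₁ (fun t => P.a (c t) * θ' t) U := by
  set g : ℝ → ℝ := fun t => P.a (c t) * θ' t
  have hca : ∀ t ∈ U, ContinuousAt c t := fun t ht => (h.dev.1 t ht).continuousAt (hU.mem_nhds ht)
  have hg : ContinuousOn g U := fun t ht =>
    (((P.continuousAt_a (h.dev.notMem ht)).comp (hca t ht)).continuousWithinAt).mul
      (h.continuousOn t ht)
  set θ₁ : ℝ → ℝ := fun t => v + ∫ s in t₀..t, g s
  have hθ₁ : ∀ t ∈ U, HasDerivAt θ₁ (g t) t := fun t ht => by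
    refine (intervalIntegral.integral_hasDerivAt_right ?_ ?_ ?_).const_add v
    · exact (hg.mono (hU'.uIcc_subset ht₀ ht)).intervalIntegrable
    · exact hg.stronglyMeasurableAtFilter hU t ht
    · exact (hg t ht).continuousAt (hU.mem_nhds ht)
  have heθ₁ : ∀ t ∈ U, HasDerivAt (fun t => e * θ₁ t) (e * g t) t := fun t ht =>
    (hθ₁ t ht).const_mul e
  refine ⟨θ₁, by simp [θ₁], ⟨?_, hθ₁, hg⟩⟩
  refine ⟨P.continuous_f.comp_continuousOn h.dev.1, fun z hz =>
    ⟨fun hs => h.dev.notMem hz (P.f_mem_sing.1 hs), fun V G hV hcV hG => ?_⟩⟩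
  rw [nhdsWithin_eq_nhds.2 (hU.mem_nhds hz)]
  have hUz := hU.mem_nhds hz
  have hθe : ∀ t ∈ U, HasDerivAt (fun t => e * (θ t - θ z)) (e * θ' t) t := fun t ht =>
    ((h.hasDerivAt t ht).sub_const _).const_mul e
  rcases P.disc_or_out (h.dev.notMem hz) with ⟨σ, hσ, hs, hs'⟩ | hout
  · set p := P.profile hσ
    set w := X.chart σ (c z) ^ X.n σ
    have h1 := (h.dev.2 z hz).2 _ _ (X.chart σ).open_source hs (X.chart_form σ hσ)
    rw [nhdsWithin_eq_nhds.2 hUz] at h1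
    have hx : ∀ t, X.chart σ (c t) ^ X.n σ - X.chart σ (c z) ^ X.n σ =
        ((e * θ t : ℝ) : ℂ) - ((e * θ z : ℝ) : ℂ) →
        X.chart σ (c t) ^ X.n σ = ⟨w.re + e * (θ t - θ z), w.im⟩ := fun t ht => by
      rw [sub_eq_iff_eq_add] at ht
      rw [ht]
      apply Complex.ext
      · simp [w]; ring
      · simp [w]
    have h2 : ∀ᶠ t in 𝓝 z, HasDerivAt
        (fun t => (p.map ⟨w.re + e * (θ t - θ z), w.im⟩).re) (e * g t) t := by
      filter_upwards [h1, hUz, hca z hz ((X.chart σ).open_source.mem_nhds hs),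
        hca z hz (isOpen_ne.mem_nhds hs')] with t a1 a2 a3 a4
      have a5 := hx t a1
      have a6 := X.chart_ne_zero hσ a3 a4
      have b1 := Profile.Box.hasDerivAt_map_re (pow_ne_zero (X.n σ) a6) p
      rw [a5] at b1
      have b2 := HasDerivAt.comp t b1 ((hθe t a2).const_add w.re)
      have b3 : e * g t = p.a ⟨w.re + e * (θ t - θ z), w.im⟩ * (e * θ' t) := by
        simp only [g]
        rw [P.a_disc hσ a3 a4, a5]
        ring
      rw [b3]
      exact b2
    filter_upwards [eventually_sub_eq_of_hasDerivAt h2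
      (Filter.eventually_of_mem hUz heθ₁), h1,
      (hca z hz).eventually (P.f_sub_disc hσ hs hV hcV hG)] with t a1 a2 a3
    simp only [Function.comp]
    rw [a3, hx t a2]
    have hw : w = ⟨w.re + e * (θ z - θ z), w.im⟩ := by simp
    change _ - p.map w = _
    apply Complex.ext
    · have : (p.map w).re = (p.map ⟨w.re + e * (θ z - θ z), w.im⟩).re := by rw [← hw]
      simp only [Complex.sub_re, Complex.ofReal_re, this]
      exact a1
    · simp [Profile.map]
  · obtain ⟨E, hE1, -, hE3⟩ := X.exists_regular_chart (h.dev.notMem hz) univ_mem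
    have h1 := (h.dev.2 z hz).2 _ _ E.open_source hE1 hE3
    rw [nhdsWithin_eq_nhds.2 hUz] at h1
    have h2 : ∀ᶠ t in 𝓝 z, HasDerivAt (fun t => φ.lam * (e * (θ t - θ z))) (e * g t) t := by
      filter_upwards [hUz, (hca z hz).eventually (P.eventually_out hout)] with t a1 a2
      have b3 : e * g t = φ.lam * (e * θ' t) := by
        simp only [g]
        rw [P.a_out a2]
        ring
      rw [b3]
      exact (hθe t a1).const_mul _
    filter_upwards [eventually_sub_eq_of_hasDerivAt h2
      (Filter.eventually_of_mem hUz heθ₁), h1,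
      (hca z hz).eventually (P.f_sub_out hout E.open_source hE1 hE3 hV hcV hG)] with t a1 a2 a3
    simp only [Function.comp]
    rw [a3, a2, ← Complex.ofReal_sub, stretch_ofReal, ← Complex.ofReal_mul, ← Complex.ofReal_sub]
    congr 1
    simp only [sub_self, mul_zero, sub_zero] at a1
    rw [← a1]
    ring

theorem HPath.iterate_f (h : HPath X e c θ θ' U) (hU : IsOpen U) (hU' : U.OrdConnected)
    (hpos : ∀ t ∈ U, 0 < θ' t) (m : ℕ) :
    ∃ θ₁ θ₁', HPath X e (P.f^[m] ∘ c) θ₁ θ₁' U ∧ ∀ t ∈ U, 0 < θ₁' t := by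
  rcases U.eq_empty_or_nonempty with rfl | ⟨t₀, ht₀⟩
  · exact ⟨θ, θ', ⟨⟨continuousOn_empty _, by simp⟩, by simp, continuousOn_empty _⟩, by simp⟩
  induction m with
  | zero => exact ⟨θ, θ', h, hpos⟩
  | succ m ih =>
    obtain ⟨θ₁, θ₁', h1, h2⟩ := ih
    obtain ⟨θ₂, -, h3⟩ := h1.map_f P hU hU' ht₀ 0
    rw [Function.iterate_succ', Function.comp_assoc]
    exact ⟨θ₂, _, h3, fun t ht => mul_pos (P.a_pos (h1.dev.notMem ht)) (h2 t ht)⟩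

/-- A horizontal segment that leaves the basin of a conical point crosses the stable set of one of
the saddles near this point. -/
theorem HPath.exists_mem_stable (h : HPath X e c θ θ' U) (hU : IsOpen U) (hU' : U.OrdConnected)
    (hpos : ∀ t ∈ U, 0 < θ' t) (hσ : σ ∈ X.sing) {t₁ t₂ : ℝ} (ht₁ : t₁ ∈ U) (ht₂ : t₂ ∈ U)
    (h1 : c t₁ ∉ P.basin σ) (h2 : c t₂ ∈ P.basin σ) : ∃ t ∈ uIcc t₁ t₂,
      ∃ ζ e', ∃ hs : IsSector X σ ζ e', c t ∈ P.stable (branch X σ ζ (P.profile hs.mem).τ) := by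
  by_contra hcon
  set p := P.profile hσ
  set B := P.box hσ
  set ξ : S → ℂ := fun x => X.chart σ x ^ X.n σ with hξ
  have hξc : ∀ x ∈ (X.chart σ).source, ContinuousAt ξ x := fun x hx =>
    ((X.chart σ).continuousAt hx).pow _
  have hσs := X.mem_source σ hσ
  have hξ0 : ξ σ = 0 := by
    simp only [ξ]; rw [X.chart_center σ hσ, zero_pow (X.n_pos σ hσ).ne']
  have hN : ∀ᶠ x in 𝓝 σ, x ∈ (X.chart σ).source ∧ |(ξ x).im| < B.ε ∧ |(ξ x).re| < B.x₁ := by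
    have a1 := (Complex.continuous_im.continuousAt.comp (hξc σ hσs)).abs
    have a2 := (Complex.continuous_re.continuousAt.comp (hξc σ hσs)).abs
    refine (Filter.eventually_of_mem ((X.chart σ).open_source.mem_nhds hσs) fun _ h => h).and
      ((a1.eventually_lt_const ?_).and (a2.eventually_lt_const ?_))
    · simpa [hξ0] using B.ε_pos
    · simpa [hξ0] using B.x₁_pos
  -- Iterate until the end point in the basin is in a thin rectangle about `σ`, between the two
  -- local stable manifolds.
  obtain ⟨m, m1, m2, m3⟩ := (show Tendsto (fun m => P.f^[m] (c t₂)) atTop (𝓝 σ) from h2).eventually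
    hN |>.exists
  obtain ⟨θ₁, θ₁', H, -⟩ := h.iterate_f P hU hU' hpos m
  set g : ℝ → S := P.f^[m] ∘ c
  set y := (ξ (g t₂)).im
  have hy : |y| ≤ B.ε := m2.le
  have hsub : uIcc t₁ t₂ ⊆ U := hU'.uIcc_subset ht₁ ht₂
  have hcl : IsClosed (X.closedDisc σ ‖(⟨p.edge y, y⟩ : ℂ)‖) :=
    (X.isCompact_closedDisc hσ (B.norm_lt _ (B.edge_mem hy).1 hy)).isClosed
  -- `G` says that the iterated segment is still strictly between the two graphs. If it never meets
  -- them, `G` propagates from `t₂` back to `t₁`, and `c t₁` would lie in the basin.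
  let G : ℝ → Prop := fun t => g t ∈ (X.chart σ).source ∧ (ξ (g t)).im = y ∧
    |(ξ (g t)).re| < p.edge y
  have hG2 : G t₂ := ⟨m1, rfl, m3.trans_le (B.le_edge hy)⟩
  have hG1 : G t₁ := by
    refine (eq_of_eventually_eq_nhdsWithin (isPreconnected_uIcc (a := t₁) (b := t₂)) (g := G)
      (fun z hz => ?_) right_mem_uIcc left_mem_uIcc).mp hG2
    have hgz : ContinuousAt g z := (H.dev.1 z (hsub hz)).continuousAt (hU.mem_nhds (hsub hz))
    have him : g z ∈ (X.chart σ).source → ∀ᶠ t in 𝓝 z, (ξ (g t)).im = (ξ (g z)).im := fun hs => by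
      have := (H.dev.2 z (hsub hz)).2 _ _ (X.chart σ).open_source hs (X.chart_form σ hσ)
      rw [nhdsWithin_eq_nhds.2 (hU.mem_nhds (hsub hz))] at this
      filter_upwards [this] with t ht
      have h3 := congr_arg Complex.im ht
      simp only [Complex.sub_im, Complex.ofReal_im, sub_self] at h3
      exact sub_eq_zero.1 h3
    by_cases hGz : G z
    · have : ∀ᶠ t in 𝓝 z, G t := by
        have a2 := ((Complex.continuous_re.continuousAt.comp (hξc _ hGz.1)).comp hgz).abs
        filter_upwards [him hGz.1, hgz ((X.chart σ).open_source.mem_nhds hGz.1),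
          a2.eventually_lt_const hGz.2.2] with t b1 b2 b3
        exact ⟨b2, b1.trans hGz.2.1, b3⟩
      filter_upwards [this.filter_mono nhdsWithin_le_nhds] with t ht
      exact propext (iff_of_true ht hGz)
    · have : ∀ᶠ t in 𝓝 z, ¬ G t := by
        by_contra hfr
        have hfr : ∃ᶠ t in 𝓝 z, G t := hfr
        have hmem : g z ∈ X.closedDisc σ ‖(⟨p.edge y, y⟩ : ℂ)‖ := by
          refine hcl.mem_of_frequently_of_tendsto (hfr.mono fun t ht => ⟨ht.1, ?_⟩) hgz
          have : X.chart σ (g t) ^ X.n σ = ⟨(ξ (g t)).re, y⟩ := Complex.ext rfl ht.2.1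
          rw [this, Complex.norm_def, Complex.norm_def]
          apply Real.sqrt_le_sqrt
          rw [Complex.normSq_mk, Complex.normSq_mk]
          have := abs_lt.1 ht.2.2
          nlinarith
        have hgs := hmem.1
        have himz : (ξ (g z)).im = y := by
          obtain ⟨t, a1, a2⟩ := (hfr.and_eventually (him hgs)).exists
          exact a2.symm.trans a1.2.1
        have hle : |(ξ (g z)).re| ≤ p.edge y := by
          have a2 := ((Complex.continuous_re.continuousAt.comp (hξc _ hgs)).comp hgz).abs
          exact isClosed_Iic.mem_of_frequently_of_tendsto (hfr.mono fun t ht => ht.2.2.le) a2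
        rcases hle.lt_or_eq with hlt | heq
        · exact hGz ⟨hgs, himz, hlt⟩
        · obtain ⟨ζ, e', hs, hst⟩ := P.exists_mem_stable_of_abs_eq_edge hσ hgs
            (himz ▸ hy) (himz.symm ▸ heq)
          exact hcon ⟨z, hz, ζ, e', hs, (P.iterate_mem_stable m).1 hst⟩
      filter_upwards [this.filter_mono nhdsWithin_le_nhds] with t ht
      exact propext (iff_of_false ht hGz)
  have him : (X.chart σ (g t₁) ^ X.n σ).im = y := hG1.2.1
  have := P.mem_basin_of_abs_lt_edge hσ hG1.1 (him ▸ hy) (him ▸ hG1.2.2)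
  exact h1 ((P.iterate_mem_stable (q := σ) m).1 this)

end Manifold

/-! ### The invariant set contains no horizontal segment. -/

variable {S : Type*} [MetricSpace S] [ChartedSpace ℂ S] {X : ConicalSurface S} {φ : LinearPA X}
  (P : Perturbation φ) {σ : S} {ζ : ℂ} {e : ℝ} [CompactSpace S] [IsManifold 𝓘(ℂ) 1 S]

namespace Perturbation

/-- A horizontal segment of half length `L` centred at `x` is contained in the invariant set. -/
def HasSegment (L : ℝ) (x : S) : Prop :=
  ∃ c : ℝ → S, Dev X (line (1 : ℝ)) c (Ioo (-L) L) ∧ c 0 = x ∧ ∀ t ∈ Ioo (-L) L, c t ∈ P.K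

/-- Along the segment `a ≥ μ`, so the image covers `μ` times the length. It is reparametrised by the
inverse `g` of its position function, which is Lipschitz. -/
theorem HasSegment.map {L : ℝ} (hL : 0 < L) {x : S} (h : P.HasSegment L x) {μ : ℝ} (hμ : 1 < μ)
    (hK : ∀ x ∈ P.K, μ ≤ P.a x) : P.HasSegment (μ * L) (P.f x) := by
  obtain ⟨c, hc, rfl, hcK⟩ := h
  have hμ0 : 0 < μ := zero_lt_one.trans hμ
  have h0 : (0 : ℝ) ∈ Ioo (-L) L := ⟨by linarith, hL⟩
  obtain ⟨θ, hθ0, hθ⟩ := (HPath.of_line hc).map_f P isOpen_Ioo ordConnected_Ioo h0 0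
  have hexp : ∀ s ∈ Ioo (-L) L, ∀ t ∈ Ioo (-L) L, s ≤ t → μ * (t - s) ≤ θ t - θ s :=
    (convex_Ioo (-L) L).mul_sub_le_image_sub_of_le_deriv
      (fun t ht => (hθ.hasDerivAt t ht).continuousAt.continuousWithinAt)
      (fun t ht => (hθ.hasDerivAt t (interior_subset ht)).differentiableAt.differentiableWithinAt)
      fun t ht => by
        rw [(hθ.hasDerivAt t (interior_subset ht)).deriv, mul_one]
        exact hK _ (hcK t (interior_subset ht))
  have hex : ∀ s ∈ Ioo (-(μ * L)) (μ * L), ∃ t ∈ Ioo (-L) L, θ t = s := by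
    intro s hs
    have hsL : |s| < μ * L := abs_lt.2 hs
    have hr : |s| / μ < L := by rwa [div_lt_iff₀ hμ0, mul_comm]
    have hr0 : 0 ≤ |s| / μ := by positivity
    have m1 : |s| / μ ∈ Ioo (-L) L := ⟨by linarith, hr⟩
    have m2 : -(|s| / μ) ∈ Ioo (-L) L := ⟨by linarith, by linarith⟩
    have e1 := hexp 0 h0 _ m1 hr0
    have e2 := hexp _ m2 0 h0 (by linarith)
    have e3 : μ * (|s| / μ) = |s| := mul_div_cancel₀ _ hμ0.ne'
    rw [hθ0, sub_zero, sub_zero, e3] at e1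
    rw [hθ0, zero_sub, neg_neg, zero_sub, e3] at e2
    have hsub : Icc (-(|s| / μ)) (|s| / μ) ⊆ Ioo (-L) L := fun t ht =>
      ⟨by linarith [ht.1], by linarith [ht.2]⟩
    obtain ⟨t, ht, hts⟩ := intermediate_value_Icc (by linarith : -(|s| / μ) ≤ |s| / μ)
      (fun t ht => (hθ.hasDerivAt t (hsub ht)).continuousAt.continuousWithinAt)
      (show s ∈ Icc _ _ from ⟨by linarith [neg_abs_le s], by linarith [le_abs_self s]⟩)
    exact ⟨t, hsub ht, hts⟩
  have hex' : ∀ s, ∃ t, s ∈ Ioo (-(μ * L)) (μ * L) → t ∈ Ioo (-L) L ∧ θ t = s := fun s => by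
    by_cases hs : s ∈ Ioo (-(μ * L)) (μ * L)
    · obtain ⟨t, h1, h2⟩ := hex s hs
      exact ⟨t, fun _ => ⟨h1, h2⟩⟩
    · exact ⟨0, fun h => (hs h).elim⟩
  choose g hg using hex'
  have habs : ∀ s ∈ Ioo (-L) L, ∀ t ∈ Ioo (-L) L, μ * |t - s| ≤ |θ t - θ s| := by
    intro s hs t ht
    rcases le_total s t with hst | hst
    · rw [abs_of_nonneg (sub_nonneg.2 hst)]
      exact (hexp s hs t ht hst).trans (le_abs_self _)
    · rw [abs_sub_comm, abs_of_nonneg (sub_nonneg.2 hst), abs_sub_comm]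
      exact (hexp t ht s hs hst).trans (le_abs_self _)
  have hcont : ContinuousOn g (Ioo (-(μ * L)) (μ * L)) := by
    have : LipschitzOnWith 1 g (Ioo (-(μ * L)) (μ * L)) :=
      LipschitzOnWith.of_dist_le_mul fun s hs s' hs' => by
        have h1 := habs _ (hg s' hs').1 _ (hg s hs).1
        rw [(hg s hs).2, (hg s' hs').2] at h1
        rw [Real.dist_eq, Real.dist_eq, NNReal.coe_one, one_mul]
        exact (le_mul_of_one_le_left (abs_nonneg _) hμ.le).trans h1
    exact this.continuousOn
  refine ⟨fun s => P.f (c (g s)), ?_, ?_, fun s hs => P.f_mem_K.2 (hcK _ (hg s hs).1)⟩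
  · refine (hθ.dev.comp hcont fun s hs => (hg s hs).1).congr_line fun s hs t ht => ?_
    simp only [Function.comp, (hg s hs).2, (hg t ht).2]
    push_cast; ring
  · have h0' : (0 : ℝ) ∈ Ioo (-(μ * L)) (μ * L) := by
      have := mul_pos hμ0 hL
      exact ⟨by linarith, this⟩
    have h1 := habs _ (hg 0 h0').1 0 h0
    rw [(hg 0 h0').2, hθ0, sub_self, abs_zero, zero_sub, abs_neg] at h1
    have h2 : g 0 = 0 := by
      by_contra hne
      have := mul_pos hμ0 (abs_pos.2 hne)
      linarith
    simp only [h2]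

/-- The invariant set contains no straight leaf. -/
theorem no_leaf_in_K [ConnectedSpace S] {c : ℝ → S} (hc : Dev X (line (1 : ℝ)) c univ)
    (hcK : ∀ t, c t ∈ P.K) : False := by
  set C := closure (range c)
  have hCK : C ⊆ P.K := closure_minimal (by rintro _ ⟨t, rfl⟩; exact hcK t) P.isClosed_K
  -- A vertical segment that ends at a conical point and is shorter than the radius `τ` starts in
  -- the trap, hence outside `K`. With this `η₀` no conical point is vertically visible from `C`.
  obtain ⟨η₀, hη, hη₀⟩ : ∃ η₀ : ℝ, (∀ σ ∈ X.sing, η₀ < P.fixedRadius σ) ∧ 0 < η₀ := by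
    have h1 : ∀ᶠ η in 𝓝[>] (0 : ℝ), ∀ σ ∈ X.sing, η < P.fixedRadius σ :=
      (Filter.eventually_all_finite X.finite_sing).2 fun σ hσ =>
        (eventually_lt_nhds (by rw [P.fixedRadius_eq hσ]; exact (P.profile hσ).τ_pos)).filter_mono
          nhdsWithin_le_nhds
    exact (h1.and self_mem_nhdsWithin).exists
  have huniv := φ.eq_univ_of_saturated isClosed_closure (saturated_leaf hc).closure
    (subset_closure (mem_range_self 0)) (hc.notMem (mem_univ 0)) hη₀ ?_
  · obtain ⟨σ, hσ⟩ := X.exists_zero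
    exact P.notMem_sing_of_mem_K (hCK (huniv.ge (mem_univ σ))) hσ
  intro δ hδ V s hs hsη hV hV0 _ σ hσ hlim
  have hτ := hη σ hσ
  rw [P.fixedRadius_eq hσ] at hτ
  set p := P.profile hσ
  have hsτ : s < p.τ := hsη.trans hτ
  have hδ' : ‖((-1 : ℝ) : ℂ) * (δ * Complex.I)‖ = 1 := by
    rcases hδ with rfl | rfl <;> simp
  have hW : Dev X (line (((-1 : ℝ) : ℂ) * (δ * Complex.I))) (fun t => V (s + (-1) * t)) (Ioo 0 s) :=
    hV.comp_affine s (-1) (fun t ht => ⟨by linarith [ht.2], by linarith [ht.1]⟩) rfl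
  have hWlim : Tendsto (fun t => V (s + (-1) * t)) (𝓝[>] 0) (𝓝 σ) := by
    refine hlim.comp (tendsto_nhdsWithin_of_tendsto_nhds_of_eventually_within _ ?_ ?_)
    · have : Continuous fun t : ℝ => s + (-1) * t := by fun_prop
      have h2 := this.tendsto 0
      rw [mul_zero, add_zero] at h2
      exact h2.mono_left nhdsWithin_le_nhds
    · filter_upwards [self_mem_nhdsWithin] with t ht
      have : 0 < t := ht
      rw [mem_Iio]; linarith
  have hn := (X.n_pos σ hσ).ne'
  have hr : (p.τ ^ ((X.n σ : ℝ)⁻¹)) ^ X.n σ = p.τ := Real.rpow_inv_natCast_pow p.τ_pos.le hn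
  have hcoord := hW.ray_coord hσ hs hWlim (Real.rpow_pos_of_pos p.τ_pos ((X.n σ : ℝ)⁻¹))
    (lt_of_pow_lt_pow_left₀ (X.n σ) (X.radius_pos σ hσ).le (by rw [hr]; exact P.τ_lt_radius hσ))
    (by rw [hr, hδ', mul_one]; exact hsτ.le) (norm_ne_zero_iff.1 (by rw [hδ']; exact one_ne_zero))
  have hmem : V 0 ∈ X.closedDisc σ s := by
    have hcl := (X.isCompact_closedDisc hσ (hsτ.trans (P.τ_lt_radius hσ))).isClosed
    have h1 : Tendsto V (𝓝[>] 0) (𝓝 (V 0)) :=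
      (hV.1 0 (left_mem_Ico.2 hs)).mono_left (by
        refine nhdsWithin_le_iff.2 ?_
        filter_upwards [Ioo_mem_nhdsGT hs] with t ht using ⟨ht.1.le, ht.2⟩)
    refine hcl.mem_of_tendsto h1 ?_
    filter_upwards [Ioo_mem_nhdsGT hs] with t ht
    obtain ⟨h2, h3⟩ := hcoord (s - t) ⟨by linarith [ht.2], by linarith [ht.1]⟩
    rw [show s + (-1) * (s - t) = t by ring] at h2 h3
    refine ⟨h2, ?_⟩
    rw [h3, norm_mul, hδ', mul_one, Complex.norm_real,
      Real.norm_of_nonneg (by linarith [ht.2])]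
    linarith [ht.1]
  exact P.notMem_trap_of_mem_K (hCK hV0) hσ ⟨hmem.1, hmem.2.trans_lt hsτ⟩

/-- The invariant set contains no horizontal segment. -/
theorem not_hasSegment [ConnectedSpace S] {L : ℝ} (hL : 0 < L) (x : S) : ¬ P.HasSegment L x := by
  intro h
  obtain ⟨μ, hμ, hK⟩ := P.exists_lt_a_of_mem_K
  have hμ0 : 0 < μ := zero_lt_one.trans hμ
  -- The segments around the iterates of `x` have lengths tending to infinity, so at a cluster point
  -- `w` of the iterates the whole leaf lies in the closed set `K`. It cannot end at a conical
  -- point, since `K` contains none.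
  have hit : ∀ m : ℕ, P.HasSegment (μ ^ m * L) (P.f^[m] x) := fun m => by
    induction m with
    | zero => simpa using h
    | succ m ih =>
      rw [Function.iterate_succ_apply', pow_succ', mul_assoc]
      exact ih.map P (mul_pos (pow_pos hμ0 m) hL) hμ hK
  obtain ⟨w, hw⟩ := exists_clusterPt_of_compactSpace (Filter.map (fun m : ℕ => P.f^[m] x) atTop)
  have hxK : ∀ m, P.f^[m] x ∈ P.K := fun m => by
    obtain ⟨c, -, h0, hcK⟩ := hit m
    have := mul_pos (pow_pos hμ0 m) hL
    rw [← h0]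
    exact hcK 0 ⟨by linarith, this⟩
  have hwK : w ∈ P.K := by
    have := hw.mem_closure_of_mem (s := P.K) (by
      rw [Filter.mem_map]; exact Eventually.of_forall hxK)
    rwa [P.isClosed_K.closure_eq] at this
  have hws := P.notMem_sing_of_mem_K hwK
  -- the leaf of `w` is a limit of long segments
  have hleafK : ∀ u : ℝ, |u| = 1 → ∀ c : ℝ → S, ∀ T ≥ 0, Dev X (line u) c (Icc 0 T) → c 0 = w →
      c T ∈ P.K := by
    intro u hu c T hT hc hc0
    obtain ⟨δ, hδ, E, hE0, hE⟩ := hc.exists_tube isCompact_Icc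
    have hslice : ∀ q ∈ Icc 0 T, Dev X id (fun z => E (q, z)) (Metric.ball 0 δ) := fun q hq =>
      (hE.comp (g := fun z : ℂ => (q, z)) (P := Metric.ball 0 δ) (by fun_prop)
        (fun z hz => ⟨hq, hz⟩)).congr_dev fun z _ z' _ => by simp
    have hball : Metric.ball (0 : ℂ) δ ∈ 𝓝 0 := Metric.ball_mem_nhds _ hδ
    have h0T : (0 : ℝ) ∈ Icc 0 T := left_mem_Icc.2 hT
    have hTT : T ∈ Icc 0 T := right_mem_Icc.2 hT
    by_contra hnot
    have hcontT : ContinuousAt (fun z => E (T, z)) 0 :=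
      ((hslice T hTT).1 0 (Metric.mem_ball_self hδ)).continuousAt hball
    have hout : ∀ᶠ z in 𝓝 (0 : ℂ), E (T, z) ∉ P.K ∧ z ∈ Metric.ball (0 : ℂ) δ :=
      (hcontT.eventually (P.isClosed_K.isOpen_compl.mem_nhds (by
        change E (T, 0) ∈ P.Kᶜ
        rw [hE0 T hTT]; exact hnot))).and (Filter.eventually_of_mem hball fun _ h => h)
    have hn := (hslice 0 h0T).isOpenMap_at hball hout
    simp only [hE0 0 h0T, hc0] at hn
    have hfr : ∃ᶠ m : ℕ in atTop, P.f^[m] x ∈ (fun z => E (0, z)) ''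
        {z | E (T, z) ∉ P.K ∧ z ∈ Metric.ball 0 δ} :=
      hw.frequently (Filter.eventually_of_mem hn fun _ h => h)
    have hbig : ∀ᶠ m : ℕ in atTop, T < μ ^ m * L :=
      ((tendsto_pow_atTop_atTop_of_one_lt hμ).atTop_mul_const hL).eventually_gt_atTop T
    obtain ⟨m, ⟨z, ⟨hz1, hz2⟩, hz3⟩, hm⟩ := (hfr.and_eventually hbig).exists
    obtain ⟨c', hc', hc'0, hc'K⟩ := hit m
    have hmem : ∀ t ∈ Icc (0 : ℝ) T, 0 + u * t ∈ Ioo (-(μ ^ m * L)) (μ ^ m * L) := fun t ht => by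
      rw [zero_add, mem_Ioo, ← abs_lt, abs_mul, hu, one_mul, abs_of_nonneg ht.1]
      exact ht.2.trans_lt hm
    have d1 : Dev X (line u) (fun t => c' (0 + u * t)) (Icc 0 T) :=
      hc'.comp_affine 0 u hmem (by simp)
    have d2 : Dev X (line u) (fun t => E (t, z)) (Icc 0 T) := by
      refine (hE.comp (g := fun t : ℝ => (t, z)) (P := Icc 0 T) (by fun_prop)
        (fun t ht => ⟨ht, hz2⟩)).congr_line fun s _ t _ => ?_
      simp only [Function.comp, line]; ring
    have hEq := Dev.eqOn isPreconnected_Icc d2 d1 h0T (by simpa [hc'0] using hz3) hTT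
    simp only at hEq
    exact hz1 (hEq ▸ hc'K _ (hmem T hTT))
  have hleaf : ∀ u : ℝ, |u| = 1 → ∃ c : ℝ → S, c 0 = w ∧ Dev X (line u) c (Ici 0) ∧
      ∀ t ≥ 0, c t ∈ P.K := by
    intro u hu
    rcases X.exists_leaf hws (u : ℂ) with ⟨c, hc0, hc⟩ | ⟨T, hT, c, hc0, hc, σ, hσ, hlim⟩
    · exact ⟨c, hc0, hc, fun t ht => hleafK u hu c t ht (hc.mono fun s hs => hs.1) hc0⟩
    · exfalso
      refine P.notMem_sing_of_mem_K (P.isClosed_K.mem_of_tendsto hlim ?_) hσ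
      filter_upwards [Ioo_mem_nhdsLT hT] with t ht
      exact hleafK u hu c t ht.1.le (hc.mono fun s hs => ⟨hs.1, hs.2.trans_lt ht.2⟩) hc0
  obtain ⟨c₁, h1, h2, h3⟩ := hleaf 1 (by simp)
  obtain ⟨c₂, k1, k2, k3⟩ := hleaf (-1) (by simp)
  have hA : Dev X (line (1 : ℝ)) (fun t => c₂ (0 + (-1 : ℝ) * t)) (univ ∩ Iic 0) :=
    k2.comp_affine 0 (-1) (fun t ht => by
      have h2 : t ≤ 0 := ht.2
      rw [mem_Ici]; linarith) (by simp)
  have hB := hA.glue (c' := c₁) (h2.mono inter_subset_right) (by simp [h1, k1])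
  refine P.no_leaf_in_K hB fun t => ?_
  split_ifs with ht
  · exact k3 _ (by linarith)
  · exact h3 t (not_le.1 ht).le

end Perturbation

/-! ### Rays, transversality, and density of the stable sets. -/

variable {S : Type*} [MetricSpace S] [ChartedSpace ℂ S] {X : ConicalSurface S} {φ : LinearPA X}
  (P : Perturbation φ) {σ σ' : S} {ζ ζ' : ℂ} {e e' : ℝ} [CompactSpace S] [IsManifold 𝓘(ℂ) 1 S]

theorem norm_ofReal_lt {t R : ℝ} (ht : t ∈ Ioo 0 R) : ‖(t : ℂ)‖ < R := by
  rw [Complex.norm_real, Real.norm_of_nonneg ht.1.le]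
  exact ht.2

theorem ofReal_mem_halfDisc {t : ℝ} (ht : t ∈ Ioo 0 (X.radius σ ^ X.n σ)) :
    (t : ℂ) ∈ halfDisc X σ :=
  ⟨by simpa using ht.1, norm_ofReal_lt ht⟩

namespace IsSector

theorem dev_ray (h : IsSector X σ ζ e) : Dev X (line e) (fun t : ℝ => branch X σ ζ t)
    (Ioo 0 (X.radius σ ^ X.n σ)) := by
  refine (h.dev_branch.comp (g := fun t : ℝ => (t : ℂ)) (by fun_prop)
    fun t ht => ofReal_mem_halfDisc ht).congr_line fun s _ t _ => ?_
  simp only [Function.comp]; ring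

theorem tendsto_branch_zero (h : IsSector X σ ζ e) :
    Tendsto (fun t : ℝ => branch X σ ζ t) (𝓝[>] 0) (𝓝 σ) := by
  have hn := X.n_pos σ h.mem
  have h0 : (0 : ℂ) ∈ (X.chart σ).target := by
    rw [← X.chart_center σ h.mem]; exact (X.chart σ).map_source (X.mem_source σ h.mem)
  have h1 : Tendsto (fun t : ℝ => ζ * (t : ℂ) ^ ((X.n σ : ℂ)⁻¹)) (𝓝[>] 0) (𝓝 0) := by
    have hr : Tendsto (fun t : ℝ => t ^ ((X.n σ : ℝ)⁻¹)) (𝓝[>] 0) (𝓝 0) := by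
      have hpos : (0 : ℝ) < (X.n σ : ℝ)⁻¹ := by positivity
      have : ContinuousAt (fun t : ℝ => t ^ ((X.n σ : ℝ)⁻¹)) 0 :=
        Real.continuousAt_rpow_const _ _ (Or.inr hpos.le)
      have h2 := this.tendsto
      rw [Real.zero_rpow hpos.ne'] at h2
      exact h2.mono_left nhdsWithin_le_nhds
    have h3 := ((Complex.continuous_ofReal.tendsto 0).comp hr).const_mul ζ
    rw [Complex.ofReal_zero, mul_zero] at h3
    refine h3.congr' ?_
    filter_upwards [self_mem_nhdsWithin] with t ht
    simp only [Function.comp]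
    rw [Complex.ofReal_cpow (le_of_lt ht)]
    push_cast
    rfl
  have h2 := ((X.chart σ).continuousAt_symm h0).tendsto.comp h1
  rwa [X.chart_symm_zero h.mem] at h2

/-- The horizontal ray of a sector is infinite. -/
theorem exists_ray (φ : LinearPA X) (h : IsSector X σ ζ e) : ∃ ρ : ℝ → S,
    Dev X (line e) ρ (Ioi 0) ∧ EqOn ρ (fun t : ℝ => branch X σ ζ t) (Ioo 0 (X.radius σ ^ X.n σ)) ∧
      Tendsto ρ (𝓝[>] 0) (𝓝 σ) := by
  set R := X.radius σ ^ X.n σ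
  have hR : 0 < R := pow_pos (X.radius_pos σ h.mem) _
  set t₁ := R / 2
  have ht₁ : t₁ ∈ Ioo 0 R := ⟨half_pos hR, half_lt_self hR⟩
  have he0 : (e : ℂ) ≠ 0 := fun h0 => by simpa [h0] using h.mul_self'
  have hd := h.dev_ray
  have hlim : ∀ c : ℝ → S, Tendsto
      (fun t : ℝ => if t ≤ t₁ then branch X σ ζ t else c (-t₁ + 1 * t)) (𝓝[>] 0) (𝓝 σ) := by
    intro c
    refine h.tendsto_branch_zero.congr' ?_
    filter_upwards [Ioo_mem_nhdsGT ht₁.1] with t ht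
    rw [if_pos ht.2.le]
  rcases X.exists_leaf (hd.notMem ht₁) (e : ℂ) with ⟨c, hc0, hc⟩ | ⟨T, hT, c, hc0, hc, σ₂, hσ₂, hl⟩
  · have hD : Dev X (line e) (fun t : ℝ => if t ≤ t₁ then branch X σ ζ t else c (-t₁ + 1 * t))
        (Ioi 0) := by
      refine Dev.glue (hd.mono fun t ht => ⟨ht.1, lt_of_le_of_lt ht.2 ht₁.2⟩)
        (hc.comp_affine (-t₁) 1 (fun t ht => ?_) (by simp)) (by simp [hc0])
      have : t₁ ≤ t := ht.2
      rw [mem_Ici]; linarith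
    refine ⟨_, hD, ?_, hlim c⟩
    exact Dev.eqOn isPreconnected_Ioo (hD.mono fun t ht => ht.1) hd ht₁ (if_pos le_rfl)
  -- A finite prolongation would end at a conical point and give a saddle connection.
  · exfalso
    have hD : Dev X (line e) (fun t : ℝ => if t ≤ t₁ then branch X σ ζ t else c (-t₁ + 1 * t))
        (Ioo 0 (t₁ + T)) := by
      refine Dev.glue (hd.mono fun t ht => ⟨ht.1.1, lt_of_le_of_lt ht.2 ht₁.2⟩)
        (hc.comp_affine (-t₁) 1 (fun t ht => ?_) (by simp)) (by simp [hc0])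
      have : t₁ ≤ t := ht.2
      constructor <;> linarith [ht.1.2]
    refine φ.no_saddle_connection h.mem hD (by linarith [ht₁.1]) (hlim c) he0 (stretch_ofReal _ _)
      hσ₂ ?_
    have h1 : Tendsto (fun t => c (-t₁ + 1 * t)) (𝓝[<] (t₁ + T)) (𝓝 σ₂) := by
      refine hl.comp (tendsto_nhdsWithin_of_tendsto_nhds_of_eventually_within _ ?_ ?_)
      · have : Continuous fun t : ℝ => -t₁ + 1 * t := by fun_prop
        have h2 := this.tendsto (t₁ + T)
        rw [show -t₁ + 1 * (t₁ + T) = T by ring] at h2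
        exact h2.mono_left nhdsWithin_le_nhds
      · filter_upwards [self_mem_nhdsWithin] with t ht
        have : t < t₁ + T := ht
        rw [mem_Iio]; linarith
    refine h1.congr' ?_
    filter_upwards [Ioo_mem_nhdsLT (show t₁ < t₁ + T by linarith)] with t ht
    rw [if_neg (not_le.2 ht.1)]

/-- The perturbed map expands the part of a horizontal ray beyond the saddle without bound. -/
theorem exists_ray_dynamics (h : IsSector X σ ζ e) {ρ : ℝ → S} (hρ : Dev X (line e) ρ (Ioi 0))
    (hρb : EqOn ρ (fun t : ℝ => branch X σ ζ t) (Ioo 0 (X.radius σ ^ X.n σ))) {x : ℝ}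
    (hx : (P.profile h.mem).τ < x) (hxR : x < X.radius σ ^ X.n σ) :
    ∃ θ : ℝ → ℝ, θ (P.profile h.mem).τ = (P.profile h.mem).τ ∧
      StrictMonoOn θ (Ici (P.profile h.mem).τ) ∧ ContinuousOn θ (Ici (P.profile h.mem).τ) ∧
      (∀ t ≥ (P.profile h.mem).τ, P.f (ρ t) = ρ (θ t)) ∧ ∀ T, ∃ k : ℕ, T < θ^[k] x := by
  set p := P.profile h.mem
  have hτ := p.τ_pos
  obtain ⟨θ, hθτ, hθ⟩ := (HPath.of_line hρ).map_f P isOpen_Ioi ordConnected_Ioi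
    (mem_Ioi.2 hτ) p.τ
  simp only [mul_one] at hθ
  have hsub : Ici p.τ ⊆ Ioi 0 := fun t ht => hτ.trans_le ht
  have hcont : ContinuousOn θ (Ici p.τ) := fun t ht =>
    (hθ.hasDerivAt t (hsub ht)).continuousAt.continuousWithinAt
  have hmono : StrictMonoOn θ (Ici p.τ) := by
    refine strictMonoOn_of_deriv_pos (convex_Ici _) hcont fun t ht => ?_
    have ht' := hsub (interior_subset ht)
    rw [(hθ.hasDerivAt t ht').deriv]
    exact P.a_pos (hρ.notMem ht')
  have hmaps : ∀ t ∈ Ici p.τ, θ t ∈ Ici p.τ := fun t ht => by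
    have := hmono.monotoneOn (mem_Ici.2 le_rfl) ht ht
    rwa [hθτ] at this
  have hconj : EqOn (P.f ∘ ρ) (ρ ∘ θ) (Ici p.τ) := by
    refine Dev.eqOn isPreconnected_Ici (hθ.dev.mono hsub) ((hρ.comp hcont fun t ht =>
      hsub (hmaps t ht)).congr_dev fun t _ t' _ => ?_) (mem_Ici.2 le_rfl) ?_
    · simp only [Function.comp, line]; push_cast; ring
    · have hb : ρ p.τ = branch X σ ζ p.τ := hρb ⟨hτ, hx.trans hxR⟩
      simp only [Function.comp, hθτ, hb]
      exact P.f_saddle h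
  refine ⟨θ, hθτ, hmono, hcont, fun t ht => hconj ht, ?_⟩
  -- Between `τ` and `x` the expansion `a` exceeds `1` and `τ` is fixed, so `x` moves outwards. Its
  -- orbit then increases.
  have hxx : x < θ x := by
    have hd : ∀ t ∈ Icc p.τ x, HasDerivAt (fun t => θ t - t) (P.a (ρ t) - 1) t := fun t ht =>
      (hθ.hasDerivAt t (hsub ht.1)).sub (hasDerivAt_id t)
    have := strictMonoOn_of_deriv_pos (convex_Icc p.τ x) (f := fun t => θ t - t)
      (fun t ht => (hd t ht).continuousAt.continuousWithinAt) (fun t ht => by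
        rw [(hd t (interior_subset ht)).deriv]
        rw [interior_Icc] at ht
        have ht0 := hτ.trans ht.1
        have htR : t ∈ Ioo 0 (X.radius σ ^ X.n σ) := ⟨ht0, ht.2.trans hxR⟩
        have hn := norm_ofReal_lt htR
        have hb : ρ t = branch X σ ζ t := hρb htR
        have hne : ρ t ≠ σ := fun h0 => hρ.notMem (mem_Ioi.2 ht0) (h0 ▸ h.mem)
        rw [P.a_disc h.mem (hb ▸ h.branch_mem hn) hne, hb, h.coord_branch hn]
        have h1 := p.κ_le_a ((e : ℂ) * t)
        rw [h.norm_mul, Complex.norm_real, Real.norm_of_nonneg ht0.le] at h1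
        have := p.one_lt_κ ht.1
        linarith)
      (left_mem_Icc.2 hx.le) (right_mem_Icc.2 hx.le) hx
    simp only [hθτ] at this
    linarith
  have hmem : ∀ k : ℕ, θ^[k] x ∈ Ici p.τ := fun k => by
    induction k with
    | zero => exact hx.le
    | succ k ih => rw [Function.iterate_succ_apply']; exact hmaps _ ih
  have hlt : ∀ k : ℕ, θ^[k] x < θ^[k + 1] x := fun k => by
    induction k with
    | zero => exact hxx
    | succ k ih =>
      rw [Function.iterate_succ_apply' θ k, Function.iterate_succ_apply' θ (k + 1)]
      exact hmono (hmem _) (hmem _) ih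
  have hmonoseq : StrictMono fun k : ℕ => θ^[k] x := strictMono_nat_of_lt_succ hlt
  by_contra hcon
  push Not at hcon
  obtain ⟨T, hT⟩ := hcon
  have hbdd : BddAbove (range fun k : ℕ => θ^[k] x) := ⟨T, by rintro _ ⟨k, rfl⟩; exact hT k⟩
  have hlim := tendsto_atTop_ciSup hmonoseq.monotone hbdd
  set E := ⨆ k : ℕ, θ^[k] x
  have hltE : ∀ k : ℕ, θ^[k] x < E := fun k => (hlt k).trans_le (le_ciSup hbdd (k + 1))
  have hE : p.τ < E := hx.trans (hltE 0)
  have hE0 : (0 : ℝ) < E := hτ.trans hE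
  -- A bounded orbit would converge to a fixed point `E`. This point is regular and fixed, so it
  -- lies in `K` and `a > 1` there. A repelling fixed point cannot be the limit of an orbit that
  -- increases strictly to it.
  have hθE : θ E = E := by
    have h1 := (hθ.hasDerivAt E hE0).continuousAt.tendsto.comp hlim
    have h2 : Tendsto (fun k : ℕ => θ^[k + 1] x) atTop (𝓝 E) := (tendsto_add_atTop_iff_nat 1).2 hlim
    refine tendsto_nhds_unique h1 (h2.congr fun k => ?_)
    rw [Function.iterate_succ_apply']
    rfl
  have hfix : P.f (ρ E) = ρ E := by
    have := hconj (show E ∈ Ici p.τ from hE.le)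
    simpa [hθE] using this
  have hK : ρ E ∈ P.K := by
    rw [P.mem_K]
    intro σ₂ hσ₂ hb
    have h1 : Tendsto (fun m => P.f^[m] (ρ E)) atTop (𝓝 σ₂) := hb
    simp only [Function.iterate_fixed hfix] at h1
    exact hρ.notMem (mem_Ioi.2 hE0) (tendsto_nhds_unique h1 tendsto_const_nhds ▸ hσ₂)
  have ha := P.one_lt_a hK
  have hslope := (hasDerivAt_iff_tendsto_slope.1 (hθ.hasDerivAt E hE0)).eventually_const_lt ha
  have hlim' : Tendsto (fun k : ℕ => θ^[k] x) atTop (𝓝[≠] E) :=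
    tendsto_nhdsWithin_of_tendsto_nhds_of_eventually_within _ hlim
      (Eventually.of_forall fun k => (hltE k).ne)
  obtain ⟨k, hk⟩ := (hlim'.eventually hslope).exists
  rw [slope_def_field, hθE, ← Function.iterate_succ_apply' θ k x,
    lt_div_iff_of_neg (sub_neg.2 (hltE k))] at hk
  have := hlt k
  linarith

end IsSector

namespace Perturbation

variable [ConnectedSpace S]

/-- A horizontal ray crosses the local stable manifold of every other saddle beyond its own
saddle. -/
theorem exists_ray_mem_edge (h : IsSector X σ ζ e) (h' : IsSector X σ' ζ' e')
    (hne : branch X σ ζ (P.profile h.mem).τ ≠ branch X σ' ζ' (P.profile h'.mem).τ) {ρ : ℝ → S}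
    (hρ : Dev X (line e') ρ (Ioi 0))
    (hρb : EqOn ρ (fun t : ℝ => branch X σ' ζ' t) (Ioo 0 (X.radius σ' ^ X.n σ')))
    (hρl : Tendsto ρ (𝓝[>] 0) (𝓝 σ')) : ∃ t > (P.profile h'.mem).τ, ∃ y, |y| < (P.box h.mem).ε ∧
      ρ t = branch X σ ζ ⟨(P.profile h.mem).edge y, y⟩ := by
  set p := P.profile h.mem
  set p' := P.profile h'.mem
  set B := P.box h.mem
  have hdense := φ.dense_ray h'.sign h'.mem hρ hρl
  have hsat := saturated_ray h'.sign h'.mem hρ hρl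
  have hN : {z : ℂ | z ∈ B.set ∧ |z.im| < B.ε} ∈ 𝓝 (p.τ : ℂ) := by
    have h1 : ∀ᶠ z : ℂ in 𝓝 (p.τ : ℂ), z.re ∈ Ioo B.x₁ B.x₂ :=
      Complex.continuous_re.continuousAt.eventually
        (isOpen_Ioo.mem_nhds (by simpa using ⟨B.x₁_lt, B.lt_x₂⟩))
    have h2 : ∀ᶠ z : ℂ in 𝓝 (p.τ : ℂ), |z.im| < B.ε :=
      (Complex.continuous_im.abs.continuousAt (x := (p.τ : ℂ))).eventually_lt_const
        (by simpa using B.ε_pos)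
    filter_upwards [h1, h2] with z a1 a2 using ⟨⟨Ioo_subset_Icc_self a1, a2.le⟩, a2⟩
  have hnb := h.image_branch_mem_nhds (P.τ_mem_halfDisc h.mem) hN
  obtain ⟨_, ⟨z, ⟨hzB, hzε⟩, rfl⟩, hzρ⟩ := mem_closure_iff_nhds.1
    (hdense.ge (mem_univ (branch X σ ζ p.τ))) _ hnb
  set y := z.im
  have hseg : ∀ t ∈ Icc (0 : ℝ) 1, (⟨z.re + (p.edge y - z.re) * t, y⟩ : ℂ) ∈ B.set := fun t ht => by
    refine ⟨?_, hzε.le⟩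
    have := (convex_Icc B.x₁ B.x₂).add_smul_sub_mem hzB.1 (B.edge_mem hzε.le).1 ht
    simpa [mul_comm] using this
  have hD : Dev X (line ((e * (p.edge y - z.re) : ℝ) : ℂ))
      (fun t : ℝ => branch X σ ζ ⟨z.re + (p.edge y - z.re) * t, y⟩) (Icc 0 1) := by
    have hc : Continuous fun t : ℝ => (⟨z.re + (p.edge y - z.re) * t, y⟩ : ℂ) :=
      (Profile.Box.continuous_mk_right y).comp (by fun_prop)
    refine (h.dev_branch.comp hc.continuousOn
      fun t ht => P.box_subset h.mem (hseg t ht)).congr_line fun s _ t _ => ?_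
    simp only [Function.comp]
    apply Complex.ext
    · simp; ring
    · simp
  -- By density the ray enters the box. Being saturated, it contains the horizontal segment in the
  -- box from there to the graph of `edge`.
  have hmem := hsat _ _ 0 1 hD 0 (by simp) 1 (by simp) (by simpa [y] using hzρ)
  obtain ⟨t, ht, htb⟩ := hmem
  simp only [mul_one, add_sub_cancel] at htb
  refine ⟨t, ?_, y, hzε, htb⟩
  have hst := P.edge_mem_stable h hzε.le
  change branch X σ ζ ⟨p.edge y, y⟩ ∈ P.stable (branch X σ ζ p.τ) at hst
  rw [← htb] at hst
  -- Before its own saddle the ray lies in the trap, outside `K`, and the saddle itself converges to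
  -- itself and not to the other one. So the crossing is beyond the saddle.
  by_contra hle
  rcases (not_lt.1 hle).lt_or_eq with hlt | heq
  · have htR : t ∈ Ioo 0 (X.radius σ' ^ X.n σ') := ⟨ht, hlt.trans (P.τ_lt_radius h'.mem)⟩
    have hb : ρ t = branch X σ' ζ' t := hρb htR
    refine P.notMem_trap_of_mem_K (P.stable_subset_K h hst) h'.mem ?_
    rw [hb]
    refine ⟨h'.branch_mem (norm_ofReal_lt htR), ?_⟩
    rw [h'.coord_branch (norm_ofReal_lt htR), h'.norm_mul]
    exact norm_ofReal_lt ⟨ht, hlt⟩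
  · have hb : ρ t = branch X σ' ζ' t := hρb ⟨ht, heq ▸ P.τ_lt_radius h'.mem⟩
    rw [hb, heq] at hst
    have h1 : Tendsto (fun m => P.f^[m] (branch X σ' ζ' p'.τ)) atTop (𝓝 (branch X σ ζ p.τ)) := hst
    exact hne (tendsto_nhds_unique h1 (tendsto_const_nhds.congr fun m =>
      (Function.iterate_fixed (P.f_saddle h') m).symm))

/-- Near the unstable ray of a saddle, all horizontal segments cross the stable set of every other
saddle. -/
theorem exists_transverse (h : IsSector X σ ζ e) (h' : IsSector X σ' ζ' e')
    (hne : branch X σ ζ (P.profile h.mem).τ ≠ branch X σ' ζ' (P.profile h'.mem).τ) :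
    ∃ η > 0, ∀ y : ℝ, |y| < η → ∃ s, (P.profile h'.mem).τ ≤ s ∧ s ≤ (P.box h'.mem).x₂ ∧
      branch X σ' ζ' ⟨s, y⟩ ∈ P.stable (branch X σ ζ (P.profile h.mem).τ) := by
  obtain ⟨ρ, hρ, hρb, hρl⟩ := h'.exists_ray φ
  obtain ⟨T, hT, y₀, hy₀, hTy⟩ := P.exists_ray_mem_edge h h' hne hρ hρb hρl
  set p := P.profile h.mem
  set p' := P.profile h'.mem
  set B := P.box h.mem
  set x₂ := (P.box h'.mem).x₂
  set R' := X.radius σ' ^ X.n σ'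
  have hτ' := p'.τ_pos
  have hx₂ : p'.τ < x₂ := (P.box h'.mem).lt_x₂
  have hx₂R : x₂ < R' := by
    have := (P.box h'.mem).norm_lt (x₂ : ℂ) ⟨by simpa using ((P.box h'.mem).x₁_lt.trans hx₂).le,
      by simp [x₂]⟩ (by simpa using (P.box h'.mem).ε_pos.le)
    rwa [Complex.norm_real, Real.norm_of_nonneg (hτ'.trans hx₂).le] at this
  obtain ⟨θ, hθτ, hmono, hcont, hconj, hbig⟩ := h'.exists_ray_dynamics P hρ hρb hx₂ hx₂R
  obtain ⟨k, hk⟩ := hbig T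
  have hmaps : MapsTo θ (Ici p'.τ) (Ici p'.τ) := fun t ht => by
    have := hmono.monotoneOn (mem_Ici.2 le_rfl) ht ht
    rwa [hθτ] at this
  have hitm : MapsTo θ^[k] (Ici p'.τ) (Ici p'.τ) := hmaps.iterate k
  have hitτ : θ^[k] p'.τ = p'.τ := Function.iterate_fixed hθτ k
  have hitc : ∀ m : ℕ, ContinuousOn θ^[m] (Ici p'.τ) := fun m => by
    induction m with
    | zero => exact continuousOn_id
    | succ m ih => rw [Function.iterate_succ']; exact hcont.comp ih (hmaps.iterate m)
  have hitmono : ∀ m : ℕ, StrictMonoOn θ^[m] (Ici p'.τ) := fun m => by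
    induction m with
    | zero => exact strictMono_id.strictMonoOn _
    | succ m ih => rw [Function.iterate_succ']; exact hmono.comp ih (hmaps.iterate m)
  have hitf : ∀ m : ℕ, ∀ t ∈ Ici p'.τ, P.f^[m] (ρ t) = ρ (θ^[m] t) := fun m t ht => by
    induction m with
    | zero => rfl
    | succ m ih =>
      rw [Function.iterate_succ_apply', Function.iterate_succ_apply', ih,
        hconj _ (hmaps.iterate m ht)]
  -- Since `f^[k]` stretches `[τ, x₂]` past the crossing time `T`, the crossing pulls back to a
  -- point `s₀` of the ray inside the box of `σ'`.
  obtain ⟨s₀, hs₀, hs₀T⟩ := intermediate_value_Ioo hx₂.le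
    ((hitc k).mono Icc_subset_Ici_self) (show T ∈ Ioo (θ^[k] p'.τ) (θ^[k] x₂) from
      ⟨hitτ.symm ▸ hT, hk⟩)
  have hs₀R : s₀ ∈ Ioo 0 R' := ⟨hτ'.trans hs₀.1, hs₀.2.trans hx₂R⟩
  have hs₀d : (s₀ : ℂ) ∈ halfDisc X σ' := ofReal_mem_halfDisc hs₀R
  set H : ℂ → S := fun z => P.f^[k] (branch X σ' ζ' z) with hH
  set hh : ℂ → ℂ := fun z => e * X.chart σ (H z) ^ X.n σ with hhdef
  have hHreal : ∀ s ∈ Ioo p'.τ x₂, H s = ρ (θ^[k] s) := fun s hs => by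
    have hb : ρ s = branch X σ' ζ' s := hρb ⟨hτ'.trans hs.1, hs.2.trans hx₂R⟩
    rw [hH, ← hitf k s hs.1.le, hb]
  have hHs₀ : H s₀ = branch X σ ζ ⟨p.edge y₀, y₀⟩ := by rw [hHreal s₀ hs₀, hs₀T, hTy]
  have hz₀ : (⟨p.edge y₀, y₀⟩ : ℂ) ∈ halfDisc X σ := P.box_subset h.mem (B.edge_mem hy₀.le)
  have hHc : ∀ z ∈ halfDisc X σ', ContinuousAt H z := fun z hz =>
    ((P.continuous_f.iterate k).continuousAt).comp (h'.continuousAt_branch hz)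
  have hyN : {z : ℂ | |z.im| < B.ε} ∈ 𝓝 (⟨p.edge y₀, y₀⟩ : ℂ) :=
    (Complex.continuous_im.abs.continuousAt (x := (⟨p.edge y₀, y₀⟩ : ℂ))).eventually_lt_const
      (by simpa using hy₀)
  -- a neighbourhood of `s₀` on which everything takes place in flat coordinates
  have hgood : ∀ᶠ z in 𝓝 (s₀ : ℂ), z ∈ halfDisc X σ' ∧ z.re ∈ Ioo p'.τ x₂ ∧
      H z ∈ (X.chart σ).source ∧ |(hh z).im| < B.ε ∧ branch X σ ζ (hh z) = H z := by
    have h1 := (hHc s₀ hs₀d).eventually (hHs₀.symm ▸ h.eventually_branch_coord hz₀ hyN)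
    have h2 : ∀ᶠ z : ℂ in 𝓝 (s₀ : ℂ), z.re ∈ Ioo p'.τ x₂ :=
      Complex.continuous_re.continuousAt.eventually (isOpen_Ioo.mem_nhds (by simpa using hs₀))
    filter_upwards [h'.isOpen_halfDisc.mem_nhds hs₀d, h1, h2] with z a1 a2 a3
    exact ⟨a1, a3, a2.1, a2.2.1, a2.2.2⟩
  have hreal : ∀ᶠ s : ℝ in 𝓝 s₀, hh s = ⟨p.edge y₀ + e * e' * (θ^[k] s - T), y₀⟩ := by
    have hsrc : ρ T ∈ (X.chart σ).source := hTy ▸ h.branch_mem hz₀.2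
    have hT0 : T ∈ Ioi (0 : ℝ) := hτ'.trans hT
    have h1 := (hρ.2 T hT0).2 _ _ (X.chart σ).open_source hsrc (X.chart_form σ h.mem)
    rw [nhdsWithin_eq_nhds.2 (isOpen_Ioi.mem_nhds hT0)] at h1
    have h2 : ContinuousAt θ^[k] s₀ := (hitc k).continuousAt (Ici_mem_nhds hs₀.1)
    have h3 : Tendsto θ^[k] (𝓝 s₀) (𝓝 T) := by
      have := h2.tendsto
      rwa [hs₀T] at this
    filter_upwards [h3.eventually h1, isOpen_Ioo.mem_nhds hs₀] with s a1 a2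
    rw [hTy, h.coord_branch hz₀.2, sub_eq_iff_eq_add, line_sub] at a1
    simp only [hh]
    rw [hHreal s a2, a1, mul_add, ← mul_assoc (e : ℂ) e, h.mul_self', one_mul]
    apply Complex.ext
    · simp; ring
    · simp
  obtain ⟨r, hr, hball⟩ := Metric.eventually_nhds_iff_ball.1 hgood
  obtain ⟨r', hr', hball'⟩ := Metric.eventually_nhds_iff_ball.1 hreal
  set d := min r r' / 2 with hd
  have hd0 : 0 < d := half_pos (lt_min hr hr')
  have hdr : d < r := (half_lt_self (lt_min hr hr')).trans_le (min_le_left _ _)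
  have hdr' : d < r' := (half_lt_self (lt_min hr hr')).trans_le (min_le_right _ _)
  have hmemball : ∀ s y : ℝ, |s - s₀| ≤ d → |y| < r - d → (⟨s, y⟩ : ℂ) ∈ Metric.ball (s₀ : ℂ) r :=
    fun s y hs hy => by
      rw [mem_ball_iff_norm]
      refine (Complex.norm_le_abs_re_add_abs_im _).trans_lt ?_
      simp only [Complex.sub_re, Complex.sub_im, Complex.ofReal_re, Complex.ofReal_im, sub_zero]
      linarith
  -- Signed horizontal offset of the `k`-th image from the local stable manifold of the target
  -- saddle. The sign `e * e'` accounts for the orientations of the two sectors and makes `Φ`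
  -- increasing along the ray.
  set Φ : ℂ → ℝ := fun z => e * e' * ((hh z).re - p.edge (hh z).im) with hΦ
  have hee : (e * e') * (e * e') = 1 := by
    rw [show (e * e') * (e * e') = (e * e) * (e' * e') by ring, h.mul_self, h'.mul_self, one_mul]
  have hΦreal : ∀ s : ℝ, |s - s₀| ≤ d → Φ s = θ^[k] s - T := fun s hs => by
    simp only [Φ]
    rw [hball' s (by rw [Metric.mem_ball, Real.dist_eq]; linarith)]
    simp only
    linear_combination (θ^[k] s - T) * hee
  have hΦc : ∀ z ∈ Metric.ball (s₀ : ℂ) r, ContinuousAt Φ z := fun z hz => by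
    obtain ⟨a1, -, a3, a4, -⟩ := hball z hz
    have b1 : ContinuousAt hh z := continuousAt_const.mul
      ((((X.chart σ).continuousAt a3).comp (hHc z a1)).pow _)
    have b2 : ContinuousAt p.edge (hh z).im := B.continuousOn_edge.continuousAt
      (Icc_mem_nhds (abs_lt.1 a4).1 (abs_lt.1 a4).2)
    exact continuousAt_const.mul ((Complex.continuous_re.continuousAt.comp b1).sub
      (ContinuousAt.comp (f := fun z => (hh z).im) b2 (Complex.continuous_im.continuousAt.comp b1)))
  have hmem₁ : |(s₀ - d) - s₀| ≤ d := by rw [sub_sub_cancel_left, abs_neg, abs_of_pos hd0]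
  have hmem₂ : |(s₀ + d) - s₀| ≤ d := by rw [add_sub_cancel_left, abs_of_pos hd0]
  have hrd : |(0 : ℝ)| < r - d := by rw [abs_zero]; linarith
  have hre : ∀ s : ℝ, |s - s₀| ≤ d → s ∈ Ioo p'.τ x₂ := fun s hs =>
    (hball _ (hmemball s 0 hs hrd)).2.1
  have hΦ₁ : Φ ((s₀ - d : ℝ) : ℂ) < 0 := by
    rw [hΦreal _ hmem₁, sub_neg, ← hs₀T]
    exact hitmono k (hre _ hmem₁).1.le hs₀.1.le (by linarith)
  have hΦ₂ : 0 < Φ ((s₀ + d : ℝ) : ℂ) := by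
    rw [hΦreal _ hmem₂, sub_pos, ← hs₀T]
    exact hitmono k hs₀.1.le (hre _ hmem₂).1.le (by linarith)
  have hvert : ∀ s : ℝ, |s - s₀| ≤ d → ContinuousAt (fun y : ℝ => Φ ⟨s, y⟩) 0 := fun s hs => by
    have hc : Continuous fun y : ℝ => (⟨s, y⟩ : ℂ) := by
      have : (fun y : ℝ => (⟨s, y⟩ : ℂ)) = fun y : ℝ => (s + y * Complex.I : ℂ) := by
        funext y; rw [Complex.mk_eq_add_mul_I]
      rw [this]; fun_prop
    exact ContinuousAt.comp (f := fun y : ℝ => (⟨s, y⟩ : ℂ)) (hΦc _ (hmemball s 0 hs hrd))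
      hc.continuousAt
  -- `Φ` has opposite signs at `s₀ - d` and `s₀ + d` at height `0`, hence also at small heights. The
  -- intermediate value theorem then gives a zero on each nearby horizontal segment, with no
  -- differentiability needed.
  have hev : ∀ᶠ y in 𝓝 (0 : ℝ), Φ ⟨s₀ - d, y⟩ < 0 ∧ 0 < Φ ⟨s₀ + d, y⟩ ∧ |y| < r - d :=
    ((hvert _ hmem₁).eventually_lt_const hΦ₁).and (((hvert _ hmem₂).eventually_const_lt hΦ₂).and
      (continuous_abs.continuousAt.eventually_lt_const hrd))
  obtain ⟨η, hη, hηb⟩ := Metric.eventually_nhds_iff_ball.1 hev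
  refine ⟨η, hη, fun y hy => ?_⟩
  obtain ⟨c1, c2, c3⟩ := hηb y (by simpa using hy)
  have habs : ∀ s ∈ Icc (s₀ - d) (s₀ + d), |s - s₀| ≤ d := fun s hs =>
    abs_le.2 ⟨by linarith [hs.1], by linarith [hs.2]⟩
  obtain ⟨s, hs, hs0⟩ := intermediate_value_Icc (by linarith : s₀ - d ≤ s₀ + d)
    (f := fun s : ℝ => Φ ⟨s, y⟩) (fun s hs => (ContinuousAt.comp (f := fun s : ℝ => (⟨s, y⟩ : ℂ))
      (hΦc _ (hmemball s y (habs s hs) c3))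
      (Profile.Box.continuous_mk_right y).continuousAt).continuousWithinAt)
    (show (0 : ℝ) ∈ Icc _ _ from ⟨c1.le, c2.le⟩)
  refine ⟨s, (hre s (habs s hs)).1.le, (hre s (habs s hs)).2.le, ?_⟩
  obtain ⟨-, -, -, a4, a5⟩ := hball _ (hmemball s y (habs s hs) c3)
  have hzero : (hh ⟨s, y⟩).re = p.edge (hh ⟨s, y⟩).im := by
    have hne0 : e * e' ≠ 0 := fun h0 => by rw [h0] at hee; norm_num at hee
    have : e * e' * ((hh ⟨s, y⟩).re - p.edge (hh ⟨s, y⟩).im) = 0 := hs0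
    exact sub_eq_zero.1 ((mul_eq_zero.1 this).resolve_left hne0)
  refine (P.iterate_mem_stable k).1 ?_
  change H ⟨s, y⟩ ∈ _
  rw [← a5, show hh ⟨s, y⟩ = ⟨p.edge (hh ⟨s, y⟩).im, (hh ⟨s, y⟩).im⟩ from Complex.ext hzero rfl]
  exact P.edge_mem_stable h a4.le

/-- Arbitrarily close to the right of the local stable manifold of a saddle there are points of
the stable set of every other saddle. -/
theorem exists_mem_stable_near_edge (h : IsSector X σ ζ e) (h' : IsSector X σ' ζ' e')
    (hne : branch X σ ζ (P.profile h.mem).τ ≠ branch X σ' ζ' (P.profile h'.mem).τ) {y : ℝ}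
    (hy : |y| ≤ (P.box h'.mem).ε) {s₀ : ℝ} (hs₀ : 0 < s₀) :
    ∃ q, (P.profile h'.mem).edge y ≤ q ∧ q < (P.profile h'.mem).edge y + s₀ ∧
      branch X σ' ζ' ⟨q, y⟩ ∈ P.stable (branch X σ ζ (P.profile h.mem).τ) := by
  obtain ⟨η, hη, hη'⟩ := P.exists_transverse h h' hne
  set p' := P.profile h'.mem
  set B := P.box h'.mem
  have h1 : Tendsto (fun m : ℕ => |φ.lam⁻¹ ^ m * y|) atTop (𝓝 0) := by
    have := ((tendsto_pow_atTop_nhds_zero_of_lt_one (inv_nonneg.2 φ.lam_pos.le)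
      (inv_lt_one_of_one_lt₀ φ.one_lt_lam)).mul_const y).abs
    simpa using this
  have h2 : Tendsto (fun m : ℕ => B.μ ^ m * s₀) atTop atTop :=
    (tendsto_pow_atTop_atTop_of_one_lt B.one_lt_μ).atTop_mul_const hs₀
  -- After `i` iterates the height is in the range of `exists_transverse`, and `i` inverse steps
  -- contract horizontal distances to the edge below `s₀`.
  obtain ⟨i, hi1, hi2⟩ := ((h1.eventually_lt_const hη).and
    (h2.eventually_gt_atTop (B.x₂ - B.x₁))).exists
  obtain ⟨s, hs1, hs2, hs3⟩ := hη' _ hi1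
  obtain ⟨q, q1, -, q3, q4, q5⟩ := B.exists_backward hy i
    ((B.edge_le_τ (p'.abs_inv_pow_mul_le hy i)).trans hs1) hs2
  refine ⟨q, q1, ?_, ?_⟩
  · have hμ : 0 < B.μ ^ i := pow_pos (zero_lt_one.trans B.one_lt_μ) i
    have := lt_of_mul_lt_mul_left (q3.trans_lt hi2) hμ.le
    linarith
  · refine (P.iterate_mem_stable i).1 ?_
    rw [h'.iterate_branch P i fun j hj => P.box_subset h'.mem (q5 j hj), q4]
    exact hs3

/-- A horizontal segment through a point of the stable set of a saddle meets the stable set of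
every other saddle. -/
theorem exists_mem_stable_of_mem_stable (h : IsSector X σ ζ e) (h' : IsSector X σ' ζ' e')
    (hne : branch X σ ζ (P.profile h.mem).τ ≠ branch X σ' ζ' (P.profile h'.mem).τ) {c : ℝ → S}
    {θ θ' : ℝ → ℝ} {U : Set ℝ} (hc : HPath X 1 c θ θ' U) (hU : IsOpen U) (hU' : U.OrdConnected)
    (hpos : ∀ t ∈ U, 0 < θ' t) {t₀ : ℝ} (ht₀ : t₀ ∈ U)
    (hst : c t₀ ∈ P.stable (branch X σ' ζ' (P.profile h'.mem).τ)) :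
    ∃ t ∈ U, c t ∈ P.stable (branch X σ ζ (P.profile h.mem).τ) := by
  set p' := P.profile h'.mem
  set B := P.box h'.mem
  obtain ⟨m, y, -, hy, hm⟩ := (P.exists_iterate_eq_edge h' hst one_pos).exists
  change P.f^[m] (c t₀) = branch X σ' ζ' ⟨p'.edge y, y⟩ at hm
  obtain ⟨θ₁, θ₁', H, hpos₁⟩ := hc.iterate_f P hU hU' hpos m
  have hz₀ : (⟨p'.edge y, y⟩ : ℂ) ∈ halfDisc X σ' := P.box_subset h'.mem (B.edge_mem hy.le)
  have hUt := hU.mem_nhds ht₀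
  have hgt : ContinuousAt (P.f^[m] ∘ c) t₀ := (H.dev.1 t₀ ht₀).continuousAt hUt
  have hsrc : (P.f^[m] ∘ c) t₀ ∈ (X.chart σ').source := by
    change P.f^[m] (c t₀) ∈ _
    rw [hm]
    exact h'.branch_mem hz₀.2
  have h1 := (H.dev.2 t₀ ht₀).2 _ _ (X.chart σ').open_source hsrc (X.chart_form σ' h'.mem)
  rw [nhdsWithin_eq_nhds.2 hUt] at h1
  have h2 : ∀ᶠ t in 𝓝 t₀, t ∈ U ∧
      P.f^[m] (c t) = branch X σ' ζ' ⟨p'.edge y + e' * (θ₁ t - θ₁ t₀), y⟩ := by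
    have h3 := hgt.eventually (show ∀ᶠ x in 𝓝 ((P.f^[m] ∘ c) t₀), _ from by
      simp only [Function.comp, hm]
      exact h'.eventually_branch_coord hz₀ univ_mem)
    filter_upwards [hUt, h1, h3] with t a1 a2 a3
    refine ⟨a1, ?_⟩
    obtain ⟨-, -, a4⟩ := a3
    simp only [Function.comp] at a2 a4
    rw [hm, h'.coord_branch hz₀.2, sub_eq_iff_eq_add] at a2
    rw [← a4, a2]
    congr 1
    rw [mul_add, ← mul_assoc (e' : ℂ) e', h'.mul_self', one_mul]
    apply Complex.ext
    · simp; ring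
    · simp
  obtain ⟨r, hr, hb⟩ := Metric.eventually_nhds_iff_ball.1 h2
  have hsub : Icc (t₀ - r / 2) (t₀ + r / 2) ⊆ Metric.ball t₀ r := fun t ht => by
    rw [Metric.mem_ball, Real.dist_eq, abs_lt]
    constructor <;> linarith [ht.1, ht.2]
  have hd : ∀ t ∈ Icc (t₀ - r / 2) (t₀ + r / 2), HasDerivAt θ₁ (θ₁' t) t := fun t ht =>
    H.hasDerivAt t (hb t (hsub ht)).1
  have hcont : ContinuousOn θ₁ (Icc (t₀ - r / 2) (t₀ + r / 2)) := fun t ht =>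
    (hd t ht).continuousAt.continuousWithinAt
  have hmono : StrictMonoOn θ₁ (Icc (t₀ - r / 2) (t₀ + r / 2)) :=
    strictMonoOn_of_deriv_pos (convex_Icc _ _) hcont fun t ht => by
      rw [(hd t (interior_subset ht)).deriv]
      exact hpos₁ t (hb t (hsub (interior_subset ht))).1
  have i0 : t₀ ∈ Icc (t₀ - r / 2) (t₀ + r / 2) := ⟨by linarith, by linarith⟩
  have i1 : t₀ - r / 2 ∈ Icc (t₀ - r / 2) (t₀ + r / 2) := ⟨le_rfl, by linarith⟩
  have i2 : t₀ + r / 2 ∈ Icc (t₀ - r / 2) (t₀ + r / 2) := ⟨by linarith, le_rfl⟩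
  have l1 := hmono i1 i0 (by linarith)
  have l2 := hmono i0 i2 (by linarith)
  -- Room is kept on both sides of `t₀`: the orientation `e'` of the sector decides on which side
  -- the point `q` is reached.
  set s₀ := min (θ₁ (t₀ + r / 2) - θ₁ t₀) (θ₁ t₀ - θ₁ (t₀ - r / 2))
  have hs₀ : 0 < s₀ := lt_min (sub_pos.2 l2) (sub_pos.2 l1)
  obtain ⟨q, q1, q2, q3⟩ := P.exists_mem_stable_near_edge h h' hne hy.le hs₀
  have hq1 : q - p'.edge y ≤ θ₁ (t₀ + r / 2) - θ₁ t₀ := by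
    have := min_le_left (θ₁ (t₀ + r / 2) - θ₁ t₀) (θ₁ t₀ - θ₁ (t₀ - r / 2))
    linarith
  have hq2 : q - p'.edge y ≤ θ₁ t₀ - θ₁ (t₀ - r / 2) := by
    have := min_le_right (θ₁ (t₀ + r / 2) - θ₁ t₀) (θ₁ t₀ - θ₁ (t₀ - r / 2))
    linarith
  obtain ⟨t, ht, htv⟩ := intermediate_value_Icc (by linarith : t₀ - r / 2 ≤ t₀ + r / 2) hcont
    (show θ₁ t₀ + e' * (q - p'.edge y) ∈ Icc _ _ from by
      rcases h'.sign with he | he <;> rw [he] <;> constructor <;> linarith)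
  obtain ⟨k1, k2⟩ := hb t (hsub ht)
  refine ⟨t, k1, (P.iterate_mem_stable m).1 ?_⟩
  rw [k2, htv, add_sub_cancel_left, ← mul_assoc, h'.mul_self, one_mul, add_sub_cancel]
  exact q3

/-- The stable set of every saddle is dense in the invariant set. -/
theorem K_eq_closure_stable (h : IsSector X σ ζ e) :
    P.K = closure (P.stable (branch X σ ζ (P.profile h.mem).τ)) := by
  refine Subset.antisymm (fun x hx => ?_)
    (closure_minimal (P.stable_subset_K h) P.isClosed_K)
  rw [mem_closure_iff]
  intro N hN hxN
  obtain ⟨r, hr, E, hE0, hE⟩ := X.exists_exp (P.notMem_sing_of_mem_K hx)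
  have hEN : ∀ᶠ t : ℝ in 𝓝 0, E t ∈ N ∧ (t : ℂ) ∈ Metric.ball (0 : ℂ) r := by
    have hc : ContinuousAt E ((0 : ℝ) : ℂ) := by
      rw [Complex.ofReal_zero]
      exact (hE.1 0 (Metric.mem_ball_self hr)).continuousAt (Metric.ball_mem_nhds 0 hr)
    have hc2 : ContinuousAt (fun t : ℝ => (t : ℂ)) 0 := Complex.continuous_ofReal.continuousAt
    refine ((ContinuousAt.comp (f := fun t : ℝ => (t : ℂ)) hc hc2).eventually
      (hN.mem_nhds (by simpa [hE0] using hxN))).and (hc2.eventually ?_)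
    change ∀ᶠ y in 𝓝 ((0 : ℝ) : ℂ), _
    rw [Complex.ofReal_zero]
    exact Filter.eventually_of_mem (Metric.ball_mem_nhds 0 hr) fun _ h => h
  obtain ⟨L, hL, hLb⟩ := Metric.eventually_nhds_iff_ball.1 hEN
  have hmem : ∀ t ∈ Ioo (-L) L, E t ∈ N ∧ (t : ℂ) ∈ Metric.ball (0 : ℂ) r := fun t ht =>
    hLb t (by rw [mem_ball_zero_iff, Real.norm_eq_abs]; exact abs_lt.2 ht)
  have hD : Dev X (line (1 : ℝ)) (fun t : ℝ => E (0 + t * ((1 : ℝ) : ℂ))) (Ioo (-L) L) :=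
    hE.comp_line 0 _ fun t ht => by simpa using (hmem t ht).2
  simp only [zero_add, Complex.ofReal_one, mul_one] at hD
  rw [← Complex.ofReal_one] at hD
  have h0 : (0 : ℝ) ∈ Ioo (-L) L := ⟨by linarith, hL⟩
  -- The short horizontal segment through `x` is not contained in `K`, so it enters a basin and
  -- crosses the stable set of some saddle. If this is not the given one, a second crossing on the
  -- same segment is supplied by `exists_mem_stable_of_mem_stable`.
  have hnot : ∃ t ∈ Ioo (-L) L, E t ∉ P.K := by
    by_contra hcon
    push Not at hcon
    exact P.not_hasSegment hL x ⟨_, hD, by simpa using hE0, hcon⟩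
  obtain ⟨t₂, ht₂, htK⟩ := hnot
  rw [P.mem_K] at htK
  push Not at htK
  obtain ⟨σ₂, hσ₂, hb⟩ := htK
  have hH := HPath.of_line hD
  obtain ⟨t, ht, ζ', e', h', hst⟩ := hH.exists_mem_stable P isOpen_Ioo ordConnected_Ioo
    (fun _ _ => one_pos) hσ₂ h0 ht₂
    (by simpa [hE0] using P.mem_K.1 hx σ₂ hσ₂) hb
  have htL : t ∈ Ioo (-L) L := ordConnected_Ioo.uIcc_subset h0 ht₂ ht
  by_cases hne : branch X σ ζ (P.profile h.mem).τ = branch X σ₂ ζ' (P.profile h'.mem).τ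
  · rw [← hne] at hst
    exact ⟨_, (hmem t htL).1, hst⟩
  · obtain ⟨s, hs, hst'⟩ := P.exists_mem_stable_of_mem_stable h h' hne hH isOpen_Ioo
      ordConnected_Ioo (fun _ _ => one_pos) htL hst
    exact ⟨_, (hmem s hs).1, hst'⟩

end Perturbation

/-! ### The slope series and the stable vector field. -/

variable {S : Type*} [MetricSpace S] [CompactSpace S] [ChartedSpace ℂ S] [IsManifold 𝓘(ℂ) 1 S]
  {X : ConicalSurface S} {φ : LinearPA X} (P : Perturbation φ) {σ : S} {x : S}

namespace Perturbation

theorem vsTerm_zero (x : S) : P.vsTerm x 0 = (P.a x)⁻¹ * P.b x := by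
  simp [vsTerm, mul_comm]

theorem vsTerm_succ (x : S) (i : ℕ) :
    P.vsTerm x (i + 1) = (P.a x)⁻¹ * (φ.lam⁻¹ * P.vsTerm (P.f x) i) := by
  simp only [vsTerm]
  rw [Finset.prod_range_succ']
  simp only [Function.iterate_succ_apply, Function.iterate_zero, id]
  ring

theorem sum_abs_vsTerm_succ (hx : x ∉ X.sing) (n : ℕ) :
    ∑ i ∈ Finset.range (n + 1), |P.vsTerm x i| =
      (P.a x)⁻¹ * (|P.b x| + φ.lam⁻¹ * ∑ i ∈ Finset.range n, |P.vsTerm (P.f x) i|) := by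
  have ha : 0 ≤ (P.a x)⁻¹ := inv_nonneg.2 (P.a_pos hx).le
  have hl : 0 ≤ φ.lam⁻¹ := inv_nonneg.2 φ.lam_pos.le
  rw [Finset.sum_range_succ', vsTerm_zero, mul_add, Finset.mul_sum, Finset.mul_sum, add_comm,
    abs_mul, abs_of_nonneg ha]
  congr 1
  refine Finset.sum_congr rfl fun i _ => ?_
  rw [vsTerm_succ, abs_mul, abs_mul, abs_of_nonneg ha, abs_of_nonneg hl]

theorem inv_sq_lt_one (φ : LinearPA X) : φ.lam⁻¹ * φ.lam⁻¹ < 1 := by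
  have hl1 : φ.lam⁻¹ < 1 := inv_lt_one_of_one_lt₀ φ.one_lt_lam
  have hl0 : 0 < φ.lam⁻¹ := inv_pos.2 φ.lam_pos
  nlinarith

/-- In the trap the series for the slope is controlled by the product of the coordinates. -/
theorem exists_sum_le_of_mem_trap (hσ : σ ∈ X.sing) : ∃ C ≥ 0, ∀ n, ∀ x ∈ P.trap hσ, x ≠ σ →
    ∑ i ∈ Finset.range n, |P.vsTerm x i| ≤
      C * (|(X.chart σ x ^ X.n σ).re| * |(X.chart σ x ^ X.n σ).im|) := by
  set p := P.profile hσ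
  obtain ⟨C, hC, hb⟩ := p.exists_abs_b_le
  have hl0 : 0 < φ.lam⁻¹ := inv_pos.2 φ.lam_pos
  have hsq := inv_sq_lt_one φ
  have hκ : 0 < p.κ 0 := p.pos
  -- `D` is the fixed point of `D ↦ C / κ 0 + lam⁻² D`, which is the recursion for partial sums
  -- after division by `a`.
  set D := C / p.κ 0 / (1 - φ.lam⁻¹ * φ.lam⁻¹)
  have hD : 0 ≤ D := div_nonneg (div_nonneg hC hκ.le) (by linarith)
  have hDe : C / p.κ 0 + φ.lam⁻¹ * φ.lam⁻¹ * D = D := by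
    have : D * (1 - φ.lam⁻¹ * φ.lam⁻¹) = C / p.κ 0 := div_mul_cancel₀ _ (by linarith)
    linarith
  refine ⟨D, hD, fun n => ?_⟩
  induction n with
  | zero => intro x _ _; simpa using by positivity
  | succ n ih =>
    intro x hx hxσ
    have hxs := X.notMem_sing_of_mem_source hσ hx.1 hxσ
    obtain ⟨h1, h2⟩ := P.f_trap hσ hx
    have h3 := ih _ h1 fun h => hxs (P.f_mem_sing.1 (h.symm ▸ hσ))
    rw [P.sum_abs_vsTerm_succ hxs, P.a_disc hσ hx.1 hxσ, P.b_disc hσ hx.1 hxσ]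
    rw [h2] at h3
    set z := X.chart σ x ^ X.n σ
    have ha := p.a_pos z
    -- One iterate multiplies the product of the coordinates by `κ lam⁻¹`. The factor `κ` absorbs
    -- the division by `a ≥ κ`, however small `a` is.
    have h4 : |(p.map z).re| * |(p.map z).im| = p.κ ‖z‖ * φ.lam⁻¹ * (|z.re| * |z.im|) := by
      change |p.κ ‖z‖ * z.re| * |φ.lam⁻¹ * z.im| = _
      rw [abs_mul, abs_mul, abs_of_pos (p.κ_norm_pos z), abs_of_pos hl0]
      ring
    rw [h4] at h3
    have hq : 0 ≤ |z.re| * |z.im| := by positivity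
    rw [inv_mul_le_iff₀ ha]
    have h5 : C ≤ p.a z * (C / p.κ 0) := by
      rw [mul_div_assoc', le_div_iff₀ hκ, mul_comm]
      exact mul_le_mul_of_nonneg_right (p.κ_zero_le_a z) hC
    calc |p.b z| + φ.lam⁻¹ * ∑ i ∈ Finset.range n, |P.vsTerm (P.f x) i|
        ≤ C * (|z.re| * |z.im|) +
          φ.lam⁻¹ * (D * (p.κ ‖z‖ * φ.lam⁻¹ * (|z.re| * |z.im|))) :=
        add_le_add (hb z) (mul_le_mul_of_nonneg_left h3 hl0.le)
      _ = C * (|z.re| * |z.im|) +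
          p.κ ‖z‖ * (φ.lam⁻¹ * φ.lam⁻¹ * D * (|z.re| * |z.im|)) := by ring
      _ ≤ p.a z * (C / p.κ 0) * (|z.re| * |z.im|) +
          p.a z * (φ.lam⁻¹ * φ.lam⁻¹ * D * (|z.re| * |z.im|)) :=
        add_le_add (mul_le_mul_of_nonneg_right h5 hq)
          (mul_le_mul_of_nonneg_right (p.κ_le_a z) (by positivity))
      _ = p.a z * ((C / p.κ 0 + φ.lam⁻¹ * φ.lam⁻¹ * D) * (|z.re| * |z.im|)) := by ring
      _ = _ := by rw [hDe]

/-- The series for the slope of the stable vector field is uniformly bounded. -/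
theorem exists_sum_abs_vsTerm_le : ∃ M ≥ 0, ∀ n, ∀ x ∉ X.sing,
    ∑ i ∈ Finset.range n, |P.vsTerm x i| ≤ M := by
  have h : ∀ σ : S, ∃ C ≥ (0 : ℝ), ∀ hσ : σ ∈ X.sing, ∀ n, ∀ x ∈ P.trap hσ, x ≠ σ →
      ∑ i ∈ Finset.range n, |P.vsTerm x i| ≤ C := fun σ => by
    by_cases hσ : σ ∈ X.sing
    · obtain ⟨C, h0, hC⟩ := P.exists_sum_le_of_mem_trap hσ
      have hτ := (P.profile hσ).τ_pos
      refine ⟨C * ((P.profile hσ).τ * (P.profile hσ).τ), by positivity, fun _ n x hx hxσ =>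
        (hC n x hx hxσ).trans (mul_le_mul_of_nonneg_left ?_ h0)⟩
      exact mul_le_mul ((Complex.abs_re_le_norm _).trans hx.2.le)
        ((Complex.abs_im_le_norm _).trans hx.2.le) (abs_nonneg _) hτ.le
    · exact ⟨0, le_rfl, fun h => (hσ h).elim⟩
  choose C hC0 hC using h
  obtain ⟨B, hB0, hB⟩ := P.exists_abs_b_le
  have hl0 : 0 < φ.lam⁻¹ := inv_pos.2 φ.lam_pos
  have hl1 : φ.lam⁻¹ < 1 := inv_lt_one_of_one_lt₀ φ.one_lt_lam
  set Cs := ∑ σ ∈ X.finite_sing.toFinset, C σ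
  have hCs : 0 ≤ Cs := Finset.sum_nonneg fun σ _ => hC0 σ
  -- `Cs` bounds the sums started in a trap. Outside the traps `a ≥ 1`, and the second summand makes
  -- `B + lam⁻¹ M ≤ M`, which closes the induction.
  set M := Cs + B / (1 - φ.lam⁻¹)
  have hBM : 0 ≤ B / (1 - φ.lam⁻¹) := div_nonneg hB0 (by linarith)
  have hM : B + φ.lam⁻¹ * M ≤ M := by
    have h1 : B / (1 - φ.lam⁻¹) * (1 - φ.lam⁻¹) = B := div_mul_cancel₀ _ (by linarith)
    have h2 := mul_le_mul_of_nonneg_right hl1.le hCs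
    have h3 : M = Cs + B / (1 - φ.lam⁻¹) := rfl
    rw [h3]
    linarith
  refine ⟨M, by positivity, fun n => ?_⟩
  induction n with
  | zero => intro x _; simpa using by positivity
  | succ n ih =>
    intro x hx
    by_cases ht : ∃ σ, ∃ hσ : σ ∈ X.sing, x ∈ P.trap hσ
    · obtain ⟨σ, hσ, ht⟩ := ht
      have h1 := hC σ hσ (n + 1) x ht fun h => hx (h ▸ hσ)
      have h2 := Finset.single_le_sum (f := C) (fun σ _ => hC0 σ) (X.finite_sing.mem_toFinset.2 hσ)
      exact h1.trans (h2.trans (le_add_of_nonneg_right hBM))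
    · push Not at ht
      have h1 := P.one_le_a ht
      have h2 := ih _ (mt P.f_mem_sing.1 hx)
      rw [P.sum_abs_vsTerm_succ hx, inv_mul_le_iff₀ (P.a_pos hx)]
      have h3 := mul_le_mul_of_nonneg_left h2 hl0.le
      have hM0 : 0 ≤ M := by positivity
      have h4 := le_mul_of_one_le_left hM0 h1
      linarith [hB x hx]

theorem summable_abs_vsTerm (hx : x ∉ X.sing) : Summable fun i => |P.vsTerm x i| := by
  obtain ⟨M, -, hM⟩ := P.exists_sum_abs_vsTerm_le
  have h0 : ∀ i, 0 ≤ |P.vsTerm x i| := fun i => abs_nonneg (P.vsTerm x i)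
  exact summable_of_sum_range_le h0 fun n => hM n x hx

theorem summable_vsTerm (hx : x ∉ X.sing) : Summable (P.vsTerm x) :=
  (P.summable_abs_vsTerm hx).of_abs

/-- The slope of the stable direction. -/
def slope (x : S) : ℝ := ∑' i, P.vsTerm x i

theorem exists_abs_slope_le : ∃ M ≥ 0, ∀ x ∉ X.sing, |P.slope x| ≤ M := by
  obtain ⟨M, h0, hM⟩ := P.exists_sum_abs_vsTerm_le
  refine ⟨M, h0, fun x hx => ?_⟩
  have h0 : ∀ i, 0 ≤ |P.vsTerm x i| := fun i => abs_nonneg (P.vsTerm x i)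
  have h1 : ∑' i, |P.vsTerm x i| ≤ M := Real.tsum_le_of_sum_range_le h0 fun n => hM n x hx
  exact le_trans (norm_tsum_le_tsum_norm (f := P.vsTerm x) (P.summable_abs_vsTerm hx)) h1

/-- Splitting off the first term of the series and shifting the rest. This is the invariance of the
stable direction under the differential. -/
theorem a_mul_slope (hx : x ∉ X.sing) :
    P.a x * P.slope x = P.b x + φ.lam⁻¹ * P.slope (P.f x) := by
  rw [slope, (P.summable_vsTerm hx).tsum_eq_zero_add]
  simp only [vsTerm_zero, vsTerm_succ, tsum_mul_left]
  rw [mul_add, mul_inv_cancel_left₀ (P.a_pos hx).ne', mul_inv_cancel_left₀ (P.a_pos hx).ne', slope]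

theorem vs_eq (x : S) : P.vs x = ⟨-P.slope x, 1⟩ := by
  apply Complex.ext <;> simp [vs, slope]

theorem norm_vs_le {M : ℝ} (h : |P.slope x| ≤ M) : ‖P.vs x‖ ≤ M + 1 := by
  rw [vs_eq]
  refine (Complex.norm_le_abs_re_add_abs_im _).trans ?_
  simpa using h

theorem flatDeriv_vs (hx : x ∉ X.sing) :
    P.flatDeriv x (P.vs x) = (φ.lam⁻¹ : ℝ) * P.vs (P.f x) := by
  have h := P.a_mul_slope hx
  rw [P.flatDeriv_apply hx, vs_eq, vs_eq]
  apply Complex.ext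
  · simp; linarith
  · simp

theorem exists_flatDeriv_left_inv (hx : x ∉ X.sing) :
    ∃ B : ℂ →L[ℝ] ℂ, ∀ v, B (P.flatDeriv x v) = v := by
  have hinj : LinearMap.ker (P.flatDeriv x : ℂ →ₗ[ℝ] ℂ) = ⊥ := by
    rw [LinearMap.ker_eq_bot']
    intro v hv
    have hv' : P.flatDeriv x v = 0 := hv
    rw [P.flatDeriv_apply hx] at hv'
    have h1 := congr_arg Complex.re hv'
    have h2 := congr_arg Complex.im hv'
    simp only [Complex.zero_re, Complex.zero_im] at h1 h2
    have h3 : v.im = 0 := (mul_eq_zero.1 h2).resolve_left (inv_pos.2 φ.lam_pos).ne'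
    rw [h3, mul_zero, add_zero] at h1
    exact Complex.ext ((mul_eq_zero.1 h1).resolve_left (P.a_pos hx).ne') h3
  obtain ⟨B, hB⟩ := LinearMap.exists_leftInverse_of_injective _ hinj
  exact ⟨LinearMap.toContinuousLinearMap B, fun v => LinearMap.congr_fun hB v⟩

end Perturbation

/-- The curve `c` moves at time `t` with velocity `v`, in flat coordinates. -/
def HasVelocity (X : ConicalSurface S) (c : ℝ → S) (v : ℂ) (t : ℝ) : Prop :=
  ContinuousAt c t ∧ c t ∉ X.sing ∧ ∀ (U : Set S) (F : S → ℂ), IsOpen U → c t ∈ U →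
    IsPrimitiveOn X.form F U → HasDerivAt (fun s => F (c s)) v t

/-! ### Velocities of curves and their transport by `f`. -/

namespace HasVelocity

variable {c : ℝ → S} {v : ℂ} {t : ℝ}

theorem of_coord {U : Set S} {F : S → ℂ} (hc : ContinuousAt c t) (ht : c t ∉ X.sing)
    (hU : IsOpen U) (hcU : c t ∈ U) (hF : IsPrimitiveOn X.form F U)
    (h : HasDerivAt (fun s => F (c s)) v t) : HasVelocity X c v t := by
  refine ⟨hc, ht, fun V G hV hcV hG => ?_⟩
  have h1 := hc.eventually (hG.eventually_sub_eq hF hV hU hcV hcU)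
  refine (h.add_const (G (c t) - F (c t))).congr_of_eventuallyEq ?_
  filter_upwards [h1] with s hs
  linear_combination hs

theorem f (h : HasVelocity X c v t) :
    HasVelocity X (fun s => P.f (c s)) (P.flatDeriv (c t) v) t := by
  obtain ⟨hc, ht, hF⟩ := h
  obtain ⟨e, h1, -, h3⟩ := X.exists_regular_chart ht univ_mem
  obtain ⟨e', h1', -, h3'⟩ := X.exists_regular_chart (mt P.f_mem_sing.1 ht) univ_mem
  refine of_coord ((P.continuous_f.continuousAt).comp hc) (mt P.f_mem_sing.1 ht) e'.open_source h1'
    h3' ?_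
  have h4 := (Perturbation.HasFlatDerivAt.hasFDerivAt P (P.hasFlatDerivAt ht) h1 h3 e'.open_source
    h1' h3').comp_hasDerivAt t (hF _ _ e.open_source h1 h3)
  refine h4.congr_of_eventuallyEq ?_
  filter_upwards [hc.eventually (e.open_source.mem_nhds h1)] with s hs
  simp only [Function.comp, e.left_inv hs]

/-- Velocities can be pulled back because the differential has a left inverse `B`. Applying `B` to
the linearisation of `f` recovers the displacement of `c` up to an error. -/
theorem of_f (hc : ContinuousAt c t) (ht : c t ∉ X.sing)
    (h : HasVelocity X (fun s => P.f (c s)) (P.flatDeriv (c t) v) t) : HasVelocity X c v t := by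
  obtain ⟨e, h1, -, h3⟩ := X.exists_regular_chart ht univ_mem
  obtain ⟨e', h1', -, h3'⟩ := X.exists_regular_chart (mt P.f_mem_sing.1 ht) univ_mem
  refine of_coord hc ht e.open_source h1 h3 ?_
  obtain ⟨B, hB⟩ := P.exists_flatDeriv_left_inv ht
  set A := P.flatDeriv (c t)
  have h4 : (fun s => e' (P.f (c s)) - e' (P.f (c t)) - A (e (c s) - e (c t))) =o[𝓝 t]
      fun s => e (c s) - e (c t) := (P.hasFlatDerivAt ht e.source e'.source e e' e.open_source h1 h3
    e'.open_source h1' h3').comp_tendsto hc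
  have h5 : (fun s => e' (P.f (c s)) - e' (P.f (c t)) - (s - t) • A v) =o[𝓝 t] fun s => s - t :=
    hasDerivAt_iff_isLittleO.1 (h.2.2 _ _ e'.open_source h1' h3')
  have h6 := (B.isBigO_comp (fun s => e' (P.f (c s)) - e' (P.f (c t)) - A (e (c s) - e (c t)))
    (𝓝 t)).trans_isLittleO h4
  have h7 := (B.isBigO_comp (fun s => e' (P.f (c s)) - e' (P.f (c t)) - (s - t) • A v)
    (𝓝 t)).trans_isLittleO h5
  -- The linearisation error is small only relative to the unknown displacement, so the displacement
  -- must first be bounded by `s - t`: the error is absorbed, since a quantity is dominated by its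
  -- sum with something negligible against it.
  have hu : (fun s => e (c s) - e (c t)) =O[𝓝 t] fun s => s - t := by
    have h9 : (fun s => e (c s) - e (c t)) =O[𝓝 t]
        fun s => B (e' (P.f (c s)) - e' (P.f (c t)) - A (e (c s) - e (c t))) +
          (e (c s) - e (c t)) := h6.right_isBigO_add
    refine h9.trans ?_
    have h10 : (fun s => (s - t) • v) =O[𝓝 t] fun s => s - t :=
      Asymptotics.IsBigO.of_bound ‖v‖ (Eventually.of_forall fun s => by
        rw [norm_smul, mul_comm])
    refine (h7.isBigO.add h10).congr_left fun s => ?_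
    rw [map_sub B _ (A _), hB, map_sub B _ ((s - t) • A v), map_smul, hB]
    abel
  rw [hasDerivAt_iff_isLittleO]
  refine (h7.sub (h6.trans_isBigO hu)).congr_left fun s => ?_
  rw [map_sub B _ (A _), hB, map_sub B _ ((s - t) • A v), map_smul, hB]
  abel

end HasVelocity

/-! ### The stable leaf of a saddle as a trajectory. -/

variable {S : Type*} [MetricSpace S] [CompactSpace S] [ChartedSpace ℂ S] [IsManifold 𝓘(ℂ) 1 S]
  {X : ConicalSurface S} {φ : LinearPA X} (P : Perturbation φ) {σ : S} {x : S} {ζ : ℂ} {e : ℝ}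

theorem HasVelocity.comp_const_mul {c : ℝ → S} {v : ℂ} (k : ℝ) {t : ℝ}
    (h : HasVelocity X c v (k * t)) : HasVelocity X (fun s => c (k * s)) (k * v) t := by
  obtain ⟨h1, h2, h3⟩ := h
  refine ⟨ContinuousAt.comp (f := fun s => k * s) h1 (by fun_prop), h2, fun U F hU hcU hF => ?_⟩
  have h4 : HasDerivAt (fun s : ℝ => k * s) k t := by
    simpa using (hasDerivAt_id t).const_mul k
  have h5 := (h3 U F hU hcU hF).scomp t h4
  rwa [Complex.real_smul] at h5

theorem HasVelocity.congr {c c' : ℝ → S} {v : ℂ} {t : ℝ} (h : HasVelocity X c v t)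
    (hc : c' =ᶠ[𝓝 t] c) : HasVelocity X c' v t := by
  obtain ⟨h1, h2, h3⟩ := h
  have ht := hc.self_of_nhds
  refine ⟨h1.congr hc.symm, ht ▸ h2, fun U F hU hcU hF => ?_⟩
  refine (h3 U F hU (ht ▸ hcU) hF).congr_of_eventuallyEq ?_
  filter_upwards [hc] with s hs
  rw [hs]

namespace Perturbation

/-- The local stable manifold of the saddle of a sector, parametrised by height. -/
def arc (hσ : σ ∈ X.sing) (ζ : ℂ) (y : ℝ) : S := branch X σ ζ ⟨(P.profile hσ).edge y, y⟩

theorem exists_abs_inv_pow_mul_lt (φ : LinearPA X) {ε : ℝ} (hε : 0 < ε) (s : ℝ) :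
    ∃ m : ℕ, ∀ k ≥ m, |φ.lam⁻¹ ^ k * s| < ε := by
  have h := (tendsto_pow_atTop_nhds_zero_of_lt_one (inv_nonneg.2 φ.lam_pos.le)
    (inv_lt_one_of_one_lt₀ φ.one_lt_lam)).mul_const s
  rw [zero_mul] at h
  have h2 := h.abs
  rw [abs_zero] at h2
  exact eventually_atTop.1 (h2.eventually_lt_const hε)

/-- The number of iterates that bring the point at height `s` to the local stable manifold. -/
def entry (hσ : σ ∈ X.sing) (s : ℝ) : ℕ :=
  (exists_abs_inv_pow_mul_lt φ (P.box hσ).ε_pos s).choose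

theorem lt_of_entry (hσ : σ ∈ X.sing) (s : ℝ) :
    |φ.lam⁻¹ ^ P.entry hσ s * s| < (P.box hσ).ε :=
  (exists_abs_inv_pow_mul_lt φ (P.box hσ).ε_pos s).choose_spec _ le_rfl

/-- The stable manifold of the saddle of a sector, parametrised by height. -/
def leaf (hσ : σ ∈ X.sing) (ζ : ℂ) (s : ℝ) : S :=
  P.homeo.symm^[P.entry hσ s] (P.arc hσ ζ (φ.lam⁻¹ ^ P.entry hσ s * s))

theorem iterate_injective (m : ℕ) : Function.Injective P.f^[m] := P.injective_f.iterate m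

theorem iterate_homeo_symm (m : ℕ) (x : S) : P.f^[m] (P.homeo.symm^[m] x) = x := by
  rw [← P.coe_homeo]
  exact Function.LeftInverse.iterate P.homeo.apply_symm_apply m x

theorem iterate_arc (h : IsSector X σ ζ e) {y : ℝ} (hy : |y| ≤ (P.box h.mem).ε) (m : ℕ) :
    P.f^[m] (P.arc h.mem ζ y) = P.arc h.mem ζ (φ.lam⁻¹ ^ m * y) := P.iterate_edge_branch h hy m

/-- The iterate used to define `leaf` does not matter: the arcs are compatible under `f`, which
divides heights by `lam`, and `f` is injective. -/
theorem iterate_leaf (h : IsSector X σ ζ e) {s : ℝ} {m : ℕ}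
    (hm : |φ.lam⁻¹ ^ m * s| < (P.box h.mem).ε) :
    P.f^[m] (P.leaf h.mem ζ s) = P.arc h.mem ζ (φ.lam⁻¹ ^ m * s) := by
  have h0 := P.lt_of_entry h.mem s
  have h1 : P.f^[P.entry h.mem s] (P.leaf h.mem ζ s) = _ := P.iterate_homeo_symm _ _
  rcases le_total (P.entry h.mem s) m with hle | hle
  · obtain ⟨k, rfl⟩ := Nat.exists_eq_add_of_le' hle
    rw [Function.iterate_add_apply, h1, P.iterate_arc h h0.le, ← mul_assoc, ← pow_add]
  · obtain ⟨k, hk⟩ := Nat.exists_eq_add_of_le' hle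
    apply P.iterate_injective k
    rw [P.iterate_arc h hm.le, ← Function.iterate_add_apply, ← hk, h1, ← mul_assoc, ← pow_add, ← hk]

theorem eq_leaf (h : IsSector X σ ζ e) {s : ℝ} {m : ℕ}
    (hm : |φ.lam⁻¹ ^ m * s| < (P.box h.mem).ε)
    (hx : P.f^[m] x = P.arc h.mem ζ (φ.lam⁻¹ ^ m * s)) : x = P.leaf h.mem ζ s :=
  P.iterate_injective m (hx.trans (P.iterate_leaf h hm).symm)

theorem leaf_eq_arc (h : IsSector X σ ζ e) {s : ℝ} (hs : |s| < (P.box h.mem).ε) :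
    P.leaf h.mem ζ s = P.arc h.mem ζ s := by
  have := P.iterate_leaf h (s := s) (m := 0) (by simpa using hs)
  simpa using this

theorem leaf_zero (h : IsSector X σ ζ e) :
    P.leaf h.mem ζ 0 = branch X σ ζ (P.profile h.mem).τ := by
  rw [P.leaf_eq_arc h (by simpa using (P.box h.mem).ε_pos), arc, (P.box h.mem).edge_zero]
  rfl

/-- A point of the stable set arrives after `m` steps on the local stable manifold at some height
`y`, so it is the leaf point at height `lam ^ m * y`. -/
theorem range_leaf (h : IsSector X σ ζ e) :
    range (P.leaf h.mem ζ) = P.stable (branch X σ ζ (P.profile h.mem).τ) := by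
  ext x
  constructor
  · rintro ⟨s, rfl⟩
    rw [← P.iterate_mem_stable (P.entry h.mem s), P.iterate_leaf h (P.lt_of_entry h.mem s)]
    exact P.edge_mem_stable h (P.lt_of_entry h.mem s).le
  · intro hx
    obtain ⟨m, y, -, hy, hm⟩ := (P.exists_iterate_eq_edge h hx one_pos).exists
    have hl := φ.lam_pos.ne'
    have h1 : φ.lam⁻¹ ^ m * (φ.lam ^ m * y) = y := by
      rw [← mul_assoc, ← mul_pow, inv_mul_cancel₀ hl, one_pow, one_mul]
    exact ⟨φ.lam ^ m * y, (P.eq_leaf h (m := m) (by rwa [h1]) (by rwa [h1])).symm⟩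

theorem arc_mem (hσ : σ ∈ X.sing) {y : ℝ} (hy : |y| ≤ (P.box hσ).ε) :
    (⟨(P.profile hσ).edge y, y⟩ : ℂ) ∈ halfDisc X σ := P.box_subset hσ ((P.box hσ).edge_mem hy)

theorem continuousAt_arc (h : IsSector X σ ζ e) {y : ℝ} (hy : |y| < (P.box h.mem).ε) :
    ContinuousAt (P.arc h.mem ζ) y := by
  have h1 : ContinuousAt (P.profile h.mem).edge y :=
    (P.box h.mem).continuousOn_edge.continuousAt (Icc_mem_nhds (abs_lt.1 hy).1 (abs_lt.1 hy).2)
  have h2 : ContinuousAt (fun y : ℝ => (⟨(P.profile h.mem).edge y, y⟩ : ℂ)) y := by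
    have : (fun y : ℝ => (⟨(P.profile h.mem).edge y, y⟩ : ℂ)) =
        fun y => ((P.profile h.mem).edge y : ℂ) + y * Complex.I := by
      funext y; exact Complex.mk_eq_add_mul_I _ _
    rw [this]
    exact (Complex.continuous_ofReal.continuousAt.comp h1).add (by fun_prop)
  exact ContinuousAt.comp (f := fun y : ℝ => (⟨(P.profile h.mem).edge y, y⟩ : ℂ))
    (h.continuousAt_branch (P.arc_mem h.mem hy.le)) h2

theorem eventually_leaf (h : IsSector X σ ζ e) {s : ℝ} {m : ℕ}
    (hm : |φ.lam⁻¹ ^ m * s| < (P.box h.mem).ε) : ∀ᶠ s' in 𝓝 s,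
    P.f^[m] (P.leaf h.mem ζ s') = P.arc h.mem ζ (φ.lam⁻¹ ^ m * s') := by
  have hc : ContinuousAt (fun s' : ℝ => |φ.lam⁻¹ ^ m * s'|) s := by fun_prop
  filter_upwards [hc.eventually_lt_const hm] with s' hs' using P.iterate_leaf h hs'

theorem continuous_leaf (h : IsSector X σ ζ e) : Continuous (P.leaf h.mem ζ) := by
  refine continuous_iff_continuousAt.2 fun s => ?_
  have hm := P.lt_of_entry h.mem s
  set m := P.entry h.mem s
  have h1 : ContinuousAt (fun s' => P.homeo.symm^[m] (P.arc h.mem ζ (φ.lam⁻¹ ^ m * s'))) s :=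
    ContinuousAt.comp (f := fun s' => P.arc h.mem ζ (φ.lam⁻¹ ^ m * s'))
      (P.homeo.symm.continuous.iterate m).continuousAt
      (ContinuousAt.comp (f := fun s' => φ.lam⁻¹ ^ m * s') (P.continuousAt_arc h hm) (by fun_prop))
  refine h1.congr ?_
  filter_upwards [P.eventually_leaf h hm] with s' hs'
  rw [← hs', ← P.coe_homeo]
  exact Function.LeftInverse.iterate P.homeo.symm_apply_apply m _

theorem K_isConnected (h : IsSector X σ ζ e) (hK : P.K = closure (P.stable
    (branch X σ ζ (P.profile h.mem).τ))) : IsConnected P.K := by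
  rw [hK, ← P.range_leaf h]
  exact (isConnected_range (P.continuous_leaf h)).closure

/-- The slope series, restricted to the arc, is bounded and satisfies the invariance equation, so
`hasDerivAt_edge` identifies it with minus the derivative of the graph. The factor `e` appears
because a left-pointing sector is read after multiplication by `-1`. -/
theorem hasVelocity_arc (h : IsSector X σ ζ e) {y : ℝ} (hy : |y| < (P.box h.mem).ε) :
    HasVelocity X (P.arc h.mem ζ) (e * P.vs (P.arc h.mem ζ y)) y := by
  set p := P.profile h.mem
  set B := P.box h.mem
  have hD := h.dev_branch
  have hσ : ∀ y, |y| ≤ B.ε → P.arc h.mem ζ y ∉ X.sing := fun y hy =>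
    hD.notMem (P.arc_mem h.mem hy)
  have hxy : ∀ y, |y| ≤ B.ε → P.arc h.mem ζ y ∈ (X.chart σ).source ∧
      X.chart σ (P.arc h.mem ζ y) ^ X.n σ = e * ⟨p.edge y, y⟩ := fun y hy =>
    ⟨h.branch_mem (P.arc_mem h.mem hy).2, h.coord_branch (P.arc_mem h.mem hy).2⟩
  obtain ⟨M, -, hM⟩ := P.exists_abs_slope_le
  have h1 : HasDerivAt p.edge (-P.slope (P.arc h.mem ζ y)) y := by
    refine B.hasDerivAt_edge (W := fun y => P.slope (P.arc h.mem ζ y)) (M := M)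
      (fun y hy => hM _ (hσ y hy)) (fun y hy => ?_) hy
    have h2 := P.a_mul_slope (hσ y hy)
    have hne : P.arc h.mem ζ y ≠ σ := fun h' => hσ y hy (by rw [h']; exact h.mem)
    rw [P.a_disc h.mem (hxy y hy).1 hne, P.b_disc h.mem (hxy y hy).1 hne, (hxy y hy).2] at h2
    have h3 := P.iterate_arc h hy 1
    rw [pow_one, Function.iterate_one] at h3
    rw [h3] at h2
    have ha : p.a (e * ⟨p.edge y, y⟩) = p.a ⟨p.edge y, y⟩ := by
      rcases h.sign with h | h <;> rw [h] <;> simp [Profile.a]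
    have hb : p.b (e * ⟨p.edge y, y⟩) = p.b ⟨p.edge y, y⟩ := by
      rcases h.sign with h | h <;> rw [h] <;> simp [Profile.b]
    rwa [ha, hb] at h2
  refine HasVelocity.of_coord (P.continuousAt_arc h hy) (hσ y hy.le) (X.chart σ).open_source
    (hxy y hy.le).1 (X.chart_form σ h.mem) ?_
  have h2 : HasDerivAt (fun y : ℝ => (e : ℂ) * ((p.edge y : ℂ) + y * Complex.I))
      (e * (((-P.slope (P.arc h.mem ζ y) : ℝ) : ℂ) + ((1 : ℝ) : ℂ) * Complex.I)) y :=
    ((h1.ofReal_comp).add ((hasDerivAt_id y).ofReal_comp.mul_const _)).const_mul _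
  rw [vs_eq, Complex.mk_eq_add_mul_I]
  refine h2.congr_of_eventuallyEq ?_
  have hc : ContinuousAt (fun s' : ℝ => |s'|) y := by fun_prop
  filter_upwards [hc.eventually_lt_const hy] with y' hy'
  rw [(hxy y' hy'.le).2, Complex.mk_eq_add_mul_I]

/-- Pulls back through `of_f` one step at a time, using that `f` carries the stable field to `lam⁻¹`
times itself. -/
theorem hasVelocity_of_iterate {c : ℝ → S} {t k : ℝ} (m : ℕ) (hc : ContinuousAt c t)
    (ht : c t ∉ X.sing)
    (h : HasVelocity X (fun s => P.f^[m] (c s)) ((φ.lam⁻¹ : ℝ) ^ m * (k * P.vs (P.f^[m] (c t)))) t) :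
    HasVelocity X c (k * P.vs (c t)) t := by
  induction m generalizing c k with
  | zero => simpa using h
  | succ m ih =>
    have h1 := ih (c := fun s => P.f (c s)) (P.continuous_f.continuousAt.comp hc)
      (mt P.f_mem_sing.1 ht) (k := k * φ.lam⁻¹) (by
        simp only [Function.iterate_succ_apply] at h
        convert h using 1
        push_cast
        ring)
    refine HasVelocity.of_f P hc ht ?_
    have h2 : P.flatDeriv (c t) (k * P.vs (c t)) = (k * φ.lam⁻¹ : ℝ) * P.vs (P.f (c t)) := by
      rw [← Complex.real_smul, map_smul, P.flatDeriv_vs ht, Complex.real_smul]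
      push_cast
      ring
    rw [h2]
    exact h1

theorem hasVelocity_iterate {c : ℝ → S} {t k : ℝ} (m : ℕ)
    (h : HasVelocity X c (k * P.vs (c t)) t) :
    HasVelocity X (fun s => P.f^[m] (c s)) ((φ.lam⁻¹ : ℝ) ^ m * (k * P.vs (P.f^[m] (c t)))) t := by
  induction m generalizing c k with
  | zero => simpa using h
  | succ m ih =>
    have h2 : P.flatDeriv (c t) (k * P.vs (c t)) = (k * φ.lam⁻¹ : ℝ) * P.vs (P.f (c t)) := by
      rw [← Complex.real_smul, map_smul, P.flatDeriv_vs h.2.1, Complex.real_smul]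
      push_cast
      ring
    have h1 := HasVelocity.f P h
    rw [h2] at h1
    have h3 := ih h1
    simp only [Function.iterate_succ_apply]
    convert h3 using 1
    push_cast
    ring

/-- The `m`-th iterate of the leaf is the arc run at speed `lam⁻¹ ^ m`, exactly the factor by which
`f^[m]` contracts the stable field. -/
theorem hasVelocity_leaf (h : IsSector X σ ζ e) (s : ℝ) :
    HasVelocity X (P.leaf h.mem ζ) (e * P.vs (P.leaf h.mem ζ s)) s := by
  have hm := P.lt_of_entry h.mem s
  set m := P.entry h.mem s
  have h1 := (P.hasVelocity_arc h hm).comp_const_mul (φ.lam⁻¹ ^ m)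
  have hns : P.leaf h.mem ζ s ∉ X.sing := by
    rw [← P.iterate_mem_sing m, P.iterate_leaf h hm]
    exact h.dev_branch.notMem (P.arc_mem h.mem hm.le)
  refine P.hasVelocity_of_iterate m (P.continuous_leaf h).continuousAt hns ?_
  rw [P.iterate_leaf h hm]
  have h2 := h1.congr (P.eventually_leaf h hm)
  push_cast at h2 ⊢
  exact h2

theorem isTrajectoryOn_iff {γ : ℝ → S} {J : Set ℝ} (hJ : IsOpen J) :
    P.IsTrajectoryOn γ J ↔ ∀ t ∈ J, HasVelocity X γ (P.vs (γ t)) t :=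
  ⟨fun h t ht => ⟨h.1.continuousAt (hJ.mem_nhds ht), h.2 t ht⟩,
    fun h => ⟨fun t ht => (h t ht).1.continuousWithinAt, fun t ht => (h t ht).2⟩⟩

/-- The stable manifold of the saddle of a sector is a trajectory of the stable vector field. -/
theorem isTrajectoryOn_leaf (h : IsSector X σ ζ e) :
    P.IsTrajectoryOn (fun t => P.leaf h.mem ζ (e * t)) univ := by
  rw [P.isTrajectoryOn_iff isOpen_univ]
  intro t _
  have h1 := (P.hasVelocity_leaf h (e * t)).comp_const_mul e
  rwa [← mul_assoc, h.mul_self', one_mul] at h1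

end Perturbation

/-! ### Uniqueness of the trajectories at the saddles. -/

variable {S : Type*} [MetricSpace S] [CompactSpace S] [ChartedSpace ℂ S] [IsManifold 𝓘(ℂ) 1 S]
  {X : ConicalSurface S} {φ : LinearPA X} (P : Perturbation φ) {σ : S} {x : S} {ζ : ℂ} {e : ℝ}

/-- A slow curve starting in the image of a branch stays there. -/
theorem IsSector.exists_coord_of_velocity (h : IsSector X σ ζ e) {η : ℝ → S} {v : ℝ → ℂ}
    {L ρ κ : ℝ} {z₀ : ℂ} (hd : ∀ s ∈ Icc (0 : ℝ) 1, HasVelocity X η (v s) s)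
    (hv : ∀ s ∈ Icc (0 : ℝ) 1, ‖v s‖ ≤ L) (him : ∀ s, (v s).im = κ)
    (h0 : η 0 = branch X σ ζ z₀) (hL : L < ρ) (hball : Metric.ball z₀ ρ ⊆ halfDisc X σ) :
    ∃ w ∈ Metric.ball z₀ ρ, η 1 = branch X σ ζ w ∧ w.im = z₀.im + e * κ := by
  have hL0 : 0 ≤ L := (norm_nonneg _).trans (hv 0 ⟨le_rfl, zero_le_one⟩)
  have hρ : 0 < ρ := hL0.trans_lt hL
  set N := branch X σ ζ '' Metric.ball z₀ ρ
  set W : ℝ → ℂ := fun s => e * X.chart σ (η s) ^ X.n σ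
  have hN : IsOpen N := isOpen_iff_mem_nhds.2 (by
    rintro _ ⟨w, hw, rfl⟩
    exact h.image_branch_mem_nhds (hball hw) (Metric.isOpen_ball.mem_nhds hw))
  have hcoord : ∀ w ∈ halfDisc X σ, (e : ℂ) * X.chart σ (branch X σ ζ w) ^ X.n σ = w := fun w hw => by
    rw [h.coord_branch hw.2, ← mul_assoc, h.mul_self', one_mul]
  have hz₀ : z₀ ∈ Metric.ball z₀ ρ := Metric.mem_ball_self hρ
  have hW0 : W 0 = z₀ := by
    simp only [W, h0]
    exact hcoord _ (hball hz₀)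
  have hNs : ∀ s, η s ∈ N → W s ∈ Metric.ball z₀ ρ ∧ η s = branch X σ ζ (W s) ∧
      η s ∈ (X.chart σ).source := by
    rintro s ⟨w, hw, hws⟩
    have h1 : W s = w := by
      simp only [W, ← hws]
      exact hcoord _ (hball hw)
    rw [h1]
    exact ⟨hw, hws.symm, hws ▸ h.branch_mem (hball hw).2⟩
  have hder : ∀ s ∈ Icc (0 : ℝ) 1, η s ∈ N → HasDerivAt W (e * v s) s := fun s hs hsN =>
    ((hd s hs).2.2 _ _ (X.chart σ).open_source (hNs s hsN).2.2 (X.chart_form σ h.mem)).const_mul _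
  have hest : ∀ b ∈ Icc (0 : ℝ) 1, (∀ s ∈ Icc 0 b, η s ∈ N) → ‖W b - z₀‖ ≤ L := by
    intro b hb hbN
    have h1 := norm_image_sub_le_of_norm_deriv_le_segment' (f := W) (f' := fun s => e * v s) (C := L)
      (fun s hs => (hder s ⟨hs.1, hs.2.trans hb.2⟩ (hbN s hs)).hasDerivWithinAt)
      (fun s hs => by rw [h.norm_mul]; exact hv s ⟨hs.1, hs.2.le.trans hb.2⟩) b ⟨hb.1, le_rfl⟩
    rw [hW0, sub_zero] at h1
    exact h1.trans (mul_le_of_le_one_right hL0 hb.2)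
  have hcont : ContinuousOn η (Icc 0 1) := fun s hs => (hd s hs).1.continuousWithinAt
  -- First-exit argument: before the first exit time the speed bound keeps the curve in the image of
  -- the smaller closed ball, which is compact, so the exit point would still be in `N`.
  have hall : ∀ s ∈ Icc (0 : ℝ) 1, η s ∈ N := by
    by_contra hcon
    push Not at hcon
    have hcpt : IsCompact (Icc (0 : ℝ) 1 ∩ η ⁻¹' Nᶜ) :=
      isCompact_Icc.of_isClosed_subset
        (hcont.preimage_isClosed_of_isClosed isClosed_Icc hN.isClosed_compl) inter_subset_left
    obtain ⟨s, ⟨hs, hsN⟩, hmin⟩ := hcpt.exists_isLeast hcon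
    have hlt : ∀ s' ∈ Ico 0 s, η s' ∈ N := fun s' hs' => by
      by_contra hn
      exact absurd (hmin ⟨⟨hs'.1, hs'.2.le.trans hs.2⟩, hn⟩) (not_le.2 hs'.2)
    have hspos : 0 < s := by
      rcases hs.1.eq_or_lt with h1 | h1
      · rw [← h1] at hsN
        exact absurd ⟨z₀, hz₀, h0.symm⟩ hsN
      · exact h1
    have hsub : Metric.closedBall z₀ L ⊆ Metric.ball z₀ ρ := Metric.closedBall_subset_ball hL
    have hcl : IsClosed (branch X σ ζ '' Metric.closedBall z₀ L) :=
      ((isCompact_closedBall _ _).image_of_continuousOn fun z hz =>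
        (h.continuousAt_branch (hball (hsub hz))).continuousWithinAt).isClosed
    have hev : ∀ᶠ s' in 𝓝[<] s, η s' ∈ branch X σ ζ '' Metric.closedBall z₀ L := by
      filter_upwards [Ioo_mem_nhdsLT hspos] with s' hs'
      have h1 := hest s' ⟨hs'.1.le, hs'.2.le.trans hs.2⟩ fun r hr =>
        hlt r ⟨hr.1, hr.2.trans_lt hs'.2⟩
      exact ⟨W s', by rwa [mem_closedBall_iff_norm], (hNs s' (hlt s' ⟨hs'.1.le, hs'.2⟩)).2.1.symm⟩
    have hmem := hcl.mem_of_tendsto ((hd s hs).1.tendsto.mono_left nhdsWithin_le_nhds) hev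
    exact hsN (image_mono hsub hmem)
  obtain ⟨h1, h2, -⟩ := hNs 1 (hall 1 ⟨zero_le_one, le_rfl⟩)
  refine ⟨W 1, h1, h2, ?_⟩
  have h3 := norm_image_sub_le_of_norm_deriv_le_segment' (f := fun s => (W s).im - e * κ * s)
    (f' := fun s => (e * v s).im - e * κ * 1) (C := 0) (a := 0) (b := 1)
    (fun s hs => ((Complex.imCLM.hasFDerivAt.comp_hasDerivAt s (hder s hs (hall s hs))).sub
      ((hasDerivAt_id s).const_mul _)).hasDerivWithinAt)
    (fun s _ => by simp [him s]) 1 ⟨zero_le_one, le_rfl⟩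
  rw [zero_mul, norm_le_zero_iff, hW0] at h3
  linarith

namespace Perturbation

/-- A trajectory starting at a saddle is attracted to it, at a definite height. -/
theorem eventually_branch_of_isTrajectoryOn (h : IsSector X σ ζ e) {J : Set ℝ} {δ : ℝ → S}
    (hJ : IsOpen J) (hJc : J.OrdConnected) (h0 : 0 ∈ J) (hδ : P.IsTrajectoryOn δ J)
    (hδ0 : δ 0 = branch X σ ζ (P.profile h.mem).τ) {t : ℝ} (ht : t ∈ J) {ρ : ℝ} (hρ : 0 < ρ)
    (hball : Metric.ball ((P.profile h.mem).τ : ℂ) ρ ⊆ halfDisc X σ) :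
    ∀ᶠ m in atTop, ∃ w ∈ Metric.ball ((P.profile h.mem).τ : ℂ) ρ,
      P.f^[m] (δ t) = branch X σ ζ w ∧ w.im = φ.lam⁻¹ ^ m * (e * t) := by
  rw [P.isTrajectoryOn_iff hJ] at hδ
  obtain ⟨M, hM0, hM⟩ := P.exists_abs_slope_le
  have hl0 : 0 ≤ φ.lam⁻¹ := inv_nonneg.2 φ.lam_pos.le
  obtain ⟨m₀, hm₀⟩ := exists_abs_inv_pow_mul_lt φ hρ (t * (M + 1))
  filter_upwards [eventually_ge_atTop m₀] with m hm
  have hJt : ∀ s ∈ Icc (0 : ℝ) 1, t * s ∈ J := fun s hs => by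
    rw [mul_comm]
    exact hJc.convex.smul_mem_of_zero_mem h0 ht hs
  -- The piece of trajectory up to time `t` is run in unit time. Its `m`-th image has velocity
  -- `lam⁻¹ ^ m * t` times the field, which is bounded, so it moves arbitrarily little; its vertical
  -- velocity is exactly `lam⁻¹ ^ m * t`.
  have hv : ∀ s ∈ Icc (0 : ℝ) 1, HasVelocity X (fun s => P.f^[m] (δ (t * s)))
      ((φ.lam⁻¹ : ℝ) ^ m * (t * P.vs (P.f^[m] (δ (t * s))))) s := fun s hs =>
    P.hasVelocity_iterate m ((hδ _ (hJt s hs)).comp_const_mul t)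
  have him : ∀ y, ((φ.lam⁻¹ : ℝ) ^ m * (t * P.vs y) : ℂ) = (φ.lam⁻¹ ^ m * t : ℝ) * P.vs y :=
    fun y => by push_cast; ring
  have hL : ∀ s ∈ Icc (0 : ℝ) 1, ‖((φ.lam⁻¹ : ℝ) ^ m * (t * P.vs (P.f^[m] (δ (t * s)))) : ℂ)‖ ≤
      |φ.lam⁻¹ ^ m * (t * (M + 1))| := fun s hs => by
    rw [him, norm_mul, Complex.norm_real, Real.norm_eq_abs, ← mul_assoc, abs_mul _ (M + 1),
      abs_of_nonneg (a := M + 1) (by linarith)]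
    exact mul_le_mul_of_nonneg_left (P.norm_vs_le (hM _ (hv s hs).2.1)) (abs_nonneg _)
  have h1 : P.f^[m] (δ (t * 0)) = branch X σ ζ (P.profile h.mem).τ := by
    rw [mul_zero, hδ0]
    exact Function.iterate_fixed (P.f_saddle h) m
  obtain ⟨w, hw, hw1, hw2⟩ := h.exists_coord_of_velocity (κ := φ.lam⁻¹ ^ m * t) hv hL
    (fun s => by rw [him, vs_eq, Complex.im_ofReal_mul, mul_one]) h1 (hm₀ m hm) hball
  refine ⟨w, hw, by rwa [mul_one] at hw1, ?_⟩
  rw [hw2, Complex.ofReal_im]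
  ring

/-- Uniqueness of trajectories starting at a saddle. -/
theorem eq_leaf_of_isTrajectoryOn (h : IsSector X σ ζ e) {J : Set ℝ} {δ : ℝ → S}
    (hJ : IsOpen J) (hJc : J.OrdConnected) (h0 : 0 ∈ J) (hδ : P.IsTrajectoryOn δ J)
    (hδ0 : δ 0 = branch X σ ζ (P.profile h.mem).τ) {t : ℝ} (ht : t ∈ J) :
    δ t = P.leaf h.mem ζ (e * t) := by
  have hτ := P.τ_mem_halfDisc h.mem
  obtain ⟨ρ₀, hρ₀, hball₀⟩ := Metric.isOpen_iff.1 h.isOpen_halfDisc _ hτ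
  have hst : δ t ∈ P.stable (branch X σ ζ (P.profile h.mem).τ) := by
    change Tendsto _ _ _
    intro N hN
    obtain ⟨ρ, hρ, hball⟩ := Metric.mem_nhds_iff.1
      (inter_mem (h.continuousAt_branch hτ hN) (h.isOpen_halfDisc.mem_nhds hτ))
    rw [Filter.mem_map]
    filter_upwards [P.eventually_branch_of_isTrajectoryOn h hJ hJc h0 hδ hδ0 ht hρ fun z hz =>
      (hball hz).2] with m hm
    obtain ⟨w, hw, hw1, -⟩ := hm
    rw [mem_preimage, hw1]
    exact (hball hw).1
  -- The same iterate is located twice: on the local stable manifold at height `y`, and at height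
  -- `lam⁻¹ ^ m * (e * t)` by its velocity. Comparing the two fixes the point of the leaf.
  obtain ⟨m, ⟨w, hw, hw1, hw2⟩, y, -, hy, hm⟩ :=
    ((P.eventually_branch_of_isTrajectoryOn h hJ hJc h0 hδ hδ0 ht hρ₀ hball₀).and
      (P.exists_iterate_eq_edge h hst one_pos)).exists
  have hwy := h.branch_inj (hball₀ hw).2 (P.arc_mem h.mem hy.le).2 (hw1.symm.trans hm)
  have hyt : φ.lam⁻¹ ^ m * (e * t) = y := by rw [← hw2, hwy]
  exact P.eq_leaf h (m := m) (by rwa [hyt]) (by rw [hyt]; exact hm)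

end Perturbation

end DerivedPA

end

/-! ### Assembly of the theorem. -/

open Filter Topology Set Manifold in
theorem mainTheorem11 {S : Type*} [MetricSpace S] [CompactSpace S] [ConnectedSpace S]
    [ChartedSpace ℂ S] [IsManifold 𝓘(ℂ) 1 S]
    (X : DerivedPA.ConicalSurface S) (φ : DerivedPA.LinearPA X)
    (P : DerivedPA.Perturbation φ) :
    IsConnected P.K ∧
    (∀ σ ∈ X.sing, ∀ j : Fin (2 * X.n σ), P.K = closure (P.Wss (P.p σ j))) ∧
    ((∀ σ ∈ X.sing, -φ.lam + (φ.lam ^ 2)⁻¹ < P.β σ) →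
      (∀ x ∉ X.sing, (∃ A, P.HasFlatDerivAt x A) ∧ Summable (P.vsTerm x)) ∧
      ∀ σ ∈ X.sing, ∀ j : Fin (2 * X.n σ), ∃ γ : ℝ → S,
        P.IsTrajectoryOn γ univ ∧ γ 0 = P.p σ j ∧
        (∀ (J : Set ℝ) (δ : ℝ → S), IsOpen J → J.OrdConnected → 0 ∈ J →
          P.IsTrajectoryOn δ J → δ 0 = P.p σ j → EqOn δ γ J) ∧
        P.Wss (P.p σ j) = range γ) := by
  have hWss : ∀ σ (hσ : σ ∈ X.sing), ∀ j : Fin (2 * X.n σ), P.Wss (P.p σ j) =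
      P.stable (DerivedPA.branch X σ (DerivedPA.Perturbation.dir X σ j) (P.profile hσ).τ) :=
    fun σ hσ j => by
      rw [P.p_eq hσ j]
      exact P.Wss_eq_stable (P.f_saddle (DerivedPA.Perturbation.isSector_dir hσ j))
  refine ⟨?_, fun σ hσ j => ?_, fun _ => ⟨fun x hx => ?_, fun σ hσ j => ?_⟩⟩
  · obtain ⟨σ, hσ⟩ := X.exists_zero
    have h := DerivedPA.Perturbation.isSector_dir (X := X) hσ 0
    exact P.K_isConnected h (P.K_eq_closure_stable h)
  · rw [hWss σ hσ j]
    exact P.K_eq_closure_stable (DerivedPA.Perturbation.isSector_dir hσ j)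
  · exact ⟨⟨_, P.hasFlatDerivAt hx⟩, P.summable_vsTerm hx⟩
  · have h := DerivedPA.Perturbation.isSector_dir (X := X) hσ j
    -- The trajectory is the leaf run in the direction given by the sign of the sector: in a
    -- left-pointing sector the height coordinate is reversed with respect to `e₂`.
    refine ⟨_, P.isTrajectoryOn_leaf h, ?_, fun J δ hJ hJc h0 hδ hδ0 t ht => ?_, ?_⟩
    · rw [mul_zero, P.leaf_zero h, P.p_eq hσ j]
    · exact P.eq_leaf_of_isTrajectoryOn h hJ hJc h0 hδ (hδ0.trans (P.p_eq hσ j)) ht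
    · rw [hWss σ hσ j, ← P.range_leaf h]
      have hs : Function.Surjective fun t : ℝ => (-1 : ℝ) ^ (j : ℕ) * t := fun s =>
        ⟨(-1) ^ (j : ℕ) * s, by simp only [← mul_assoc, h.mul_self, one_mul]⟩
      exact (hs.range_comp (P.leaf hσ (DerivedPA.Perturbation.dir X σ j))).symm
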